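/- **Setting.** Let $G$ be a forest on a vertex set $V$ and $X\subseteq V$ the set of *exposed* vertices. A *top tree* of a tree $T$ of $G$ that has at least one edge is a rooted binary tree whose leaves are the edges of $T$; the *cluster* of a node is the set of edges at the leaves below it, so the cluster of an internal node is the disjoint union of the clusters of its two children. A vertex is a *boundary vertex* of a cluster if it is incident to an edge of the cluster and is either exposed or also incident to an edge of $G$ outside the cluster. A cluster is *valid* if it is connected and has at most two boundary vertices; it is a *path cluster* if it has exactly two, and a *point cluster* otherwise. The *central vertex* of an internal node is the vertex shared by its two children. The children of each node are ordered (left, right), and so are the endpoints of each edge. A boundary vertex of an internal node is *middle* if it is the central vertex, and otherwise *left* or *right* according to the child it comes from; a boundary vertex of a leaf is left or right according to which endpoint it is. The *leftmost* boundary vertex is the left one if there is one, and otherwise the middle one if there is one; *rightmost* is analogous. The *orientation invariant* says that for each internal node the rightmost boundary vertex of the left child and the leftmost boundary vertex of the right child both exist and equal the central vertex. **Data structure.** For each tree of $G$ with at least one edge, one top tree is stored in memory, with all clusters valid and the orientation invariant satisfied. A node stores a parent pointer, its two children (or, for a leaf, the two endpoints of its edge), its number of boundary vertices, and a flip bit which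 means that the whole subtree below the node is to be mirrored. A vertex stores whether it is exposed and a doubly linked list of its incident edges. Time is the number of elementary steps, each of which reads, writes, allocates or deletes one node record, reads or writes one exposed mark, or performs one operation on a list of incident edges (get some edge, test whether there are at least two, insert an edge, delete an edge). The potential is $\Phi=\sum_T\sum_{x\in T}\log_2 s(x)$, where $T$ runs over the stored top trees, $x$ over the nodes of $T$, and $s(x)$ is the number of leaves in the subtree rooted at $x$. **Algorithm.** Write $\mathrm{flip}(x)$ for inverting the flip bit of $x$, and call two nodes *on the same side* if both are left children or both are right children (of their respective parents). * *rotate_up$(x)$*, for a node $x$ with parent $y$, grandparent $z$, sibling $a$ of $x$ and sibling $b$ of $y$: exchanges the positions of $x$ and $b$, so that $z$ has the children $x$ and $y$, and $y$ has the children $a$ and $b$; it adjusts the order of the children, the flip bits and the boundary count of $y$ so that all invariants hold. (It is only called where $a\cup b$ is a valid cluster.) * *semi_splay_step$(x)$*: let $y$, $z$, $w$ be the parent, grandparent and great-grandparent of $x$. If $z$ does not exist, return null. If $x$ and $z$ are point clusters, do rotate_up$(x)$ and return $z$. Otherwise, if $w$ does not exist, return null. Otherwise, if $y$ is a path cluster,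 and $z$ is a path cluster or $w$ is a point cluster: if $x,y$ are on the same side, do rotate_up$(x)$ and return $z$; else if $y,z$ are on the same side, do rotate_up$(y)$ and return $w$; else do rotate_up(sibling of $x$), then rotate_up$(y)$, and return $w$. In all other cases return semi_splay_step$(y)$. * *semi_splay$(x)$*: starting from $x$, repeatedly replace the current node by the result of semi_splay_step on it, until that result is null. * *full_splay$(x)$*: repeat $t:=$ semi_splay_step$(x)$; stop if $t$ is null; otherwise call semi_splay_step$(t)$. * *find_consuming_node$(v)$*: null if $v$ is isolated. Otherwise take an edge incident to $v$, semi_splay its leaf, and then walk up from this leaf, keeping track of the position (left, middle or right) of $v$, to find and return the lowest common ancestor of all edges incident to $v$. * *expose$(v)$*: let $c:=$ find_consuming_node$(v)$. If $c$ is null, mark $v$ as exposed and return null. Otherwise, while $c$ is a path cluster, do rotate_up on the child of $c$ that is on the same side as $c$ and replace $c$ by its parent. Then full_splay$(c)$, add $1$ to the boundary counts of $c$ and all its ancestors, mark $v$ as exposed, and return the root. * *deexpose$(v)$*: let $c:=$ find_consuming_node$(v)$, subtract $1$ from the boundary counts of $c$ and all its ancestors (if $c$ is not null), mark $v$ as not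 exposed, and return the root (null if $c$ is null). * *link$(u,v)$*: expose $u$, flip the resulting root $T_u$ if it has a left boundary vertex, and unmark $u$; expose $v$, flip the resulting root $T_v$ if it has a right boundary vertex, and unmark $v$; create a leaf for the edge $uv$ (with left endpoint $u$), then, if $T_u$ is not null, a node with the children $T_u$ and this leaf, then, if $T_v$ is not null, a node with the node created last and $T_v$ as children; return the node created last. * *cut$(e)$*, for an edge $e$ with endpoints $u,v$: full_splay$(e)$, delete the leaf $e$ and all its ancestors, delete the edge from the lists of $u$ and $v$, mark $u$ and $v$ as exposed, then deexpose$(u)$ and deexpose$(v)$, and return their results. **Theorem.** The data structure of the forest without edges and without exposed vertices is the empty one, with $\Phi=0$. There are absolute constants $K,C>0$ such that the following holds for every state of the data structure satisfying the above invariants, with underlying forest $G$ and set $X$ of exposed vertices. Each of the operations below terminates without error, leads to a state that again satisfies all invariants (in particular, all clusters are valid and the orientation invariant holds) for the new forest and the new set of exposed vertices, and satisfies $$(\text{number of elementary steps}) + K\cdot(\Phi_{\text{after}}-\Phi_{\text{before}})\;\le\; C\,(1+\log_2 n).$$ 1. *expose$(v)$*, if $v$ is not exposed and its tree has at most one exposed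 vertex: the new exposed set is $X\cup\{v\}$, the forest is unchanged; the root node of the top tree of $v$ (null if $v$ is isolated) is returned and is the same node before and after. Here $n$ is the number of vertices of the tree containing $v$. 2. *deexpose$(v)$*, if $v$ is exposed: the same with the new exposed set $X\setminus\{v\}$. 3. *link$(u,v)$*, if $u,v$ lie in different trees, neither of which has an exposed vertex: the edge $uv$ is added to the forest, $X$ is unchanged, and the root of the top tree of the resulting tree is returned. Here $n$ is the number of vertices of the resulting tree. 4. *cut$(e)$*, for an edge $e$ with endpoints $u,v$ in a tree without exposed vertices: $e$ is deleted from the forest, $X$ is unchanged, and the roots of the top trees of $u$ and of $v$ (null for an isolated vertex) are returned. Here $n$ is the number of vertices of the tree containing $e$ before the operation. In all cases the leaves of the other edges keep their addresses and endpoints. -/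

import Mathlib

/-! # Memory, cost model and program of the splay-based top tree

A node of a top tree is a record in memory, addressed by a natural number.  An edge of the
underlying forest is identified with (the address of) the leaf node that represents it. -/

/-- What a node stores besides its header: a leaf stores the two endpoints of its edge, an internal
node the addresses of its two children (entries `0` and `1` of the array `children`). -/
inductive NodeBody (V : Type) where
  | leaf (a b : V)
  | internal (c₀ c₁ : ℕ)

/-- The record stored for a node. -/
structure NodeRec (V : Type) where
  parent : Option ℕ
  body : NodeBody V
  numBoundary : ℕ
  flip : Bool

/-- The state of the machine: the allocated nodes, the next fresh address, the `exposed` mark of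
each vertex, the linked list of incident edges of each vertex, and the number of elementary steps
made so far. -/
structure Mem (V : Type) where
  node : ℕ → Option (NodeRec V)
  next : ℕ
  exposed : V → Bool
  incident : V → List ℕ
  time : ℕ

/-- The initial state: all vertices are isolated and not exposed, no node is allocated. -/
def Mem.init (V : Type) : Mem V where
  node := fun _ => none
  next := 0
  exposed := fun _ => false
  incident := fun _ => []
  time := 0

/-- The endpoints of the edge stored at address `e`, if there is a leaf node at `e`. -/
def Mem.edgeAt {V : Type} (s : Mem V) (e : ℕ) : Option (V × V) :=
  match s.node e with
  | some ⟨_, .leaf a b, _, _⟩ => some (a, b)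
  | _ => none

/-- Programs.  The outcome `none` stands for a run that does not terminate or that fails (it
dereferences a null pointer, accesses memory that is not allocated, or asks for the children of a
leaf or for the endpoints of an internal node). -/
abbrev Prog (V : Type) := StateT (Mem V) Option

namespace TopTreeProg

variable {V : Type}

/-! ## Elementary steps

Each of the following takes one unit of time.  Nothing else touches the memory. -/

/-- Count one unit of time. -/
def tick : Prog V Unit := modify fun s => { s with time := s.time + 1 }

/-- Read the record at address `x`. -/
def readNode (x : ℕ) : Prog V (NodeRec V) := do
  tick
  match (← get).node x with
  | some r => return r
  | none => failure

/-- Overwrite the record at the allocated address `x`. -/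
def writeNode (x : ℕ) (r : NodeRec V) : Prog V Unit := do
  tick
  match (← get).node x with
  | some _ => modify fun s => { s with node := Function.update s.node x (some r) }
  | none => failure

/-- Allocate a new node. -/
def newNode (r : NodeRec V) : Prog V ℕ := do
  tick
  let x := (← get).next
  modify fun s => { s with node := Function.update s.node x (some r), next := x + 1 }
  return x

/-- Delete the node at the allocated address `x`. -/
def deleteNode (x : ℕ) : Prog V Unit := do
  tick
  match (← get).node x with
  | some _ => modify fun s => { s with node := Function.update s.node x none }
  | none => failure

/-- Read the mark of a vertex. -/
def isExposed (v : V) : Prog V Bool := do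
  tick
  return (← get).exposed v

/-- Any edge incident to `v` (the first one in its list), or null. -/
def anyEdge (v : V) : Prog V (Option ℕ) := do
  tick
  return ((← get).incident v).head?

/-- Has `v` at least two incident edges? -/
def degreeGeTwo (v : V) : Prog V Bool := do
  tick
  match (← get).incident v with
  | _ :: _ :: _ => return true
  | _ => return false

section
variable [DecidableEq V]

/-- Write the mark of a vertex. -/
def setExposed (v : V) (b : Bool) : Prog V Unit := do
  tick
  modify fun s => { s with exposed := Function.update s.exposed v b }

/-- Put the edge `e` in front of the list of `v`. -/
def addIncident (v : V) (e : ℕ) : Prog V Unit := do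
  tick
  modify fun s => { s with incident := Function.update s.incident v (e :: s.incident v) }

/-- Take the edge `e` out of the (doubly linked) list of `v`. -/
def removeIncident (v : V) (e : ℕ) : Prog V Unit := do
  tick
  modify fun s => { s with incident := Function.update s.incident v ((s.incident v).erase e) }

end

/-! ## Access to single fields -/

/-- Dereference a pointer that may be null. -/
def deref (p : Option ℕ) : Prog V ℕ :=
  match p with
  | some x => return x
  | none => failure

def getParent (x : ℕ) : Prog V (Option ℕ) := do
  return (← readNode x).parent

def setParent (x : ℕ) (p : Option ℕ) : Prog V Unit := do
  writeNode x { (← readNode x) with parent := p }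

def getFlip (x : ℕ) : Prog V Bool := do
  return (← readNode x).flip

def setFlip (x : ℕ) (b : Bool) : Prog V Unit := do
  writeNode x { (← readNode x) with flip := b }

/-- `x.flip = !x.flip` -/
def toggleFlip (x : ℕ) : Prog V Unit := do
  setFlip x (!(← getFlip x))

def getNumBoundary (x : ℕ) : Prog V ℕ := do
  return (← readNode x).numBoundary

def setNumBoundary (x : ℕ) (k : ℕ) : Prog V Unit := do
  writeNode x { (← readNode x) with numBoundary := k }

/-- The pair `(children[0], children[1])`. -/
def getChildren (x : ℕ) : Prog V (ℕ × ℕ) := do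
  match (← readNode x).body with
  | .internal c₀ c₁ => return (c₀, c₁)
  | .leaf _ _ => failure

def setChildren (x c₀ c₁ : ℕ) : Prog V Unit := do
  writeNode x { (← readNode x) with body := .internal c₀ c₁ }

/-- The pair `(endpoints[0], endpoints[1])`. -/
def getEndpoints (x : ℕ) : Prog V (V × V) := do
  match (← readNode x).body with
  | .leaf a b => return (a, b)
  | .internal _ _ => failure

def isLeafNode (x : ℕ) : Prog V Bool := do
  match (← readNode x).body with
  | .leaf _ _ => return true
  | .internal _ _ => return false

/-- `p.children[0] == x` -/
def isChildZero (p x : ℕ) : Prog V Bool := do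
  return (← getChildren p).1 == x

/-- The other child of the parent of `x`. -/
def sibling (x : ℕ) : Prog V ℕ := do
  let p ← deref (← getParent x)
  let c ← getChildren p
  return if c.1 == x then c.2 else c.1

/-! ## Internal operations -/

def isPath (x : ℕ) : Prog V Bool := do
  return (← getNumBoundary x) == 2

def isPoint (x : ℕ) : Prog V Bool := do
  return !(← isPath x)

def pushFlip (x : ℕ) : Prog V Unit := do
  if ← getFlip x then
    let c ← getChildren x
    setChildren x c.2 c.1
    toggleFlip c.1
    toggleFlip c.2
    setFlip x false

def hasMiddleBoundary (x : ℕ) : Prog V Bool := do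
  let k ← getNumBoundary x
  if (← isLeafNode x) || k == 0 then
    return false
  else
    let c ← getChildren x
    let p₀ ← isPath c.1
    let p₁ ← isPath c.2
    return k - p₀.toNat - p₁.toNat != 0

/-- The common code of `has_left_boundary` and `has_right_boundary`: is there a boundary vertex on
the side with index `side` (taking the flip bit of `x` into account)? -/
def hasSideBoundary (side : Bool) (x : ℕ) : Prog V Bool := do
  let i := (side != (← getFlip x))
  if ← isLeafNode x then
    let ends ← getEndpoints x
    let w := if i then ends.2 else ends.1
    return (← isExposed w) || (← degreeGeTwo w)
  else
    let c ← getChildren x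
    isPath (if i then c.2 else c.1)

def hasLeftBoundary (x : ℕ) : Prog V Bool := hasSideBoundary false x

def hasRightBoundary (x : ℕ) : Prog V Bool := hasSideBoundary true x

def rotateUp (node : ℕ) : Prog V Unit := do
  let parent ← deref (← getParent node)
  let grandparent ← deref (← getParent parent)
  let sib ← sibling node
  let uncle ← sibling parent
  pushFlip grandparent
  pushFlip parent
  let uncleIsLeft ← isChildZero grandparent uncle
  let sibIsLeft ← isChildZero parent sib
  let toSameSide := uncleIsLeft == sibIsLeft
  let sibIsPath ← isPath sib
  let uncleIsPath ← isPath uncle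
  let gpIsPath ← isPath grandparent
  -- the values of `new_parent_is_path`, `flip_new_parent` and `flip_grandparent`
  let (newParentIsPath, flipNewParent, flipGrandparent) ← (do
    if toSameSide && sibIsPath then
      let gpMiddle ← hasMiddleBoundary grandparent
      let flipGp ← (do
        if gpMiddle && !gpIsPath then
          match ← getParent grandparent with
          | some ggp => return (← isChildZero ggp grandparent) == uncleIsLeft
          | none => return false
        else
          return false)
      return (gpMiddle || uncleIsPath, false, flipGp)
    else if !toSameSide then
      toggleFlip node
      return (sibIsPath || uncleIsPath, sibIsPath, sibIsPath)
    else
      toggleFlip sib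
      return (uncleIsPath, false, false))
  if uncleIsLeft then
    setChildren parent uncle sib
    setChildren grandparent parent node
  else
    setChildren parent sib uncle
    setChildren grandparent node parent
  setFlip parent flipNewParent
  setNumBoundary parent (if newParentIsPath then 2 else 1)
  setFlip grandparent flipGrandparent
  setParent node (some grandparent)
  setParent uncle (some parent)

/-- Returns the root of the changed subtree, or null if nothing was changed. -/
def semiSplayStep (node : ℕ) : Prog V (Option ℕ) := do
  let some parent ← getParent node | return none
  let some gparent ← getParent parent | return none
  if (← isPoint node) && (← isPoint gparent) then
    rotateUp node
    return some gparent
  else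
    let some ggparent ← getParent gparent | return none
    if (← isPath parent) && ((← isPath gparent) || (← isPoint ggparent)) then
      pushFlip gparent
      pushFlip parent
      let nodeIsLeft ← isChildZero parent node
      let parentIsLeft ← isChildZero gparent parent
      let gparentIsLeft ← isChildZero ggparent gparent
      if nodeIsLeft == parentIsLeft then
        rotateUp node
        return some gparent
      else if parentIsLeft == gparentIsLeft then
        rotateUp parent
        return some ggparent
      else
        rotateUp (← sibling node)
        rotateUp parent
        return some ggparent
    else
      semiSplayStep parent
  partial_fixpoint

def semiSplay (top : ℕ) : Prog V Unit := do
  match ← semiSplayStep top with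
  | some top' => semiSplay top'
  | none => return ()
  partial_fixpoint

def fullSplay (node : ℕ) : Prog V Unit := do
  match ← semiSplayStep node with
  | some top =>
    let _ ← semiSplayStep top
    fullSplay node
  | none => return ()
  partial_fixpoint

/-- The loop of `find_consuming_node`.  The Booleans tell where the vertex lies in `node`, seen from
the parent of `node`. -/
def consumingLoop (node : ℕ) (isLeft isMiddle isRight : Bool) (lastMiddle : Option ℕ) :
    Prog V (Option ℕ) := do
  match ← getParent node with
  | none => return lastMiddle
  | some parent =>
    let isLeftChild ← isChildZero parent node
    let hasL ← hasLeftBoundary node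
    let hasR ← hasRightBoundary node
    let parentFlip ← getFlip parent
    let isMiddle' := if isLeftChild then isRight || (isMiddle && !hasR)
      else isLeft || (isMiddle && !hasL)
    let isLeft' := (isLeftChild != parentFlip) && !isMiddle'
    let isRight' := (isLeftChild == parentFlip) && !isMiddle'
    if isMiddle' then
      if ← hasMiddleBoundary parent then
        consumingLoop parent isLeft' isMiddle' isRight' (some parent)
      else
        return some parent
    else
      consumingLoop parent isLeft' isMiddle' isRight' lastMiddle
  partial_fixpoint

def findConsumingNode [DecidableEq V] (v : V) : Prog V (Option ℕ) := do
  match ← anyEdge v with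
  | none => return none
  | some node =>
    semiSplay node
    if ← degreeGeTwo v then
      let ends ← getEndpoints node
      let fl ← getFlip node
      consumingLoop node (decide (ends.1 = v) != fl) false (decide (ends.2 = v) != fl) none
    else
      return some node

/-! ## External operations -/

/-- The first loop of `expose`: rotate until the consuming node is a point cluster. -/
def rotateToPoint (node : ℕ) : Prog V ℕ := do
  if ← isPath node then
    let parent ← deref (← getParent node)
    pushFlip node
    let isZero ← isChildZero parent node
    let c ← getChildren node
    rotateUp (if isZero then c.1 else c.2)
    rotateToPoint parent
  else
    return node
  partial_fixpoint

/-- Add one to the number of boundary vertices of `node` and of all its ancestors; returns the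
root. -/
def incrementPath (node : ℕ) : Prog V ℕ := do
  setNumBoundary node ((← getNumBoundary node) + 1)
  match ← getParent node with
  | some parent => incrementPath parent
  | none => return node
  partial_fixpoint

/-- Subtract one from the number of boundary vertices of `node` and of all its ancestors; returns
the root. -/
def decrementPath (node : ℕ) : Prog V ℕ := do
  setNumBoundary node ((← getNumBoundary node) - 1)
  match ← getParent node with
  | some parent => decrementPath parent
  | none => return node
  partial_fixpoint

/-- Delete `node` and all its ancestors; the siblings on the way become roots. -/
def deleteAllAncestors (node : ℕ) : Prog V Unit := do
  match ← getParent node with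
  | some p =>
    let s ← sibling node
    deleteAllAncestors p
    setParent s none
  | none => pure ()
  deleteNode node
  partial_fixpoint

/-- A new internal node with the roots `c₀` and `c₁` as children. -/
def newInternal (c₀ c₁ : ℕ) (numBoundary : ℕ) : Prog V ℕ := do
  let x ← newNode ⟨none, .internal c₀ c₁, numBoundary, false⟩
  setParent c₀ (some x)
  setParent c₁ (some x)
  return x

variable [DecidableEq V]

def expose (v : V) : Prog V (Option ℕ) := do
  match ← findConsumingNode v with
  | none =>
    setExposed v true
    return none
  | some node =>
    let node ← rotateToPoint node
    fullSplay node
    let root ← incrementPath node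
    setExposed v true
    return some root

def deexpose (v : V) : Prog V (Option ℕ) := do
  match ← findConsumingNode v with
  | none =>
    setExposed v false
    return none
  | some node =>
    let root ← decrementPath node
    setExposed v false
    return some root

def link (u v : V) : Prog V (Option ℕ) := do
  let Tu ← expose u
  match Tu with
  | some x => if ← hasLeftBoundary x then toggleFlip x
  | none => pure ()
  setExposed u false
  let Tv ← expose v
  match Tv with
  | some y => if ← hasRightBoundary y then toggleFlip y
  | none => pure ()
  setExposed v false
  let e ← newNode ⟨none, .leaf u v, Tu.isSome.toNat + Tv.isSome.toNat, false⟩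
  addIncident u e
  addIncident v e
  let T ← (match Tu with
    | some x => newInternal x e Tv.isSome.toNat
    | none => pure e)
  let T ← (match Tv with
    | some y => newInternal T y 0
    | none => pure T)
  return some T

def cut (e : ℕ) : Prog V (Option ℕ × Option ℕ) := do
  let ends ← getEndpoints e
  fullSplay e
  deleteAllAncestors e
  removeIncident ends.1 e
  removeIncident ends.2 e
  setExposed ends.1 true
  setExposed ends.2 true
  let Tu ← deexpose ends.1
  let Tv ← deexpose ends.2
  return (Tu, Tv)

end TopTreeProg

/-! # Top trees

The conceptual oriented binary tree, that is, with all flip bits carried out.  Each node carries its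
address. -/

inductive TopTree (V : Type) where
  | leaf (addr : ℕ) (a b : V)
  | node (addr : ℕ) (l r : TopTree V)

namespace TopTree

variable {V : Type}

def addr : TopTree V → ℕ
  | leaf x _ _ => x
  | node x _ _ => x

/-- Reverse the left-to-right order in the whole subtree. -/
def mirror : TopTree V → TopTree V
  | leaf x a b => leaf x b a
  | node x l r => node x r.mirror l.mirror

def mirrorIf (b : Bool) (t : TopTree V) : TopTree V := if b then t.mirror else t

/-- All nodes of the tree, each given as the subtree rooted at it. -/
def subtrees : TopTree V → List (TopTree V)
  | leaf x a b => [leaf x a b]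
  | node x l r => node x l r :: (l.subtrees ++ r.subtrees)

/-- `s(x)` for the root `x` of the tree. -/
def numLeaves : TopTree V → ℕ
  | leaf _ _ _ => 1
  | node _ l r => l.numLeaves + r.numLeaves

/-- The cluster of the root of the tree: its set of edges. -/
def cluster : TopTree V → Set (Sym2 V)
  | leaf _ a b => {s(a, b)}
  | node _ l r => l.cluster ∪ r.cluster

/-- The vertices that are incident to an edge of the cluster. -/
def verts : TopTree V → Set V
  | leaf _ a b => {a, b}
  | node _ l r => l.verts ∪ r.verts

section
variable (G : SimpleGraph V) (X : Set V)

/-- The boundary vertices of the cluster, where `G` is the underlying forest and `X` the set of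
exposed vertices. -/
def boundary (t : TopTree V) : Set V :=
  {v | v ∈ t.verts ∧ (v ∈ X ∨ ∃ e ∈ G.edgeSet, e ∉ t.cluster ∧ v ∈ e)}

/-- `v` is a left boundary vertex of the root of the tree. -/
def IsLeftBoundary (t : TopTree V) (v : V) : Prop :=
  v ∈ t.boundary G X ∧
    match t with
    | leaf _ a _ => v = a
    | node _ l r => v ∈ l.verts ∧ v ∉ r.verts

/-- `v` is a middle boundary vertex: it is the central vertex. -/
def IsMiddleBoundary (t : TopTree V) (v : V) : Prop :=
  v ∈ t.boundary G X ∧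
    match t with
    | leaf _ _ _ => False
    | node _ l r => v ∈ l.verts ∧ v ∈ r.verts

/-- `v` is a right boundary vertex. -/
def IsRightBoundary (t : TopTree V) (v : V) : Prop :=
  v ∈ t.boundary G X ∧
    match t with
    | leaf _ _ b => v = b
    | node _ l r => v ∉ l.verts ∧ v ∈ r.verts

def IsLeftmostBoundary (t : TopTree V) (v : V) : Prop :=
  t.IsLeftBoundary G X v ∨ ((¬ ∃ w, t.IsLeftBoundary G X w) ∧ t.IsMiddleBoundary G X v)

def IsRightmostBoundary (t : TopTree V) (v : V) : Prop :=
  t.IsRightBoundary G X v ∨ ((¬ ∃ w, t.IsRightBoundary G X w) ∧ t.IsMiddleBoundary G X v)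

/-- The root of the tree is a valid cluster: a connected set of edges of the forest, with at most
two boundary vertices, and the disjoint union of its two children if it is not a leaf. -/
structure IsValidCluster (t : TopTree V) : Prop where
  subset : t.cluster ⊆ G.edgeSet
  connected : ∀ v ∈ t.verts, ∀ w ∈ t.verts, (SimpleGraph.fromEdgeSet t.cluster).Reachable v w
  boundary_le : (t.boundary G X).encard ≤ 2
  disjoint : match t with
    | leaf _ _ _ => True
    | node _ l r => Disjoint l.cluster r.cluster

/-- The orientation invariant at the root of the tree: the rightmost boundary vertex of the left
child and the leftmost boundary vertex of the right child exist and are the central vertex, that is,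
the only vertex shared by the two children. -/
def IsOriented (t : TopTree V) : Prop :=
  match t with
  | leaf _ _ _ => True
  | node _ l r => ∃ c, l.verts ∩ r.verts = {c} ∧
      l.IsRightmostBoundary G X c ∧ r.IsLeftmostBoundary G X c

end

/-- `Σ_{x ∈ T} r(x)` with `r(x) = log₂ s(x)`. -/
noncomputable def potential (t : TopTree V) : ℝ :=
  (t.subtrees.map fun c => Real.logb 2 c.numLeaves).sum

end TopTree

/-- `F` is a family of top trees, satisfying all invariants, for the forest `G` with the set `X` of
exposed vertices: one top tree for each tree of `G` with at least one edge. -/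
structure IsTopForest {V : Type} (G : SimpleGraph V) (X : Set V) (F : List (TopTree V)) :
    Prop where
  acyclic : G.IsAcyclic
  valid : ∀ t ∈ F, ∀ c ∈ t.subtrees, c.IsValidCluster G X
  oriented : ∀ t ∈ F, ∀ c ∈ t.subtrees, c.IsOriented G X
  /-- The root cluster consists of all the edges of one tree of the forest. -/
  component : ∀ t ∈ F, ∀ v ∈ t.verts,
    t.cluster = {e | e ∈ G.edgeSet ∧ ∀ w ∈ e, G.Reachable v w}
  covers : ∀ e ∈ G.edgeSet, ∃ t ∈ F, e ∈ t.cluster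
  disjoint : F.Pairwise fun t t' => Disjoint t.cluster t'.cluster

/-- The potential `Φ` of a family of top trees. -/
noncomputable def forestPotential {V : Type} (F : List (TopTree V)) : ℝ :=
  (F.map TopTree.potential).sum

/-- `StoredAt s p x t`: the subtree of nodes below address `x` in memory, with the flip bits in it
carried out, is `t`, and the parent pointer of `x` is `p`. -/
inductive StoredAt {V : Type} (s : Mem V) : Option ℕ → ℕ → TopTree V → Prop
  | leaf {p : Option ℕ} {x k : ℕ} {fl : Bool} {a b : V}
      (h : s.node x = some ⟨p, .leaf a b, k, fl⟩) :
      StoredAt s p x ((TopTree.leaf x a b).mirrorIf fl)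
  | node {p : Option ℕ} {x k : ℕ} {fl : Bool} {c₀ c₁ : ℕ} {t₀ t₁ : TopTree V}
      (h : s.node x = some ⟨p, .internal c₀ c₁, k, fl⟩)
      (h₀ : StoredAt s (some x) c₀ t₀) (h₁ : StoredAt s (some x) c₁ t₁) :
      StoredAt s p x ((TopTree.node x t₀ t₁).mirrorIf fl)

/-- The memory `s` holds the forest `G`, the exposed vertices `X` and the top trees `F`. -/
structure Stores {V : Type} (s : Mem V) (G : SimpleGraph V) (X : Set V) (F : List (TopTree V)) :
    Prop where
  stored : ∀ t ∈ F, StoredAt s none t.addr t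
  /-- Different nodes have different addresses. -/
  nodup : ((F.flatMap TopTree.subtrees).map TopTree.addr).Nodup
  /-- There are no other nodes in memory. -/
  allocated : ∀ x, s.node x ≠ none → x ∈ (F.flatMap TopTree.subtrees).map TopTree.addr
  fresh : ∀ x, s.node x ≠ none → x < s.next
  numBoundary : ∀ t ∈ F, ∀ c ∈ t.subtrees, ∀ r, s.node c.addr = some r →
    r.numBoundary = (c.boundary G X).ncard
  exposed : ∀ v, s.exposed v = true ↔ v ∈ X
  incident_nodup : ∀ v, (s.incident v).Nodup
  incident_mem : ∀ v e, e ∈ s.incident v ↔ ∃ a b, s.edgeAt e = some (a, b) ∧ (v = a ∨ v = b)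

/-- The state of the data structure: the memory `s` holds the forest `G` with exposed vertices `X`
and the family `F` of top trees, and all invariants hold. -/
def Represents {V : Type} (s : Mem V) (G : SimpleGraph V) (X : Set V) (F : List (TopTree V)) :
    Prop :=
  IsTopForest G X F ∧ Stores s G X F

/-- `r` is the root of the top tree of the tree containing `v`; it is null if `v` is isolated. -/
def IsRootOf {V : Type} (F : List (TopTree V)) (v : V) (r : Option ℕ) : Prop :=
  match r with
  | some x => ∃ t ∈ F, v ∈ t.verts ∧ t.addr = x
  | none => ∀ t ∈ F, v ∉ t.verts

/-- The number of vertices of the tree of `G` containing `v`. -/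
noncomputable def treeSize {V : Type} (G : SimpleGraph V) (v : V) : ℕ :=
  {w | G.Reachable v w}.ncard

/-- The amortized cost of an operation leading from memory `s` with top trees `F` to memory `s'`
with top trees `F'`: the number of steps plus the change of the potential, where one unit of
potential pays for `K` steps. -/
noncomputable def amortizedCost {V : Type} (K : ℝ) (s : Mem V) (F : List (TopTree V))
    (s' : Mem V) (F' : List (TopTree V)) : ℝ :=
  ((s'.time : ℝ) - (s.time : ℝ)) + K * (forestPotential F' - forestPotential F)

set_option linter.unusedSimpArgs false

/-- The physical shape of a top tree in memory: addresses, flip bits and boundary counts. -/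
inductive RTree (V : Type) where
  | leaf (x : ℕ) (fl : Bool) (k : ℕ) (a b : V)
  | node (x : ℕ) (fl : Bool) (k : ℕ) (l r : RTree V)

namespace RTree

variable {V : Type}

def addr : RTree V → ℕ
  | leaf x _ _ _ _ => x
  | node x _ _ _ _ => x

def count : RTree V → ℕ
  | leaf _ _ k _ _ => k
  | node _ _ k _ _ => k

def toggle : RTree V → RTree V
  | leaf x fl k a b => leaf x (!fl) k a b
  | node x fl k l r => node x (!fl) k l r

def verts : RTree V → Set V
  | leaf _ _ _ a b => {a, b}
  | node _ _ _ l r => l.verts ∪ r.verts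

/-- The node with the children `p` and `q`, where `p` is child zero if and only if `σ`. -/
def mk (x : ℕ) (fl : Bool) (k : ℕ) (σ : Bool) (p q : RTree V) : RTree V :=
  match σ with
  | true => node x fl k p q
  | false => node x fl k q p

/-- `v` is a left (`σ = false`) or right (`σ = true`) boundary vertex, where `O` is the set of
vertices that are exposed or incident to an edge outside the cluster. -/
def Side (O : Set V) (σ : Bool) : RTree V → V → Prop
  | leaf _ fl _ a b, v => v ∈ O ∧ v = if (σ ^^ fl) then b else a
  | node _ fl _ l r, v =>
    v ∈ O ∧ if (σ ^^ fl) then v ∈ r.verts ∧ v ∉ l.verts else v ∈ l.verts ∧ v ∉ r.verts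

def Mid (O : Set V) : RTree V → V → Prop
  | leaf _ _ _ _ _, _ => False
  | node _ _ _ l r, v => v ∈ O ∧ v ∈ l.verts ∧ v ∈ r.verts

/-- The leftmost or rightmost boundary vertex. -/
def Most (O : Set V) (σ : Bool) (t : RTree V) (v : V) : Prop :=
  t.Side O σ v ∨ (¬ ∃ w, t.Side O σ w) ∧ t.Mid O v

/-- All the invariants of a top tree, relative to the set `O` of vertices that are exposed or
incident to an edge outside the tree. -/
def WF (O : Set V) : RTree V → Prop
  | leaf _ _ k a b => a ≠ b ∧ k = (({a, b} : Set V) ∩ O).ncard ∧ k ≤ 2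
  | node _ _ k l r =>
    k = ((l.verts ∪ r.verts) ∩ O).ncard ∧ k ≤ 2 ∧ WF (O ∪ r.verts) l ∧ WF (O ∪ l.verts) r ∧
      ∃ c, l.verts ∩ r.verts = {c} ∧ l.Most (O ∪ r.verts) true c ∧ r.Most (O ∪ l.verts) false c

def isP (t : RTree V) : Bool := t.count == 2

@[simp] theorem mk_addr (x fl k σ) (p q : RTree V) : (mk x fl k σ p q).addr = x := by
  cases σ <;> rfl
@[simp] theorem mk_count (x fl k σ) (p q : RTree V) : (mk x fl k σ p q).count = k := by
  cases σ <;> rfl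
@[simp] theorem mk_isP (x fl k σ) (p q : RTree V) : (mk x fl k σ p q).isP = (k == 2) := by
  cases σ <;> rfl
@[simp] theorem mk_verts (x fl k σ) (p q : RTree V) :
    (mk x fl k σ p q).verts = p.verts ∪ q.verts := by
  cases σ
  · exact Set.union_comm _ _
  · rfl
@[simp] theorem mk_toggle (x fl k σ) (p q : RTree V) :
    (mk x fl k σ p q).toggle = mk x (!fl) k σ p q := by
  cases σ <;> rfl
theorem mk_swap (x fl k σ) (p q : RTree V) : mk x fl k (!σ) p q = mk x fl k σ q p := by
  cases σ <;> rfl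
@[simp] theorem toggle_addr (t : RTree V) : t.toggle.addr = t.addr := by cases t <;> rfl
@[simp] theorem toggle_count (t : RTree V) : t.toggle.count = t.count := by cases t <;> rfl
@[simp] theorem toggle_isP (t : RTree V) : t.toggle.isP = t.isP := by cases t <;> rfl
@[simp] theorem toggle_verts (t : RTree V) : t.toggle.verts = t.verts := by cases t <;> rfl
@[simp] theorem toggle_toggle (t : RTree V) : t.toggle.toggle = t := by cases t <;> simp [toggle]

theorem side_mk (O : Set V) (τ x fl k σ) (p q : RTree V) (v : V) :
    (mk x fl k σ p q).Side O τ v ↔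
      v ∈ O ∧ if (τ ^^ fl) = σ then v ∈ q.verts ∧ v ∉ p.verts else v ∈ p.verts ∧ v ∉ q.verts := by
  cases σ <;> cases τ <;> cases fl <;> simp [mk, Side]

theorem mid_mk (O : Set V) (x fl k σ) (p q : RTree V) (v : V) :
    (mk x fl k σ p q).Mid O v ↔ v ∈ O ∧ v ∈ p.verts ∧ v ∈ q.verts := by
  cases σ <;> simp [mk, Mid, and_comm]

theorem side_toggle (O : Set V) (σ) (t : RTree V) (v : V) :
    t.toggle.Side O σ v ↔ t.Side O (!σ) v := by
  cases t <;> simp [Side, toggle]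

theorem mid_toggle (O : Set V) (t : RTree V) (v : V) : t.toggle.Mid O v ↔ t.Mid O v := by
  cases t <;> simp [Mid, toggle]

theorem most_toggle (O : Set V) (σ) (t : RTree V) (v : V) :
    t.toggle.Most O σ v ↔ t.Most O (!σ) v := by
  simp only [Most, side_toggle, mid_toggle]

theorem wf_toggle (O : Set V) (t : RTree V) : t.toggle.WF O ↔ t.WF O := by
  cases t <;> simp [WF, toggle]

theorem wf_mk (O : Set V) (x fl k σ) (p q : RTree V) :
    (mk x fl k σ p q).WF O ↔ k = ((p.verts ∪ q.verts) ∩ O).ncard ∧ k ≤ 2 ∧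
      p.WF (O ∪ q.verts) ∧ q.WF (O ∪ p.verts) ∧
      ∃ c, p.verts ∩ q.verts = {c} ∧ p.Most (O ∪ q.verts) σ c ∧ q.Most (O ∪ p.verts) (!σ) c := by
  cases σ
  · simp only [mk, WF, Bool.not_false, Set.union_comm q.verts p.verts,
      Set.inter_comm q.verts p.verts]
    constructor <;> rintro ⟨h1, h2, h3, h4, c, h5, h6, h7⟩ <;> exact ⟨h1, h2, h4, h3, c, h5, h7, h6⟩
  · rfl

theorem verts_finite (t : RTree V) : t.verts.Finite := by
  induction t with
  | leaf x fl k a b => exact (Set.finite_singleton b).insert a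
  | node x fl k l r hl hr => exact hl.union hr

theorem WF.count_eq {O : Set V} {t : RTree V} (h : t.WF O) : t.count = (t.verts ∩ O).ncard := by
  cases t with
  | leaf => exact h.2.1
  | node => exact h.1

theorem WF.count_le {O : Set V} {t : RTree V} (h : t.WF O) : t.count ≤ 2 := by
  cases t with
  | leaf => exact h.2.2
  | node => exact h.2.1

theorem Side.mem {O : Set V} {σ} {t : RTree V} {v : V} (h : t.Side O σ v) :
    v ∈ t.verts ∧ v ∈ O := by
  cases t with
  | leaf x fl k a b =>
    obtain ⟨h1, h2⟩ := h
    refine ⟨?_, h1⟩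
    rw [h2]
    split_ifs
    · exact Or.inr rfl
    · exact Or.inl rfl
  | node x fl k l r =>
    obtain ⟨h1, h2⟩ := h
    refine ⟨?_, h1⟩
    split_ifs at h2
    · exact Or.inr h2.1
    · exact Or.inl h2.1

theorem Mid.mem {O : Set V} {t : RTree V} {v : V} (h : t.Mid O v) : v ∈ t.verts ∧ v ∈ O := by
  cases t with
  | leaf x fl k a b => exact h.elim
  | node x fl k l r => exact ⟨Or.inl h.2.1, h.1⟩

theorem Most.mem {O : Set V} {σ} {t : RTree V} {v : V} (h : t.Most O σ v) :
    v ∈ t.verts ∧ v ∈ O := by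
  rcases h with h | ⟨-, h⟩
  exacts [h.mem, h.mem]

theorem side_congr {O O' : Set V} {t : RTree V} (h : ∀ v ∈ t.verts, v ∈ O ↔ v ∈ O') (σ) (v : V) :
    t.Side O σ v ↔ t.Side O' σ v := by
  have key : ∀ {A B : Set V}, (∀ v ∈ t.verts, v ∈ A ↔ v ∈ B) → t.Side A σ v → t.Side B σ v := by
    intro A B hAB hs
    have := (hAB v hs.mem.1).1 hs.mem.2
    cases t with
    | leaf => exact ⟨this, hs.2⟩
    | node => exact ⟨this, hs.2⟩
  exact ⟨key h, key fun v hv => (h v hv).symm⟩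

theorem mid_congr {O O' : Set V} {t : RTree V} (h : ∀ v ∈ t.verts, v ∈ O ↔ v ∈ O') (v : V) :
    t.Mid O v ↔ t.Mid O' v := by
  cases t with
  | leaf => exact Iff.rfl
  | node x fl k l r =>
    constructor <;> rintro ⟨h1, h2, h3⟩
    · exact ⟨(h v (Or.inl h2)).1 h1, h2, h3⟩
    · exact ⟨(h v (Or.inl h2)).2 h1, h2, h3⟩

theorem most_congr {O O' : Set V} {t : RTree V} (h : ∀ v ∈ t.verts, v ∈ O ↔ v ∈ O') (σ) (v : V) :
    t.Most O σ v ↔ t.Most O' σ v := by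
  simp only [Most, side_congr h, mid_congr h]

theorem wf_congr {O O' : Set V} {t : RTree V} (h : ∀ v ∈ t.verts, v ∈ O ↔ v ∈ O') :
    t.WF O ↔ t.WF O' := by
  induction t generalizing O O' with
  | leaf x fl k a b =>
    have : ({a, b} : Set V) ∩ O = {a, b} ∩ O' := by
      ext v; exact and_congr_right fun hv => h v hv
    simp only [WF, this]
  | node x fl k l r hl hr =>
    have h1 : (l.verts ∪ r.verts) ∩ O = (l.verts ∪ r.verts) ∩ O' := by
      ext v; exact and_congr_right fun hv => h v hv
    have h2 : ∀ v ∈ l.verts, v ∈ O ∪ r.verts ↔ v ∈ O' ∪ r.verts := fun v hv =>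
      or_congr_left (h v (Or.inl hv))
    have h3 : ∀ v ∈ r.verts, v ∈ O ∪ l.verts ↔ v ∈ O' ∪ l.verts := fun v hv =>
      or_congr_left (h v (Or.inr hv))
    simp only [WF, h1, hl h2, hr h3, most_congr h2, most_congr h3]

/-- A path cluster has exactly two boundary vertices. -/
theorem WF.exists_of_two {O : Set V} {t : RTree V} (h : t.WF O) (hk : t.count = 2) :
    ∃ p q, p ≠ q ∧ t.verts ∩ O = {p, q} := by
  rw [h.count_eq] at hk
  exact Set.ncard_eq_two.1 hk

theorem WF.eq_of_ne_two {O : Set V} {t : RTree V} (h : t.WF O) (hk : t.count ≠ 2) {p q : V}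
    (hp : p ∈ t.verts) (hp' : p ∈ O) (hq : q ∈ t.verts) (hq' : q ∈ O) : p = q := by
  have h1 := h.count_eq
  have h2 := h.count_le
  have : (t.verts ∩ O).ncard ≤ 1 := by omega
  exact (Set.ncard_le_one (t.verts_finite.inter_of_left O)).1 this p ⟨hp, hp'⟩ q ⟨hq, hq'⟩

theorem WF.three {O : Set V} {t : RTree V} (h : t.WF O) {p q r : V}
    (hp : p ∈ t.verts ∧ p ∈ O) (hq : q ∈ t.verts ∧ q ∈ O) (hr : r ∈ t.verts ∧ r ∈ O) :
    p = q ∨ p = r ∨ q = r := by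
  by_cases hk : t.count = 2
  · obtain ⟨a, b, -, hab⟩ := h.exists_of_two hk
    have := fun v => Set.ext_iff.1 hab v
    simp only [Set.mem_inter_iff, Set.mem_insert_iff, Set.mem_singleton_iff] at this
    rw [this] at hp hq hr
    grind
  · exact Or.inl (h.eq_of_ne_two hk hp.1 hp.2 hq.1 hq.2)

theorem WF.two_of_ne {O : Set V} {t : RTree V} (h : t.WF O) {p q : V}
    (hp : p ∈ t.verts ∧ p ∈ O) (hq : q ∈ t.verts ∧ q ∈ O) (hpq : p ≠ q) : t.count = 2 := by
  by_contra hk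
  exact hpq (h.eq_of_ne_two hk hp.1 hp.2 hq.1 hq.2)

theorem WF.exists_ne {O : Set V} {t : RTree V} (h : t.WF O) (hk : t.count = 2) (p : V) :
    ∃ q, q ∈ t.verts ∧ q ∈ O ∧ q ≠ p := by
  obtain ⟨a, b, hne, hab⟩ := h.exists_of_two hk
  have ha : a ∈ t.verts ∩ O := hab ▸ Or.inl rfl
  have hb : b ∈ t.verts ∩ O := hab ▸ Or.inr rfl
  by_cases hap : a = p
  · exact ⟨b, hb.1, hb.2, fun h => hne (hap.trans h.symm)⟩
  · exact ⟨a, ha.1, ha.2, hap⟩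

/-- Every boundary vertex is left, middle or right. -/
theorem position {O : Set V} {t : RTree V} {v : V} (hv : v ∈ t.verts) (hO : v ∈ O) (σ : Bool) :
    t.Side O σ v ∨ t.Mid O v ∨ t.Side O (!σ) v := by
  cases t with
  | leaf x fl k a b =>
    rcases hv with rfl | rfl <;> cases σ <;> cases fl <;> simp [Side, Mid, hO]
  | node x fl k l r =>
    by_cases h1 : v ∈ l.verts <;> by_cases h2 : v ∈ r.verts <;> cases σ <;> cases fl <;>
      simp_all [Side, Mid, verts]

theorem Mid.not_side {O : Set V} {t : RTree V} {v : V} (h : t.Mid O v) (σ : Bool) :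
    ¬ t.Side O σ v := by
  cases t with
  | leaf => exact h.elim
  | node x fl k l r => cases σ <;> cases fl <;> simp_all [Side, Mid]

theorem WF.mid_unique {O O' : Set V} {t : RTree V} (h : t.WF O') {v w : V} (hv : t.Mid O v)
    (hw : t.Mid O w) : v = w := by
  cases t with
  | leaf => exact hv.elim
  | node x fl k l r =>
    obtain ⟨-, -, -, -, c, hc, -⟩ := h
    have h1 : v ∈ l.verts ∩ r.verts := hv.2
    have h2 : w ∈ l.verts ∩ r.verts := hw.2
    rw [hc] at h1 h2
    exact h1.trans h2.symm

theorem WF.not_side_both {O O' : Set V} {t : RTree V} (h : t.WF O') {v : V} {σ : Bool}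
    (hv : t.Side O σ v) : ¬ t.Side O (!σ) v := by
  cases t with
  | leaf x fl k a b =>
    have := h.1
    cases σ <;> cases fl <;> simp_all [Side, eq_comm]
  | node x fl k l r => cases σ <;> cases fl <;> simp_all [Side]

theorem WF.side_unique {O : Set V} {t : RTree V} (h : t.WF O) {v w : V} {σ : Bool}
    (hv : t.Side O σ v) (hw : t.Side O σ w) : v = w := by
  cases t with
  | leaf x fl k a b => exact hv.2.trans hw.2.symm
  | node x fl k l r =>
    obtain ⟨-, -, hl, hr, c, hc, -⟩ := h
    have hc' : c ∈ l.verts ∩ r.verts := hc ▸ rfl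
    obtain ⟨hv1, hv2⟩ := hv
    obtain ⟨hw1, hw2⟩ := hw
    split_ifs at hv2 hw2
    · rcases hr.three ⟨hv2.1, Or.inl hv1⟩ ⟨hw2.1, Or.inl hw1⟩ ⟨hc'.2, Or.inr hc'.1⟩ with e | e | e
      exacts [e, (hv2.2 (e ▸ hc'.1)).elim, (hw2.2 (e ▸ hc'.1)).elim]
    · rcases hl.three ⟨hv2.1, Or.inl hv1⟩ ⟨hw2.1, Or.inl hw1⟩ ⟨hc'.1, Or.inr hc'.2⟩ with e | e | e
      exacts [e, (hv2.2 (e ▸ hc'.2)).elim, (hw2.2 (e ▸ hc'.2)).elim]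

/-- The boundary vertex of a path cluster other than the one at one end is at the other end. -/
theorem WF.most_other {O : Set V} {t : RTree V} (h : t.WF O) {σ : Bool} {c d : V}
    (hc : t.Most O σ c) (hd : d ∈ t.verts) (hd' : d ∈ O) (hne : d ≠ c) : t.Most O (!σ) d := by
  rcases position hd hd' (!σ) with hs | hm | hs
  · exact Or.inl hs
  · refine Or.inr ⟨?_, hm⟩
    rintro ⟨w, hw⟩
    have hwd : w ≠ d := fun e => hm.not_side _ (e ▸ hw)
    rcases hc with hc | ⟨-, hc⟩
    · have hwc : w ≠ c := fun e => h.not_side_both hc (e ▸ hw)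
      rcases h.three hw.mem ⟨hd, hd'⟩ hc.mem with e | e | e
      exacts [hwd e, hwc e, hne e]
    · exact hne (h.mid_unique hm hc)
  · rw [Bool.not_not] at hs
    rcases hc with hc | ⟨hc, -⟩
    · exact (hne (h.side_unique hs hc)).elim
    · exact (hc ⟨d, hs⟩).elim

/-- The computation of `has_middle_boundary` from the boundary counts. -/
def midCount (k : ℕ) (p q : RTree V) : Bool := k - p.isP.toNat - q.isP.toNat != 0

theorem WF.ncard_diff {O : Set V} {t : RTree V} (h : t.WF O) {c : V} (hc : c ∈ t.verts)
    (hO : c ∈ O) : ((t.verts ∩ O) \ {c}).ncard = t.isP.toNat := by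
  have h1 := Set.ncard_sdiff_singleton_add_one (show c ∈ t.verts ∩ O from ⟨hc, hO⟩)
    (t.verts_finite.inter_of_left O)
  rw [← h.count_eq] at h1
  have h2 := h.count_le
  have : t.isP.toNat = if t.count = 2 then 1 else 0 := by
    by_cases h : t.count = 2 <;> simp [isP, h]
  rw [this]
  split_ifs <;> omega

theorem midCount_iff {O : Set V} {k : ℕ} {p q : RTree V} {c : V}
    (hk : k = ((p.verts ∪ q.verts) ∩ O).ncard) (hp : p.WF (O ∪ q.verts)) (hq : q.WF (O ∪ p.verts))
    (hc : p.verts ∩ q.verts = {c}) : midCount k p q = true ↔ c ∈ O := by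
  have hc' : c ∈ p.verts ∩ q.verts := hc ▸ rfl
  have h1 := hp.ncard_diff hc'.1 (Or.inr hc'.2)
  have h2 := hq.ncard_diff hc'.2 (Or.inr hc'.1)
  set A := (p.verts ∩ (O ∪ q.verts)) \ {c}
  set B := (q.verts ∩ (O ∪ p.verts)) \ {c}
  have hmem : ∀ v, v ∈ p.verts → v ∈ q.verts → v = c := fun v h1 h2 => by
    have : v ∈ p.verts ∩ q.verts := ⟨h1, h2⟩
    rwa [hc] at this
  have hAB : Disjoint A B := Set.disjoint_left.2 fun v hv hw => hv.2 (hmem v hv.1.1 hw.1.1)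
  have hfA : A.Finite := (p.verts_finite.inter_of_left _).sdiff
  have hfB : B.Finite := (q.verts_finite.inter_of_left _).sdiff
  have hun : (p.verts ∪ q.verts) ∩ O = (A ∪ B) ∪ ({c} ∩ O) := by
    ext v
    simp only [A, B, Set.mem_inter_iff, Set.mem_union, Set.mem_sdiff, Set.mem_singleton_iff]
    have := hmem v
    have h3 := hc'.1
    have h4 := hc'.2
    by_cases hvc : v = c
    · subst hvc; tauto
    · tauto
  have hcard : k = (p.isP.toNat + q.isP.toNat) + (({c} : Set V) ∩ O).ncard := by
    have hd : Disjoint (A ∪ B) ({c} ∩ O) := by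
      refine Set.disjoint_left.2 fun v hv hw => ?_
      have : v = c := hw.1
      rcases hv with hv | hv
      · exact hv.2 this
      · exact hv.2 this
    rw [hk, hun, Set.ncard_union_eq hd (hfA.union hfB) ((Set.finite_singleton c).inter_of_left O),
      Set.ncard_union_eq hAB hfA hfB, h1, h2]
  by_cases hO : c ∈ O
  · have : ({c} : Set V) ∩ O = {c} := by simpa using hO
    rw [this, Set.ncard_singleton] at hcard
    simp only [midCount, hO, iff_true, bne_iff_ne]
    omega
  · have : ({c} : Set V) ∩ O = ∅ := by simpa using hO
    rw [this, Set.ncard_empty] at hcard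
    simp only [midCount, hO, iff_false, bne_iff_ne]
    omega

/-- A child is a path cluster if and only if it contributes a boundary vertex. -/
theorem isP_iff_exists {O : Set V} {p q : RTree V} {c : V} (hp : p.WF (O ∪ q.verts))
    (hc : p.verts ∩ q.verts = {c}) :
    p.isP = true ↔ ∃ v, v ∈ O ∧ v ∈ p.verts ∧ v ∉ q.verts := by
  have hc' : c ∈ p.verts ∩ q.verts := hc ▸ rfl
  simp only [isP, beq_iff_eq]
  constructor
  · intro h
    obtain ⟨v, hv1, hv2, hne⟩ := hp.exists_ne h c
    have : v ∉ q.verts := fun hq => by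
      have : v ∈ p.verts ∩ q.verts := ⟨hv1, hq⟩
      rw [hc] at this
      exact hne this
    exact ⟨v, hv2.resolve_right this, hv1, this⟩
  · rintro ⟨v, hO, hv, hq⟩
    exact hp.two_of_ne ⟨hv, Or.inl hO⟩ ⟨hc'.1, Or.inr hc'.2⟩ fun e => hq (e ▸ hc'.2)

/-- The outcome of rotating `x` up, where the grandparent `z` has the children `b` and
`y = mk σ' a x`, and `ζ` tells whether `z` is child zero of its parent. -/
def rotRes (ζ : Option Bool) (σ σ' : Bool) (y z kz : ℕ) (b a x : RTree V)
    (gpMid : Bool) : RTree V :=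
  if σ' = σ then
    if a.isP then
      mk z (gpMid && !(kz == 2) && (ζ == some σ)) kz σ
        (mk y false (if gpMid || b.isP then 2 else 1) σ b a) x
    else mk z false kz σ (mk y false (if b.isP then 2 else 1) σ b a.toggle) x
  else mk z a.isP kz σ (mk y a.isP (if a.isP || b.isP then 2 else 1) σ b a) x.toggle

end RTree

namespace RTree
variable {V : Type}

theorem ncard_eq_ite {S : Set V} {c : V} (hc : c ∈ S)
    (h3 : ∀ p q, p ∈ S → q ∈ S → p = c ∨ q = c ∨ p = q) {P : Bool}
    (hP : P = true ↔ ∃ q, q ∈ S ∧ q ≠ c) : S.ncard = if P then 2 else 1 := by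
  cases P
  · have : S = {c} := by
      ext v
      constructor
      · intro hv
        by_contra hne
        exact absurd (hP.2 ⟨v, hv, hne⟩) (by simp)
      · rintro rfl; exact hc
    simp [this]
  · obtain ⟨q, hq, hne⟩ := hP.1 rfl
    have : S = {q, c} := by
      ext v
      constructor
      · intro hv
        rcases h3 v q hv hq with h | h | h
        · exact Or.inr h
        · exact (hne h).elim
        · exact Or.inl h
      · rintro (rfl | rfl)
        exacts [hq, hc]
    simp [this, Set.ncard_pair hne]

/-- Reassembling the three parts of a rotation. -/
theorem wf_assemble {O : Set V} {σ : Bool} {y z kz : ℕ} {fz fy : Bool} {b a x : RTree V}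
    {cy cz : V} {P : Bool}
    (hk : kz = ((b.verts ∪ (a.verts ∪ x.verts)) ∩ O).ncard) (hk2 : kz ≤ 2)
    (hb : b.WF (O ∪ (a.verts ∪ x.verts))) (ha : a.WF (O ∪ b.verts ∪ x.verts))
    (hx : x.WF (O ∪ b.verts ∪ a.verts))
    (hcz : b.verts ∩ a.verts = {cz}) (hcy : (b.verts ∪ a.verts) ∩ x.verts = {cy})
    (mb : b.Most (O ∪ (a.verts ∪ x.verts)) σ cz) (ma : a.Most (O ∪ b.verts ∪ x.verts) (!σ) cz)
    (mx : x.Most (O ∪ b.verts ∪ a.verts) (!σ) cy)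
    (h3 : ∀ p q, p ∈ b.verts ∪ a.verts → p ∈ O ∪ x.verts → q ∈ b.verts ∪ a.verts →
      q ∈ O ∪ x.verts → p = cy ∨ q = cy ∨ p = q)
    (hP : P = true ↔ ∃ q, q ∈ b.verts ∪ a.verts ∧ q ∈ O ∪ x.verts ∧ q ≠ cy)
    (my : (RTree.mk y fy (if P then 2 else 1) σ b a).Most (O ∪ x.verts) σ cy) :
    (RTree.mk z fz kz σ (RTree.mk y fy (if P then 2 else 1) σ b a) x).WF O := by
  have hc' : cy ∈ (b.verts ∪ a.verts) ∩ x.verts := hcy ▸ rfl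
  simp only [wf_mk, mk_verts]
  refine ⟨by rw [hk, Set.union_assoc], hk2, ⟨?_, by split_ifs <;> omega, ?_, ?_, cz, hcz, ?_, ?_⟩,
    ?_, cy, hcy, my, ?_⟩
  · symm
    refine ncard_eq_ite (c := cy) (show cy ∈ _ ∩ _ from ⟨hc'.1, Or.inr hc'.2⟩) (fun p q hp hq => h3 p q hp.1 hp.2 hq.1 hq.2)
      ?_
    rw [hP]
    simp only [Set.mem_inter_iff, and_assoc]
  · exact (wf_congr fun v _ => by simp only [Set.mem_union]; tauto).1 hb
  · exact (wf_congr fun v _ => by simp only [Set.mem_union]; tauto).1 ha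
  · exact (most_congr (fun v _ => by simp only [Set.mem_union]; tauto) _ _).1 mb
  · exact (most_congr (fun v _ => by simp only [Set.mem_union]; tauto) _ _).1 ma
  · exact (wf_congr fun v _ => by simp only [Set.mem_union]; tauto).1 hx
  · exact (most_congr (fun v _ => by simp only [Set.mem_union]; tauto) _ _).1 mx

structure RotHyp (O : Set V) (σ σ' : Bool) (y z ky kz : ℕ) (b a x : RTree V) (cy cz : V) :
    Prop where
  hk : kz = ((b.verts ∪ (a.verts ∪ x.verts)) ∩ O).ncard
  hk2 : kz ≤ 2
  hb : b.WF (O ∪ (a.verts ∪ x.verts))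
  ha : a.WF (O ∪ b.verts ∪ x.verts)
  hx : x.WF (O ∪ b.verts ∪ a.verts)
  hz : (RTree.mk z false kz σ b (RTree.mk y false ky σ' a x)).WF O
  hy : (RTree.mk y false ky σ' a x).WF (O ∪ b.verts)
  cy_mem : cy ∈ a.verts ∧ cy ∈ x.verts
  cy_uniq : ∀ v, v ∈ a.verts → v ∈ x.verts → v = cy
  cz_mem : cz ∈ b.verts ∧ (cz ∈ a.verts ∨ cz ∈ x.verts)
  cz_uniq : ∀ v, v ∈ b.verts → v ∈ a.verts ∨ v ∈ x.verts → v = cz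
  mb : b.Most (O ∪ (a.verts ∪ x.verts)) σ cz
  ma : a.Most (O ∪ b.verts ∪ x.verts) σ' cy
  mx : x.Most (O ∪ b.verts ∪ a.verts) (!σ') cy
  my : (RTree.mk y false ky σ' a x).Most (O ∪ b.verts) (!σ) cz
  mid : midCount kz b (RTree.mk y false ky σ' a x) = true ↔ cz ∈ O

theorem exists_rotHyp {O : Set V} {σ σ' : Bool} {y z ky kz : ℕ} {b a x : RTree V}
    (h : (RTree.mk z false kz σ b (RTree.mk y false ky σ' a x)).WF O) :
    ∃ cy cz, RotHyp O σ σ' y z ky kz b a x cy cz := by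
  have h' := h
  simp only [wf_mk, mk_verts] at h
  obtain ⟨hk, hk2, hb, hy, cz, hcz, mb, my⟩ := h
  have hy' := hy
  obtain ⟨-, -, ha, hx, cy, hcy, ma, mx⟩ := hy
  have e1 := Set.ext_iff.1 hcy
  have e2 := Set.ext_iff.1 hcz
  simp only [Set.mem_inter_iff, Set.mem_union, Set.mem_singleton_iff] at e1 e2
  have hy := (wf_mk (O ∪ b.verts) y false ky σ' a x).2 hy'
  refine ⟨cy, cz, hk, hk2, hb, ha, hx, h', hy, (e1 cy).2 rfl, fun v h1 h2 => (e1 v).1 ⟨h1, h2⟩,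
    (e2 cz).2 rfl, fun v h1 h2 => (e2 v).1 ⟨h1, h2⟩, mb, ma, mx, my, ?_⟩
  refine midCount_iff ?_ ?_ hy ?_
  · rw [mk_verts]; exact hk
  · rw [mk_verts]; exact hb
  · rw [mk_verts]; exact hcz

variable {O : Set V} {σ σ' : Bool} {y z ky kz : ℕ} {b a x : RTree V} {cy cz : V}

/-- Sufficient conditions for the new parent in a rotation to be a valid cluster. -/
def RotPre (σ σ' : Bool) (ky kz : ℕ) (x : RTree V) : Prop :=
  (σ' = σ ∧ (ky = 2 ∨ kz ≠ 2)) ∨ (σ' ≠ σ ∧ x.count ≠ 2 ∧ kz ≠ 2)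

theorem RotHyp.cz_mem_a (h : RotHyp O σ σ' y z ky kz b a x cy cz) (pre : RotPre σ σ' ky kz x) :
    cz ∈ a.verts := by
  rcases pre with ⟨rfl, -⟩ | ⟨hne, hx, -⟩
  · have := h.my
    simp only [Most, side_mk, mid_mk] at this
    rcases this with h | ⟨-, h⟩
    · simp at h
      exact h.2.1
    · exact h.2.1
  · by_contra hcon
    have hczx := h.cz_mem.2.resolve_left hcon
    have := h.hx.eq_of_ne_two hx hczx (Or.inl (Or.inr h.cz_mem.1)) h.cy_mem.2 (Or.inr h.cy_mem.1)
    exact hcon (this ▸ h.cy_mem.1)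

theorem RotHyp.three (h : RotHyp O σ σ' y z ky kz b a x cy cz) (pre : RotPre σ σ' ky kz x)
    (p q : V) (hp : p ∈ b.verts ∪ a.verts) (hp' : p ∈ O ∪ x.verts) (hq : q ∈ b.verts ∪ a.verts)
    (hq' : q ∈ O ∪ x.verts) : p = cy ∨ q = cy ∨ p = q := by
  have hcza := h.cz_mem_a pre
  have aux : ∀ p, p ∈ b.verts ∪ a.verts → p ∈ O ∪ x.verts → p = cy ∨ p ∈ O := by
    intro p hp hp'
    rcases hp' with hO | hx
    · exact Or.inr hO
    rcases hp with hb | ha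
    · have := h.cz_uniq p hb (Or.inr hx)
      subst this
      exact Or.inl (h.cy_uniq _ hcza hx)
    · exact Or.inl (h.cy_uniq p ha hx)
  rcases aux p hp hp' with e | hpO
  · exact Or.inl e
  rcases aux q hq hq' with e | hqO
  · exact Or.inr (Or.inl e)
  have zm : ∀ p, p ∈ b.verts ∪ a.verts → p ∈ (RTree.mk z false kz σ b (RTree.mk y false ky σ' a x)).verts := by
    intro p hp
    rw [mk_verts, mk_verts]
    rcases hp with hp | hp
    exacts [Or.inl hp, Or.inr (Or.inl hp)]
  by_cases hkz : kz = 2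
  · have hky : ky = 2 := by
      rcases pre with ⟨-, h | h⟩ | ⟨-, -, h⟩
      exacts [h, (h hkz).elim, (h hkz).elim]
    obtain ⟨d, hd, hdO, hdc⟩ := h.hy.exists_ne (by simpa using hky) cz
    rw [mk_verts] at hd
    have hdb : d ∉ b.verts := fun hb => hdc (h.cz_uniq d hb hd)
    have hdO := hdO.resolve_right hdb
    have hdz : d ∈ (RTree.mk z false kz σ b (RTree.mk y false ky σ' a x)).verts := by
      rw [mk_verts, mk_verts]; exact Or.inr hd
    have t1 := h.hz.three ⟨zm p hp, hpO⟩ ⟨zm q hq, hqO⟩ ⟨hdz, hdO⟩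
    have key : d ∈ b.verts ∪ a.verts → d = cy := by
      intro hda
      have hda := hda.resolve_left hdb
      rcases h.ha.three ⟨hda, Or.inl (Or.inl hdO)⟩ ⟨h.cy_mem.1, Or.inr h.cy_mem.2⟩
        ⟨hcza, Or.inl (Or.inr h.cz_mem.1)⟩ with e | e | e
      · exact e
      · exact (hdc e).elim
      · by_contra hdcy
        have hσ : σ' = σ := by
          rcases pre with ⟨h, -⟩ | ⟨-, -, h⟩
          exacts [h, (h hkz).elim]
        subst hσ
        have hmy := h.my
        have hdx : d ∉ x.verts := fun hx => hdcy (h.cy_uniq d hda hx)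
        simp only [Most, side_mk, mid_mk] at hmy
        rcases hmy with hmy | ⟨hmy, -⟩
        · simp at hmy
          exact hmy.2.2 (e ▸ h.cy_mem.2)
        · exact hmy ⟨d, Or.inl hdO, by simp [hda, hdx]⟩
    rcases t1 with e | e | e
    · exact Or.inr (Or.inr e)
    · exact Or.inl (e.trans (key (e ▸ hp)))
    · exact Or.inr (Or.inl (e.trans (key (e ▸ hq))))
  · refine Or.inr (Or.inr (h.hz.eq_of_ne_two (by simpa using hkz) (zm p hp) hpO (zm q hq) hqO))

theorem RotHyp.wf_of (h : RotHyp O σ σ' y z ky kz b a x cy cz) (pre : RotPre σ σ' ky kz x)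
    {a' x' : RTree V} (va : a'.verts = a.verts) (vx : x'.verts = x.verts)
    (wa : a'.WF (O ∪ b.verts ∪ x.verts)) (wx : x'.WF (O ∪ b.verts ∪ a.verts))
    (ma : a'.Most (O ∪ b.verts ∪ x.verts) (!σ) cz)
    (mx : x'.Most (O ∪ b.verts ∪ a.verts) (!σ) cy) {fy fz P : Bool}
    (hP : P = true ↔ ∃ q, q ∈ b.verts ∪ a.verts ∧ q ∈ O ∪ x.verts ∧ q ≠ cy)
    (my : (RTree.mk y fy (if P then 2 else 1) σ b a').Most (O ∪ x.verts) σ cy) :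
    (RTree.mk z fz kz σ (RTree.mk y fy (if P then 2 else 1) σ b a') x').WF O := by
  have hcza := h.cz_mem_a pre
  refine wf_assemble (cy := cy) (cz := cz) ?_ h.hk2 ?_ ?_ ?_ ?_ ?_ ?_ ?_ ?_ ?_ ?_ ?_
  · rw [va, vx]; exact h.hk
  · rw [va, vx]; exact h.hb
  · rw [vx]; exact wa
  · rw [va]; exact wx
  · rw [va]
    ext v
    constructor
    · rintro ⟨h1, h2⟩; exact h.cz_uniq v h1 (Or.inl h2)
    · rintro rfl; exact ⟨h.cz_mem.1, hcza⟩
  · rw [va, vx]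
    ext v
    constructor
    · rintro ⟨h1 | h1, h2⟩
      · have := h.cz_uniq v h1 (Or.inr h2)
        subst this
        exact h.cy_uniq _ hcza h2
      · exact h.cy_uniq v h1 h2
    · rintro rfl; exact ⟨Or.inr h.cy_mem.1, h.cy_mem.2⟩
  · rw [va, vx]; exact h.mb
  · rw [vx]; exact ma
  · rw [va]; exact mx
  · rw [va, vx]; exact h.three pre
  · rw [va, vx]; exact hP
  · rw [vx]; exact my

theorem RotHyp.isP_b (h : RotHyp O σ σ' y z ky kz b a x cy cz) :
    b.isP = true ↔ ∃ q, q ∈ O ∧ q ∈ b.verts ∧ q ≠ cz := by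
  simp only [isP, beq_iff_eq]
  constructor
  · intro hb
    obtain ⟨q, h1, h2, h3⟩ := h.hb.exists_ne hb cz
    exact ⟨q, h2.resolve_right fun h4 => h3 (h.cz_uniq q h1 h4), h1, h3⟩
  · rintro ⟨q, h1, h2, h3⟩
    exact h.hb.two_of_ne ⟨h2, Or.inl h1⟩ ⟨h.cz_mem.1, Or.inr h.cz_mem.2⟩ h3

theorem RotHyp.isP_a (h : RotHyp O σ σ' y z ky kz b a x cy cz) :
    a.isP = true ↔ ∃ q, q ∈ O ∪ b.verts ∧ q ∈ a.verts ∧ q ≠ cy := by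
  simp only [isP, beq_iff_eq]
  constructor
  · intro hb
    obtain ⟨q, h1, h2, h3⟩ := h.ha.exists_ne hb cy
    exact ⟨q, h2.resolve_right fun h4 => h3 (h.cy_uniq q h1 h4), h1, h3⟩
  · rintro ⟨q, h1, h2, h3⟩
    exact h.ha.two_of_ne ⟨h2, Or.inl h1⟩ ⟨h.cy_mem.1, Or.inr h.cy_mem.2⟩ h3

/-- The effect of a rotation on the clusters. -/
structure RotOk (O : Set V) (ζ : Option Bool) (t t' : RTree V) : Prop where
  wf : t'.WF O
  most : ∀ ρ, ζ = some ρ → ∀ v, t.Most O ρ v → t'.Most O ρ v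

theorem most_mk (O : Set V) (τ x fl k σ) (p q : RTree V) (v : V) :
    (RTree.mk x fl k σ p q).Most O τ v ↔
      if (τ ^^ fl) = σ then
        (v ∈ O ∧ v ∈ q.verts ∧ v ∉ p.verts) ∨
          (∀ w, w ∈ O → w ∈ q.verts → w ∈ p.verts) ∧ v ∈ O ∧ v ∈ p.verts ∧ v ∈ q.verts
      else
        (v ∈ O ∧ v ∈ p.verts ∧ v ∉ q.verts) ∨
          (∀ w, w ∈ O → w ∈ p.verts → w ∈ q.verts) ∧ v ∈ O ∧ v ∈ p.verts ∧ v ∈ q.verts := by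
  simp only [Most, side_mk, mid_mk]
  split_ifs <;> simp

theorem RotHyp.ok_same_path (h : RotHyp O σ σ y z ky kz b a x cy cz)
    (pre : RotPre σ σ ky kz x) (hap : a.isP = true) (ζ : Option Bool) {gm : Bool}
    (hmid : gm = true ↔ cz ∈ O) :
    RotOk O ζ (RTree.mk z false kz σ b (RTree.mk y false ky σ a x))
      (RTree.mk z (gm && !(kz == 2) && (ζ == some σ)) kz σ
        (RTree.mk y false (if gm || b.isP then 2 else 1) σ b a) x) := by
  have hcza := h.cz_mem_a pre
  have hpb := h.isP_b
  obtain ⟨hcy1, hcy2⟩ := h.cy_mem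
  have hcz1 := h.cz_mem.1
  have hyu := h.cy_uniq
  have hzu := h.cz_uniq
  have hczx : cz ∉ x.verts := by
    intro hcon
    obtain ⟨q, hq, hqa, hne⟩ := h.isP_a.1 hap
    have hmy := h.my
    rw [most_mk, if_neg (by simp)] at hmy
    rcases hmy with hmy | ⟨hmy, -⟩
    · exact hmy.2.2 hcon
    · exact hne (hyu q hqa (hmy q hq hqa))
  have hne : cz ≠ cy := fun e => hczx (e ▸ hcy2)
  have hcyb : cy ∉ b.verts := fun hb => hne (hzu cy hb (Or.inl hcy1)).symm
  have ha2 : ∀ q, q ∈ O → q ∈ a.verts → q = cy ∨ q = cz := fun q hq hqa => by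
    rcases h.ha.three ⟨hqa, Or.inl (Or.inl hq)⟩ ⟨hcy1, Or.inr hcy2⟩ ⟨hcza, Or.inl (Or.inr hcz1)⟩
      with e | e | e
    exacts [Or.inl e, Or.inr e, (hne e.symm).elim]
  refine ⟨h.wf_of pre rfl rfl h.ha h.hx ?_ h.mx ?_ ?_, ?_⟩
  · exact h.ha.most_other h.ma hcza (Or.inl (Or.inr hcz1)) hne
  · rw [Bool.or_eq_true, hmid, hpb]
    constructor
    · rintro (h1 | ⟨q, h1, h2, h3⟩)
      · exact ⟨cz, Or.inl hcz1, Or.inl h1, hne⟩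
      · exact ⟨q, Or.inl h2, Or.inl h1, fun e => hcyb (e ▸ h2)⟩
    · rintro ⟨q, h1 | h1, h2 | h2, h3⟩
      · by_cases e : q = cz
        · exact Or.inl (e ▸ h2)
        · exact Or.inr ⟨q, h2, h1, e⟩
      · exact (hczx (hzu q h1 (Or.inr h2) ▸ h2)).elim
      · exact Or.inl ((ha2 q h2 h1).resolve_left h3 ▸ h2)
      · exact (h3 (hyu q h1 h2)).elim
  · rw [most_mk, if_pos (by simp)]
    exact Or.inl ⟨Or.inr hcy2, hcy1, hcyb⟩
  · rintro ρ rfl v hv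
    have hy3 : ∀ p q, p ∈ O → q ∈ O → p ∈ a.verts ∨ p ∈ x.verts → q ∈ a.verts ∨ q ∈ x.verts →
        p = q ∨ p = cz ∨ q = cz := fun p q hp hq hpy hqy =>
      h.hy.three ⟨by rw [mk_verts]; exact hpy, Or.inl hp⟩ ⟨by rw [mk_verts]; exact hqy, Or.inl hq⟩
        ⟨by rw [mk_verts]; exact Or.inl hcza, Or.inr hcz1⟩
    have hz3 := fun p q r => h.hz.three (p := p) (q := q) (r := r)
    have hz1 : kz ≠ 2 → ∀ p q, _ := fun hk p q =>
      h.hz.eq_of_ne_two (by simpa using hk) (p := p) (q := q)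
    have hd : kz = 2 → ∃ d, d ∈ O ∧ (d ∈ a.verts ∨ d ∈ x.verts) ∧ d ∉ b.verts := by
      intro hk
      have hky : ky = 2 := by
        rcases pre with ⟨-, h | h⟩ | ⟨h, -⟩
        exacts [h, (h hk).elim, (h rfl).elim]
      obtain ⟨d, h1, h2, h3⟩ := h.hy.exists_ne (by simpa using hky) cz
      rw [mk_verts] at h1
      have : d ∉ b.verts := fun hb => h3 (hzu d hb h1)
      exact ⟨d, h2.resolve_right this, h1, this⟩
    rw [most_mk] at hv ⊢
    simp only [mk_verts, Set.mem_union] at *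
    clear h hpb hap pre
    by_cases hgm : (gm && !(kz == 2) && (some ρ == some σ)) = true
    · rw [hgm]
      simp only [Bool.and_eq_true, Bool.not_eq_true', beq_eq_false_iff_ne, ne_eq,
        beq_iff_eq, Option.some.injEq] at hgm
      obtain ⟨⟨hg, hk⟩, rfl⟩ := hgm
      have hz1 := hz1 hk
      have hO := hmid.1 hg
      simp at hv ⊢
      grind
    · by_cases hs : ρ = σ
      · subst hs
        have : (gm && !(kz == 2) && (some ρ == some ρ)) = false := by simpa using hgm
        rw [this]
        simp at hv hgm ⊢
        grind
      · have : (gm && !(kz == 2) && (some ρ == some σ)) = false := by simpa using hgm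
        rw [this]
        have : (ρ ^^ false) ≠ σ := by simpa using hs
        rw [if_neg this] at hv ⊢
        grind

theorem RotHyp.cz_eq_cy (h : RotHyp O σ σ' y z ky kz b a x cy cz) (pre : RotPre σ σ' ky kz x)
    (hap : a.isP = false) : cz = cy := by
  have hcza := h.cz_mem_a pre
  have ha : a.count ≠ 2 := by simpa [isP] using hap
  exact h.ha.eq_of_ne_two ha hcza (Or.inl (Or.inr h.cz_mem.1)) h.cy_mem.1 (Or.inr h.cy_mem.2)

theorem RotHyp.ok_same_point (h : RotHyp O σ σ y z ky kz b a x cy cz)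
    (pre : RotPre σ σ ky kz x) (hap : a.isP = false) (ζ : Option Bool) :
    RotOk O ζ (RTree.mk z false kz σ b (RTree.mk y false ky σ a x))
      (RTree.mk z false kz σ (RTree.mk y false (if b.isP then 2 else 1) σ b a.toggle) x) := by
  have hcza := h.cz_mem_a pre
  have hpb := h.isP_b
  have hcc := h.cz_eq_cy pre hap
  subst hcc
  obtain ⟨hcy1, hcy2⟩ := h.cy_mem
  have hcz1 := h.cz_mem.1
  have hyu := h.cy_uniq
  have hzu := h.cz_uniq
  have ha : a.count ≠ 2 := by simpa [isP] using hap
  have ha1 : ∀ q, q ∈ O → q ∈ a.verts → q = cz := fun q hq hqa =>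
    h.ha.eq_of_ne_two ha hqa (Or.inl (Or.inl hq)) hcza (Or.inr hcy2)
  refine ⟨h.wf_of pre (toggle_verts a) rfl ((wf_toggle _ _).2 h.ha) h.hx ?_ h.mx ?_ ?_, ?_⟩
  · rw [most_toggle, Bool.not_not]; exact h.ma
  · rw [hpb]
    constructor
    · rintro ⟨q, h1, h2, h3⟩
      exact ⟨q, Or.inl h2, Or.inl h1, h3⟩
    · rintro ⟨q, h1 | h1, h2 | h2, h3⟩
      · exact ⟨q, h2, h1, h3⟩
      · exact (h3 (hzu q h1 (Or.inr h2))).elim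
      · exact (h3 (ha1 q h2 h1)).elim
      · exact (h3 (hyu q h1 h2)).elim
  · rw [most_mk, if_pos (by simp), toggle_verts]
    refine Or.inr ⟨fun w hw hwa => ?_, Or.inr hcy2, hcz1, hcza⟩
    rcases hw with hw | hw
    · exact ha1 w hw hwa ▸ hcz1
    · exact hyu w hwa hw ▸ hcz1
  · rintro ρ rfl v hv
    rw [most_mk] at hv ⊢
    simp only [mk_verts, toggle_verts, Set.mem_union] at *
    clear h hpb hap pre
    by_cases hs : (ρ ^^ false) = σ
    · rw [if_pos hs] at hv ⊢
      grind
    · rw [if_neg hs] at hv ⊢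
      grind

theorem RotHyp.ok_opp (h : RotHyp O σ (!σ) y z ky kz b a x cy cz)
    (pre : RotPre σ (!σ) ky kz x) (ζ : Option Bool) :
    RotOk O ζ (RTree.mk z false kz σ b (RTree.mk y false ky (!σ) a x))
      (RTree.mk z a.isP kz σ (RTree.mk y a.isP (if a.isP || b.isP then 2 else 1) σ b a)
        x.toggle) := by
  have hcza := h.cz_mem_a pre
  have hpb := h.isP_b
  have hpa := h.isP_a
  obtain ⟨hcy1, hcy2⟩ := h.cy_mem
  have hcz1 := h.cz_mem.1
  have hyu := h.cy_uniq
  have hzu := h.cz_uniq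
  obtain ⟨hx2, hz2⟩ : x.count ≠ 2 ∧ kz ≠ 2 := by
    rcases pre with ⟨h, -⟩ | ⟨-, h⟩
    · cases σ <;> simp at h
    · exact h
  have hx1 : ∀ q, q ∈ O → q ∈ x.verts → q = cy := fun q hq hqa =>
    h.hx.eq_of_ne_two hx2 hqa (Or.inl (Or.inl hq)) hcy2 (Or.inr hcy1)
  have hcc : cz = cy := by
    have hmy := h.my
    rw [most_mk, if_pos (by simp)] at hmy
    rcases hmy with hmy | ⟨-, hmy⟩
    · exact (hmy.2.2 hcza).elim
    · exact hyu cz hcza hmy.2.2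
  subst hcc
  have hz1 : ∀ p q, _ := fun p q =>
    h.hz.eq_of_ne_two (by simpa using hz2) (p := p) (q := q)
  simp only [mk_verts, Set.mem_union] at hz1
  have hma := h.ma
  have hmx := h.mx
  rw [Bool.not_not] at hmx
  have hP : (a.isP || b.isP) = true ↔
      ∃ q, q ∈ b.verts ∪ a.verts ∧ q ∈ O ∪ x.verts ∧ q ≠ cz := by
    rw [Bool.or_eq_true, hpa, hpb]
    constructor
    · rintro (⟨q, h1 | h1, h2, h3⟩ | ⟨q, h1, h2, h3⟩)
      · exact ⟨q, Or.inr h2, Or.inl h1, h3⟩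
      · exact (h3 (hzu q h1 (Or.inl h2))).elim
      · exact ⟨q, Or.inl h2, Or.inl h1, h3⟩
    · rintro ⟨q, h1 | h1, h2 | h2, h3⟩
      · exact Or.inr ⟨q, h2, h1, h3⟩
      · exact (h3 (hzu q h1 (Or.inr h2))).elim
      · exact Or.inl ⟨q, Or.inl h2, h1, h3⟩
      · exact (h3 (hyu q h1 h2)).elim
  refine ⟨h.wf_of pre rfl (toggle_verts x) h.ha ((wf_toggle _ _).2 h.hx) hma ?_ hP ?_, ?_⟩
  · rw [most_toggle, Bool.not_not]; exact hmx
  · simp only [Set.mem_union] at hpa hpb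
    rw [most_mk]
    simp only [Set.mem_union]
    clear h pre hP hmx hma
    cases hap : a.isP
    · rw [if_pos (by simp)]
      rw [hap] at hpa
      grind
    · rw [if_neg (by simp)]
      rw [hap] at hpa
      grind
  · rintro ρ rfl v hv
    rw [most_mk] at hv ⊢
    simp only [mk_verts, toggle_verts, Set.mem_union] at *
    clear h pre hP hmx hma
    by_cases hs : (ρ ^^ false) = σ
    · rw [if_pos hs] at hv
      cases hap : a.isP
      · rw [if_pos hs]
        rw [hap] at hpa
        grind
      · rw [if_neg (by simpa using hs)]
        rw [hap] at hpa
        grind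
    · rw [if_neg hs] at hv
      cases hap : a.isP
      · rw [if_neg hs]
        rw [hap] at hpa
        grind
      · rw [if_pos (by cases ρ <;> cases σ <;> simp_all)]
        rw [hap] at hpa
        grind

theorem rotate_ok (h : (RTree.mk z false kz σ b (RTree.mk y false ky σ' a x)).WF O)
    (pre : RotPre σ σ' ky kz x) (ζ : Option Bool) :
    RotOk O ζ (RTree.mk z false kz σ b (RTree.mk y false ky σ' a x))
      (rotRes ζ σ σ' y z kz b a x (midCount kz b (RTree.mk y false ky σ' a x))) := by
  obtain ⟨cy, cz, h⟩ := exists_rotHyp h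
  unfold rotRes
  by_cases hs : σ' = σ
  · subst hs
    rw [if_pos rfl]
    cases hap : a.isP
    · exact h.ok_same_point pre hap ζ
    · exact h.ok_same_path pre hap ζ h.mid
  · rw [if_neg hs]
    have : σ' = !σ := by cases σ <;> cases σ' <;> simp_all
    subst this
    exact h.ok_opp pre ζ

end RTree

/-- One step of the path from a node to the root: the parent, and the sibling of the node. -/
structure Fr (V : Type) where
  addr : ℕ
  fl : Bool
  k : ℕ
  zero : Bool
  sib : RTree V

namespace RTree
variable {V : Type}

def Fr.fill (f : Fr V) (t : RTree V) : RTree V := mk f.addr f.fl f.k f.zero t f.sib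

/-- The tree with the subtree `t` whose path to the root is `C`. -/
def fill : List (Fr V) → RTree V → RTree V
  | [], t => t
  | f :: C, t => fill C (Fr.fill f t)

/-- The vertices that are exposed or incident to an edge outside the subtree with context `C`. -/
def oC (O : Set V) : List (Fr V) → Set V
  | [] => O
  | f :: C => oC O C ∪ f.sib.verts

@[simp] theorem Fr.fill_addr (f : Fr V) (t : RTree V) : (Fr.fill f t).addr = f.addr := mk_addr ..
@[simp] theorem Fr.fill_count (f : Fr V) (t : RTree V) : (Fr.fill f t).count = f.k := mk_count ..
@[simp] theorem Fr.fill_isP (f : Fr V) (t : RTree V) : (Fr.fill f t).isP = (f.k == 2) := mk_isP ..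
@[simp] theorem Fr.fill_verts (f : Fr V) (t : RTree V) :
    (Fr.fill f t).verts = t.verts ∪ f.sib.verts := mk_verts ..
@[simp] theorem fill_nil (t : RTree V) : fill [] t = t := rfl
@[simp] theorem fill_cons (f : Fr V) (C) (t : RTree V) : fill (f :: C) t = fill C (Fr.fill f t) :=
  rfl
theorem fill_append (C D : List (Fr V)) (t : RTree V) : fill (C ++ D) t = fill D (fill C t) := by
  induction C generalizing t with
  | nil => rfl
  | cons f C ih => exact ih _

theorem WF.of_fill {O : Set V} {C : List (Fr V)} {t : RTree V} (h : (fill C t).WF O) :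
    t.WF (oC O C) := by
  induction C generalizing t with
  | nil => exact h
  | cons f C ih =>
    have := ih h
    rw [Fr.fill, wf_mk] at this
    exact this.2.2.1

theorem fr_most_congr {O : Set V} (f : Fr V) {t t' : RTree V} (hv : t'.verts = t.verts) (ρ) (v : V)
    (h : (Fr.fill f t).Most O ρ v) : (Fr.fill f t').Most O ρ v := by
  unfold Fr.fill at *
  rw [most_mk] at *
  rwa [hv]

theorem WF.replace {O : Set V} {C : List (Fr V)} {t t' : RTree V} (h : (fill C t).WF O)
    (hv : t'.verts = t.verts) (h' : t'.WF (oC O C))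
    (hm : ∀ ρ, C.head?.map Fr.zero = some ρ → ∀ v, t.Most (oC O C) ρ v → t'.Most (oC O C) ρ v) :
    (fill C t').WF O := by
  induction C generalizing t t' with
  | nil => exact h'
  | cons f C ih =>
    refine ih (t := Fr.fill f t) h (by simp [hv]) ?_ fun ρ _ v => fr_most_congr f hv ρ v
    have hw := WF.of_fill (C := C) h
    rw [Fr.fill, wf_mk] at hw ⊢
    obtain ⟨h1, h2, -, h4, c, h5, h6, h7⟩ := hw
    rw [hv]
    exact ⟨h1, h2, h', h4, c, h5, hm _ rfl _ h6, h7⟩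

/-! ### Sizes and potential -/

def size : RTree V → ℕ
  | leaf _ _ _ _ _ => 1
  | node _ _ _ l r => l.size + r.size

noncomputable def rk (n : ℕ) : ℝ := Real.logb 2 n

noncomputable def pot : RTree V → ℝ
  | leaf _ _ _ _ _ => 0
  | node _ _ _ l r => rk (l.size + r.size) + (pot l + pot r)

def csize : List (Fr V) → ℕ
  | [] => 0
  | f :: C => f.sib.size + csize C

/-- The sum of the ranks of the nodes on the path `C` from a node of size `n` to the root. -/
noncomputable def pathPot : List (Fr V) → ℕ → ℝ
  | [], _ => 0
  | f :: C, n => rk (n + f.sib.size) + pathPot C (n + f.sib.size)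

noncomputable def sibPot : List (Fr V) → ℝ
  | [] => 0
  | f :: C => f.sib.pot + sibPot C

/-- The sum of the ranks of the `k` lowest proper ancestors, padded with the rank of a tree of
size `N`. -/
noncomputable def win (N : ℕ) : ℕ → List (Fr V) → ℕ → ℝ
  | 0, _, _ => 0
  | j + 1, [], n => rk N + win N j [] n
  | j + 1, f :: C, n => rk (n + f.sib.size) + win N j C (n + f.sib.size)

noncomputable def nthRank (N : ℕ) : ℕ → List (Fr V) → ℕ → ℝ
  | _, [], _ => rk N
  | 0, f :: _, n => rk (n + f.sib.size)
  | j + 1, f :: C, n => nthRank N j C (n + f.sib.size)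

theorem size_pos (t : RTree V) : 0 < t.size := by
  induction t with
  | leaf => exact Nat.one_pos
  | node => simp only [size]; omega

@[simp] theorem mk_size (x fl k σ) (p q : RTree V) : (mk x fl k σ p q).size = p.size + q.size := by
  cases σ
  · exact Nat.add_comm _ _
  · rfl
theorem mk_pot (x fl k σ) (p q : RTree V) :
    (mk x fl k σ p q).pot = rk (p.size + q.size) + (p.pot + q.pot) := by
  cases σ
  · simp only [mk, pot, Nat.add_comm q.size, add_comm q.pot]
  · rfl
@[simp] theorem toggle_size (t : RTree V) : t.toggle.size = t.size := by cases t <;> rfl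
@[simp] theorem toggle_pot (t : RTree V) : t.toggle.pot = t.pot := by cases t <;> rfl
@[simp] theorem Fr.fill_size (f : Fr V) (t : RTree V) : (Fr.fill f t).size = t.size + f.sib.size :=
  mk_size ..
theorem fill_size (C : List (Fr V)) (t : RTree V) : (fill C t).size = t.size + csize C := by
  induction C generalizing t with
  | nil => rfl
  | cons f C ih => simp [ih, csize]; omega
theorem csize_append (C D : List (Fr V)) : csize (C ++ D) = csize C + csize D := by
  induction C with
  | nil => simp [csize]
  | cons f C ih => simp [csize, ih]; omega

theorem fill_pot (C : List (Fr V)) (t : RTree V) :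
    (fill C t).pot = t.pot + (sibPot C + pathPot C t.size) := by
  induction C generalizing t with
  | nil => simp [sibPot, pathPot]
  | cons f C ih =>
    rw [fill_cons, ih, Fr.fill_size, Fr.fill, mk_pot, sibPot, pathPot]; ring

theorem rk_mono {m n : ℕ} (hm : 0 < m) (h : m ≤ n) : rk m ≤ rk n := by
  unfold rk
  exact Real.logb_le_logb_of_le (by norm_num) (by exact_mod_cast hm) (by exact_mod_cast h)

theorem rk_nonneg (n : ℕ) : 0 ≤ rk n := by
  unfold rk
  rcases Nat.eq_zero_or_pos n with rfl | h
  · simp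
  · exact Real.logb_nonneg (by norm_num) (by exact_mod_cast h)

theorem rk_add_rk {m n : ℕ} (hm : 0 < m) (hn : 0 < n) : rk m + rk n ≤ 2 * rk (m + n) - 2 := by
  unfold rk
  have hm' : (0 : ℝ) < m := by exact_mod_cast hm
  have hn' : (0 : ℝ) < n := by exact_mod_cast hn
  have h1 : Real.logb 2 (4 * (m * n)) ≤ Real.logb 2 ((m + n) ^ 2) := by
    apply Real.logb_le_logb_of_le (by norm_num) (by positivity)
    nlinarith [sq_nonneg ((m : ℝ) - n)]
  rw [Real.logb_mul (by norm_num) (by positivity), Real.logb_mul hm'.ne' hn'.ne',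
    Real.logb_pow] at h1
  have h4 : Real.logb 2 4 = 2 := by
    rw [show (4 : ℝ) = 2 ^ 2 by norm_num, Real.logb_pow, Real.logb_self_eq_one (by norm_num)]
    norm_num
  push_cast at *
  linarith

theorem pot_nonneg (t : RTree V) : 0 ≤ t.pot := by
  induction t with
  | leaf => exact le_rfl
  | node x fl k l r hl hr => simp only [pot]; linarith [rk_nonneg (l.size + r.size)]

theorem win_succ (N j : ℕ) (C : List (Fr V)) (n : ℕ) :
    win N (j + 1) C n = win N j C n + nthRank N j C n := by
  induction j generalizing C n with
  | zero => cases C <;> simp [win, nthRank]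
  | succ j ih =>
    cases C with
    | nil =>
      have h1 : win N (j + 1 + 1) ([] : List (Fr V)) n = rk N + win N (j + 1) [] n := rfl
      have h2 : win N (j + 1) ([] : List (Fr V)) n = rk N + win N j [] n := rfl
      have h4 : nthRank N (j + 1) ([] : List (Fr V)) n = rk N := rfl
      rw [h1, h2, h4]; ring
    | cons f C => rw [win, ih, win, nthRank]; ring

theorem win_append (N j : ℕ) (C D : List (Fr V)) (n : ℕ) :
    win N (C.length + j) (C ++ D) n = pathPot C n + win N j D (n + csize C) := by
  induction C generalizing n with
  | nil => simp [pathPot, csize]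
  | cons f C ih =>
    rw [List.length_cons, show C.length + 1 + j = (C.length + j) + 1 by omega, List.cons_append,
      win, ih, pathPot, csize, add_assoc, ← Nat.add_assoc n, add_assoc (rk _)]

theorem win_nonneg (N j : ℕ) (C : List (Fr V)) (n : ℕ) : 0 ≤ win N j C n := by
  induction j generalizing C n with
  | zero => exact le_rfl
  | succ j ih =>
    cases C with
    | nil => exact add_nonneg (rk_nonneg _) (ih _ _)
    | cons f C => exact add_nonneg (rk_nonneg _) (ih _ _)

theorem nthRank_le {N : ℕ} (j : ℕ) (C : List (Fr V)) {n : ℕ} (hn : 0 < n) (h : n + csize C ≤ N) :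
    nthRank N j C n ≤ rk N := by
  induction j generalizing C n with
  | zero =>
    cases C with
    | nil => exact le_rfl
    | cons f C => exact rk_mono (by omega) (by simp only [csize] at h; omega)
  | succ j ih =>
    cases C with
    | nil => exact le_rfl
    | cons f C => exact ih C (by omega) (by simp only [csize] at h; omega)

theorem le_nthRank {N : ℕ} (j : ℕ) (C : List (Fr V)) {n : ℕ} (hn : 0 < n) (h : n + csize C ≤ N) :
    rk n ≤ nthRank N j C n := by
  induction j generalizing C n with
  | zero =>
    cases C with
    | nil => exact rk_mono hn (by simp only [csize] at h; omega)
    | cons f C => exact rk_mono hn (by omega)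
  | succ j ih =>
    cases C with
    | nil => exact rk_mono hn (by simp only [csize] at h; omega)
    | cons f C =>
      exact (rk_mono hn (by omega)).trans (ih C (by omega) (by simp only [csize] at h; omega))

theorem le_nthRank_append {N : ℕ} (j : ℕ) (C D : List (Fr V)) {n : ℕ} (hn : 0 < n)
    (h : n + csize (C ++ D) ≤ N) (hj : C.length ≤ j + 1) :
    rk (n + csize C) ≤ nthRank N j (C ++ D) n := by
  induction C generalizing j n with
  | nil => exact le_nthRank j D hn h
  | cons f C ih =>
    simp only [List.cons_append, csize] at h ⊢
    rw [← Nat.add_assoc]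
    cases j with
    | zero =>
      have : C = [] := List.length_eq_zero_iff.1 (by simpa using hj)
      subst this
      simp [nthRank, csize]
    | succ j => exact ih j (by omega) (by omega) (by simpa using hj)

theorem win_le (N j : ℕ) (C : List (Fr V)) {n : ℕ} (hn : 0 < n) (h : n + csize C ≤ N) :
    win N j C n ≤ j * rk N := by
  induction j with
  | zero => simp [win]
  | succ j ih =>
    rw [win_succ]
    have := nthRank_le (N := N) j C hn h
    push_cast
    linarith

theorem pathPot_le {N : ℕ} (C : List (Fr V)) {n : ℕ} (hn : 0 < n) (h : n + csize C ≤ N) :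
    pathPot C n ≤ C.length * rk N := by
  induction C generalizing n with
  | nil => simp [pathPot]
  | cons f C ih =>
    simp only [csize] at h
    have h1 := ih (n := n + f.sib.size) (by omega) (by omega)
    have h2 := rk_mono (m := n + f.sib.size) (n := N) (by omega) (by omega)
    simp only [pathPot, List.length_cons]
    push_cast
    linarith

theorem le_pathPot (C : List (Fr V)) {n : ℕ} (hn : 0 < n) : C.length * rk n ≤ pathPot C n := by
  induction C generalizing n with
  | nil => simp [pathPot]
  | cons f C ih =>
    have h1 := ih (n := n + f.sib.size) (by omega)
    have h2 := rk_mono hn (show n ≤ n + f.sib.size by omega)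
    simp only [pathPot, List.length_cons]
    push_cast
    nlinarith [(Nat.cast_nonneg C.length : (0 : ℝ) ≤ C.length)]

/-! ### The set of records -/

def addrs : RTree V → List ℕ
  | leaf x _ _ _ _ => [x]
  | node x _ _ l r => x :: (l.addrs ++ r.addrs)

def leaves : RTree V → List (ℕ × V × V)
  | leaf x _ _ a b => [(x, a, b)]
  | node _ _ _ l r => l.leaves ++ r.leaves

def inner : RTree V → List ℕ
  | leaf _ _ _ _ _ => []
  | node x _ _ l r => x :: (l.inner ++ r.inner)

/-- `t'` arises from `t` by rearranging the nodes, keeping the address of the root. -/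
structure Rearr (t t' : RTree V) : Prop where
  leaves : t.leaves.Perm t'.leaves
  inner : t.inner.Perm t'.inner
  addr : t'.addr = t.addr

theorem Rearr.refl (t : RTree V) : Rearr t t := ⟨.refl _, .refl _, rfl⟩
theorem Rearr.trans {t t' t'' : RTree V} (h : Rearr t t') (h' : Rearr t' t'') : Rearr t t'' :=
  ⟨h.1.trans h'.1, h.2.trans h'.2, h'.3.trans h.3⟩

theorem addrs_perm (t : RTree V) : t.addrs.Perm (t.leaves.map Prod.fst ++ t.inner) := by
  induction t with
  | leaf => exact .refl _
  | node x fl k l r hl hr =>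
    simp only [addrs, leaves, inner, List.map_append]
    refine (List.Perm.cons x (hl.append hr)).trans ?_
    simp only [← Multiset.coe_eq_coe, ← Multiset.cons_coe, ← Multiset.coe_add]
    simp only [← Multiset.singleton_add]
    abel

theorem Rearr.addrs {t t' : RTree V} (h : Rearr t t') : t.addrs.Perm t'.addrs :=
  (addrs_perm t).trans (((h.1.map _).append h.2).trans (addrs_perm t').symm)

theorem mem_verts_iff (t : RTree V) (v : V) :
    v ∈ t.verts ↔ ∃ e ∈ t.leaves, v = e.2.1 ∨ v = e.2.2 := by
  induction t with
  | leaf => simp [verts, leaves]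
  | node x fl k l r hl hr =>
    simp only [verts, Set.mem_union, hl, hr, leaves, List.mem_append]
    grind

theorem size_eq (t : RTree V) : t.size = t.leaves.length := by
  induction t with
  | leaf => rfl
  | node x fl k l r hl hr => simp [size, leaves, hl, hr]

theorem Rearr.verts {t t' : RTree V} (h : Rearr t t') : t'.verts = t.verts := by
  ext v
  simp only [mem_verts_iff, h.1.mem_iff]

theorem Rearr.size {t t' : RTree V} (h : Rearr t t') : t'.size = t.size := by
  rw [size_eq, size_eq, h.1.length_eq]

theorem toggle_leaves (t : RTree V) : t.toggle.leaves = t.leaves := by cases t <;> rfl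
theorem toggle_inner (t : RTree V) : t.toggle.inner = t.inner := by cases t <;> rfl
@[simp] theorem toggle_addrs (t : RTree V) : t.toggle.addrs = t.addrs := by cases t <;> rfl
theorem Rearr.toggle (t : RTree V) : Rearr t t.toggle :=
  ⟨by rw [toggle_leaves], by rw [toggle_inner], toggle_addr t⟩

theorem mk_leaves (x fl k σ) (p q : RTree V) :
    (mk x fl k σ p q).leaves.Perm (p.leaves ++ q.leaves) := by
  cases σ
  · exact List.perm_append_comm
  · exact .refl _
theorem mk_inner (x fl k σ) (p q : RTree V) :
    (mk x fl k σ p q).inner.Perm (x :: (p.inner ++ q.inner)) := by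
  cases σ
  · exact List.Perm.cons _ List.perm_append_comm
  · exact .refl _
theorem mk_addrs (x fl k σ) (p q : RTree V) :
    (mk x fl k σ p q).addrs.Perm (x :: (p.addrs ++ q.addrs)) := by
  cases σ
  · exact List.Perm.cons _ List.perm_append_comm
  · exact .refl _

theorem Rearr.node {x fl fl' k k' σ} {p p' q q' : RTree V} (hp : Rearr p p') (hq : Rearr q q') :
    Rearr (RTree.mk x fl k σ p q) (RTree.mk x fl' k' σ p' q') :=
  ⟨(mk_leaves ..).trans ((hp.leaves.append hq.leaves).trans (mk_leaves ..).symm),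
    (mk_inner ..).trans (((hp.inner.append hq.inner).cons x).trans (mk_inner ..).symm), by simp⟩

theorem Rearr.fill {t t' : RTree V} (h : Rearr t t') (C : List (Fr V)) :
    Rearr (fill C t) (fill C t') := by
  induction C generalizing t t' with
  | nil => exact h
  | cons f C ih => exact ih (Rearr.node h (Rearr.refl _))

def caddrs : List (Fr V) → List ℕ
  | [] => []
  | f :: C => f.addr :: (f.sib.addrs ++ caddrs C)

theorem fill_addrs (C : List (Fr V)) (t : RTree V) :
    (fill C t).addrs.Perm (t.addrs ++ caddrs C) := by
  induction C generalizing t with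
  | nil => simp [caddrs]
  | cons f C ih =>
    refine (ih _).trans (((mk_addrs ..).append_right _).trans ?_)
    simp only [caddrs, ← Multiset.coe_eq_coe, ← Multiset.cons_coe, ← Multiset.coe_add]
    simp only [← Multiset.singleton_add]
    abel

theorem fill_leaves (C : List (Fr V)) (t : RTree V) :
    (fill C t).leaves.Perm (t.leaves ++ C.flatMap fun f => f.sib.leaves) := by
  induction C generalizing t with
  | nil => simp
  | cons f C ih =>
    refine (ih _).trans (((mk_leaves ..).append_right _).trans ?_)
    simp

theorem addr_mem (t : RTree V) : t.addr ∈ t.addrs := by cases t <;> simp [addr, addrs]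

end RTree

namespace Mem
variable {V : Type}
/-- The state after `n` further units of time. -/
def adv (s : Mem V) (n : ℕ) : Mem V := { s with time := s.time + n }
/-- The state after overwriting the record at `x`. -/
def upd (s : Mem V) (x : ℕ) (r : NodeRec V) : Mem V :=
  { s with node := Function.update s.node x (some r) }
@[simp] theorem adv_node (s : Mem V) (n) : (s.adv n).node = s.node := rfl
@[simp] theorem adv_exposed (s : Mem V) (n) : (s.adv n).exposed = s.exposed := rfl
@[simp] theorem adv_incident (s : Mem V) (n) : (s.adv n).incident = s.incident := rfl
@[simp] theorem adv_next (s : Mem V) (n) : (s.adv n).next = s.next := rfl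
@[simp] theorem adv_time (s : Mem V) (n) : (s.adv n).time = s.time + n := rfl
@[simp] theorem adv_adv (s : Mem V) (m n) : (s.adv m).adv n = s.adv (m + n) := by
  simp [adv, Nat.add_assoc]
@[simp] theorem upd_adv (s : Mem V) (n x r) : (s.upd x r).adv n = (s.adv n).upd x r := rfl
theorem upd_node (s : Mem V) (x r y) :
    (s.upd x r).node y = if y = x then some r else s.node y := by
  simp [upd, Function.update_apply]
@[simp] theorem upd_exposed (s : Mem V) (x r) : (s.upd x r).exposed = s.exposed := rfl
@[simp] theorem upd_incident (s : Mem V) (x r) : (s.upd x r).incident = s.incident := rfl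
@[simp] theorem upd_next (s : Mem V) (x r) : (s.upd x r).next = s.next := rfl
@[simp] theorem upd_time (s : Mem V) (x r) : (s.upd x r).time = s.time := rfl
end Mem

namespace TopTreeProg
variable {V : Type}

theorem run_tick (s : Mem V) : (tick : Prog V Unit).run s = some ((), s.adv 1) := rfl

theorem run_readNode (x : ℕ) (s : Mem V) :
    (readNode x).run s = (s.node x).bind fun r => some (r, s.adv 1) := by
  unfold readNode
  simp only [StateT.run_bind, run_tick, StateT.run_get, Option.bind_eq_bind, Option.bind_some,
    pure, Mem.adv_node]
  cases s.node x <;> rfl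

theorem run_writeNode (x : ℕ) (r : NodeRec V) (s : Mem V) :
    (writeNode x r).run s = (s.node x).bind fun _ => some ((), (s.adv 1).upd x r) := by
  unfold writeNode
  simp only [StateT.run_bind, run_tick, StateT.run_get, Option.bind_eq_bind, Option.bind_some,
    pure, Mem.adv_node]
  cases s.node x <;> rfl

theorem run_deleteNode (x : ℕ) (s : Mem V) :
    (deleteNode x).run s = (s.node x).bind fun _ =>
      some ((), { s.adv 1 with node := Function.update s.node x none }) := by
  unfold deleteNode
  simp only [StateT.run_bind, run_tick, StateT.run_get, Option.bind_eq_bind, Option.bind_some,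
    pure, Mem.adv_node]
  cases s.node x <;> rfl

theorem run_newNode (r : NodeRec V) (s : Mem V) :
    (newNode r).run s = some (s.next, { (s.adv 1).upd s.next r with next := s.next + 1 }) := rfl

theorem run_isExposed (v : V) (s : Mem V) :
    (isExposed v).run s = some (s.exposed v, s.adv 1) := rfl

theorem run_anyEdge (v : V) (s : Mem V) :
    (anyEdge v).run s = some ((s.incident v).head?, s.adv 1) := rfl

theorem run_degreeGeTwo (v : V) (s : Mem V) :
    (degreeGeTwo v).run s = some (decide (2 ≤ (s.incident v).length), s.adv 1) := by
  unfold degreeGeTwo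
  simp only [StateT.run_bind, run_tick, StateT.run_get, Option.bind_eq_bind, Option.bind_some,
    pure, Mem.adv_incident]
  rcases s.incident v with - | ⟨a, - | ⟨b, l⟩⟩ <;> simp <;> rfl

theorem run_pure {α : Type} (a : α) (s : Mem V) : (pure a : Prog V α).run s = some (a, s) := rfl

theorem run_bind {α β : Type} (m : Prog V α) (f : α → Prog V β) (s : Mem V) :
    (m >>= f).run s = (m.run s).bind fun p => (f p.1).run p.2 := rfl

theorem run_deref_some (x : ℕ) (s : Mem V) : (deref (some x)).run s = some (x, s) := rfl

theorem run_getParent (x : ℕ) (s : Mem V) :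
    (getParent x).run s = (s.node x).bind fun r => some (r.parent, s.adv 1) := by
  simp only [getParent, run_bind, run_readNode, run_pure]
  cases s.node x <;> rfl
theorem run_getFlip (x : ℕ) (s : Mem V) :
    (getFlip x).run s = (s.node x).bind fun r => some (r.flip, s.adv 1) := by
  simp only [getFlip, run_bind, run_readNode, run_pure]
  cases s.node x <;> rfl
theorem run_getNumBoundary (x : ℕ) (s : Mem V) :
    (getNumBoundary x).run s = (s.node x).bind fun r => some (r.numBoundary, s.adv 1) := by
  simp only [getNumBoundary, run_bind, run_readNode, run_pure]
  cases s.node x <;> rfl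
theorem run_isPath (x : ℕ) (s : Mem V) :
    (isPath x).run s = (s.node x).bind fun r => some (r.numBoundary == 2, s.adv 1) := by
  simp only [isPath, run_bind, run_getNumBoundary, run_pure]
  cases s.node x <;> rfl
theorem run_isPoint (x : ℕ) (s : Mem V) :
    (isPoint x).run s = (s.node x).bind fun r => some (!(r.numBoundary == 2), s.adv 1) := by
  simp only [isPoint, run_bind, run_isPath, run_pure]
  cases s.node x <;> rfl
theorem run_setParent (x : ℕ) (p : Option ℕ) (s : Mem V) :
    (setParent x p).run s =
      (s.node x).bind fun r => some ((), (s.adv 2).upd x { r with parent := p }) := by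
  simp only [setParent, run_bind, run_readNode, run_writeNode]
  cases h : s.node x <;> simp [h]
theorem run_setFlip (x : ℕ) (b : Bool) (s : Mem V) :
    (setFlip x b).run s =
      (s.node x).bind fun r => some ((), (s.adv 2).upd x { r with flip := b }) := by
  simp only [setFlip, run_bind, run_readNode, run_writeNode]
  cases h : s.node x <;> simp [h]
theorem run_setNumBoundary (x : ℕ) (k : ℕ) (s : Mem V) :
    (setNumBoundary x k).run s =
      (s.node x).bind fun r => some ((), (s.adv 2).upd x { r with numBoundary := k }) := by
  simp only [setNumBoundary, run_bind, run_readNode, run_writeNode]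
  cases h : s.node x <;> simp [h]
theorem run_setChildren (x c₀ c₁ : ℕ) (s : Mem V) :
    (setChildren x c₀ c₁).run s =
      (s.node x).bind fun r => some ((), (s.adv 2).upd x { r with body := .internal c₀ c₁ }) := by
  simp only [setChildren, run_bind, run_readNode, run_writeNode]
  cases h : s.node x <;> simp [h]
theorem run_toggleFlip (x : ℕ) (s : Mem V) :
    (toggleFlip x).run s =
      (s.node x).bind fun r => some ((), (s.adv 3).upd x { r with flip := !r.flip }) := by
  simp only [toggleFlip, run_bind, run_getFlip, run_setFlip]
  cases h : s.node x <;> simp [h]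
theorem run_getChildren {x : ℕ} {s : Mem V} {p k fl c₀ c₁}
    (h : s.node x = some ⟨p, .internal c₀ c₁, k, fl⟩) :
    (getChildren x).run s = some ((c₀, c₁), s.adv 1) := by
  simp [getChildren, run_bind, run_readNode, h, run_pure]
theorem run_getEndpoints {x : ℕ} {s : Mem V} {p k fl a b}
    (h : s.node x = some ⟨p, .leaf a b, k, fl⟩) :
    (getEndpoints x).run s = some ((a, b), s.adv 1) := by
  simp [getEndpoints, run_bind, run_readNode, h, run_pure]
theorem run_isChildZero {x y : ℕ} {s : Mem V} {p k fl c₀ c₁}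
    (h : s.node x = some ⟨p, .internal c₀ c₁, k, fl⟩) :
    (isChildZero x y).run s = some (c₀ == y, s.adv 1) := by
  simp [isChildZero, run_bind, run_getChildren h, run_pure]
theorem run_sibling {x y : ℕ} {s : Mem V} {bx kx fx p k fl c₀ c₁}
    (hx : s.node x = some ⟨some y, bx, kx, fx⟩)
    (h : s.node y = some ⟨p, .internal c₀ c₁, k, fl⟩) :
    (sibling x).run s = some (if c₀ == x then c₁ else c₀, s.adv 2) := by
  have h' : (s.adv 1).node y = some ⟨p, .internal c₀ c₁, k, fl⟩ := h
  simp [sibling, run_bind, run_getParent, hx, run_deref_some, run_getChildren h', run_pure]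

theorem run_ite {α : Type} (c : Prop) [Decidable c] (m m' : Prog V α) (s : Mem V) :
    (if c then m else m').run s = if c then m.run s else m'.run s := by split_ifs <;> rfl

end TopTreeProg

namespace TopTreeProg
variable {V : Type}

/-- The case distinction in `rotateUp`. -/
def rotDecide (node grandparent sib : ℕ) (uncleIsLeft sibIsLeft sibIsPath uncleIsPath gpIsPath : Bool) :
    Prog V (Bool × Bool × Bool) := do
  if (uncleIsLeft == sibIsLeft) && sibIsPath then
    let gpMiddle ← hasMiddleBoundary grandparent
    let flipGp ← (do
      if gpMiddle && !gpIsPath then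
        match ← getParent grandparent with
        | some ggp => return (← isChildZero ggp grandparent) == uncleIsLeft
        | none => return false
      else
        return false)
    return (gpMiddle || uncleIsPath, false, flipGp)
  else if !(uncleIsLeft == sibIsLeft) then
    toggleFlip node
    return (sibIsPath || uncleIsPath, sibIsPath, sibIsPath)
  else
    toggleFlip sib
    return (uncleIsPath, false, false)

/-- The pointer changes in `rotateUp`. -/
def rotWrites (node parent grandparent sib uncle : ℕ) (uncleIsLeft : Bool)
    (d : Bool × Bool × Bool) : Prog V Unit := do
  if uncleIsLeft then
    setChildren parent uncle sib
    setChildren grandparent parent node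
  else
    setChildren parent sib uncle
    setChildren grandparent node parent
  setFlip parent d.2.1
  setNumBoundary parent (if d.1 then 2 else 1)
  setFlip grandparent d.2.2
  setParent node (some grandparent)
  setParent uncle (some parent)

/-- The part of `rotateUp` after the flips have been pushed. -/
def rotRest (node parent grandparent sib uncle : ℕ) : Prog V Unit := do
  let uncleIsLeft ← isChildZero grandparent uncle
  let sibIsLeft ← isChildZero parent sib
  let sibIsPath ← isPath sib
  let uncleIsPath ← isPath uncle
  let gpIsPath ← isPath grandparent
  let d ← rotDecide node grandparent sib uncleIsLeft sibIsLeft sibIsPath uncleIsPath gpIsPath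
  rotWrites node parent grandparent sib uncle uncleIsLeft d

theorem rotateUp_eq (node : ℕ) : (rotateUp node : Prog V Unit) = (do
  let parent ← deref (← getParent node)
  let grandparent ← deref (← getParent parent)
  let sib ← sibling node
  let uncle ← sibling parent
  pushFlip grandparent
  pushFlip parent
  rotRest node parent grandparent sib uncle) := rfl

theorem run_hasMiddle {s : Mem V} {z p c₀ c₁ k fl} {r₀ r₁ : NodeRec V}
    (hz : s.node z = some ⟨p, .internal c₀ c₁, k, fl⟩) (h₀ : s.node c₀ = some r₀)
    (h₁ : s.node c₁ = some r₁) :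
    ∃ n ≤ 5, (hasMiddleBoundary z).run s =
      some (k - (r₀.numBoundary == 2).toNat - (r₁.numBoundary == 2).toNat != 0, s.adv n) := by
  simp only [hasMiddleBoundary, run_bind, run_getNumBoundary, hz, Option.bind_some, isLeafNode,
    run_readNode, Mem.adv_node, run_pure, Bool.false_or, beq_iff_eq]
  by_cases hk : k = 0
  · subst hk
    exact ⟨2, by omega, by simp [run_pure]⟩
  · refine ⟨5, le_rfl, ?_⟩
    rw [if_neg hk]
    simp only [run_bind, getChildren, run_readNode, Mem.adv_node, hz, Option.bind_some, run_pure, run_isPath, h₀, h₁, Mem.adv_adv]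

theorem run_rotWrites {s : Mem V} {x y z a b : ℕ} (σ : Bool) {px py pz pb : Option ℕ}
    {kz ky kx kb : ℕ} {fx fy fz fb : Bool} {bx by' bz bb : NodeBody V} (d : Bool × Bool × Bool)
    (hz : s.node z = some ⟨pz, bz, kz, fz⟩) (hy : s.node y = some ⟨py, by', ky, fy⟩)
    (hx : s.node x = some ⟨px, bx, kx, fx⟩) (hb : s.node b = some ⟨pb, bb, kb, fb⟩)
    (hzy : z ≠ y) (hzx : z ≠ x) (hzb : z ≠ b) (hyx : y ≠ x) (hyb : y ≠ b) (hxb : x ≠ b) :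
    ∃ s', (rotWrites x y z a b σ d).run s = some ((), s') ∧ s'.time ≤ s.time + 20 ∧
      s'.exposed = s.exposed ∧ s'.incident = s.incident ∧ s'.next = s.next ∧
      (∀ n, n ≠ z → n ≠ y → n ≠ x → n ≠ b → s'.node n = s.node n) ∧
      s'.node z = some ⟨pz, .internal (if σ then y else x) (if σ then x else y), kz, d.2.2⟩ ∧
      s'.node y = some ⟨py, .internal (if σ then b else a) (if σ then a else b),
        if d.1 then 2 else 1, d.2.1⟩ ∧
      s'.node x = some ⟨some z, bx, kx, fx⟩ ∧
      s'.node b = some ⟨some y, bb, kb, fb⟩ := by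
  have key : ∀ c c' d' d₁ d₂ d₃, ∃ s', (do
      setChildren y c c'
      setChildren z d₁ d₂
      setFlip y d.2.1
      setNumBoundary y d₃
      setFlip z d.2.2
      setParent x (some z)
      setParent b (some y) : Prog V Unit).run s = some (d', s') ∧ s'.time ≤ s.time + 20 ∧
      s'.exposed = s.exposed ∧ s'.incident = s.incident ∧ s'.next = s.next ∧
      (∀ n, n ≠ z → n ≠ y → n ≠ x → n ≠ b → s'.node n = s.node n) ∧
      s'.node z = some ⟨pz, .internal d₁ d₂, kz, d.2.2⟩ ∧
      s'.node y = some ⟨py, .internal c c', d₃, d.2.1⟩ ∧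
      s'.node x = some ⟨some z, bx, kx, fx⟩ ∧
      s'.node b = some ⟨some y, bb, kb, fb⟩ := by
    intro c c' d' d₁ d₂ d₃
    simp only [run_bind, run_toggleFlip, run_setChildren, run_setFlip, run_setNumBoundary,
      run_setParent, Mem.adv_node, Mem.upd_node, Mem.upd_adv, Mem.adv_adv, hx, hb, hy, hz,
      Option.bind_some, hzy, hzx, hzb, hyx, hyb, hxb, hzy.symm, hzx.symm, hzb.symm, hyx.symm,
      hyb.symm, hxb.symm, if_true, if_false]
    refine ⟨_, rfl, ?_, rfl, rfl, rfl, ?_, ?_, ?_, ?_, ?_⟩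
    · simp
    · intro n h1 h2 h3 h4
      simp [Mem.upd_node, h1, h2, h3, h4]
    · simp [Mem.upd_node, hzb, hzx, hzy]
    · simp [Mem.upd_node, hyx, hyb, hzy.symm]
    · simp [Mem.upd_node, hxb]
    · simp [Mem.upd_node]
  cases σ
  · exact key _ _ _ _ _ _
  · exact key _ _ _ _ _ _

theorem run_rotRest {s : Mem V} {x y z a b : ℕ} {σ σ' : Bool} {pz : Option ℕ} {kz ky kx ka kb : ℕ}
    {fx fa fb : Bool} {bx ba bb : NodeBody V}
    (hz : s.node z = some ⟨pz, .internal (if σ then b else y) (if σ then y else b), kz, false⟩)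
    (hy : s.node y = some ⟨some z, .internal (if σ' then a else x) (if σ' then x else a), ky, false⟩)
    (hx : s.node x = some ⟨some y, bx, kx, fx⟩) (ha : s.node a = some ⟨some y, ba, ka, fa⟩)
    (hb : s.node b = some ⟨some z, bb, kb, fb⟩)
    (hzy : z ≠ y) (hzx : z ≠ x) (hza : z ≠ a) (hzb : z ≠ b) (hyx : y ≠ x) (hya : y ≠ a)
    (hyb : y ≠ b) (hxa : x ≠ a) (hxb : x ≠ b) (hab : a ≠ b) {ζ : Option Bool}
    (hp : (pz = none ∧ ζ = none) ∨ ∃ g pg g0 g1 kg fg, pz = some g ∧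
      s.node g = some ⟨pg, .internal g0 g1, kg, fg⟩ ∧ ζ = some (g0 == z)) (gm : Bool)
    (hgm : gm = (kz - (kb == 2).toNat - (ky == 2).toNat != 0)) :
    ∃ s', (rotRest x y z a b).run s = some ((), s') ∧ s'.time ≤ s.time + 60 ∧
      s'.exposed = s.exposed ∧ s'.incident = s.incident ∧ s'.next = s.next ∧
      (∀ n, n ≠ z → n ≠ y → n ≠ x → n ≠ a → n ≠ b → s'.node n = s.node n) ∧
      s'.node z = some ⟨pz, .internal (if σ then y else x) (if σ then x else y), kz,
        if σ' = σ then (ka == 2) && gm && !(kz == 2) && (ζ == some σ) else ka == 2⟩ ∧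
      s'.node y = some ⟨some z, .internal (if σ then b else a) (if σ then a else b),
        if (if σ' = σ then (if ka == 2 then gm || (kb == 2) else kb == 2) else
          (ka == 2) || (kb == 2)) then 2 else 1, if σ' = σ then false else ka == 2⟩ ∧
      s'.node x = some ⟨some z, bx, kx, if σ' = σ then fx else !fx⟩ ∧
      s'.node a = some ⟨some y, ba, ka, if σ' = σ then (if ka == 2 then fa else !fa) else fa⟩ ∧
      s'.node b = some ⟨some y, bb, kb, fb⟩ := by
  have hgm' : gm = (kz - (ky == 2).toNat - (kb == 2).toNat != 0) := by
    rw [hgm, Nat.sub_right_comm]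
  have e3 : ((if σ then b else y) == b) = σ := by cases σ <;> simp [hyb]
  have e4 : ((if σ' then a else x) == a) = σ' := by cases σ' <;> simp [hxa]
  obtain ⟨n, hn, hmid⟩ : ∃ n ≤ 5, (hasMiddleBoundary z).run (s.adv 5) = some (gm, s.adv (5 + n)) := by
    have hz' : (s.adv 5).node z = _ := hz
    cases σ
    · obtain ⟨n, hn, h⟩ := run_hasMiddle hz' (r₀ := ⟨some z, .internal _ _, ky, _⟩) hy hb
      exact ⟨n, hn, by rw [h, ← hgm', Mem.adv_adv]⟩
    · obtain ⟨n, hn, h⟩ := run_hasMiddle hz' hb (r₁ := ⟨some z, .internal _ _, ky, _⟩) hy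
      exact ⟨n, hn, by rw [h, ← hgm, Mem.adv_adv]⟩
  have i1 : (isChildZero z b).run s = some (σ, s.adv 1) := by rw [run_isChildZero hz, e3]
  have i2 : (isChildZero y a).run (s.adv 1) = some (σ', s.adv 2) := by
    rw [run_isChildZero (s := s.adv 1) hy, e4]; rfl
  have i3 : (isPath a).run (s.adv 2) = some (ka == 2, s.adv 3) := by
    rw [run_isPath, Mem.adv_node, ha]; rfl
  have i4 : (isPath b).run (s.adv 3) = some (kb == 2, s.adv 4) := by
    rw [run_isPath, Mem.adv_node, hb]; rfl
  have i5 : (isPath z).run (s.adv 4) = some (kz == 2, s.adv 5) := by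
    rw [run_isPath, Mem.adv_node, hz]; rfl
  have hdec : ∃ (s' : Mem V) (d : Bool × Bool × Bool),
      (rotDecide x z a σ σ' (ka == 2) (kb == 2) (kz == 2)).run (s.adv 5) = some (d, s') ∧
      d = (if σ' = σ then (if ka == 2 then gm || (kb == 2) else kb == 2) else
          (ka == 2) || (kb == 2), if σ' = σ then false else ka == 2,
          if σ' = σ then (ka == 2) && gm && !(kz == 2) && (ζ == some σ) else ka == 2) ∧
      s'.time ≤ s.time + 15 ∧
      s'.exposed = s.exposed ∧ s'.incident = s.incident ∧ s'.next = s.next ∧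
      (∀ n, n ≠ x → n ≠ a → s'.node n = s.node n) ∧
      s'.node x = some ⟨some y, bx, kx, if σ' = σ then fx else !fx⟩ ∧
      s'.node a = some ⟨some y, ba, ka, if σ' = σ then (if ka == 2 then fa else !fa) else fa⟩ := by
    unfold rotDecide
    generalize (ka == 2) = P at *
    generalize (kb == 2) = Q at *
    generalize (kz == 2) = R at *
    by_cases hs : σ' = σ
    · subst hs
      simp only [beq_self_eq_true, Bool.true_and, Bool.not_true, if_true, run_ite,
        Bool.false_eq_true, if_false]
      cases P
      · simp only [Bool.false_eq_true, if_false, run_bind, run_toggleFlip, Mem.adv_node, ha,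
          Option.bind_some, run_pure, Mem.adv_adv, Bool.false_and]
        refine ⟨_, _, rfl, rfl, by simp, rfl, rfl, rfl, ?_, ?_, ?_⟩
        · intro n h1 h2; simp [Mem.upd_node, h2]
        · simp [Mem.upd_node, hxa, hx]
        · simp [Mem.upd_node]
      · simp only [if_true, run_bind, hmid, Option.bind_some, run_pure, run_ite, Bool.true_and]
        cases hg : gm && !R
        · simp only [Bool.false_eq_true, if_false, Option.bind_some, Bool.false_and]
          exact ⟨_, _, rfl, rfl, by simp; omega, rfl, rfl, rfl, fun _ _ _ => rfl, hx, ha⟩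
        · simp only [if_true, run_bind, run_getParent, Mem.adv_node, hz, Option.bind_some,
            Mem.adv_adv, Bool.true_and]
          rcases hp with ⟨rfl, rfl⟩ | ⟨g, pg, g0, g1, kg, fg, rfl, hpg, rfl⟩
          · simp only [run_pure, Option.bind_some]
            exact ⟨_, _, rfl, rfl, by simp; omega, rfl, rfl, rfl, fun _ _ _ => rfl, hx, ha⟩
          · have hpg' : (s.adv (5 + n + 1)).node g = _ := hpg
            simp only [run_bind, run_isChildZero hpg', run_pure, Option.bind_some, Mem.adv_adv]
            refine ⟨_, _, rfl, ?_, by simp; omega, rfl, rfl, rfl, fun _ _ _ => rfl, hx, ha⟩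
            cases (g0 == z) <;> cases σ' <;> rfl
    · have : (σ == σ') = false := by cases σ <;> cases σ' <;> simp_all
      simp only [this, Bool.false_and, Bool.false_eq_true, if_false, Bool.not_false, if_true, hs,
        run_bind, run_toggleFlip, Mem.adv_node, hx, Option.bind_some, run_pure, Mem.adv_adv]
      refine ⟨_, _, rfl, rfl, by simp, rfl, rfl, rfl, ?_, ?_, ?_⟩
      · intro n h1 h2; simp [Mem.upd_node, h1]
      · simp [Mem.upd_node]
      · simp [Mem.upd_node, hxa.symm, ha]
  obtain ⟨s1, d, r1, hd, t1, e1, e2, e3, n1, hx1, ha1⟩ := hdec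
  have hz1 := (n1 z hzx hza).trans hz
  have hy1 := (n1 y hyx hya).trans hy
  have hb1 := (n1 b hxb.symm hab.symm).trans hb
  obtain ⟨s2, r2, t2, e1', e2', e3', n2, hz2, hy2, hx2, hb2⟩ :=
    run_rotWrites (a := a) σ d hz1 hy1 hx1 hb1 hzy hzx hzb hyx hyb hxb
  refine ⟨s2, ?_, by omega, e1'.trans e1, e2'.trans e2, e3'.trans e3, ?_, ?_, ?_, hx2, ?_, hb2⟩
  · unfold rotRest
    rw [run_bind, i1, Option.bind_some, run_bind, i2, Option.bind_some, run_bind, i3,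
      Option.bind_some, run_bind, i4, Option.bind_some, run_bind, i5, Option.bind_some, run_bind,
      r1, Option.bind_some]
    exact r2
  · intro n h1 h2 h3 h4 h5
    exact (n2 n h1 h2 h3 h5).trans (n1 n h3 h4)
  · rw [hz2, hd]
  · rw [hy2, hd]
  · rw [n2 a hza.symm hya.symm hxa.symm hab]; exact ha1
end TopTreeProg

namespace RTree
variable {V : Type}

def flip : RTree V → Bool
  | leaf _ fl _ _ _ => fl
  | node _ fl _ _ _ => fl

def body : RTree V → NodeBody V
  | leaf _ _ _ a b => .leaf a b
  | node _ _ _ l r => .internal l.addr r.addr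

/-- The record of the root of the tree, where `p` is its parent pointer. -/
def rcd (t : RTree V) (p : Option ℕ) : NodeRec V := ⟨p, t.body, t.count, t.flip⟩

/-- The tree `t` is stored in memory, and `p` is the parent pointer of its root. -/
def Holds (h : ℕ → Option (NodeRec V)) : Option ℕ → RTree V → Prop
  | p, leaf x fl k a b => h x = some ⟨p, .leaf a b, k, fl⟩
  | p, node x fl k l r => h x = some ⟨p, .internal l.addr r.addr, k, fl⟩ ∧
      Holds h (some x) l ∧ Holds h (some x) r

/-- The proper descendants of the root of `t` are stored in memory. -/
def Below (h : ℕ → Option (NodeRec V)) : RTree V → Prop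
  | leaf _ _ _ _ _ => True
  | node x _ _ l r => Holds h (some x) l ∧ Holds h (some x) r

def belowAddrs : RTree V → List ℕ
  | leaf _ _ _ _ _ => []
  | node _ _ _ l r => l.addrs ++ r.addrs

theorem addrs_eq (t : RTree V) : t.addrs = t.addr :: t.belowAddrs := by cases t <;> rfl

theorem holds_iff (h : ℕ → Option (NodeRec V)) (p : Option ℕ) (t : RTree V) :
    Holds h p t ↔ h t.addr = some (t.rcd p) ∧ t.Below h := by
  cases t <;> simp [Holds, Below, addr, rcd, body, count, flip]

theorem Holds.congr {h h' : ℕ → Option (NodeRec V)} {p : Option ℕ} {t : RTree V}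
    (ht : Holds h p t) (hh : ∀ n ∈ t.addrs, h' n = h n) : Holds h' p t := by
  induction t generalizing p with
  | leaf x fl k a b => exact (hh x (by simp [addrs])).trans ht
  | node x fl k l r hl hr =>
    obtain ⟨h1, h2, h3⟩ := ht
    exact ⟨(hh x (by simp [addrs])).trans h1, hl h2 fun n hn => hh n (by simp [addrs, hn]),
      hr h3 fun n hn => hh n (by simp [addrs, hn])⟩

theorem Below.congr {h h' : ℕ → Option (NodeRec V)} {t : RTree V}
    (ht : t.Below h) (hh : ∀ n ∈ t.belowAddrs, h' n = h n) : t.Below h' := by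
  cases t with
  | leaf => trivial
  | node x fl k l r =>
    exact ⟨ht.1.congr fun n hn => hh n (by simp [belowAddrs, hn]),
      ht.2.congr fun n hn => hh n (by simp [belowAddrs, hn])⟩

@[simp] theorem toggle_body (t : RTree V) : t.toggle.body = t.body := by cases t <;> rfl
@[simp] theorem toggle_flip (t : RTree V) : t.toggle.flip = !t.flip := by cases t <;> rfl
@[simp] theorem toggle_belowAddrs (t : RTree V) : t.toggle.belowAddrs = t.belowAddrs := by
  cases t <;> rfl
theorem toggle_below (h : ℕ → Option (NodeRec V)) (t : RTree V) :
    t.toggle.Below h ↔ t.Below h := by cases t <;> rfl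

theorem mk_body (x fl k σ) (p q : RTree V) : (mk x fl k σ p q).body =
    .internal (if σ then p.addr else q.addr) (if σ then q.addr else p.addr) := by
  cases σ <;> rfl
@[simp] theorem mk_flip (x fl k σ) (p q : RTree V) : (mk x fl k σ p q).flip = fl := by
  cases σ <;> rfl
theorem mk_below (h : ℕ → Option (NodeRec V)) (x fl k σ) (p q : RTree V) :
    (mk x fl k σ p q).Below h ↔ Holds h (some x) p ∧ Holds h (some x) q := by
  cases σ
  · exact and_comm
  · rfl

theorem holds_mk (h : ℕ → Option (NodeRec V)) (o : Option ℕ) (x fl k σ) (p q : RTree V) :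
    Holds h o (mk x fl k σ p q) ↔
      h x = some ⟨o, .internal (if σ then p.addr else q.addr) (if σ then q.addr else p.addr), k, fl⟩
        ∧ Holds h (some x) p ∧ Holds h (some x) q := by
  rw [holds_iff, mk_below, rcd, mk_body, mk_addr, mk_count, mk_flip]

/-- The parent pointer of a node with context `C`. -/
def par : List (Fr V) → Option ℕ
  | [] => none
  | f :: _ => some f.addr

/-- The context `C` of a node with address `x` is stored in memory. -/
def CHolds (h : ℕ → Option (NodeRec V)) : List (Fr V) → ℕ → Prop
  | [], _ => True
  | f :: C, x => h f.addr = some ⟨par C, .internal (if f.zero then x else f.sib.addr)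
      (if f.zero then f.sib.addr else x), f.k, f.fl⟩ ∧ Holds h (some f.addr) f.sib ∧
      CHolds h C f.addr

theorem holds_fill (h : ℕ → Option (NodeRec V)) (C : List (Fr V)) (t : RTree V) :
    Holds h none (fill C t) ↔ Holds h (par C) t ∧ CHolds h C t.addr := by
  induction C generalizing t with
  | nil => simp [par, CHolds]
  | cons f C ih =>
    rw [fill_cons, ih, Fr.fill, holds_mk, mk_addr, par, CHolds]
    tauto

theorem CHolds.congr {h h' : ℕ → Option (NodeRec V)} {C : List (Fr V)} {x : ℕ}
    (ht : CHolds h C x) (hh : ∀ n ∈ caddrs C, h' n = h n) : CHolds h' C x := by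
  induction C generalizing x with
  | nil => trivial
  | cons f C ih =>
    obtain ⟨h1, h2, h3⟩ := ht
    exact ⟨(hh _ (by simp [caddrs])).trans h1, h2.congr fun n hn => hh n (by simp [caddrs, hn]),
      ih h3 fun n hn => hh n (by simp [caddrs, hn])⟩

/-- A subtree may be replaced in memory. -/
theorem Holds.replace {h h' : ℕ → Option (NodeRec V)} {C : List (Fr V)} {t t' : RTree V}
    (ht : Holds h none (fill C t)) (hn : (fill C t).addrs.Nodup)
    (hh : ∀ n, n ∉ t.addrs → h' n = h n) (ht' : Holds h' (par C) t') (ha : t'.addr = t.addr) :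
    Holds h' none (fill C t') := by
  rw [holds_fill] at ht ⊢
  refine ⟨ht', ha ▸ ht.2.congr fun n hnC => hh n fun hnt => ?_⟩
  have := (fill_addrs C t).nodup_iff.1 hn
  exact (List.nodup_append.1 this).2.2 n hnt n hnC rfl

def togIf (c : Bool) (t : RTree V) : RTree V := if c then t.toggle else t

@[simp] theorem togIf_false (t : RTree V) : t.togIf false = t := rfl
@[simp] theorem togIf_addr (c) (t : RTree V) : (t.togIf c).addr = t.addr := by
  cases c <;> simp [togIf]
@[simp] theorem togIf_count (c) (t : RTree V) : (t.togIf c).count = t.count := by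
  cases c <;> simp [togIf]
@[simp] theorem togIf_isP (c) (t : RTree V) : (t.togIf c).isP = t.isP := by
  cases c <;> simp [togIf]
@[simp] theorem togIf_verts (c) (t : RTree V) : (t.togIf c).verts = t.verts := by
  cases c <;> simp [togIf]
@[simp] theorem togIf_addrs (c) (t : RTree V) : (t.togIf c).addrs = t.addrs := by
  cases c <;> simp [togIf]
@[simp] theorem togIf_size (c) (t : RTree V) : (t.togIf c).size = t.size := by
  cases c <;> simp [togIf]
@[simp] theorem togIf_pot (c) (t : RTree V) : (t.togIf c).pot = t.pot := by
  cases c <;> simp [togIf]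
theorem togIf_mk (c x fl k σ) (p q : RTree V) :
    (mk x fl k σ p q).togIf c = mk x (fl ^^ c) k σ p q := by
  cases c <;> simp [togIf]
theorem Rearr.togIf (c) (t : RTree V) : Rearr t (t.togIf c) := by
  cases c
  · exact Rearr.refl t
  · exact Rearr.toggle t
theorem togIf_cases (c) (t : RTree V) : t.togIf c = t ∨ t.togIf c = t.toggle := by
  cases c
  · exact Or.inl rfl
  · exact Or.inr rfl
theorem togIf_togIf (c d) (t : RTree V) : (t.togIf c).togIf d = t.togIf (c ^^ d) := by
  cases c <;> cases d <;> simp [togIf]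

/-- Pushing down the flip bit of a node does not change the tree. -/
theorem most_push (O : Set V) (τ x fl k σ) (p q : RTree V) (v : V) :
    (mk x false k (σ ^^ fl) (p.togIf fl) (q.togIf fl)).Most O τ v ↔
      (mk x fl k σ p q).Most O τ v := by
  simp only [most_mk, togIf_verts]
  cases fl <;> cases σ <;> cases τ <;> simp

theorem most_togIf (O : Set V) (σ c) (t : RTree V) (v : V) :
    (t.togIf c).Most O σ v ↔ t.Most O (σ ^^ c) v := by
  cases c
  · simp
  · simpa [togIf] using most_toggle O σ t v

theorem wf_togIf (O : Set V) (c) (t : RTree V) : (t.togIf c).WF O ↔ t.WF O := by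
  cases c
  · rfl
  · exact wf_toggle O t

theorem wf_push (O : Set V) (x fl k σ) (p q : RTree V) :
    (mk x false k (σ ^^ fl) (p.togIf fl) (q.togIf fl)).WF O ↔ (mk x fl k σ p q).WF O := by
  simp only [wf_mk, togIf_verts, wf_togIf, most_togIf]
  cases fl <;> simp

end RTree

/-- The state `s'` differs from `s` only in the time and in the nodes with address in `A`. -/
structure Mem.Same {V : Type} (s s' : Mem V) (A : List ℕ) : Prop where
  node : ∀ n, n ∉ A → s'.node n = s.node n
  exposed : s'.exposed = s.exposed
  incident : s'.incident = s.incident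
  next : s'.next = s.next

namespace Mem
variable {V : Type}
theorem Same.trans {s s' s'' : Mem V} {A B : List ℕ} (h : s.Same s' A) (h' : s'.Same s'' B)
    (hBA : ∀ n ∈ B, n ∈ A) : s.Same s'' A :=
  ⟨fun n hn => (h'.node n fun hB => hn (hBA n hB)).trans (h.node n hn),
    h'.exposed.trans h.exposed, h'.incident.trans h.incident, h'.next.trans h.next⟩
theorem Same.mono {s s' : Mem V} {A B : List ℕ} (h : s.Same s' A) (hAB : ∀ n ∈ A, n ∈ B) :
    s.Same s' B :=
  ⟨fun n hn => h.node n fun hA => hn (hAB n hA), h.exposed, h.incident, h.next⟩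
theorem Same.adv (s : Mem V) (n : ℕ) (A : List ℕ) : s.Same (s.adv n) A :=
  ⟨fun _ _ => rfl, rfl, rfl, rfl⟩
end Mem

namespace TopTreeProg
open RTree
variable {V : Type}

theorem pushFlip_spec {s : Mem V} {o : Option ℕ} {x : ℕ} {fl : Bool} {k : ℕ} {σ : Bool}
    {p q : RTree V} (h : Holds s.node o (RTree.mk x fl k σ p q))
    (hn : (RTree.mk x fl k σ p q).addrs.Nodup) :
    ∃ s', (pushFlip x).run s = some ((), s') ∧ s'.time ≤ s.time + 20 ∧
      s.Same s' (RTree.mk x fl k σ p q).addrs ∧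
      Holds s'.node o (RTree.mk x false k (σ ^^ fl) (p.togIf fl) (q.togIf fl)) := by
  rw [holds_mk] at h
  obtain ⟨hx, hp, hq⟩ := h
  cases fl
  · refine ⟨s.adv 1, ?_, by simp, Mem.Same.adv _ _ _, ?_⟩
    · simp [pushFlip, run_getFlip, hx, run_pure]
    · rw [Bool.xor_false]; exact (holds_mk ..).2 ⟨hx, hp, hq⟩
  · have hn' := (mk_addrs x true k σ p q).nodup_iff.1 hn
    rw [List.nodup_cons, List.nodup_append] at hn'
    obtain ⟨hxn, hnp, hnq, hd⟩ := hn'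
    rw [holds_iff] at hp hq
    have hxp : x ≠ p.addr := fun e => hxn (by rw [e]; simp [addr_mem])
    have hxq : x ≠ q.addr := fun e => hxn (by rw [e]; simp [addr_mem])
    have hpq : p.addr ≠ q.addr := hd _ (addr_mem p) _ (addr_mem q)
    obtain ⟨hp, hpb⟩ := hp
    obtain ⟨hq, hqb⟩ := hq
    have key : ∃ s', (pushFlip x).run s = some ((), s') ∧ s'.time ≤ s.time + 20 ∧
        s'.exposed = s.exposed ∧ s'.incident = s.incident ∧ s'.next = s.next ∧
        (∀ n, n ≠ x → n ≠ p.addr → n ≠ q.addr → s'.node n = s.node n) ∧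
        s'.node x = some ⟨o, .internal (if σ then q.addr else p.addr)
          (if σ then p.addr else q.addr), k, false⟩ ∧
        s'.node p.addr = some (p.toggle.rcd (some x)) ∧
        s'.node q.addr = some (q.toggle.rcd (some x)) := by
      have hg : (getChildren x).run (s.adv 1) = _ := run_getChildren (s := s.adv 1) hx
      simp only [rcd] at hp hq
      simp only [pushFlip, run_bind, run_getFlip, hx, Option.bind_some, if_true, hg]
      cases σ <;>
      · simp only [run_bind, run_setChildren, run_toggleFlip, run_setFlip, Mem.adv_node,
          Mem.adv_adv, Mem.upd_node, Mem.upd_adv, Option.bind_some, hx, hp, hq, hxp, hxq, hpq,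
          hxp.symm, hxq.symm, hpq.symm, if_true, if_false, Bool.false_eq_true]
        refine ⟨_, rfl, by simp, rfl, rfl, rfl, ?_, ?_, ?_, ?_⟩
        · intro n h1 h2 h3; simp [Mem.upd_node, h1, h2, h3]
        · simp [Mem.upd_node]
        · simp [Mem.upd_node, hxp.symm, hpq, rcd]
        · simp [Mem.upd_node, hxq.symm, hpq.symm, rcd]
    obtain ⟨s', r, ht, e1, e2, e3, hn0, hx', hp', hq'⟩ := key
    refine ⟨s', r, ht, ⟨fun n hn => ?_, e1, e2, e3⟩, ?_⟩
    · rw [(mk_addrs ..).mem_iff] at hn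
      simp only [List.mem_cons, List.mem_append, not_or] at hn
      exact hn0 n hn.1 (fun e => hn.2.1 (e ▸ addr_mem p)) (fun e => hn.2.2 (e ▸ addr_mem q))
    · rw [Bool.xor_true, mk_swap, holds_mk]
      simp only [togIf, if_true, toggle_addr]
      rw [addrs_eq, List.nodup_cons] at hnp hnq
      simp only [List.mem_append, not_or] at hxn
      refine ⟨hx', (holds_iff ..).2 ⟨by simpa using hq', ?_⟩,
        (holds_iff ..).2 ⟨by simpa using hp', ?_⟩⟩
      · rw [toggle_below]
        refine hqb.congr fun n hm => hn0 n ?_ ?_ ?_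
        · rintro rfl; exact hxn.2 (by rw [addrs_eq]; exact .tail _ hm)
        · rintro rfl; exact hd _ (addr_mem p) p.addr (by rw [addrs_eq]; exact .tail _ hm) rfl
        · rintro rfl; exact hnq.1 hm
      · rw [toggle_below]
        refine hpb.congr fun n hm => hn0 n ?_ ?_ ?_
        · rintro rfl; exact hxn.1 (by rw [addrs_eq]; exact .tail _ hm)
        · rintro rfl; exact hnp.1 hm
        · rintro rfl; exact hd q.addr (by rw [addrs_eq]; exact .tail _ hm) _ (addr_mem q) rfl

end TopTreeProg

namespace TopTreeProg
open RTree
variable {V : Type}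

/-- Is the node with context `C` child zero of its parent? -/
def headZero (C : List (Fr V)) : Option Bool := C.head?.map Fr.zero

theorem rotRes_addr (ζ σ σ' y z kz) (b a x : RTree V) (gm) :
    (rotRes ζ σ σ' y z kz b a x gm).addr = z := by
  unfold rotRes; split_ifs <;> simp

theorem rotRest_spec {s : Mem V} {C : List (Fr V)} {y z ky kz : ℕ} {σ σ' : Bool}
    {b a x : RTree V}
    (h : Holds s.node none (fill C (RTree.mk z false kz σ b (RTree.mk y false ky σ' a x))))
    (hn : (fill C (RTree.mk z false kz σ b (RTree.mk y false ky σ' a x))).addrs.Nodup) :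
    ∃ s', (rotRest x.addr y z a.addr b.addr).run s = some ((), s') ∧ s'.time ≤ s.time + 60 ∧
      s.Same s' (RTree.mk z false kz σ b (RTree.mk y false ky σ' a x)).addrs ∧
      Holds s'.node none (fill C (rotRes (headZero C) σ σ' y z kz b a x
        (midCount kz b (RTree.mk y false ky σ' a x)))) := by
  have hA := (fill_addrs C _).nodup_iff.1 hn
  rw [List.nodup_append] at hA
  obtain ⟨hZ, hC, hZC⟩ := hA
  have hperm : (RTree.mk z false kz σ b (RTree.mk y false ky σ' a x)).addrs.Perm
      (z :: (b.addrs ++ y :: (a.addrs ++ x.addrs))) :=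
    (mk_addrs ..).trans (((mk_addrs ..).append_left _).cons _)
  have hmem := fun n => hperm.mem_iff (a := n)
  have hnd := hperm.nodup_iff.1 hZ
  have hh := (holds_fill ..).1 h
  obtain ⟨hz, hCh⟩ := hh
  rw [holds_mk] at hz
  obtain ⟨hz, hb, hy⟩ := hz
  rw [holds_mk] at hy
  obtain ⟨hy, ha, hx⟩ := hy
  rw [holds_iff] at hb ha hx
  simp only [mk_addr] at hz hCh
  simp only [List.nodup_cons, List.nodup_append, List.mem_append, List.mem_cons, not_or] at hnd
  obtain ⟨⟨hzb, hzy, hza, hzx⟩, hnb, ⟨⟨hya, hyx⟩, hna, hnx, hax⟩, hbyax⟩ := hnd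
  have hby : y ∉ b.addrs := fun h => hbyax _ h y (Or.inl rfl) rfl
  have hba : ∀ n ∈ b.addrs, n ∉ a.addrs := fun n h h' => hbyax _ h n (Or.inr (Or.inl h')) rfl
  have hbx : ∀ n ∈ b.addrs, n ∉ x.addrs := fun n h h' => hbyax _ h n (Or.inr (Or.inr h')) rfl
  have hax : ∀ n ∈ a.addrs, n ∉ x.addrs := fun n h h' => hax _ h n h' rfl
  have ne_of : ∀ {m : ℕ} {t : RTree V}, m ∉ t.addrs → m ≠ t.addr :=
    fun h e => h (e ▸ addr_mem _)
  have hp : (par C = none ∧ headZero C = none) ∨ ∃ g pg g0 g1 kg fg, par C = some g ∧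
      s.node g = some ⟨pg, .internal g0 g1, kg, fg⟩ ∧ headZero C = some (g0 == z) := by
    cases C with
    | nil => exact Or.inl ⟨rfl, rfl⟩
    | cons f C =>
      refine Or.inr ⟨f.addr, _, _, _, _, _, rfl, hCh.1, ?_⟩
      have hne : f.sib.addr ≠ z := fun e => by
        refine hZC z (by rw [hmem]; simp) z ?_ rfl
        rw [caddrs, ← e]
        simp [addr_mem]
      cases hf : f.zero <;> simp [headZero, hf, hne]
  obtain ⟨s', r, ht, e1, e2, e3, hs, hz', hy', hx', ha', hb'⟩ := run_rotRest hz hy hx.1 ha.1 hb.1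
    hzy (ne_of hzx) (ne_of hza) (ne_of hzb) (ne_of hyx) (ne_of hya) (ne_of hby)
    (fun e => hax _ (addr_mem a) (e ▸ addr_mem x)) (fun e => hbx _ (addr_mem b) (e ▸ addr_mem x))
    (fun e => hba _ (addr_mem b) (e ▸ addr_mem a)) hp
    (midCount kz b (RTree.mk y false ky σ' a x)) (by simp [midCount, RTree.isP])
  refine ⟨s', r, ht, ⟨fun n hn => ?_, e1, e2, e3⟩, ?_⟩
  · rw [hmem] at hn
    simp only [List.mem_append, List.mem_cons, not_or] at hn
    exact hs n hn.1 hn.2.2.1 (ne_of hn.2.2.2.2) (ne_of hn.2.2.2.1) (ne_of hn.2.1)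
  · refine h.replace hn (fun n hn => ?_) ?_ (by rw [rotRes_addr, mk_addr])
    · rw [hmem] at hn
      simp only [List.mem_append, List.mem_cons, not_or] at hn
      exact hs n hn.1 hn.2.2.1 (ne_of hn.2.2.2.2) (ne_of hn.2.2.2.1) (ne_of hn.2.1)
    · rw [addrs_eq, List.nodup_cons] at hna hnb hnx
      have below_mem : ∀ {n : ℕ} {t : RTree V}, n ∈ t.belowAddrs → n ∈ t.addrs := fun h => by
        rw [addrs_eq]; exact .tail _ h
      have ba : a.Below s'.node := ha.2.congr fun n hn => hs n
        (fun e => hza (e ▸ below_mem hn)) (fun e => hya (e ▸ below_mem hn))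
        (fun e => hax n (below_mem hn) (e ▸ addr_mem x)) (fun e => hna.1 (e ▸ hn))
        (fun e => hba _ (addr_mem b) (e ▸ below_mem hn))
      have bb : b.Below s'.node := hb.2.congr fun n hn => hs n
        (fun e => hzb (e ▸ below_mem hn)) (fun e => hby (e ▸ below_mem hn))
        (fun e => hbx n (below_mem hn) (e ▸ addr_mem x))
        (fun e => hba n (below_mem hn) (e ▸ addr_mem a)) (fun e => hnb.1 (e ▸ hn))
      have bx : x.Below s'.node := hx.2.congr fun n hn => hs n
        (fun e => hzx (e ▸ below_mem hn)) (fun e => hyx (e ▸ below_mem hn)) (fun e => hnx.1 (e ▸ hn))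
        (fun e => hax _ (addr_mem a) (e ▸ below_mem hn))
        (fun e => hbx _ (addr_mem b) (e ▸ below_mem hn))
      have rb : Holds s'.node (some y) b := (holds_iff ..).2 ⟨hb', bb⟩
      unfold rotRes
      simp only [RTree.isP] at *
      by_cases hσ : σ' = σ
      · simp only [hσ, if_true] at hz' hy' hx' ha' ⊢
        have rx : Holds s'.node (some z) x := (holds_iff ..).2 ⟨hx', bx⟩
        by_cases hpa : (a.count == 2) = true
        · simp only [hpa, if_true, Bool.true_and] at hz' hy' ha' ⊢
          rw [holds_mk, holds_mk, mk_addr]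
          exact ⟨hz', ⟨hy', rb, (holds_iff ..).2 ⟨ha', ba⟩⟩, rx⟩
        · rw [Bool.not_eq_true] at hpa
          simp only [hpa, Bool.false_eq_true, if_false, Bool.false_and] at hz' ha' hy' ⊢
          rw [holds_mk, holds_mk, mk_addr, toggle_addr]
          refine ⟨hz', ⟨hy', rb, (holds_iff ..).2 ⟨?_, (toggle_below ..).2 ba⟩⟩, rx⟩
          rw [toggle_addr]; simpa [rcd] using ha'
      · simp only [hσ, if_false] at hz' hy' hx' ha' ⊢
        rw [holds_mk, holds_mk, mk_addr, toggle_addr]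
        refine ⟨hz', ⟨hy', rb, (holds_iff ..).2 ⟨ha', ba⟩⟩,
          (holds_iff ..).2 ⟨?_, (toggle_below ..).2 bx⟩⟩
        rw [toggle_addr]; simpa [rcd] using hx'

theorem push_two {s : Mem V} {C : List (Fr V)} {y z ky kz : ℕ} {σ σ' fy fz : Bool}
    {b a x : RTree V}
    (h : Holds s.node none (fill C (RTree.mk z fz kz σ b (RTree.mk y fy ky σ' a x))))
    (hn : (fill C (RTree.mk z fz kz σ b (RTree.mk y fy ky σ' a x))).addrs.Nodup) :
    ∃ s', (do pushFlip z; pushFlip y : Prog V Unit).run s = some ((), s') ∧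
      s'.time ≤ s.time + 40 ∧
      s.Same s' (RTree.mk z fz kz σ b (RTree.mk y fy ky σ' a x)).addrs ∧
      Holds s'.node none (fill C (RTree.mk z false kz (σ ^^ fz) (b.togIf fz)
        (RTree.mk y false ky (σ' ^^ (fy ^^ fz)) (a.togIf (fy ^^ fz)) (x.togIf (fy ^^ fz))))) ∧
      (fill C (RTree.mk z false kz (σ ^^ fz) (b.togIf fz)
        (RTree.mk y false ky (σ' ^^ (fy ^^ fz)) (a.togIf (fy ^^ fz))
          (x.togIf (fy ^^ fz))))).addrs.Nodup := by
  have hz0 := ((holds_fill ..).1 h).1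
  have hnd := (List.nodup_append.1 ((fill_addrs C _).nodup_iff.1 hn)).1
  obtain ⟨s1, r1, t1, S1, H1⟩ := pushFlip_spec hz0 hnd
  have H1' := Holds.replace (h' := s1.node) h hn (fun n hn => S1.node n hn) H1 (by simp)
  have P1 : ((fill C (RTree.mk z false kz (σ ^^ fz) (b.togIf fz)
      ((RTree.mk y fy ky σ' a x).togIf fz))).addrs).Nodup := by
    refine List.Perm.nodup ?_ hn
    refine (fill_addrs ..).trans (List.Perm.trans ?_ (fill_addrs ..).symm)
    refine List.Perm.append_right _ ((mk_addrs ..).trans (List.Perm.trans ?_ (mk_addrs ..).symm))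
    simp
  rw [togIf_mk] at H1' P1 H1
  let f : Fr V := ⟨z, false, kz, !(σ ^^ fz), b.togIf fz⟩
  have hf : ∀ t, fill (f :: C) t = fill C (RTree.mk z false kz (σ ^^ fz) (b.togIf fz) t) := by
    intro t
    rw [fill_cons, Fr.fill]
    simp only [f]
    rw [mk_swap]
  rw [← hf] at P1 H1'
  have H1'' := ((holds_fill ..).1 H1').1
  have N1 := (List.nodup_append.1 ((fill_addrs (f :: C) _).nodup_iff.1 P1)).1
  obtain ⟨s2, r2, t2, S2, H2⟩ := pushFlip_spec H1'' N1
  have H2' := Holds.replace (h' := s2.node) H1' P1 (fun n hn => S2.node n hn) H2 (by simp)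
  have P2 : (fill (f :: C) (RTree.mk y false ky (σ' ^^ (fy ^^ fz)) (a.togIf (fy ^^ fz))
      (x.togIf (fy ^^ fz)))).addrs.Nodup := by
    refine List.Perm.nodup ?_ P1
    refine (fill_addrs ..).trans (List.Perm.trans ?_ (fill_addrs ..).symm)
    refine List.Perm.append_right _ ?_
    refine (mk_addrs ..).trans (List.Perm.trans ?_ (mk_addrs ..).symm)
    simp
  rw [hf] at H2' P2
  refine ⟨s2, ?_, by omega, S1.trans S2 ?_, H2', P2⟩
  · simp only [run_bind, r1, Option.bind_some, r2]
  · intro n hn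
    rw [(mk_addrs ..).mem_iff] at hn ⊢
    refine .tail _ (List.mem_append_right _ ?_)
    rw [(mk_addrs ..).mem_iff]; exact hn

theorem rotateUp_spec {s : Mem V} {C : List (Fr V)} {y z ky kz : ℕ} {σ σ' fy fz : Bool}
    {b a x : RTree V}
    (h : Holds s.node none (fill C (RTree.mk z fz kz σ b (RTree.mk y fy ky σ' a x))))
    (hn : (fill C (RTree.mk z fz kz σ b (RTree.mk y fy ky σ' a x))).addrs.Nodup) :
    ∃ s', (rotateUp x.addr).run s = some ((), s') ∧ s'.time ≤ s.time + 120 ∧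
      s.Same s' (RTree.mk z fz kz σ b (RTree.mk y fy ky σ' a x)).addrs ∧
      Holds s'.node none (fill C (rotRes (headZero C) (σ ^^ fz) (σ' ^^ (fy ^^ fz)) y z kz
        (b.togIf fz) (a.togIf (fy ^^ fz)) (x.togIf (fy ^^ fz))
        (midCount kz (b.togIf fz)
          (RTree.mk y false ky (σ' ^^ (fy ^^ fz)) (a.togIf (fy ^^ fz)) (x.togIf (fy ^^ fz)))))) := by
  have hh := (holds_fill ..).1 h
  obtain ⟨hz, -⟩ := hh
  have hz0 := hz
  rw [holds_mk, mk_addr] at hz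
  obtain ⟨hz, hb, hy⟩ := hz
  rw [holds_mk] at hy
  obtain ⟨hy, ha, hx⟩ := hy
  rw [holds_iff] at hb ha hx
  have hnd := (List.nodup_append.1 ((fill_addrs C _).nodup_iff.1 hn)).1
  have hperm : (RTree.mk z fz kz σ b (RTree.mk y fy ky σ' a x)).addrs.Perm
      (z :: (b.addrs ++ y :: (a.addrs ++ x.addrs))) :=
    (mk_addrs ..).trans (((mk_addrs ..).append_left _).cons _)
  have hnd' := hperm.nodup_iff.1 hnd
  simp only [List.nodup_cons, List.nodup_append, List.mem_append, List.mem_cons, not_or] at hnd'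
  obtain ⟨-, -, ⟨-, -, -, hax⟩, hbyax⟩ := hnd'
  have hxa : a.addr ≠ x.addr := hax _ (addr_mem a) _ (addr_mem x)
  have hby : b.addr ≠ y := hbyax _ (addr_mem b) y (Or.inl rfl)
  have i1 : (getParent x.addr).run s = some (some y, s.adv 1) := by
    rw [run_getParent, hx.1]; rfl
  have i2 : (getParent y).run (s.adv 1) = some (some z, s.adv 2) := by
    rw [run_getParent, Mem.adv_node, hy]; rfl
  have i3 : (sibling x.addr).run (s.adv 2) = some (a.addr, s.adv 4) := by
    rw [run_sibling (s := s.adv 2) hx.1 hy]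
    cases σ' <;> simp [hxa]
  have i4 : (sibling y).run (s.adv 4) = some (b.addr, s.adv 6) := by
    rw [run_sibling (s := s.adv 4) hy hz]
    cases σ <;> simp [hby]
  obtain ⟨s2, r2, t2, S2, H2', P2⟩ := push_two (s := s.adv 6) h hn
  simp only [run_bind] at r2
  obtain ⟨s3, r3, t3, S3, H3⟩ := rotRest_spec H2' P2
  refine ⟨s3, ?_, by simp at t2; omega, ?_, H3⟩
  · rw [rotateUp_eq]
    rw [run_bind, i1, Option.bind_some]
    simp only [run_bind, run_deref_some, Option.bind_some, i2, i3, i4]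
    rw [← Option.bind_assoc, r2]
    simpa using r3
  · refine ((Mem.Same.adv s 6 _).trans S2 fun n hn => hn).trans S3 fun n hn => ?_
    rw [(mk_addrs ..).mem_iff] at hn ⊢
    simp only [togIf_addrs] at hn
    rw [List.mem_cons, List.mem_append, (mk_addrs ..).mem_iff] at hn ⊢
    simpa using hn

/-- The whole tree `t` is stored in memory and satisfies all invariants. -/
structure Ok (s : Mem V) (O : Set V) (t : RTree V) : Prop where
  holds : Holds s.node none t
  nodup : t.addrs.Nodup
  wf : t.WF O

theorem rearr_rotRes (ζ σ σ') (fz fy y z ky kz) (b a x : RTree V) (gm) :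
    Rearr (RTree.mk z fz kz σ b (RTree.mk y fy ky σ' a x)) (rotRes ζ σ σ' y z kz b a x gm) := by
  have key : ∀ fz' fy' k', Rearr (RTree.mk z fz kz σ b (RTree.mk y fy ky σ' a x))
      (RTree.mk z fz' kz σ (RTree.mk y fy' k' σ b a) x) := by
    intro fz' fy' k'
    refine ⟨?_, ?_, by simp⟩
    · refine (mk_leaves ..).trans (((mk_leaves ..).append_left _).trans ?_)
      refine List.Perm.trans ?_ (((mk_leaves ..).append_right _).trans
        (List.Perm.refl _)|>.trans (.refl _)|>.symm |>.symm |>.symm |>.trans (mk_leaves ..).symm)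
      simp
    · refine (mk_inner ..).trans (((mk_inner ..).append_left _).cons _ |>.trans ?_)
      refine List.Perm.trans ?_ ((((mk_inner ..).append_right _).cons _).symm.trans
        (mk_inner ..).symm)
      refine List.Perm.cons _ ?_
      simp only [← Multiset.coe_eq_coe, ← Multiset.cons_coe, ← Multiset.coe_add]
      simp only [← Multiset.singleton_add]
      abel
  unfold rotRes
  split_ifs
  · exact key _ _ _
  · exact key _ _ _
  · exact (key false false 0).trans (Rearr.node (Rearr.node (.refl _) (Rearr.toggle _)) (.refl _))
  · exact (key false false 0).trans (Rearr.node (Rearr.node (.refl _) (Rearr.toggle _)) (.refl _))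
  · exact (key false a.isP 0).trans (Rearr.node (Rearr.node (.refl _) (.refl _)) (Rearr.toggle _))
  · exact (key false a.isP 0).trans (Rearr.node (Rearr.node (.refl _) (.refl _)) (Rearr.toggle _))

theorem nodup_fill_of_rearr {C : List (Fr V)} {t t' : RTree V} (h : Rearr t t')
    (hn : (fill C t).addrs.Nodup) : (fill C t').addrs.Nodup :=
  (h.fill C).addrs.nodup_iff.1 hn

theorem wf_mk_congr {O : Set V} {x fl k σ} {p q q' : RTree V} (hv : q'.verts = q.verts)
    (hw : ∀ O, q'.WF O ↔ q.WF O) (hm : ∀ O τ v, q'.Most O τ v ↔ q.Most O τ v) :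
    (RTree.mk x fl k σ p q').WF O ↔ (RTree.mk x fl k σ p q).WF O := by
  simp only [wf_mk, hv, hw, hm]

/-- Rotating in memory preserves all invariants. -/
theorem rotateUp_ok {s : Mem V} {O : Set V} {C : List (Fr V)} {y z ky kz : ℕ}
    {σ σ' fy fz : Bool} {b a x : RTree V}
    (h : Ok s O (fill C (RTree.mk z fz kz σ b (RTree.mk y fy ky σ' a x))))
    (pre : RotPre σ (σ' ^^ fy) ky kz x) :
    ∃ s' fz' fy' k' cb ca cx, (rotateUp x.addr).run s = some ((), s') ∧ s'.time ≤ s.time + 120 ∧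
      s.Same s' (RTree.mk z fz kz σ b (RTree.mk y fy ky σ' a x)).addrs ∧
      Rearr (RTree.mk z fz kz σ b (RTree.mk y fy ky σ' a x))
        (RTree.mk z fz' kz (σ ^^ fz) (RTree.mk y fy' k' (σ ^^ fz) (b.togIf cb) (a.togIf ca))
          (x.togIf cx)) ∧
      Ok s' O (fill C (RTree.mk z fz' kz (σ ^^ fz)
        (RTree.mk y fy' k' (σ ^^ fz) (b.togIf cb) (a.togIf ca)) (x.togIf cx))) ∧
      ((σ' ^^ fy) = σ → ky = 2 → fz' = false ∧ fy' = false) := by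
  obtain ⟨s', r, ht, S, H⟩ := rotateUp_spec h.holds h.nodup
  have hW := h.wf
  set Z := RTree.mk z fz kz σ b (RTree.mk y fy ky σ' a x) with hZ
  set N := RTree.mk z false kz (σ ^^ fz) (b.togIf fz)
    (RTree.mk y false ky (σ' ^^ (fy ^^ fz)) (a.togIf (fy ^^ fz)) (x.togIf (fy ^^ fz))) with hN
  have hpush : ∀ O : Set V, (RTree.mk y false ky (σ' ^^ (fy ^^ fz)) (a.togIf (fy ^^ fz))
      (x.togIf (fy ^^ fz))).WF O ↔ (RTree.mk y (fy ^^ fz) ky σ' a x).WF O := fun O => wf_push ..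
  have hNZ : ∀ O : Set V, N.WF O ↔ Z.WF O := by
    intro O
    rw [hZ, ← wf_push O z fz, togIf_mk, hN]
    exact wf_mk_congr (by simp) hpush fun _ _ _ => most_push ..
  have hMost : ∀ ρ v, N.Most (oC O C) ρ v ↔ Z.Most (oC O C) ρ v := by
    intro ρ v
    rw [hZ, ← most_push (oC O C) ρ z fz, togIf_mk, hN, most_mk, most_mk]
    simp only [mk_verts, togIf_verts]
  have hZW := hW.of_fill
  have hNW := (hNZ _).2 hZW
  have pre' : RotPre (σ ^^ fz) (σ' ^^ (fy ^^ fz)) ky kz (x.togIf (fy ^^ fz)) := by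
    unfold RotPre at pre ⊢
    rw [togIf_count]
    have : (σ' ^^ (fy ^^ fz)) = (σ ^^ fz) ↔ (σ' ^^ fy) = σ := by
      cases σ <;> cases σ' <;> cases fy <;> cases fz <;> simp
    simp only [ne_eq, this] at pre ⊢
    exact pre
  have hrot := rotate_ok hNW pre' (headZero C)
  set gm := midCount kz (b.togIf fz) (RTree.mk y false ky (σ' ^^ (fy ^^ fz))
    (a.togIf (fy ^^ fz)) (x.togIf (fy ^^ fz)))
  have hR1 : Rearr Z (rotRes (headZero C) (σ ^^ fz) (σ' ^^ (fy ^^ fz)) y z kz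
      (b.togIf fz) (a.togIf (fy ^^ fz)) (x.togIf (fy ^^ fz)) gm) := by
    refine Rearr.trans (t' := N) ?_ (rearr_rotRes ..)
    have e1 : Rearr Z (RTree.mk z false kz (σ ^^ fz) b (RTree.mk y fy ky σ' a x)) := by
      refine ⟨?_, ?_, by simp [hZ]⟩
      · exact (mk_leaves ..).trans (mk_leaves ..).symm
      · exact (mk_inner ..).trans (mk_inner ..).symm
    refine e1.trans (Rearr.node (Rearr.togIf _ _) ?_)
    have e2 : Rearr (RTree.mk y fy ky σ' a x) (RTree.mk y false ky (σ' ^^ (fy ^^ fz)) a x) := by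
      refine ⟨?_, ?_, by simp⟩
      · exact (mk_leaves ..).trans (mk_leaves ..).symm
      · exact (mk_inner ..).trans (mk_inner ..).symm
    exact e2.trans (Rearr.node (Rearr.togIf _ _) (Rearr.togIf _ _))
  have hfin : (fill C (rotRes (headZero C) (σ ^^ fz) (σ' ^^ (fy ^^ fz)) y z kz
      (b.togIf fz) (a.togIf (fy ^^ fz)) (x.togIf (fy ^^ fz)) gm)).WF O :=
    hW.replace hR1.verts hrot.wf fun ρ hρ v hv => hrot.most ρ hρ v ((hMost ρ v).2 hv)
  have hok : Ok s' O _ := ⟨H, nodup_fill_of_rearr hR1 h.nodup, hfin⟩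
  have hgp : (σ' ^^ fy) = σ → ky = 2 → a.isP = true → gm = true → kz = 2 := by
    intro hs hk hap hg
    obtain ⟨cy, cz, hr⟩ := exists_rotHyp hNW
    have hcz := hr.mid.1 hg
    obtain ⟨d, h1, h2, h3⟩ := hr.hy.exists_ne (by simpa using hk) cz
    rw [mk_verts] at h1
    have hdb : d ∉ (b.togIf fz).verts := fun hb => h3 (hr.cz_uniq d hb h1)
    have := hr.hz.two_of_ne (p := cz) (q := d) ⟨?_, hcz⟩ ⟨?_, h2.resolve_right hdb⟩ h3.symm
    · simpa using this
    · rw [mk_verts]; exact Or.inl hr.cz_mem.1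
    · rw [mk_verts, mk_verts]; exact Or.inr h1
  clear_value gm
  clear hrot hfin
  have hss : (σ' ^^ (fy ^^ fz)) = (σ ^^ fz) ↔ (σ' ^^ fy) = σ := by
    cases σ <;> cases σ' <;> cases fy <;> cases fz <;> simp
  unfold rotRes at hok hR1
  simp only [hss, togIf_isP, ← togIf_mk true, togIf_togIf,
    show ∀ t : RTree V, t.toggle = t.togIf true from fun _ => rfl] at hok hR1
  by_cases hs : (σ' ^^ fy) = σ
  · simp only [hs, if_true] at hok hR1
    cases hap : a.isP
    · simp only [hap, Bool.false_eq_true, if_false] at hok hR1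
      exact ⟨s', _, _, _, _, _, _, r, ht, S, hR1, hok, fun _ _ => ⟨rfl, rfl⟩⟩
    · simp only [hap, if_true] at hok hR1
      refine ⟨s', _, _, _, _, _, _, r, ht, S, hR1, hok, fun _ hk => ⟨?_, rfl⟩⟩
      have := hgp hs hk hap
      cases gm
      · rfl
      · simp [this rfl]
  · simp only [hs, if_false] at hok hR1
    exact ⟨s', _, _, _, _, _, _, r, ht, S, hR1, hok, fun h => (hs h).elim⟩

end TopTreeProg

namespace TopTreeProg
open RTree
variable {V : Type}

/-! ### The splay steps -/

/-- The conditions of the two kinds of rotations in `semiSplayStep`, in terms of which of the node,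
its parent, grandparent and great-grandparent are path clusters. -/
def redex (b0 b1 b2 b3 : Bool) : Bool := (!b0 && !b2) || (b1 && (b2 || !b3))

/-- The number of levels that `semiSplayStep` walks up. -/
def walk : List Bool → ℕ
  | b0 :: b1 :: b2 :: b3 :: l =>
    if redex b0 b1 b2 b3 then 0 else walk (b1 :: b2 :: b3 :: l) + 1
  | _ => 0

/-- There is nothing to do on the path. -/
def irred : List Bool → Bool
  | b0 :: b1 :: b2 :: b3 :: l => !redex b0 b1 b2 b3 && irred (b1 :: b2 :: b3 :: l)
  | [b0, _, b2] => b0 || b2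
  | _ => true

theorem walk_le_length (l : List Bool) : walk l ≤ l.length - 3 := by
  induction l with
  | nil => simp [walk]
  | cons b0 l ih =>
    rcases l with - | ⟨b1, - | ⟨b2, - | ⟨b3, l⟩⟩⟩
    · simp [walk]
    · simp [walk]
    · simp [walk]
    · simp only [walk, List.length_cons] at ih ⊢
      split_ifs <;> omega

theorem walk_le (l : List Bool) : walk l ≤ 4 := by
  have h := walk_le_length l
  rcases l with - | ⟨b0, - | ⟨b1, - | ⟨b2, - | ⟨b3, - | ⟨b4, - | ⟨b5, - | ⟨b6, - | ⟨b7, l⟩⟩⟩⟩⟩⟩⟩⟩ <;>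
    simp only [List.length_cons, List.length_nil] at h <;> try omega
  clear h
  have key : ∀ b0 b1 b2 b3 b4 b5 b6 b7 : Bool, redex b0 b1 b2 b3 = true ∨
      redex b1 b2 b3 b4 = true ∨ redex b2 b3 b4 b5 = true ∨ redex b3 b4 b5 b6 = true ∨
      redex b4 b5 b6 b7 = true := by decide
  have := key b0 b1 b2 b3 b4 b5 b6 b7
  simp only [walk]
  split_ifs <;> simp_all

/-- Which of the nodes on the path from `t` to the root are path clusters. -/
def types (C : List (Fr V)) (t : RTree V) : List Bool := t.isP :: C.map fun f => f.k == 2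

theorem types_cons (f : Fr V) (C : List (Fr V)) (t : RTree V) :
    types (f :: C) t = t.isP :: types C (Fr.fill f t) := by
  simp [types]

/-- A subtree with context `C₁` in the tree at the address returned by the step, which has context
`C₂`, has been moved up. -/
structure StepOk (s s' : Mem V) (O : Set V) (C₁ C₂ : List (Fr V)) (t : RTree V)
    (C₁' : List (Fr V)) (t' : RTree V) : Prop where
  same : s.Same s' (fill C₁ t).addrs
  ok : Ok s' O (fill (C₁' ++ C₂) t')
  tog : t' = t ∨ t' = t.toggle
  rearr : Rearr (fill C₁ t) (fill C₁' t')
  len : C₁'.length + 1 = C₁.length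
  pos : 1 ≤ C₁'.length
  pot1 : (fill C₁' t').pot - pathPot C₁' t.size ≤
    (fill C₁ t).pot - pathPot C₁ t.size + rk (fill C₁ t).size
  pot2 : (fill C₁' t').pot ≤ (fill C₁ t).pot + 2 * (rk (fill C₁ t).size - rk t.size) - 2

theorem StepOk.walk {s s' : Mem V} {O : Set V} {C₁ C₂ : List (Fr V)} {f : Fr V} {t : RTree V}
    {C₁' : List (Fr V)} {t' : RTree V} (h : StepOk s s' O C₁ C₂ (Fr.fill f t) C₁' t') :
    ∃ f', StepOk s s' O (f :: C₁) C₂ t (f' :: C₁') t := by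
  have key : ∀ f' : Fr V, t' = Fr.fill f' t → f'.sib = f.sib →
      StepOk s s' O (f :: C₁) C₂ t (f' :: C₁') t := by
    rintro f' rfl hs
    have hp : (Fr.fill f' t).pot = (Fr.fill f t).pot := by
      rw [Fr.fill, Fr.fill, mk_pot, mk_pot, hs]
    have h1 := h.pot1
    have h2 := h.pot2
    have h3 := rk_mono (size_pos t) (show t.size ≤ (Fr.fill f t).size by simp)
    refine ⟨h.same, h.ok, Or.inl rfl, h.rearr, by simp [h.len], by simp, ?_, ?_⟩
    · simp only [fill_cons, pathPot, Fr.fill_size, hs] at h1 ⊢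
      linarith
    · simp only [fill_cons] at h2 ⊢
      linarith
  rcases h.tog with e | e
  · exact ⟨f, key f e rfl⟩
  · exact ⟨{ f with fl := !f.fl }, key _ (by rw [e, Fr.fill, mk_toggle]; rfl) rfl⟩

theorem StepOk.of_same {s₀ s s' : Mem V} {O : Set V} {C₁ C₂ : List (Fr V)} {t : RTree V}
    {C₁' : List (Fr V)} {t' : RTree V} (h : StepOk s s' O C₁ C₂ t C₁' t')
    (h0 : s₀.Same s (fill C₁ t).addrs) : StepOk s₀ s' O C₁ C₂ t C₁' t' :=
  { h with same := h0.trans h.same fun _ h => h }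

/-- Rotating a node up as a step. -/
theorem rotateUp_step {s : Mem V} {O : Set V} {f₁ f₂ : Fr V} {C : List (Fr V)} {t : RTree V}
    (h : Ok s O (fill (f₁ :: f₂ :: C) t))
    (pre : RotPre f₂.zero (f₁.zero ^^ f₁.fl) f₁.k f₂.k t) :
    ∃ s' C₁' t', (rotateUp t.addr).run s = some ((), s') ∧ s'.time ≤ s.time + 120 ∧
      StepOk s s' O [f₁, f₂] C t C₁' t' := by
  have e : ∀ t, fill [f₁, f₂] t = RTree.mk f₂.addr f₂.fl f₂.k (!f₂.zero) f₂.sib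
      (RTree.mk f₁.addr f₁.fl f₁.k (!f₁.zero) f₁.sib t) := by
    intro t
    rw [mk_swap, mk_swap]; rfl
  have h' := h
  rw [show f₁ :: f₂ :: C = [f₁, f₂] ++ C from rfl, fill_append, e] at h'
  have pre' : RotPre (!f₂.zero) (!f₁.zero ^^ f₁.fl) f₁.k f₂.k t := by
    unfold RotPre at pre ⊢
    have : (!f₁.zero ^^ f₁.fl) = (!f₂.zero) ↔ (f₁.zero ^^ f₁.fl) = f₂.zero := by
      cases f₁.zero <;> cases f₂.zero <;> cases f₁.fl <;> simp
    simp only [ne_eq, this] at pre ⊢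
    exact pre
  obtain ⟨s', fz', fy', k', cb, ca, cx, r, ht, S, hR, hok, -⟩ := rotateUp_ok h' pre'
  let g : Fr V := ⟨f₂.addr, fz', f₂.k, !(!f₂.zero ^^ f₂.fl), RTree.mk f₁.addr fy' k'
    (!f₂.zero ^^ f₂.fl) (f₂.sib.togIf cb) (f₁.sib.togIf ca)⟩
  have eg : ∀ t, fill [g] t = RTree.mk f₂.addr fz' f₂.k (!f₂.zero ^^ f₂.fl) (RTree.mk f₁.addr fy' k'
    (!f₂.zero ^^ f₂.fl) (f₂.sib.togIf cb) (f₁.sib.togIf ca)) t := by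
    intro t
    simp only [fill_cons, fill_nil, Fr.fill, g]
    rw [mk_swap]
  have hsz : g.sib.size = f₂.sib.size + f₁.sib.size := by simp [g]
  have hpot : g.sib.pot = rk (f₂.sib.size + f₁.sib.size) + (f₂.sib.pot + f₁.sib.pot) := by
    simp [g, mk_pot]
  have hpos := size_pos t
  have hpos1 := size_pos f₁.sib
  have hpos2 := size_pos f₂.sib
  refine ⟨s', [g], t.togIf cx, r, ht, ⟨?_, ?_, togIf_cases _ _, ?_, rfl, le_rfl, ?_, ?_⟩⟩
  · rw [e]; exact S
  · rw [fill_append, eg]; exact hok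
  · rw [e, eg]; exact hR
  · rw [fill_pot, fill_pot, fill_size]
    simp only [togIf_pot, togIf_size, sibPot, pathPot, csize, hpot, hsz]
    have : rk (f₂.sib.size + f₁.sib.size) ≤ rk (t.size + (f₁.sib.size + (f₂.sib.size + 0))) :=
      rk_mono (by omega) (by omega)
    linarith
  · rw [fill_pot, fill_pot, fill_size]
    simp only [togIf_pot, togIf_size, sibPot, pathPot, csize, hpot, hsz]
    have h1 := rk_add_rk hpos (show 0 < f₂.sib.size + f₁.sib.size by omega)
    have h2 : rk t.size ≤ rk (t.size + f₁.sib.size) := rk_mono hpos (by omega)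
    rw [show t.size + (f₁.sib.size + (f₂.sib.size + 0)) = t.size + (f₂.sib.size + f₁.sib.size) by
      omega, show t.size + f₁.sib.size + f₂.sib.size = t.size + (f₂.sib.size + f₁.sib.size) by
      omega]
    linarith

/-- The frame after toggling the flip bit of its node if `c` is set. -/
def _root_.RTree.Fr.tog (f : Fr V) (c : Bool) : Fr V := { f with fl := f.fl ^^ c }

/-- The frame after pushing down the flip bit of its node. -/
def _root_.RTree.Fr.push (f : Fr V) : Fr V :=
  ⟨f.addr, false, f.k, f.zero ^^ f.fl, f.sib.togIf f.fl⟩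

theorem fill_togIf (f : Fr V) (t : RTree V) (c : Bool) :
    (Fr.fill f t).togIf c = Fr.fill (f.tog c) t := by
  rw [Fr.fill, togIf_mk]; rfl

theorem fill_node {h : ℕ → Option (NodeRec V)} {C : List (Fr V)} {t : RTree V}
    (H : Holds h none (fill C t)) : h t.addr = some (t.rcd (par C)) :=
  ((holds_iff ..).1 ((holds_fill ..).1 H).1).1

theorem fr_rcd (f : Fr V) (t : RTree V) (p : Option ℕ) :
    (Fr.fill f t).rcd p = ⟨p, .internal (if f.zero then t.addr else f.sib.addr)
      (if f.zero then f.sib.addr else t.addr), f.k, f.fl⟩ := by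
  rw [rcd, Fr.fill, mk_body, mk_count, mk_flip]

theorem fill_ne {f : Fr V} {C : List (Fr V)} {t : RTree V}
    (hn : (fill (f :: C) t).addrs.Nodup) : t.addr ≠ f.sib.addr ∧ t.addr ≠ f.addr := by
  have := (List.nodup_append.1 ((fill_addrs (f :: C) t).nodup_iff.1 hn)).2.2 _ (addr_mem t)
  exact ⟨this _ (by simp [caddrs, addr_mem]), this _ (by simp [caddrs])⟩

theorem isChildZero_fill {s : Mem V} {f : Fr V} {C : List (Fr V)} {t : RTree V}
    (H : Holds s.node none (fill (f :: C) t)) (hn : (fill (f :: C) t).addrs.Nodup) (n : ℕ) :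
    (isChildZero f.addr t.addr).run (s.adv n) = some (f.zero, s.adv (n + 1)) := by
  have h1 := fill_node (C := C) (t := Fr.fill f t) H
  rw [fr_rcd, Fr.fill_addr] at h1
  have h2 := (fill_ne hn).1
  have := run_isChildZero (s := s.adv n) (y := t.addr) h1
  rw [this, Mem.adv_adv]
  cases f.zero <;> simp [h2.symm]

theorem Ok.reads {s : Mem V} {O : Set V} {t : RTree V} (h : Ok s O t) (n : ℕ) :
    Ok (s.adv n) O t := ⟨h.1, h.2, h.3⟩

/-- Pushing down two flip bits. -/
theorem push_ok {s : Mem V} {O : Set V} {f₁ f₂ : Fr V} {C : List (Fr V)} {t : RTree V}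
    (h : Ok s O (fill (f₁ :: f₂ :: C) t)) :
    ∃ s', (do pushFlip f₂.addr; pushFlip f₁.addr : Prog V Unit).run s = some ((), s') ∧
      s'.time ≤ s.time + 40 ∧ s.Same s' (fill [f₁, f₂] t).addrs ∧
      Ok s' O (fill ((f₁.tog f₂.fl).push :: f₂.push :: C) (t.togIf (f₁.fl ^^ f₂.fl))) := by
  have e : ∀ t, fill [f₁, f₂] t = RTree.mk f₂.addr f₂.fl f₂.k (!f₂.zero) f₂.sib
      (RTree.mk f₁.addr f₁.fl f₁.k (!f₁.zero) f₁.sib t) := by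
    intro t
    rw [mk_swap, mk_swap]; rfl
  have e' : fill [(f₁.tog f₂.fl).push, f₂.push] (t.togIf (f₁.fl ^^ f₂.fl)) =
      RTree.mk f₂.addr false f₂.k (!f₂.zero ^^ f₂.fl) (f₂.sib.togIf f₂.fl)
      (RTree.mk f₁.addr false f₁.k (!f₁.zero ^^ (f₁.fl ^^ f₂.fl)) (f₁.sib.togIf (f₁.fl ^^ f₂.fl))
        (t.togIf (f₁.fl ^^ f₂.fl))) := by
    rw [Bool.not_xor, Bool.not_xor, mk_swap, mk_swap]; rfl
  have h' := h
  rw [show f₁ :: f₂ :: C = [f₁, f₂] ++ C from rfl, fill_append, e] at h'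
  obtain ⟨s', r, ht, S, H, N⟩ := push_two h'.holds h'.nodup
  refine ⟨s', r, ht, e t ▸ S, ?_⟩
  rw [show (f₁.tog f₂.fl).push :: f₂.push :: C = [(f₁.tog f₂.fl).push, f₂.push] ++ C from rfl,
    fill_append, e']
  refine ⟨H, N, h'.wf.replace (by simp) ?_ fun ρ _ v hv => ?_⟩
  · have := h'.wf.of_fill
    rw [← wf_push, togIf_mk] at this
    exact (wf_mk_congr (by simp) (fun O => wf_push ..) fun _ _ _ => most_push ..).2 this
  · rw [← most_push] at hv
    rw [most_mk] at hv ⊢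
    simpa only [mk_verts, togIf_verts] using hv

theorem StepOk.transport {s₀ s s' : Mem V} {O : Set V} {C₁ D₁ C₂ : List (Fr V)} {t : RTree V}
    {c : Bool} {C₁' : List (Fr V)} {t' : RTree V} (h : StepOk s s' O D₁ C₂ (t.togIf c) C₁' t')
    (hR : Rearr (fill C₁ t) (fill D₁ (t.togIf c)))
    (hs : D₁.map (fun f => f.sib.size) = C₁.map (fun f => f.sib.size))
    (hp : sibPot D₁ = sibPot C₁) (S : s₀.Same s (fill C₁ t).addrs) :
    StepOk s₀ s' O C₁ C₂ t C₁' t' := by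
  have hpp : ∀ n, pathPot D₁ n = pathPot C₁ n := by
    clear h hR hp S
    induction D₁ generalizing C₁ with
    | nil => cases C₁ with
      | nil => simp
      | cons => simp at hs
    | cons f D ih => cases C₁ with
      | nil => simp at hs
      | cons g C =>
        simp only [List.map_cons, List.cons.injEq] at hs
        intro n
        rw [pathPot, pathPot, hs.1, ih hs.2]
  have hl : D₁.length = C₁.length := by simpa using congrArg List.length hs
  have h1 := h.pot1
  have h2 := h.pot2
  rw [fill_pot, fill_pot, togIf_pot, togIf_size, hpp, hp, hR.size] at h1
  rw [fill_pot, fill_pot, togIf_pot, togIf_size, hpp, hp, hR.size] at h2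
  refine ⟨S.trans h.same fun n hn => (hR.addrs.mem_iff).2 hn, h.ok, ?_, hR.trans h.rearr,
    hl ▸ h.len, h.pos, ?_, ?_⟩
  · rcases h.tog with e | e <;> rw [e] <;> cases c <;> simp [togIf]
  · rw [fill_pot, fill_pot]; exact h1
  · rw [fill_pot, fill_pot]; exact h2

theorem rearr_push (f : Fr V) (t u : RTree V) (h : Rearr t u) :
    Rearr (Fr.fill f t) (Fr.fill f.push u) := by
  refine ⟨?_, ?_, by simp [Fr.push]⟩
  · refine (mk_leaves ..).trans (List.Perm.trans ?_ (mk_leaves ..).symm)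
    exact h.leaves.append (Rearr.togIf _ _).leaves
  · refine (mk_inner ..).trans (List.Perm.trans ?_ (mk_inner ..).symm)
    exact (h.inner.append (Rearr.togIf _ _).inner).cons _

theorem StepOk.of_push {s₀ s s' : Mem V} {O : Set V} {f₁ f₂ : Fr V} {D C : List (Fr V)}
    {t : RTree V} {c : Bool} {C₁' : List (Fr V)} {t' : RTree V} {d e : Bool}
    (h : StepOk s s' O ((f₁.tog d).push :: (f₂.tog e).push :: D) C (t.togIf c) C₁' t')
    (S : s₀.Same s (fill [f₁, f₂] t).addrs) : StepOk s₀ s' O (f₁ :: f₂ :: D) C t C₁' t' := by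
  refine h.transport ?_ (by simp [Fr.push, Fr.tog]) (by simp [Fr.push, Fr.tog, sibPot])
    (S.mono fun n hn => ?_)
  · have : ∀ (f : Fr V) (d) (t u : RTree V), Rearr t u →
        Rearr (Fr.fill f t) (Fr.fill (f.tog d).push u) := fun f d t u h =>
      (rearr_push f t u h).trans (⟨(mk_leaves ..).trans (List.Perm.trans ((List.Perm.refl _).append
        ((Rearr.togIf _ _).leaves.symm.trans (Rearr.togIf _ _).leaves)) (mk_leaves ..).symm),
        (mk_inner ..).trans (List.Perm.trans (((List.Perm.refl _).append
        ((Rearr.togIf _ _).inner.symm.trans (Rearr.togIf _ _).inner)).cons _) (mk_inner ..).symm),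
        by simp [Fr.push, Fr.tog]⟩)
    exact (this _ _ _ _ (this _ _ _ _ (Rearr.togIf _ _))).fill D
  · exact (fill_addrs D _).mem_iff.2 (List.mem_append_left _ hn)

/-- The double rotation. -/
theorem double_step {s : Mem V} {O : Set V} {f₁ f₂ f₃ : Fr V} {C : List (Fr V)} {t : RTree V}
    (h : Ok s O (fill (f₁ :: f₂ :: f₃ :: C) t)) (e₁ : f₁.fl = false) (e₂ : f₂.fl = false)
    (h₁₂ : f₁.zero = !f₂.zero) (h₂₃ : f₂.zero = !f₃.zero) (hy : f₁.k = 2)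
    (hz : f₂.k = 2 ∨ f₃.k ≠ 2) :
    ∃ s' C₁' t', (do rotateUp (← sibling t.addr); rotateUp f₁.addr : Prog V Unit).run s =
        some ((), s') ∧ s'.time ≤ s.time + 250 ∧ StepOk s s' O [f₁, f₂, f₃] C t C₁' t' := by
  have eA : fill [f₁, f₂] t = RTree.mk f₂.addr f₂.fl f₂.k (!f₂.zero) f₂.sib
      (RTree.mk f₁.addr f₁.fl f₁.k f₁.zero t f₁.sib) := by
    rw [mk_swap]; rfl
  have h' := h
  rw [show f₁ :: f₂ :: f₃ :: C = [f₁, f₂] ++ (f₃ :: C) from rfl, fill_append, eA] at h'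
  have hsib : (sibling t.addr).run s = some (f₁.sib.addr, s.adv 2) := by
    have h1 := fill_node h.holds
    have h2 := fill_node (C := f₂ :: f₃ :: C) (t := Fr.fill f₁ t) h.holds
    rw [fr_rcd, Fr.fill_addr] at h2
    have h3 := (fill_ne h.nodup).1
    rw [run_sibling h1 h2]
    cases f₁.zero <;> simp [h3.symm]
  obtain ⟨s1, fz1, fy1, k1, cb, ca, cx, r1, ht1, S1, R1, ok1, hfl⟩ := rotateUp_ok (h'.reads 2)
    (Or.inl ⟨by rw [e₁, h₁₂, Bool.xor_false], Or.inl hy⟩)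
  obtain ⟨rfl, rfl⟩ := hfl (by rw [e₁, h₁₂, Bool.xor_false]) hy
  simp only [e₂, Bool.xor_false] at S1 R1 ok1
  set Y := RTree.mk f₁.addr false k1 (!f₂.zero) (f₂.sib.togIf cb) (t.togIf ca) with hY
  set A := f₁.sib.togIf cx with hA
  have eB : ∀ R, Fr.fill f₃ R = RTree.mk f₃.addr f₃.fl f₃.k (!f₃.zero) f₃.sib R := by
    intro R; rw [mk_swap]; rfl
  have ok1' := ok1
  rw [mk_swap, fill_cons, eB] at ok1'
  obtain ⟨s2, fz2, fy2, k2, cb2, ca2, cx2, r2, ht2, S2, R2, ok2, -⟩ := rotateUp_ok ok1'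
    (Or.inl ⟨by rw [h₂₃, Bool.xor_false], hz⟩)
  let g₁ : Fr V := ⟨f₁.addr, cx2, k1, f₂.zero, f₂.sib.togIf cb⟩
  let g₂ : Fr V := ⟨f₃.addr, fz2, f₃.k, !(!f₃.zero ^^ f₃.fl), RTree.mk f₂.addr fy2 k2
    (!f₃.zero ^^ f₃.fl) (f₃.sib.togIf cb2) (A.togIf ca2)⟩
  have eg : fill [g₁, g₂] (t.togIf ca) = RTree.mk f₃.addr fz2 f₃.k (!f₃.zero ^^ f₃.fl)
      (RTree.mk f₂.addr fy2 k2 (!f₃.zero ^^ f₃.fl) (f₃.sib.togIf cb2) (A.togIf ca2))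
      (Y.togIf cx2) := by
    simp only [fill_cons, fill_nil, Fr.fill, g₁, g₂]
    rw [hY, togIf_mk, Bool.false_xor, mk_swap, mk_swap]
  have hRR : Rearr (fill [f₁, f₂, f₃] t) (fill [g₁, g₂] (t.togIf ca)) := by
    rw [eg]
    refine Rearr.trans ?_ R2
    rw [← eB, ← mk_swap, show [f₁, f₂, f₃] = [f₁, f₂] ++ [f₃] from rfl, fill_append, eA, e₂]
    exact R1.fill [f₃]
  have hsz : g₂.sib.size = f₃.sib.size + f₁.sib.size := by simp [g₂, hA]
  have hpot : g₂.sib.pot = rk (f₃.sib.size + f₁.sib.size) + (f₃.sib.pot + f₁.sib.pot) := by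
    simp [g₂, hA, mk_pot]
  have hp0 := size_pos t
  have hp1 := size_pos f₁.sib
  have hp2 := size_pos f₂.sib
  have hp3 := size_pos f₃.sib
  have hg : g₁.sib.size = f₂.sib.size := by simp [g₁]
  have hgp : g₁.sib.pot = f₂.sib.pot := by simp [g₁]
  refine ⟨s2, [g₁, g₂], t.togIf ca, ?_, ?_, ⟨?_, ?_, togIf_cases _ _, hRR, rfl, by simp, ?_, ?_⟩⟩
  · simp only [run_bind, hsib, Option.bind_some]
    rw [r1]
    simpa [hY] using r2
  · simp only [Mem.adv_time] at ht1; omega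
  · refine ((Mem.Same.adv s 2 _).trans (S1.mono fun n hn => ?_) fun _ h => h).trans S2
      fun n hn => ?_
    · rw [← e₂, ← eA] at hn
      exact (fill_addrs [f₃] _).mem_iff.2 (List.mem_append_left _ hn)
    · rw [hRR.addrs.mem_iff, eg, ← R2.addrs.mem_iff]
      exact hn
  · rw [fill_append, eg]; exact ok2
  · rw [fill_pot, fill_pot, fill_size]
    simp only [togIf_pot, togIf_size, sibPot, pathPot, csize, hpot, hsz, hg, hgp]
    have : rk (f₃.sib.size + f₁.sib.size) ≤
      rk (t.size + (f₁.sib.size + (f₂.sib.size + (f₃.sib.size + 0)))) := rk_mono (by omega) (by omega)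
    linarith
  · rw [fill_pot, fill_pot, fill_size]
    simp only [togIf_pot, togIf_size, sibPot, pathPot, csize, hpot, hsz, hg, hgp]
    have h1 := rk_add_rk (show 0 < t.size + f₂.sib.size by omega)
      (show 0 < f₃.sib.size + f₁.sib.size by omega)
    have h2 : rk t.size ≤ rk (t.size + f₁.sib.size) := rk_mono hp0 (by omega)
    have h3 : rk t.size ≤ rk (t.size + f₁.sib.size + f₂.sib.size) := rk_mono hp0 (by omega)
    rw [show t.size + (f₁.sib.size + (f₂.sib.size + (f₃.sib.size + 0))) =
        t.size + f₂.sib.size + (f₃.sib.size + f₁.sib.size) by omega,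
      show t.size + f₁.sib.size + f₂.sib.size + f₃.sib.size =
        t.size + f₂.sib.size + (f₃.sib.size + f₁.sib.size) by omega]
    linarith

end TopTreeProg

namespace TopTreeProg
open RTree
variable {V : Type}

/-- The outcome of `semiSplayStep` on the node `t` with context `C`. -/
def StepSpec (s : Mem V) (O : Set V) (C : List (Fr V)) (t : RTree V) : Prop :=
  (∃ n, (semiSplayStep t.addr).run s = some (none, s.adv n) ∧ n ≤ 10 * (walk (types C t) + 1) ∧
    C.length ≤ walk (types C t) + 2 ∧ irred (types C t) = true) ∨
  ∃ s' C₁ C₂ C₁' t', (semiSplayStep t.addr).run s = some (some (fill C₁ t).addr, s') ∧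
    s'.time ≤ s.time + 400 + 10 * walk (types C t) ∧ C = C₁ ++ C₂ ∧
    C₁.length ≤ walk (types C t) + 3 ∧ StepOk s s' O C₁ C₂ t C₁' t'

theorem semiSplayStep_rotate {s : Mem V} {O : Set V} {f₁ f₂ f₃ : Fr V} {C : List (Fr V)}
    {t : RTree V} (h : Ok s O (fill (f₁ :: f₂ :: f₃ :: C) t)) (hy : f₁.k = 2)
    (hz : f₂.k = 2 ∨ f₃.k ≠ 2) :
    ∃ s' C₁ C₂ C₁' t', (do
      pushFlip f₂.addr
      pushFlip f₁.addr
      let nodeIsLeft ← isChildZero f₁.addr t.addr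
      let parentIsLeft ← isChildZero f₂.addr f₁.addr
      let gparentIsLeft ← isChildZero f₃.addr f₂.addr
      if nodeIsLeft == parentIsLeft then
        rotateUp t.addr
        return some f₂.addr
      else if parentIsLeft == gparentIsLeft then
        rotateUp f₁.addr
        return some f₃.addr
      else
        rotateUp (← sibling t.addr)
        rotateUp f₁.addr
        return some f₃.addr : Prog V (Option ℕ)).run s = some (some (fill C₁ t).addr, s') ∧
      s'.time ≤ s.time + 300 ∧ f₁ :: f₂ :: f₃ :: C = C₁ ++ C₂ ∧ C₁.length ≤ 3 ∧
      StepOk s s' O C₁ C₂ t C₁' t' := by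
  obtain ⟨s0, r0, ht0, S0, h0⟩ := push_ok h
  set c := f₁.fl ^^ f₂.fl with hc
  set g₁ := (f₁.tog f₂.fl).push with hg₁
  set g₂ := f₂.push with hg₂
  set u := t.togIf c with hu
  have i1 := isChildZero_fill h0.holds h0.nodup 0
  have i2 := isChildZero_fill (f := g₂) (C := f₃ :: C) (t := Fr.fill g₁ u) h0.holds h0.nodup 1
  have i3 := isChildZero_fill (f := f₃) (C := C) (t := Fr.fill g₂ (Fr.fill g₁ u)) h0.holds
    h0.nodup 2
  have a1 : g₁.addr = f₁.addr := rfl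
  have a2 : g₂.addr = f₂.addr := rfl
  have a0 : u.addr = t.addr := by simp [hu]
  simp only [Fr.fill_addr, a1, a2, a0] at i1 i2 i3
  have h3 : Ok (s0.adv 3) O (fill (g₁ :: g₂ :: f₃ :: C) u) := h0.reads 3
  have S3 : s.Same (s0.adv 3) (fill [f₁, f₂] t).addrs :=
    S0.trans (Mem.Same.adv _ _ _) fun _ h => h
  have e : ∀ (F : Prog V (Option ℕ)),
      (do pushFlip f₂.addr; pushFlip f₁.addr; F : Prog V (Option ℕ)).run s = F.run s0 := by
    intro F
    have : (do pushFlip f₂.addr; pushFlip f₁.addr; F : Prog V (Option ℕ)) =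
      (do (do pushFlip f₂.addr; pushFlip f₁.addr : Prog V Unit); F) := by
      simp only [bind_assoc]
    rw [this, run_bind, r0]; rfl
  have e2 : f₂.tog false = f₂ := by simp [Fr.tog]
  rw [e]
  rw [show s0.adv 0 = s0 from rfl] at i1
  simp only [run_bind, i1, i2, i3, Option.bind_some, Nat.zero_add, Nat.reduceAdd]
  by_cases hs : g₁.zero = g₂.zero
  · obtain ⟨s', C₁', t', r, ht, st⟩ := rotateUp_step h3
      (Or.inl ⟨by rw [hs]; simp [hg₁, Fr.push], Or.inl hy⟩)
    refine ⟨s', [f₁, f₂], f₃ :: C, C₁', t', ?_, ?_, rfl, by simp, ?_⟩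
    · rw [a0] at r
      simp [hs, run_bind, r, run_pure]
    · simp only [Mem.adv_time] at ht; omega
    · refine StepOk.of_push (d := f₂.fl) (e := false) (c := c) ?_ S3
      rw [e2]; exact st
  by_cases hs' : g₂.zero = f₃.zero
  · obtain ⟨s', C₁', t', r, ht, st⟩ := rotateUp_step (t := Fr.fill g₁ u) (f₁ := g₂) (f₂ := f₃) h3
      (Or.inl ⟨by rw [hs']; simp [hg₂, Fr.push], hz⟩)
    obtain ⟨f', st'⟩ := st.walk
    refine ⟨s', [f₁, f₂, f₃], C, f' :: C₁', u, ?_, ?_, rfl, by simp, ?_⟩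
    · rw [Fr.fill_addr, a1] at r
      rw [if_neg (by simpa using hs), if_pos (by simpa using hs'), run_bind, r]
      simp [run_pure]
    · simp only [Mem.adv_time] at ht; omega
    · refine StepOk.of_push (d := f₂.fl) (e := false) (c := c) ?_ S3
      rw [e2]; exact st'
  · have n1 : g₁.zero = !g₂.zero := by revert hs; cases g₁.zero <;> cases g₂.zero <;> simp
    have n2 : g₂.zero = !f₃.zero := by revert hs'; cases g₂.zero <;> cases f₃.zero <;> simp
    obtain ⟨s', C₁', t', r, ht, st⟩ := double_step h3 rfl rfl n1 n2 hy hz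
    refine ⟨s', [f₁, f₂, f₃], C, C₁', t', ?_, ?_, rfl, by simp, ?_⟩
    · rw [a0, a1] at r
      have key : ∀ F : Prog V (Option ℕ), (do
          let x ← sibling t.addr
          rotateUp x
          rotateUp f₁.addr
          F).run (s0.adv 3) = F.run s' := by
        intro F
        have : (do
          let x ← sibling t.addr
          rotateUp x
          rotateUp f₁.addr
          F) = (do
            (do let x ← sibling t.addr
                rotateUp x
                rotateUp f₁.addr : Prog V Unit)
            F) := by simp only [bind_assoc]
        rw [this, run_bind, r]; rfl
      rw [if_neg (by simpa using hs), if_neg (by simpa using hs'), key]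
      simp [run_pure]
    · simp only [Mem.adv_time] at ht; omega
    · refine StepOk.of_push (d := f₂.fl) (e := false) (c := c) ?_ S3
      rw [e2]; exact st

theorem semiSplayStep_spec {O : Set V} (C : List (Fr V)) {s : Mem V} {t : RTree V}
    (h : Ok s O (fill C t)) : StepSpec s O C t := by
  induction C generalizing s t with
  | nil =>
    refine Or.inl ⟨1, ?_, by omega, by simp, rfl⟩
    have h1 := fill_node h.holds
    rw [semiSplayStep]
    simp [run_bind, run_getParent, h1, rcd, par, run_pure]
  | cons f₁ C ih =>
    have h1 := fill_node h.holds
    have h2 := fill_node (C := C) (t := Fr.fill f₁ t) h.holds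
    rw [fr_rcd, Fr.fill_addr] at h2
    rcases C with - | ⟨f₂, C⟩
    · refine Or.inl ⟨2, ?_, by omega, by simp, rfl⟩
      rw [semiSplayStep]
      simp [run_bind, run_getParent, h1, h2, rcd, par, run_pure]
    have h3 := fill_node (C := C) (t := Fr.fill f₂ (Fr.fill f₁ t)) h.holds
    rw [fr_rcd, Fr.fill_addr] at h3
    by_cases hp : t.isP = false ∧ (f₂.k == 2) = false
    · have hk : t.count ≠ 2 := by have := hp.1; simpa [isP] using this
      have hk2 : f₂.k ≠ 2 := by simpa using hp.2
      have pre : RotPre f₂.zero (f₁.zero ^^ f₁.fl) f₁.k f₂.k t := by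
        unfold RotPre
        by_cases e : (f₁.zero ^^ f₁.fl) = f₂.zero
        · exact Or.inl ⟨e, Or.inr hk2⟩
        · exact Or.inr ⟨e, hk, hk2⟩
      obtain ⟨s', C₁', t', r, ht, st⟩ := rotateUp_step (h.reads 4) pre
      refine Or.inr ⟨s', [f₁, f₂], C, C₁', t', ?_, ?_, rfl, by simp, ?_⟩
      · rw [semiSplayStep]
        have : (t.count == 2) = false := by simpa using hk
        simp [run_bind, run_getParent, run_isPoint, h1, h2, h3, rcd, par, run_pure, this, hp.2, r]
      · simp only [Mem.adv_time] at ht; omega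
      · exact st.of_same (Mem.Same.adv _ _ _)
    have hp' : (!t.isP && !(f₂.k == 2)) = false := by
      revert hp; cases t.isP <;> cases (f₂.k == 2) <;> simp
    have hp'' : (!(t.count == 2) && !(f₂.k == 2)) = false := hp'
    rcases C with - | ⟨f₃, C⟩
    · refine Or.inl ⟨5, ?_, by omega, by simp, ?_⟩
      · rw [semiSplayStep]
        simp only [run_bind, run_getParent, run_isPoint, h1, h2, h3, rcd, par, run_pure,
          Option.bind_some, Mem.adv_node, Mem.adv_adv, hp'', Bool.false_eq_true, if_false]
      · simp only [types, List.map, irred]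
        revert hp'; cases t.isP <;> cases (f₂.k == 2) <;> simp
    have h4 := fill_node (C := C) (t := Fr.fill f₃ (Fr.fill f₂ (Fr.fill f₁ t))) h.holds
    rw [fr_rcd, Fr.fill_addr] at h4
    have hw : walk (types (f₁ :: f₂ :: f₃ :: C) t) =
        if (f₁.k == 2 && (f₂.k == 2 || !(f₃.k == 2))) then 0
        else walk (types (f₂ :: f₃ :: C) (Fr.fill f₁ t)) + 1 := by
      simp only [types, List.map, walk, redex, hp', Bool.false_or, Fr.fill_isP]
    by_cases hr : (f₁.k == 2 && (f₂.k == 2 || !(f₃.k == 2))) = true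
    · have hr' := hr
      simp only [Bool.and_eq_true, Bool.or_eq_true, beq_iff_eq, Bool.not_eq_true',
        beq_eq_false_iff_ne] at hr'
      obtain ⟨s', C₁, C₂, C₁', t', r, ht, e, hl, st⟩ :=
        semiSplayStep_rotate (h.reads 8) hr'.1 hr'.2
      refine Or.inr ⟨s', C₁, C₂, C₁', t', ?_, ?_, e, by omega, st.of_same (Mem.Same.adv _ _ _)⟩
      · rw [semiSplayStep]
        simp only [run_bind, run_getParent, run_isPoint, run_isPath, h1, h2, h3, h4, rcd, par,
          run_pure, Option.bind_some, Mem.adv_node, Mem.adv_adv, hp'', Bool.false_eq_true,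
          if_false, Nat.reduceAdd, hr, if_true]
        simpa only [run_bind] using r
      · simp only [Mem.adv_time] at ht; omega
    · rw [Bool.not_eq_true] at hr
      rw [hr, if_neg (by simp)] at hw
      have run : (semiSplayStep t.addr).run s = (semiSplayStep f₁.addr).run (s.adv 8) := by
        conv_lhs => rw [semiSplayStep]
        simp only [run_bind, run_getParent, run_isPoint, run_isPath, h1, h2, h3, h4, rcd, par,
          run_pure, Option.bind_some, Mem.adv_node, Mem.adv_adv, hp'', Bool.false_eq_true,
          if_false, Nat.reduceAdd, hr]
      rcases ih (t := Fr.fill f₁ t) (h.reads 8) with ⟨n, r, hn, hl, hi⟩ |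
        ⟨s', C₁, C₂, C₁', t', r, ht, e, hl, st⟩
      · rw [Fr.fill_addr] at r
        refine Or.inl ⟨8 + n, ?_, by omega, by simp only [List.length_cons] at *; omega, ?_⟩
        · rw [run, r, Mem.adv_adv]
        · simp only [types, List.map, irred, redex, hp', Bool.false_or, Fr.fill_isP] at hi ⊢
          rw [hr, hi]; rfl
      · rw [Fr.fill_addr] at r
        obtain ⟨f', st'⟩ := st.walk
        refine Or.inr ⟨s', f₁ :: C₁, C₂, f' :: C₁', _, ?_, ?_, by rw [e]; rfl, ?_,
          st'.of_same (Mem.Same.adv _ _ _)⟩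
        · rw [run, r]; rfl
        · simp only [Mem.adv_time] at ht; omega
        · simp only [List.length_cons]; omega

end TopTreeProg

namespace TopTreeProg
open RTree
variable {V : Type}

theorem fill_toggle (C : List (Fr V)) (hC : 1 ≤ C.length) (t : RTree V) :
    ∃ D : List (Fr V), D.length = C.length ∧ (fill C t).toggle = fill D t ∧
      csize D = csize C ∧ ∀ n, pathPot D n = pathPot C n := by
  induction C generalizing t with
  | nil => simp at hC
  | cons f C ih =>
    rcases C with - | ⟨g, C⟩
    · exact ⟨[f.tog true], rfl, fill_togIf f t true, rfl, fun n => rfl⟩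
    · obtain ⟨D, h1, h2, h3, h4⟩ := ih (by simp) (Fr.fill f t)
      exact ⟨f :: D, by simp [h1], h2, by simp [csize, h3], fun n => by simp only [pathPot, h4]⟩

theorem fill_tog {C : List (Fr V)} (hC : 1 ≤ C.length) {t T : RTree V}
    (h : T = fill C t ∨ T = (fill C t).toggle) :
    ∃ D : List (Fr V), D.length = C.length ∧ T = fill D t ∧
      csize D = csize C ∧ ∀ n, pathPot D n = pathPot C n := by
  rcases h with h | h
  · exact ⟨C, rfl, h, rfl, fun _ => rfl⟩
  · obtain ⟨D, h1, h2, h3, h4⟩ := fill_toggle C hC t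
    exact ⟨D, h1, h.trans h2, h3, h4⟩

theorem StepOk.size {s s' : Mem V} {O : Set V} {C₁ C₂ : List (Fr V)} {t : RTree V}
    {C₁' : List (Fr V)} {t' : RTree V} (h : StepOk s s' O C₁ C₂ t C₁' t') :
    t'.size = t.size := by
  rcases h.tog with e | e <;> simp [e]

theorem tog_trans {t t' t'' : RTree V} (h : t' = t ∨ t' = t.toggle)
    (h' : t'' = t' ∨ t'' = t'.toggle) : t'' = t ∨ t'' = t.toggle := by
  rcases h with rfl | rfl <;> rcases h' with rfl | rfl <;> simp

theorem StepOk.pot_fill {s s' : Mem V} {O : Set V} {C₁ C₂ : List (Fr V)} {t : RTree V}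
    {C₁' : List (Fr V)} {t' : RTree V} (h : StepOk s s' O C₁ C₂ t C₁' t') :
    (fill (C₁' ++ C₂) t').pot - (fill (C₁ ++ C₂) t).pot =
      (fill C₁' t').pot - (fill C₁ t).pot := by
  rw [fill_append, fill_append, fill_pot C₂, fill_pot C₂, h.rearr.size]
  ring

/-- `B` results from splaying in the tree `A`. -/
structure SplayOk (s s' : Mem V) (O : Set V) (C : List (Fr V)) (t : RTree V)
    (C' : List (Fr V)) (t' : RTree V) : Prop where
  same : s.Same s' (fill C t).addrs
  ok : Ok s' O (fill C' t')
  tog : t' = t ∨ t' = t.toggle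
  rearr : Rearr (fill C t) (fill C' t')
  len : C'.length ≤ C.length

theorem StepOk.splayOk {s s' : Mem V} {O : Set V} {C₁ C₂ : List (Fr V)} {t : RTree V}
    {C₁' : List (Fr V)} {t' : RTree V} (h : StepOk s s' O C₁ C₂ t C₁' t') :
    SplayOk s s' O (C₁ ++ C₂) t (C₁' ++ C₂) t' := by
  refine ⟨h.same.mono fun n hn => ?_, h.ok, h.tog, ?_, ?_⟩
  · rw [fill_append]
    exact (fill_addrs C₂ _).mem_iff.2 (List.mem_append_left _ hn)
  · rw [fill_append, fill_append]
    exact h.rearr.fill C₂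
  · have := h.len
    simp only [List.length_append]; omega

theorem SplayOk.trans {s s' s'' : Mem V} {O : Set V} {C C' C'' : List (Fr V)} {t t' t'' : RTree V}
    (h : SplayOk s s' O C t C' t') (h' : SplayOk s' s'' O C' t' C'' t'') :
    SplayOk s s'' O C t C'' t'' :=
  ⟨h.same.trans h'.same fun _ hn => h.rearr.addrs.mem_iff.2 hn, h'.ok, tog_trans h.tog h'.tog,
    h.rearr.trans h'.rearr, h'.len.trans h.len⟩

theorem SplayOk.refl {s : Mem V} {O : Set V} {C : List (Fr V)} {t : RTree V}
    (h : Ok s O (fill C t)) (n : ℕ) : SplayOk s (s.adv n) O C t C t :=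
  ⟨Mem.Same.adv _ _ _, h.reads n, Or.inl rfl, Rearr.refl _, le_rfl⟩

/-- Splaying at an ancestor. -/
theorem SplayOk.up {s s' : Mem V} {O : Set V} {C₁ C₂ C' : List (Fr V)} {t T : RTree V}
    (h : SplayOk s s' O C₂ (fill C₁ t) C' T) (h1 : 1 ≤ C₁.length) :
    ∃ D, D.length = C₁.length ∧ T = fill D t ∧ csize D = csize C₁ ∧
      (∀ n, pathPot D n = pathPot C₁ n) ∧ SplayOk s s' O (C₁ ++ C₂) t (D ++ C') t := by
  obtain ⟨D, e1, rfl, e3, e4⟩ := fill_tog h1 h.tog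
  refine ⟨D, e1, rfl, e3, e4, ?_, ?_, Or.inl rfl, ?_, ?_⟩
  · rw [fill_append]; exact h.same
  · rw [fill_append]; exact h.ok
  · rw [fill_append, fill_append]; exact h.rearr
  · have := h.len
    simp only [List.length_append]; omega

theorem semiSplay_spec {O : Set V} {K c : ℝ} (hc : 0 ≤ c) (hK : 450 + 7 * c ≤ 2 * K)
    (m : ℕ) : ∀ (C : List (Fr V)) {s : Mem V} {t : RTree V} (_ : C.length ≤ m)
    (_ : Ok s O (fill C t)), ∃ s' C' t', (semiSplay t.addr).run s = some ((), s') ∧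
      SplayOk s s' O C t C' t' ∧
      (s'.time : ℝ) - s.time + c * C.length + K * ((fill C' t').pot - (fill C t).pot) ≤
        2 * K * (rk (fill C t).size - rk t.size) + 50 + 6 * c := by
  induction m with
  | zero => 
    intro C s t hm h
    obtain rfl : C = [] := List.length_eq_zero_iff.1 (by omega)
    refine ⟨s.adv 1, [], t, ?_, SplayOk.refl h 1, ?_⟩
    · have h1 := fill_node h.holds
      rw [semiSplay, run_bind, semiSplayStep]
      simp [run_bind, run_getParent, h1, rcd, par, run_pure]
    · simp; linarith
  | succ m ih =>
    intro C s t hm h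
    have hw := walk_le (types C t)
    rcases semiSplayStep_spec C h with ⟨n, r, hn, hl, -⟩ | ⟨s', C₁, C₂, C₁', t', r, ht, e, hl, st⟩
    · refine ⟨s.adv n, C, t, ?_, SplayOk.refl h n, ?_⟩
      · rw [semiSplay, run_bind, r]; rfl
      · have h1 : (C.length : ℝ) ≤ 6 := by exact_mod_cast (by omega : C.length ≤ 6)
        have h2 : (n : ℝ) ≤ 50 := by exact_mod_cast (by omega : n ≤ 50)
        have h3 : rk t.size ≤ rk (fill C t).size :=
          rk_mono (size_pos t) (by rw [fill_size]; omega)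
        have h4 : 0 ≤ 2 * K * (rk (fill C t).size - rk t.size) :=
          mul_nonneg (by linarith) (by linarith)
        simp only [Mem.adv_time, Nat.cast_add, sub_self, mul_zero]
        nlinarith
    · subst e
      have hlen := st.len
      have hpos := st.pos
      have ok' := st.ok
      rw [fill_append] at ok'
      obtain ⟨s'', C'', T, r', sp, hT⟩ := ih C₂
        (by simp only [List.length_append] at hm; omega) ok'
      obtain ⟨D, e1, e2, e3, e4, sp'⟩ := sp.up hpos
      refine ⟨s'', D ++ C'', t', ?_, st.splayOk.trans sp', ?_⟩
      · rw [semiSplay, run_bind, r]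
        rw [st.rearr.addr] at r'
        exact r'
      · have h1 : (C₁.length : ℝ) ≤ 7 := by exact_mod_cast (by omega : C₁.length ≤ 7)
        have h2 : (s'.time : ℝ) ≤ s.time + 440 := by
          exact_mod_cast (by omega : s'.time ≤ s.time + 440)
        have h3 := st.pot_fill
        have h4 := st.pot2
        have hs : (fill C₂ (fill C₁' t')).size = (fill (C₁ ++ C₂) t).size := by
          rw [fill_append, fill_size C₂, fill_size C₂, st.rearr.size]
        have hs' : (fill C₁' t').size = (fill C₁ t).size := st.rearr.size
        rw [hs, hs'] at hT
        rw [fill_append D, ← e2, List.length_append, Nat.cast_add]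
        rw [fill_append C₁' C₂] at h3
        have h5 : K * ((fill C₁' t').pot - (fill C₁ t).pot) ≤
            K * (2 * (rk (fill C₁ t).size - rk t.size) - 2) :=
          mul_le_mul_of_nonneg_left (by linarith) (by linarith)
        have h6 : c * C₁.length ≤ c * 7 := mul_le_mul_of_nonneg_left h1 hc
        rw [← h3] at h5
        linarith

/-- Splaying a node completely, with a crude estimate. -/
theorem fullSplay_short {O : Set V} (m : ℕ) : ∀ (C : List (Fr V)) {s : Mem V} {t : RTree V}
    (_ : C.length ≤ m) (_ : Ok s O (fill C t)),
    ∃ s' C' t', (fullSplay t.addr).run s = some ((), s') ∧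
      SplayOk s s' O C t C' t' ∧ irred (types C' t') = true ∧
      s'.time ≤ s.time + 900 * (C.length + 1) ∧
      (fill C' t').pot ≤ (fill C t).pot + 4 * C.length * rk (fill C t).size := by
  induction m with
  | zero =>
    intro C s t hm h
    obtain rfl : C = [] := List.length_eq_zero_iff.1 (by omega)
    refine ⟨s.adv 1, [], t, ?_, SplayOk.refl h 1, rfl, by simp, by simp⟩
    have h1 := fill_node h.holds
    rw [fullSplay, run_bind, semiSplayStep]
    simp [run_bind, run_getParent, h1, rcd, par, run_pure]
  | succ m ih =>
    intro C s t hm h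
    have hw := walk_le (types C t)
    have hN := rk_nonneg (fill C t).size
    rcases semiSplayStep_spec C h with ⟨n, r, hn, hl, hi⟩ | ⟨s', C₁, C₂, C₁', t', r, ht, e, hl, st⟩
    · refine ⟨s.adv n, C, t, ?_, SplayOk.refl h n, hi, ?_, ?_⟩
      · rw [fullSplay, run_bind, r]; rfl
      · simp only [Mem.adv_time]; omega
      · have : (0 : ℝ) ≤ C.length := Nat.cast_nonneg _
        nlinarith
    · subst e
      have hlen := st.len
      have hpos := st.pos
      have ok' := st.ok
      rw [fill_append] at ok'
      have hpf := st.pot_fill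
      have h2 := st.pot2
      have hN1 : rk (fill C₁ t).size ≤ rk (fill (C₁ ++ C₂) t).size := by
        rw [fill_append, fill_size C₂]
        exact rk_mono (size_pos _) (by omega)
      have hn0 := rk_nonneg t.size
      have hadr : (fill C₁' t').addr = (fill C₁ t).addr := st.rearr.addr
      have hrec : ∀ (s1 : Mem V) (C₃ : List (Fr V)), SplayOk s s1 O (C₁ ++ C₂) t C₃ t' →
          C₃.length < (C₁ ++ C₂).length → (fullSplay t.addr).run s = (fullSplay t.addr).run s1 →
          s1.time ≤ s.time + 900 →
          (fill C₃ t').pot ≤ (fill (C₁ ++ C₂) t).pot + 4 * rk (fill (C₁ ++ C₂) t).size →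
          ∃ s' C' t', (fullSplay t.addr).run s = some ((), s') ∧
            SplayOk s s' O (C₁ ++ C₂) t C' t' ∧ irred (types C' t') = true ∧
            s'.time ≤ s.time + 900 * ((C₁ ++ C₂).length + 1) ∧
            (fill C' t').pot ≤ (fill (C₁ ++ C₂) t).pot +
              4 * (C₁ ++ C₂).length * rk (fill (C₁ ++ C₂) t).size := by
        intro s1 C₃ sp hl3 hrun ht1 hp1
        obtain ⟨s2, C', t2, r2, sp2, i2, ht2, hp2⟩ := ih C₃ (by omega) sp.ok
        have ha : t'.addr = t.addr := by rcases st.tog with e | e <;> simp [e]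
        rw [ha] at r2
        refine ⟨s2, C', t2, hrun.trans r2, sp.trans sp2, i2, ?_, ?_⟩
        · have h5 : C₃.length + 1 ≤ (C₁ ++ C₂).length := hl3
          linarith
        rw [sp.rearr.size] at hp2
        have : (C₃.length : ℝ) + 1 ≤ (C₁ ++ C₂).length := by exact_mod_cast hl3
        nlinarith
      rcases semiSplayStep_spec C₂ ok' with ⟨n, r', hn, hl', -⟩ |
        ⟨s'', D₁, D₂, D₁', T, r', ht', e', hl', st'⟩
      · have hw' := walk_le (types C₂ (fill C₁' t'))
        refine hrec (s'.adv n) (C₁' ++ C₂) (st.splayOk.trans (SplayOk.refl st.ok n)) ?_ ?_ ?_ ?_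
        · simp only [List.length_append]; omega
        · rw [hadr] at r'
          conv_lhs => rw [fullSplay]
          rw [run_bind, r, Option.bind_some, run_bind, r']; rfl
        · simp only [Mem.adv_time]; omega
        · linarith
      · subst e'
        have hw' := walk_le (types (D₁ ++ D₂) (fill C₁' t'))
        obtain ⟨D, e1, e2, e3, e4, sp'⟩ := st'.splayOk.up hpos
        have hlen' := st'.len
        have hpf' := st'.pot_fill
        have h2' := st'.pot2
        have hn0' := rk_nonneg (fill C₁' t').size
        refine hrec s'' (D ++ (D₁' ++ D₂)) (st.splayOk.trans sp') ?_ ?_ (by omega) ?_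
        · simp only [List.length_append]; omega
        · rw [hadr] at r'
          conv_lhs => rw [fullSplay]
          rw [run_bind, r, Option.bind_some, run_bind, r']; rfl
        · have hN2 : rk (fill D₁ (fill C₁' t')).size ≤ rk (fill (C₁ ++ (D₁ ++ D₂)) t).size := by
            rw [fill_append, fill_append, fill_size D₂, fill_size D₁, fill_size D₁, st.rearr.size]
            exact rk_mono (by have := size_pos (fill C₁ t); omega) (by omega)
          rw [fill_append D, ← e2]
          rw [fill_append C₁'] at hpf
          linarith

theorem window_step {s s' : Mem V} {O : Set V} {C₁ C₂ : List (Fr V)} {t : RTree V}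
    {C₁' : List (Fr V)} {t' : RTree V} (h : StepOk s s' O C₁ C₂ t C₁' t') (N j : ℕ) :
    ((fill (C₁' ++ C₂) t').pot - win N (C₁.length + j) (C₁' ++ C₂) t.size) -
      ((fill (C₁ ++ C₂) t).pot - win N (C₁.length + j) (C₁ ++ C₂) t.size) ≤
      rk (fill C₁ t).size - nthRank N j C₂ (fill C₁ t).size := by
  have h1 := h.pot1
  have h3 := h.pot_fill
  have hs := h.rearr.size
  rw [fill_size, fill_size, h.size] at hs
  rw [win_append, ← h.len, show C₁'.length + 1 + j = C₁'.length + (j + 1) by omega, win_append,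
    win_succ, hs, ← fill_size]
  linarith

theorem window_step' {s s' : Mem V} {O : Set V} {C₁ C₂ : List (Fr V)} {t : RTree V}
    {C₁' : List (Fr V)} {t' : RTree V} (h : StepOk s s' O C₁ C₂ t C₁' t') (N j : ℕ) :
    ((fill (C₁' ++ C₂) t').pot - win N (C₁.length + j) (C₁' ++ C₂) t.size) -
      ((fill (C₁ ++ C₂) t).pot - win N (C₁.length + j) (C₁ ++ C₂) t.size) ≤
      2 * (rk (fill C₁ t).size - rk t.size) - 2 + C₁.length * rk (fill C₁ t).size -
        (C₁.length - 1) * rk t.size - nthRank N j C₂ (fill C₁ t).size := by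
  have h1 := h.pot2
  have h3 := h.pot_fill
  have hs := h.rearr.size
  have hl := h.len
  rw [fill_size, fill_size, h.size] at hs
  have h5 := pathPot_le (N := (fill C₁ t).size) C₁ (size_pos t) (by rw [fill_size])
  have h6 := le_pathPot C₁' (size_pos t)
  have h7 : (C₁'.length : ℝ) = C₁.length - 1 := by
    rw [← hl]; push_cast; ring
  rw [win_append]
  nth_rewrite 1 [← h.len]
  rw [show C₁'.length + 1 + j = C₁'.length + (j + 1) by omega, win_append,
    win_succ, hs, ← fill_size]
  rw [h7] at h6
  linarith

/-- Two steps decrease the modified potential. -/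
theorem window_two {s s' s'' : Mem V} {O : Set V} {C₁ C₁' D₁ D₂ D₁' D : List (Fr V)}
    {t t' T : RTree V} (h : StepOk s s' O C₁ (D₁ ++ D₂) t C₁' t')
    (h' : StepOk s' s'' O D₁ D₂ (fill C₁' t') D₁' T) (hl : C₁.length ≤ 7) (hl' : D₁.length ≤ 7)
    (eT : T = fill D t') (e1 : D.length = C₁'.length) (e3 : csize D = csize C₁')
    (e4 : ∀ n, pathPot D n = pathPot C₁' n) :
    (fill (D ++ (D₁' ++ D₂)) t').pot -
      win (fill (C₁ ++ (D₁ ++ D₂)) t).size 16 (D ++ (D₁' ++ D₂)) t'.size ≤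
    (fill (C₁ ++ (D₁ ++ D₂)) t).pot -
      win (fill (C₁ ++ (D₁ ++ D₂)) t).size 16 (C₁ ++ (D₁ ++ D₂)) t.size - 1 / 8 := by
  obtain ⟨N, hN⟩ : ∃ N, (fill (C₁ ++ (D₁ ++ D₂)) t).size = N := ⟨_, rfl⟩
  rw [hN]
  obtain ⟨j, hj⟩ : ∃ j, 16 = C₁.length + j := ⟨16 - C₁.length, by omega⟩
  obtain ⟨i, hi⟩ : ∃ i, j + 1 = D₁.length + i := ⟨j + 1 - D₁.length, by omega⟩
  have a1 := window_step h N j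
  have a2 := window_step h' N i
  have a2' := window_step' h' N i
  have hlen := h.len
  have hM : (fill C₁' t').size = (fill C₁ t).size := h.rearr.size
  have hD : win N 16 (D ++ (D₁' ++ D₂)) t'.size =
      pathPot C₁' t'.size + win N (D₁.length + i) (D₁' ++ D₂) (fill C₁' t').size := by
    rw [hj, show C₁.length + j = D.length + (D₁.length + i) by omega, win_append, e4, e3,
      ← fill_size]
  have hC' : win N (C₁.length + j) (C₁' ++ (D₁ ++ D₂)) t.size =
      pathPot C₁' t'.size + win N (D₁.length + i) (D₁ ++ D₂) (fill C₁' t').size := by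
    rw [show C₁.length + j = C₁'.length + (D₁.length + i) by omega, win_append, ← h.size,
      ← fill_size]
  have hp1 : (fill (D ++ (D₁' ++ D₂)) t').pot = (fill (D₁' ++ D₂) T).pot := by
    rw [fill_append D, eT]
  have hp2 : (fill (C₁' ++ (D₁ ++ D₂)) t').pot = (fill (D₁ ++ D₂) (fill C₁' t')).pot := by
    rw [fill_append C₁']
  rw [hC', hp2, ← hj] at a1
  rw [hD, hp1]
  have hQ : (fill D₁ (fill C₁' t')).size = (fill C₁ t).size + csize D₁ := by
    rw [fill_size, hM]
  rw [fill_append, fill_size (D₁ ++ D₂)] at hN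
  have b1 : rk (fill D₁ (fill C₁' t')).size ≤ nthRank N j (D₁ ++ D₂) (fill C₁ t).size := by
    rw [hQ]
    exact le_nthRank_append j D₁ D₂ (size_pos _) (by omega) (by omega)
  have b2 : rk (fill D₁ (fill C₁' t')).size ≤ nthRank N i D₂ (fill D₁ (fill C₁' t')).size := by
    refine le_nthRank i D₂ (size_pos _) ?_
    rw [hQ]
    rw [csize_append] at hN
    omega
  have b0 : rk (fill C₁ t).size ≤ rk (fill D₁ (fill C₁' t')).size :=
    rk_mono (size_pos _) (by rw [hQ]; omega)
  by_cases hb : 1 / 8 ≤ rk (fill D₁ (fill C₁' t')).size - rk (fill C₁ t).size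
  · linarith
  · rw [not_le] at hb
    rw [hM] at a2'
    have : (D₁.length : ℝ) ≤ 7 := by exact_mod_cast hl'
    have h0 : (0 : ℝ) ≤ D₁.length := Nat.cast_nonneg _
    rw [hM]
    rw [hM] at a1
    nlinarith

theorem fullSplay_window {O : Set V} {K : ℝ} (hK : 7200 ≤ K) (N : ℕ) (m : ℕ) :
    ∀ (C : List (Fr V)) {s : Mem V} {t : RTree V}
    (_ : C.length ≤ m) (_ : Ok s O (fill C t)) (_ : (fill C t).size = N),
    ∃ s' C' t', (fullSplay t.addr).run s = some ((), s') ∧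
      SplayOk s s' O C t C' t' ∧ irred (types C' t') = true ∧
      (s'.time : ℝ) - s.time + K * (((fill C' t').pot - win N 16 C' t'.size) -
        ((fill C t).pot - win N 16 C t.size)) ≤ 13000 + 68 * K * rk N := by
  induction m with
  | zero =>
    intro C s t hm h hN
    obtain rfl : C = [] := List.length_eq_zero_iff.1 (by omega)
    refine ⟨s.adv 1, [], t, ?_, SplayOk.refl h 1, rfl, ?_⟩
    · have h1 := fill_node h.holds
      rw [fullSplay, run_bind, semiSplayStep]
      simp [run_bind, run_getParent, h1, rcd, par, run_pure]
    · have := rk_nonneg N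
      simp only [Mem.adv_time, Nat.cast_add, sub_self, mul_zero]
      norm_num
      nlinarith
  | succ m ih =>
    intro C s t hm h hN
    have hR := rk_nonneg N
    have short : C.length ≤ 13 → _ := fun hC => fullSplay_short (O := O) C.length C le_rfl h
    by_cases hC : C.length ≤ 13
    · obtain ⟨s', C', t', r, sp, hi, ht, hp⟩ := short hC
      refine ⟨s', C', t', r, sp, hi, ?_⟩
      have h1 := win_nonneg N 16 C' t'.size
      have h2 := win_le (N := N) 16 C (size_pos t) (by rw [← fill_size, hN])
      rw [hN] at hp
      have h3 : (C.length : ℝ) ≤ 13 := by exact_mod_cast hC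
      have h4 : (s'.time : ℝ) ≤ s.time + 900 * (C.length + 1) := by exact_mod_cast ht
      have h5 : 4 * (C.length : ℝ) * rk N ≤ 52 * rk N := by nlinarith
      push_cast at h2
      have h6 : K * (((fill C' t').pot - win N 16 C' t'.size) -
        ((fill C t).pot - win N 16 C t.size)) ≤ K * (68 * rk N) :=
        mul_le_mul_of_nonneg_left (by linarith) (by linarith)
      linarith
    have hw := walk_le (types C t)
    rcases semiSplayStep_spec C h with ⟨n, r, hn, hl, hi⟩ | ⟨s', C₁, C₂, C₁', t', r, ht, e, hl, st⟩
    · omega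
    subst e
    have ok' := st.ok
    rw [fill_append] at ok'
    have hw' := walk_le (types C₂ (fill C₁' t'))
    have hadr : (fill C₁' t').addr = (fill C₁ t).addr := st.rearr.addr
    rcases semiSplayStep_spec C₂ ok' with ⟨n, r', hn, hl', -⟩ |
        ⟨s'', D₁, D₂, D₁', T, r', ht', e', hl', st'⟩
    · simp only [List.length_append] at hC; omega
    subst e'
    obtain ⟨D, e1, e2, e3, e4, sp'⟩ := st'.splayOk.up st.pos
    have sp := st.splayOk.trans sp'
    have hlen := st.len
    have hlen' := st'.len
    have hwin := window_two st st' (by omega) (by omega) e2 e1 e3 e4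
    rw [hN] at hwin
    have ha : t'.addr = t.addr := by rcases st.tog with e | e <;> simp [e]
    obtain ⟨s3, C3, t3, r3, sp3, i3, h3⟩ := ih (D ++ (D₁' ++ D₂))
      (by simp only [List.length_append] at hm ⊢; omega) sp.ok (by rw [sp.rearr.size, hN])
    refine ⟨s3, C3, t3, ?_, sp.trans sp3, i3, ?_⟩
    · rw [hadr] at r'
      rw [ha] at r3
      rw [fullSplay, run_bind, r, Option.bind_some, run_bind, r']
      exact r3
    · have h4 : (s''.time : ℝ) ≤ s.time + 900 := by
        exact_mod_cast (by omega : s''.time ≤ s.time + 900)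
      have h5 := mul_le_mul_of_nonneg_left hwin (by linarith : 0 ≤ K)
      nlinarith

theorem fullSplay_spec {O : Set V} {K : ℝ} (hK : 7200 ≤ K) (C : List (Fr V)) {s : Mem V}
    {t : RTree V} (h : Ok s O (fill C t)) :
    ∃ s' C' t', (fullSplay t.addr).run s = some ((), s') ∧
      SplayOk s s' O C t C' t' ∧ irred (types C' t') = true ∧
      (s'.time : ℝ) - s.time + K * ((fill C' t').pot - (fill C t).pot) ≤
        13000 + 84 * K * rk (fill C t).size := by
  obtain ⟨s', C', t', r, sp, hi, ht⟩ := fullSplay_window hK _ C.length C le_rfl h rfl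
  refine ⟨s', C', t', r, sp, hi, ?_⟩
  have h1 := win_nonneg (fill C t).size 16 C t.size
  have h2 := win_le (N := (fill C t).size) 16 C' (size_pos t')
    (by rw [← fill_size, sp.rearr.size])
  push_cast at h2
  nlinarith

end TopTreeProg

namespace RTree
variable {V : Type}

theorem mem_oC {O : Set V} {C : List (Fr V)} {v : V} :
    v ∈ oC O C ↔ v ∈ O ∨ ∃ g ∈ C, v ∈ g.sib.verts := by
  induction C with
  | nil => simp [oC]
  | cons f C ih => simp only [oC, Set.mem_union, ih, List.mem_cons]; grind

theorem WF.most_unique {O : Set V} {t : RTree V} (h : t.WF O) {σ : Bool} {v w : V}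
    (hv : t.Most O σ v) (hw : t.Most O σ w) : v = w := by
  rcases hv with hv | ⟨hv, hv'⟩ <;> rcases hw with hw | ⟨hw, hw'⟩
  · exact h.side_unique hv hw
  · exact (hw ⟨v, hv⟩).elim
  · exact (hv ⟨w, hw⟩).elim
  · exact h.mid_unique hv' hw'

theorem leaf_addr_mem {t : RTree V} {e : ℕ × V × V} (h : e ∈ t.leaves) : e.1 ∈ t.addrs :=
  (addrs_perm t).mem_iff.2 (List.mem_append_left _ (List.mem_map_of_mem h))

/-- The memory holds the data of the vertices of the tree `τ`. -/
structure VertOk (s : Mem V) (X : Set V) (τ : RTree V) : Prop where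
  exposed : ∀ v ∈ τ.verts, (s.exposed v = true ↔ v ∈ X)
  nodup : ∀ v ∈ τ.verts, (s.incident v).Nodup
  mem : ∀ v ∈ τ.verts, ∀ e, e ∈ s.incident v ↔ ∃ a b, (e, a, b) ∈ τ.leaves ∧ (v = a ∨ v = b)

theorem VertOk.congr {s s' : Mem V} {X : Set V} {τ τ' : RTree V} (h : VertOk s X τ)
    (he : s'.exposed = s.exposed) (hi : s'.incident = s.incident) (hR : Rearr τ τ') :
    VertOk s' X τ' := by
  refine ⟨fun v hv => ?_, fun v hv => ?_, fun v hv e => ?_⟩ <;> rw [hR.verts] at hv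
  · rw [he]; exact h.exposed v hv
  · rw [hi]; exact h.nodup v hv
  · rw [hi]; simpa only [hR.leaves.mem_iff] using h.mem v hv e

theorem VertOk.degree {s : Mem V} {X : Set V} {C : List (Fr V)} {x fl k} {a b w : V}
    (h : VertOk s X (fill C (leaf x fl k a b))) (hn : (fill C (leaf x fl k a b)).addrs.Nodup)
    (hw : w = a ∨ w = b) :
    2 ≤ (s.incident w).length ↔ ∃ g ∈ C, w ∈ g.sib.verts := by
  have hl := fill_leaves C (leaf x fl k a b)
  have hx : (x, a, b) ∈ (fill C (leaf x fl k a b)).leaves := hl.mem_iff.2 (by simp [leaves])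
  have hwv : w ∈ (fill C (leaf x fl k a b)).verts := (mem_verts_iff _ _).2 ⟨_, hx, hw⟩
  have hxi : x ∈ s.incident w := (h.mem w hwv x).2 ⟨a, b, hx, hw⟩
  have hd := (List.nodup_append.1 ((fill_addrs C _).nodup_iff.1 hn)).2.2 x (by simp [addrs])
  have hsub : ∀ g ∈ C, ∀ n ∈ g.sib.addrs, n ∈ caddrs C := by
    clear * -
    induction C with
    | nil => simp
    | cons f C ih =>
      intro g hg n hn
      rcases List.mem_cons.1 hg with rfl | hg
      · simp [caddrs, hn]
      · simp [caddrs, ih g hg n hn]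
  constructor
  · intro h2
    obtain ⟨e, he, hne⟩ : ∃ e ∈ s.incident w, e ≠ x := by
      by_contra! hall
      have hnd := h.nodup w hwv
      rcases hs : s.incident w with - | ⟨p, - | ⟨q, l⟩⟩
      · simp [hs] at h2
      · simp [hs] at h2
      · rw [hs] at hall hnd
        have := hall p (by simp)
        have := hall q (by simp)
        simp_all
    obtain ⟨a', b', hm, hw'⟩ := (h.mem w hwv e).1 he
    rw [hl.mem_iff] at hm
    simp only [leaves, List.mem_append, List.mem_singleton, List.mem_flatMap, Prod.mk.injEq] at hm
    rcases hm with hm | ⟨g, hg, hm⟩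
    · exact (hne hm.1).elim
    · exact ⟨g, hg, (mem_verts_iff _ _).2 ⟨_, hm, hw'⟩⟩
  · rintro ⟨g, hg, hv⟩
    obtain ⟨⟨e, a', b'⟩, hm, hw'⟩ := (mem_verts_iff _ _).1 hv
    have hne : x ≠ e := hd e (hsub g hg e (leaf_addr_mem hm))
    have hei : e ∈ s.incident w := (h.mem w hwv e).2
      ⟨a', b', hl.mem_iff.2 (List.mem_append_right _ (List.mem_flatMap.2 ⟨g, hg, hm⟩)), hw'⟩
    rcases hs : s.incident w with - | ⟨p, - | ⟨q, l⟩⟩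
    · simp [hs] at hxi
    · rw [hs] at hxi hei; simp at hxi hei; exact (hne (hxi.trans hei.symm)).elim
    · simp

end RTree

namespace TopTreeProg
open RTree
variable {V : Type}

theorem run_hasSide {s : Mem V} {X : Set V} {C : List (Fr V)} {t : RTree V}
    (h : Ok s X (fill C t)) (hv : VertOk s X (fill C t)) (side : Bool) (m : ℕ) :
    ∃ b n, n ≤ 5 ∧ (hasSideBoundary side t.addr).run (s.adv m) = some (b, s.adv (m + n)) ∧
      (b = true ↔ ∃ w, t.Side (oC X C) side w) := by
  have h1 := fill_node h.holds
  have hw := h.wf.of_fill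
  cases t with
  | leaf x fl k a b =>
    set w := if (side != fl) = true then b else a with hwd
    have hw' : w = a ∨ w = b := by rw [hwd]; split_ifs <;> simp
    have hdeg := hv.degree h.nodup hw'
    have hwv : w ∈ (fill C (leaf x fl k a b)).verts := by
      rw [mem_verts_iff]
      exact ⟨(x, a, b), (fill_leaves C _).mem_iff.2 (by simp [leaves]), hw'⟩
    have hex := hv.exposed w hwv
    refine ⟨s.exposed w || decide (2 ≤ (s.incident w).length), 5, le_rfl, ?_, ?_⟩
    · simp only [addr, rcd, body, count, RTree.flip] at h1
      simp only [addr, hasSideBoundary, run_bind, run_getFlip, h1, isLeafNode, run_readNode,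
        run_getEndpoints (s := s.adv _) h1, Mem.adv_node, Option.bind_some, run_pure, if_true,
        run_isExposed, run_degreeGeTwo, Mem.adv_adv, Mem.adv_exposed, Mem.adv_incident, hwd,
        Nat.add_assoc, Nat.reduceAdd]
    · simp only [Bool.or_eq_true, hex, decide_eq_true_eq, hdeg, Side, ← mem_oC]
      have hb : (side != fl) = (side ^^ fl) := by cases side <;> cases fl <;> rfl
      rw [← hb, ← hwd]
      exact ⟨fun h => ⟨w, h, rfl⟩, fun ⟨u, h, e⟩ => e ▸ h⟩
  | node x fl k l r =>
    obtain ⟨-, -, hl, hr, c, hc, -⟩ := hw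
    have hH := ((holds_fill ..).1 h.holds).1
    obtain ⟨-, Hl, Hr⟩ := hH
    have Hl' := ((holds_iff ..).1 Hl).1
    have Hr' := ((holds_iff ..).1 Hr).1
    have h1 : s.node x = some ⟨par C, .internal l.addr r.addr, k, fl⟩ := h1
    refine ⟨if (side != fl) = true then r.isP else l.isP, 4, by omega, ?_, ?_⟩
    · change (hasSideBoundary side x).run _ = _
      simp only [hasSideBoundary, run_bind, run_getFlip, h1, isLeafNode, run_readNode,
        run_getChildren (s := s.adv _) h1, Mem.adv_node, Option.bind_some, run_pure,
        Mem.adv_adv, Bool.false_eq_true, if_false, run_isPath,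
        Nat.add_assoc, Nat.reduceAdd]
      split_ifs
      · simp only [Hr', Option.bind_some]; rfl
      · simp only [Hl', Option.bind_some]; rfl
    · have hb : (side != fl) = (side ^^ fl) := by cases side <;> cases fl <;> rfl
      rw [hb]
      simp only [Side]
      split_ifs
      · exact isP_iff_exists hr (Set.inter_comm _ _ ▸ hc)
      · exact isP_iff_exists hl hc

/-- The result of the search for the consuming node of `v`, starting from a node with context `C`:
the last node on the path in whose children `v` meets. -/
def Consuming (v : V) (C : List (Fr V)) (last r : Option ℕ) : Prop :=
  (∃ C₁ f C₂, C = C₁ ++ f :: C₂ ∧ r = some f.addr ∧ v ∈ f.sib.verts ∧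
    ∀ g ∈ C₂, v ∉ g.sib.verts) ∨ ((∀ g ∈ C, v ∉ g.sib.verts) ∧ r = last)

theorem consumingLoop_spec {X : Set V} {s : Mem V} {v : V} (C : List (Fr V)) :
    ∀ {t : RTree V} {bl bm br : Bool} {last : Option ℕ} (m : ℕ) (_ : Ok s X (fill C t))
    (_ : VertOk s X (fill C t)) (_ : v ∈ t.verts) (_ : v ∈ oC X C)
    (_ : bl = true ↔ t.Side (oC X C) false v) (_ : bm = true ↔ t.Mid (oC X C) v)
    (_ : br = true ↔ t.Side (oC X C) true v),
    ∃ r n, (consumingLoop t.addr bl bm br last).run (s.adv m) = some (r, s.adv (m + n)) ∧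
      n ≤ 20 * (C.length + 1) ∧ Consuming v C last r := by
  induction C with
  | nil =>
    intro t bl bm br last m h hv hvt hvO hl hm hr
    have h1 := fill_node h.holds
    refine ⟨last, 1, ?_, by simp, Or.inr ⟨by simp, rfl⟩⟩
    rw [consumingLoop]
    simp [run_bind, run_getParent, h1, rcd, par, run_pure]
  | cons f C ih =>
    intro t bl bm br last m h hv hvt hvO hl hm hr
    have h1 := fill_node h.holds
    have h2 := fill_node (C := C) (t := Fr.fill f t) h.holds
    rw [fr_rcd, Fr.fill_addr] at h2
    have hch := isChildZero_fill h.holds h.nodup (m + 1)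
    obtain ⟨hL, n1, hn1, rL, iL⟩ := run_hasSide h hv false (m + 2)
    obtain ⟨hR, n2, hn2, rR, iR⟩ := run_hasSide h hv true (m + 2 + n1)
    have hwt := h.wf.of_fill
    have hwp := WF.of_fill (C := C) (t := Fr.fill f t) h.wf
    rw [Fr.fill, wf_mk] at hwp
    obtain ⟨hk, hk2, hwt', hws, c, hc, hmt, hms⟩ := hwp
    have hc' : c ∈ t.verts ∩ f.sib.verts := hc ▸ rfl
    have hmid : ∀ m', m' = (if f.zero then br || (bm && !hR) else bl || (bm && !hL)) →
        (m' = true ↔ v ∈ f.sib.verts) := by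
      intro m' e
      have : m' = true ↔ t.Most (oC X (f :: C)) f.zero v := by
        rw [e, Most]
        have iL' : (!hL) = true ↔ ¬ ∃ w, t.Side (oC X (f :: C)) false w := by
          rw [← iL]; cases hL <;> simp
        have iR' : (!hR) = true ↔ ¬ ∃ w, t.Side (oC X (f :: C)) true w := by
          rw [← iR]; cases hR <;> simp
        cases f.zero
        · simp only [Bool.false_eq_true, if_false, Bool.or_eq_true, Bool.and_eq_true, hl, hm, iL']
          rw [and_comm]
        · simp only [if_true, Bool.or_eq_true, Bool.and_eq_true, hr, hm, iR']
          rw [and_comm]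
      rw [this]
      constructor
      · intro hv
        exact hwt.most_unique hv hmt ▸ hc'.2
      · intro hvs
        have : v ∈ t.verts ∩ f.sib.verts := ⟨hvt, hvs⟩
        rw [hc] at this
        exact this ▸ hmt
    obtain ⟨m', hm'⟩ : ∃ m', (if f.zero then br || (bm && !hR) else bl || (bm && !hL)) = m' :=
      ⟨_, rfl⟩
    have hmid' := hmid m' hm'.symm
    clear hmid
    have hvp : v ∈ (Fr.fill f t).verts := by simp [hvt]
    have hflags : v ∈ oC X C →
        (((f.zero != f.fl) && !m') = true ↔ (Fr.fill f t).Side (oC X C) false v) ∧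
        (m' = true ↔ (Fr.fill f t).Mid (oC X C) v) ∧
        (((f.zero == f.fl) && !m') = true ↔ (Fr.fill f t).Side (oC X C) true v) := by
      intro hO
      have hnm : (!m') = true ↔ v ∉ f.sib.verts := by rw [← hmid']; cases m' <;> simp
      rw [Fr.fill, side_mk, side_mk, mid_mk, Bool.and_eq_true, Bool.and_eq_true, hnm, hmid']
      refine ⟨?_, ⟨fun h => ⟨hO, hvt, h⟩, fun h => h.2.2⟩, ?_⟩ <;> cases f.zero <;> cases f.fl <;>
        simp [hO, hvt]
    have run : (consumingLoop t.addr bl bm br last).run (s.adv m) =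
        (if m' = true then do
          if ← hasMiddleBoundary f.addr then
            consumingLoop f.addr ((f.zero != f.fl) && !m') m' ((f.zero == f.fl) && !m')
              (some f.addr)
          else
            return some f.addr
        else
          consumingLoop f.addr ((f.zero != f.fl) && !m') m' ((f.zero == f.fl) && !m') last :
          Prog V (Option ℕ)).run (s.adv (m + 2 + n1 + n2 + 1)) := by
      rw [consumingLoop]
      simp only [hasLeftBoundary, hasRightBoundary, run_bind, run_getParent, h1, rcd, par, hch, rL,
        rR, run_getFlip, h2, Option.bind_some, Mem.adv_node, Mem.adv_adv, hm']
    rw [run]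
    have hmidrun : ∃ n ≤ 5, (hasMiddleBoundary f.addr).run (s.adv (m + 2 + n1 + n2 + 1)) =
        some (midCount f.k t f.sib, s.adv (m + 2 + n1 + n2 + 1 + n)) := by
      have hs : s.node f.sib.addr = some (f.sib.rcd (some f.addr)) :=
        ((holds_iff ..).1 (((holds_fill ..).1 h.holds).2.2.1)).1
      cases hz : f.zero
      · simp only [hz, Bool.false_eq_true, if_false] at h2
        obtain ⟨n, hn, r⟩ := run_hasMiddle (s := s.adv (m + 2 + n1 + n2 + 1)) h2 hs h1
        refine ⟨n, hn, ?_⟩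
        rw [r, Mem.adv_adv]
        simp only [midCount, isP, rcd, Nat.sub_right_comm f.k]
      · simp only [hz, if_true] at h2
        obtain ⟨n, hn, r⟩ := run_hasMiddle (s := s.adv (m + 2 + n1 + n2 + 1)) h2 h1 hs
        refine ⟨n, hn, ?_⟩
        rw [r, Mem.adv_adv]
        simp only [midCount, isP, rcd]
    by_cases hmt' : m' = true
    · rw [if_pos hmt', run_bind]
      obtain ⟨n3, hn3, r3⟩ := hmidrun
      have hvs := hmid'.1 hmt'
      have hvc : v = c := by
        have : v ∈ t.verts ∩ f.sib.verts := ⟨hvt, hvs⟩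
        rwa [hc] at this
      have hmc := midCount_iff hk hwt' hws hc
      rw [r3, Option.bind_some]
      by_cases hcO : c ∈ oC X C
      · have hO : v ∈ oC X C := hvc ▸ hcO
        obtain ⟨f1, f2, f3⟩ := hflags hO
        obtain ⟨r, n, rr, hn, hcon⟩ := ih (t := Fr.fill f t) (last := some f.addr)
          (m + 2 + n1 + n2 + 1 + n3) h hv hvp hO f1 f2 f3
        rw [Fr.fill_addr] at rr
        refine ⟨r, 2 + n1 + n2 + 1 + n3 + n, ?_, ?_, ?_⟩
        · simp only [hmc.2 hcO, if_true]
          rw [rr]; simp only [Nat.add_assoc]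
        · simp only [List.length_cons]; omega
        · rcases hcon with ⟨C₁, g, C₂, e, h4⟩ | ⟨h4, h5⟩
          · exact Or.inl ⟨f :: C₁, g, C₂, by rw [e]; rfl, h4⟩
          · exact Or.inl ⟨[], f, C, rfl, h5, hvs, h4⟩
      · have hmf : midCount f.k t f.sib = false := by
          rw [← Bool.not_eq_true]; exact fun e => hcO (hmc.1 e)
        refine ⟨some f.addr, 2 + n1 + n2 + 1 + n3, ?_, ?_, Or.inl ⟨[], f, C, rfl, rfl, hvs, ?_⟩⟩
        · simp only [hmf, Bool.false_eq_true, if_false, run_pure, Nat.add_assoc]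
        · simp only [List.length_cons]; omega
        · intro g hg hvg
          exact hcO (hvc ▸ mem_oC.2 (Or.inr ⟨g, hg, hvg⟩))
    · rw [if_neg hmt']
      have hvs : v ∉ f.sib.verts := fun h => hmt' (hmid'.2 h)
      have hO : v ∈ oC X C := hvO.resolve_right hvs
      obtain ⟨f1, f2, f3⟩ := hflags hO
      obtain ⟨r, n, rr, hn, hcon⟩ := ih (t := Fr.fill f t) (last := last)
          (m + 2 + n1 + n2 + 1) h hv hvp hO f1 f2 f3
      rw [Fr.fill_addr] at rr
      refine ⟨r, 2 + n1 + n2 + 1 + n, ?_, ?_, ?_⟩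
      · rw [rr]; simp only [Nat.add_assoc]
      · simp only [List.length_cons]; omega
      · rcases hcon with ⟨C₁, g, C₂, e, h4⟩ | ⟨h4, h5⟩
        · exact Or.inl ⟨f :: C₁, g, C₂, by rw [e]; rfl, h4⟩
        · exact Or.inr ⟨by simpa [hvs] using h4, h5⟩

end TopTreeProg

namespace RTree
variable {V : Type}

theorem exists_zipper {τ : RTree V} {e : ℕ} {a b : V} (h : (e, a, b) ∈ τ.leaves) :
    ∃ C fl k, τ = fill C (leaf e fl k a b) := by
  induction τ with
  | leaf x fl k a' b' =>
    simp only [leaves, List.mem_singleton, Prod.mk.injEq] at h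
    obtain ⟨rfl, rfl, rfl⟩ := h
    exact ⟨[], fl, k, rfl⟩
  | node x fl k l r hl hr =>
    rcases List.mem_append.1 h with h | h
    · obtain ⟨C, fl', k', e⟩ := hl h
      refine ⟨C ++ [⟨x, fl, k, true, r⟩], fl', k', ?_⟩
      rw [fill_append, ← e]; rfl
    · obtain ⟨C, fl', k', e⟩ := hr h
      refine ⟨C ++ [⟨x, fl, k, false, l⟩], fl', k', ?_⟩
      rw [fill_append, ← e]; rfl

/-- If the tree is not a leaf, then both children contain `v`. -/
def Meets (v : V) : RTree V → Prop
  | leaf _ _ _ _ _ => True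
  | node _ _ _ l r => v ∈ l.verts ∧ v ∈ r.verts

theorem meets_mk (v : V) (x fl k σ) (p q : RTree V) :
    (mk x fl k σ p q).Meets v ↔ v ∈ p.verts ∧ v ∈ q.verts := by
  cases σ
  · exact and_comm
  · rfl

theorem meets_toggle (v : V) (t : RTree V) : t.toggle.Meets v ↔ t.Meets v := by cases t <;> rfl

theorem fill_tog_verts {t t' : RTree V} (h : t' = t ∨ t' = t.toggle) :
    t'.verts = t.verts ∧ t'.count = t.count ∧ t'.addr = t.addr ∧ ∀ v, t'.Meets v ↔ t.Meets v := by
  rcases h with rfl | rfl <;> simp [meets_toggle]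

end RTree

namespace TopTreeProg
open RTree
variable {V : Type}

theorem findConsumingNode_spec [DecidableEq V] {K c : ℝ} (hc : 0 ≤ c) (hK : 450 + 7 * (c + 20) ≤ 2 * K)
    {s : Mem V} {X : Set V} {τ : RTree V} (h : Ok s X τ) (hv : VertOk s X τ) {v : V}
    (hvτ : v ∈ τ.verts) :
    ∃ s' C t, (findConsumingNode v).run s = some (some t.addr, s') ∧ s.Same s' τ.addrs ∧
      Ok s' X (fill C t) ∧ Rearr τ (fill C t) ∧ v ∈ t.verts ∧ (∀ g ∈ C, v ∉ g.sib.verts) ∧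
      t.Meets v ∧
      (s'.time : ℝ) - s.time + c * C.length + K * ((fill C t).pot - τ.pot) ≤
        2 * K * rk τ.size + 200 + 6 * c := by
  obtain ⟨⟨e0, a0, b0⟩, hm0, hv0⟩ := (mem_verts_iff _ _).1 hvτ
  have he0 := (hv.mem v hvτ e0).2 ⟨a0, b0, hm0, hv0⟩
  obtain ⟨e, l, hel⟩ : ∃ e l, s.incident v = e :: l := by
    rcases hs : s.incident v with - | ⟨e, l⟩
    · simp [hs] at he0
    · exact ⟨e, l, rfl⟩
  obtain ⟨a, b, hm, hvab⟩ := (hv.mem v hvτ e).1 (by simp [hel])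
  obtain ⟨C, fl, k, rfl⟩ := exists_zipper hm
  obtain ⟨s1, C', t', r1, sp, ht⟩ := semiSplay_spec (K := K) (c := c + 20) (by linarith) hK
    C.length C le_rfl (h.reads 1)
  obtain ⟨fl', rfl⟩ : ∃ fl', t' = leaf e fl' k a b := by
    rcases sp.tog with e | e
    · exact ⟨_, e⟩
    · exact ⟨_, e⟩
  have hv1 : VertOk s1 X (fill C' (leaf e fl' k a b)) :=
    hv.congr sp.same.exposed sp.same.incident sp.rearr
  have hdeg := hv1.degree sp.ok.nodup hvab
  have hvt : v ∈ (leaf e fl' k a b).verts := by simpa [verts] using hvab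
  have hab : a ≠ b := sp.ok.wf.of_fill.1
  have hlen : (C'.length : ℝ) ≤ C.length := by exact_mod_cast sp.len
  have hrk := rk_nonneg (leaf e fl k a b).size
  have hK0 : 0 ≤ K := by linarith
  have hKr := mul_nonneg hK0 hrk
  have h1 := fill_node sp.ok.holds
  simp only [addr, rcd, body, count, RTree.flip] at h1
  have run0 : (findConsumingNode v).run s = (do
      if ← degreeGeTwo v then
        let ends ← getEndpoints e
        let fl ← getFlip e
        consumingLoop e (decide (ends.1 = v) != fl) false (decide (ends.2 = v) != fl) none
      else
        return some e : Prog V (Option ℕ)).run s1 := by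
    rw [findConsumingNode, run_bind, run_anyEdge, hel]
    simp only [List.head?_cons, Option.bind_some]
    rw [run_bind]
    have r1' : (semiSplay e).run (s.adv 1) = some ((), s1) := r1
    rw [r1']; rfl
  rw [run0, run_bind, run_degreeGeTwo, Option.bind_some]
  simp only [Mem.adv_time, Nat.cast_add, Nat.cast_one] at ht
  by_cases hd : 2 ≤ (s1.incident v).length
  · simp only [hd, decide_true, if_true]
    have hOC : v ∈ oC X C' := mem_oC.2 (Or.inr (hdeg.1 hd))
    obtain ⟨r, n, rr, hn, hcon⟩ := consumingLoop_spec (last := none) (s := s1) (X := X) (v := v) C'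
      (bl := decide (a = v) != fl') (bm := false) (br := decide (b = v) != fl') 3 sp.ok hv1 hvt hOC
      (by
        rcases hvab with rfl | rfl <;> cases fl' <;>
          simp [Side, hOC, hab, hab.symm])
      (by simp [Mid])
      (by
        rcases hvab with rfl | rfl <;> cases fl' <;>
          simp [Side, hOC, hab, hab.symm])
    have rr' : (consumingLoop e (decide (a = v) != fl') false (decide (b = v) != fl') none).run
      (s1.adv 3) = some (r, s1.adv (3 + n)) := rr
    simp only [run_bind, run_getEndpoints (s := s1.adv 1) h1, run_getFlip, Option.bind_some,
      Mem.adv_node, Mem.adv_adv, h1, Nat.reduceAdd, rr']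
    rcases hcon with ⟨C₁, f, C₂, hC, hr, hvf, hvC⟩ | ⟨hno, -⟩
    · have hfill : fill C' (leaf e fl' k a b) =
          fill C₂ (Fr.fill f (fill C₁ (leaf e fl' k a b))) := by
        rw [hC, fill_append]; rfl
      have hv2 : v ∈ (fill C₁ (leaf e fl' k a b)).verts := by
        rw [mem_verts_iff]
        exact ⟨(e, a, b), (fill_leaves C₁ _).mem_iff.2 (by simp [leaves]), hvab⟩
      refine ⟨s1.adv (3 + n), C₂, Fr.fill f (fill C₁ (leaf e fl' k a b)), ?_, ?_, ?_, ?_, ?_, hvC,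
        ?_, ?_⟩
      · rw [hr, Fr.fill_addr]
      · exact (Mem.Same.adv s 1 _).trans (sp.same.trans (Mem.Same.adv _ _ _) fun _ h => h)
          fun _ h => h
      · rw [← hfill]; exact sp.ok.reads _
      · rw [← hfill]; exact sp.rearr
      · simp [hvf]
      · rw [Fr.fill, meets_mk]; exact ⟨hv2, hvf⟩
      · rw [← hfill]
        have h2 : (C₂.length : ℝ) + 1 ≤ C'.length := by
          rw [hC]; simp only [List.length_append, List.length_cons]
          push_cast; have : (0:ℝ) ≤ C₁.length := Nat.cast_nonneg _
          linarith
        have h3 : (n : ℝ) ≤ 20 * (C'.length + 1) := by exact_mod_cast hn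
        have h4 : c * C₂.length ≤ c * C.length := mul_le_mul_of_nonneg_left (by linarith) hc
        simp only [Mem.adv_time, Nat.cast_add]
        norm_num
        nlinarith
    · obtain ⟨g, hg, hvg⟩ := hdeg.1 hd
      exact (hno g hg hvg).elim
  · simp only [hd, decide_false, Bool.false_eq_true, if_false, run_pure]
    refine ⟨s1.adv 1, C', leaf e fl' k a b, rfl, ?_, sp.ok.reads 1, sp.rearr, hvt, ?_, trivial, ?_⟩
    · exact (Mem.Same.adv s 1 _).trans (sp.same.trans (Mem.Same.adv _ _ _) fun _ h => h)
          fun _ h => h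
    · intro g hg hvg
      exact hd (hdeg.2 ⟨g, hg, hvg⟩)
    · have h4 : c * C'.length ≤ c * C.length := mul_le_mul_of_nonneg_left hlen hc
      have : (0:ℝ) ≤ C.length := Nat.cast_nonneg _
      simp only [Mem.adv_time, Nat.cast_add]
      norm_num
      nlinarith

theorem rotateToPoint_spec {X : Set V} {v : V} (hvX : v ∉ X) (C : List (Fr V)) :
    ∀ {s : Mem V} {t : RTree V} (_ : Ok s X (fill C t)) (_ : (fill C t).count ≠ 2)
      (_ : v ∈ t.verts) (_ : ∀ g ∈ C, v ∉ g.sib.verts) (_ : t.Meets v),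
    ∃ s' C' t', (rotateToPoint t.addr).run s = some (t'.addr, s') ∧ s.Same s' (fill C t).addrs ∧
      Ok s' X (fill C' t') ∧ Rearr (fill C t) (fill C' t') ∧ v ∈ t'.verts ∧
      (∀ g ∈ C', v ∉ g.sib.verts) ∧ t'.Meets v ∧ t'.count ≠ 2 ∧ (fill C' t').count ≠ 2 ∧
      s'.time ≤ s.time + 160 * (C.length + 1) ∧
      (fill C' t').pot ≤ (fill C t).pot + rk (fill C t).size - rk t.size := by
  have halt : ∀ (C : List (Fr V)) {s : Mem V} {t : RTree V} (_ : Ok s X (fill C t))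
      (_ : (fill C t).count ≠ 2) (_ : v ∈ t.verts) (_ : ∀ g ∈ C, v ∉ g.sib.verts) (_ : t.Meets v),
      t.count ≠ 2 →
      ∃ s' C' t', (rotateToPoint t.addr).run s = some (t'.addr, s') ∧
      s.Same s' (fill C t).addrs ∧
      Ok s' X (fill C' t') ∧ Rearr (fill C t) (fill C' t') ∧ v ∈ t'.verts ∧
      (∀ g ∈ C', v ∉ g.sib.verts) ∧ t'.Meets v ∧ t'.count ≠ 2 ∧ (fill C' t').count ≠ 2 ∧
      s'.time ≤ s.time + 160 * (C.length + 1) ∧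
      (fill C' t').pot ≤ (fill C t).pot + rk (fill C t).size - rk t.size := by
    intro C s t h hroot hvt hvC hm hk
    refine ⟨s.adv 1, C, t, ?_, Mem.Same.adv _ _ _, h.reads 1, Rearr.refl _, hvt, hvC, hm, hk,
      hroot, by simp only [Mem.adv_time]; omega, ?_⟩
    · have h1 := fill_node h.holds
      have : (t.count == 2) = false := by simpa using hk
      rw [rotateToPoint]
      simp [run_bind, run_isPath, h1, rcd, this, run_pure]
    · have : rk t.size ≤ rk (fill C t).size := rk_mono (size_pos t) (by rw [fill_size]; omega)
      linarith
  induction C with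
  | nil =>
    intro s t h hroot hvt hvC hm
    exact halt [] h hroot hvt hvC hm hroot
  | cons f C ih =>
    intro s t h hroot hvt hvC hm
    by_cases hk : t.count = 2
    swap
    · exact halt _ h hroot hvt hvC hm hk
    have hw := h.wf.of_fill
    have hvO : v ∉ oC X (f :: C) := fun hO => by
      rcases mem_oC.1 hO with h | ⟨g, hg, h⟩
      exacts [hvX h, hvC g hg h]
    cases t with
    | leaf x fl k a b =>
      exfalso
      have hw' := h.wf.of_fill
      obtain ⟨hab, hk', -⟩ := hw
      have hk2 : k = 2 := hk
      obtain ⟨p, hp1, hp2, hpv⟩ := hw'.exists_ne hk v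
      obtain ⟨q, hq1, hq2, hqp⟩ := hw'.exists_ne hk p
      have hvq : v ≠ q := fun e => hvO (e ▸ hq2)
      have h1 : p = a ∨ p = b := hp1
      have h2 : q = a ∨ q = b := hq1
      have h3 : v = a ∨ v = b := hvt
      rcases h1 with rfl | rfl <;> rcases h2 with rfl | rfl <;> rcases h3 with rfl | rfl <;>
        simp_all
    | node x fl k l r =>
      have hk2 : k = 2 := hk
      subst hk2
      obtain ⟨hvl, hvr⟩ : v ∈ l.verts ∧ v ∈ r.verts := hm
      have h1 := fill_node h.holds
      have hHt := ((holds_fill ..).1 h.holds).1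
      have hnt := (List.nodup_append.1 ((fill_addrs _ _).nodup_iff.1 h.nodup)).1
      obtain ⟨s1, r1, t1, S1, H1⟩ := pushFlip_spec (σ := true) (s := s.adv 2)
        (x := x) (fl := fl) (k := 2) (p := l) (q := r) hHt hnt
      have hpushW : ∀ O : Set V, (RTree.mk x false 2 (true ^^ fl) (l.togIf fl) (r.togIf fl)).WF O ↔
        (node x fl 2 l r).WF O := fun O => wf_push (V := V) O x fl 2 true l r
      have hpushM : ∀ (O : Set V) τ w, (RTree.mk x false 2 (true ^^ fl) (l.togIf fl)
        (r.togIf fl)).Most O τ w ↔ (node x fl 2 l r).Most O τ w :=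
          fun O τ w => most_push (V := V) O τ x fl 2 true l r w
      have hR1 : Rearr (node x fl 2 l r)
          (RTree.mk x false 2 (true ^^ fl) (l.togIf fl) (r.togIf fl)) := by
        refine Rearr.trans (t' := RTree.mk x false 2 (true ^^ fl) l r) ?_
          (Rearr.node (Rearr.togIf _ _) (Rearr.togIf _ _))
        exact ⟨(mk_leaves ..).symm, (mk_inner ..).symm, mk_addr ..⟩
      have ok1 : Ok s1 X (fill (f :: C)
          (RTree.mk x false 2 (true ^^ fl) (l.togIf fl) (r.togIf fl))) := by
        refine ⟨Holds.replace h.holds h.nodup (fun n hn => S1.node n hn) H1 hR1.addr,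
          nodup_fill_of_rearr hR1 h.nodup, h.wf.replace hR1.verts ((hpushW _).2 hw)
            fun ρ _ w hw' => (hpushM _ _ _).2 hw'⟩
      -- the child on the same side
      obtain ⟨p, q, hpq, hvp, hvq, hsz, hmk⟩ : ∃ p q : RTree V,
          (Fr.fill ⟨x, false, 2, f.zero, q⟩ p) =
            RTree.mk x false 2 (true ^^ fl) (l.togIf fl) (r.togIf fl) ∧ v ∈ p.verts ∧
          v ∈ q.verts ∧ p.size + q.size = l.size + r.size ∧ p.pot + q.pot = l.pot + r.pot := by
        by_cases e : (true ^^ fl) = f.zero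
        · exact ⟨l.togIf fl, r.togIf fl, by rw [e]; rfl, by simpa, by simpa, by simp, by simp⟩
        · have e' : f.zero = !(true ^^ fl) := by
            revert e; cases f.zero <;> cases fl <;> simp
          refine ⟨r.togIf fl, l.togIf fl, ?_, by simpa, by simpa, by simp [add_comm], by
            simp [add_comm]⟩
          rw [Fr.fill, e', mk_swap]
      rw [← hpq] at ok1
      have h2 := fill_node (C := f :: C) (t := Fr.fill ⟨x, false, 2, f.zero, q⟩ p) ok1.holds
      rw [fr_rcd, Fr.fill_addr] at h2
      have hch := isChildZero_fill (C := C) (t := Fr.fill ⟨x, false, 2, f.zero, q⟩ p) ok1.holds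
        ok1.nodup 0
      rw [Fr.fill_addr] at hch
      have eF : fill [⟨x, false, 2, f.zero, q⟩, f] p = RTree.mk f.addr f.fl f.k (!f.zero) f.sib
          (RTree.mk x false 2 (!f.zero) q p) := by
        rw [mk_swap, mk_swap]; rfl
      have ok2 := ok1.reads 2
      rw [← fill_cons, show (⟨x, false, 2, f.zero, q⟩ : Fr V) :: f :: C =
        [⟨x, false, 2, f.zero, q⟩, f] ++ C from rfl, fill_append, eF] at ok2
      obtain ⟨s2, fz', fy', k', cb, ca, cx, r2, t2, S2, R2, ok3, -⟩ := rotateUp_ok ok2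
        (Or.inl ⟨by simp, Or.inl rfl⟩)
      set Z := RTree.mk f.addr fz' f.k (!f.zero ^^ f.fl) (RTree.mk x fy' k' (!f.zero ^^ f.fl)
        (f.sib.togIf cb) (q.togIf ca)) (p.togIf cx) with hZ
      have hRR : Rearr (fill (f :: C) (node x fl 2 l r)) (fill C Z) := by
        refine (hR1.fill (f :: C)).trans ?_
        rw [← hpq, ← fill_cons, show (⟨x, false, 2, f.zero, q⟩ : Fr V) :: f :: C =
          [⟨x, false, 2, f.zero, q⟩, f] ++ C from rfl, fill_append, eF]
        exact R2.fill C
      have hroot' : (fill C Z).count ≠ 2 := by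
        have e1 := ok3.wf.count_eq
        have e2 := h.wf.count_eq
        rw [hRR.verts] at e1
        rw [e1, ← e2]; exact hroot
      have hvZ : v ∈ Z.verts := by simp [hZ, hvp]
      obtain ⟨s3, C', t', r3, S3, ok4, R4, hv4, hvC4, hm4, hk4, hroot4, ht4, hp4⟩ := ih ok3 hroot'
        hvZ (fun g hg => hvC g (List.mem_cons_of_mem _ hg)) (by
          rw [hZ, meets_mk]; simp [hvp, hvq])
      refine ⟨s3, C', t', ?_, ?_, ok4, hRR.trans R4, hv4, hvC4, hm4, hk4, hroot4, ?_, ?_⟩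
      · change (rotateToPoint x).run s = _
        rw [rotateToPoint]
        have h1' : s.node x = some ⟨some f.addr, .internal l.addr r.addr, 2, fl⟩ := h1
        have hpa : (if f.zero = true then (if f.zero = true then p.addr else q.addr)
          else (if f.zero = true then q.addr else p.addr)) = p.addr := by cases f.zero <;> rfl
        have r1' : (pushFlip x).run (s.adv (1 + 1)) = some ((), s1) := r1
        have hch' : (isChildZero f.addr x).run s1 = some (f.zero, s1.adv 1) := hch
        have hg := run_getChildren (s := s1.adv 1) h2
        rw [show Z.addr = f.addr by simp [hZ]] at r3
        simp only [run_bind, run_isPath, h1', Option.bind_some, beq_self_eq_true, if_true,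
          run_getParent, Mem.adv_node, Mem.adv_adv, run_deref_some, r1', hch', hg, hpa,
          Nat.reduceAdd, r2]
        exact r3
      · refine (((Mem.Same.adv s 2 _).trans (S1.mono fun n hn => ?_) fun _ h => h).trans
          (((Mem.Same.adv s1 2 _).trans S2 fun n hn => hn).mono (B := (fill C Z).addrs)
            fun n hn => ?_) fun n hn => hRR.addrs.mem_iff.2 hn) |>.trans S3
              fun n hn => hRR.addrs.mem_iff.2 hn
        · exact (fill_addrs _ _).mem_iff.2 (List.mem_append_left _ hn)
        · rw [R2.addrs.mem_iff] at hn
          exact (fill_addrs _ _).mem_iff.2 (List.mem_append_left _ hn)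
      · simp only [Mem.adv_time, List.length_cons] at *; omega
      · have hs : (fill C Z).size = (fill (f :: C) (node x fl 2 l r)).size := hRR.size
        have hq1 : (fill C Z).pot = (fill (f :: C) (node x fl 2 l r)).pot +
            rk (f.sib.size + q.size) - rk (l.size + r.size) := by
          rw [fill_cons, fill_pot C, fill_pot C]
          have e1 : (Fr.fill f (node x fl 2 l r)).size = Z.size := by
            simp only [hZ, Fr.fill_size, mk_size, togIf_size, size]; omega
          rw [e1, hZ, mk_pot, mk_pot, Fr.fill, mk_pot]
          simp only [mk_size, togIf_size, togIf_pot, size, pot]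
          rw [show f.sib.size + q.size + p.size = l.size + r.size + f.sib.size by omega]
          linarith
        have hq2 : rk (f.sib.size + q.size) ≤ rk Z.size := by
          refine rk_mono (by have := size_pos q; omega) ?_
          simp only [hZ, mk_size, togIf_size]; omega
        rw [hs] at hp4
        have : (node x fl 2 l r).size = l.size + r.size := rfl
        rw [this]
        linarith

end TopTreeProg

namespace RTree
variable {V : Type}

/-- The tree with another number of boundary vertices stored at the root. -/
def setCount (k : ℕ) : RTree V → RTree V
  | leaf x fl _ a b => leaf x fl k a b
  | node x fl _ l r => node x fl k l r

@[simp] theorem setCount_addr (k) (t : RTree V) : (t.setCount k).addr = t.addr := by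
  cases t <;> rfl
@[simp] theorem setCount_count (k) (t : RTree V) : (t.setCount k).count = k := by
  cases t <;> rfl
@[simp] theorem setCount_verts (k) (t : RTree V) : (t.setCount k).verts = t.verts := by
  cases t <;> rfl
@[simp] theorem setCount_size (k) (t : RTree V) : (t.setCount k).size = t.size := by
  cases t <;> rfl
@[simp] theorem setCount_pot (k) (t : RTree V) : (t.setCount k).pot = t.pot := by
  cases t <;> rfl
theorem Rearr.setCount (k) (t : RTree V) : Rearr t (t.setCount k) := by
  cases t <;> exact ⟨.refl _, .refl _, rfl⟩
theorem setCount_rcd (k) (t : RTree V) (p) : (t.setCount k).rcd p = { t.rcd p with numBoundary := k } := by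
  cases t <;> rfl
theorem setCount_below (k) (h : ℕ → Option (NodeRec V)) (t : RTree V) :
    (t.setCount k).Below h ↔ t.Below h := by cases t <;> rfl
theorem fill_setCount (f : Fr V) (k) (t : RTree V) :
    (Fr.fill f t).setCount k = Fr.fill { f with k := k } t := by
  unfold Fr.fill
  cases f.zero <;> rfl

/-- All boundary counts on a path changed by `g`. -/
def bump (g : ℕ → ℕ) (C : List (Fr V)) : List (Fr V) := C.map fun f => { f with k := g f.k }

theorem setCount_wf {v : V} {t : RTree V} {A B : Set V} (hm : t.Meets v)
    (hAB : ∀ w, w ≠ v → (w ∈ A ↔ w ∈ B)) (h : t.WF A) (k : ℕ) (hk : k = (t.verts ∩ B).ncard)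
    (hk2 : k ≤ 2) : (t.setCount k).WF B := by
  cases t with
  | leaf x fl k' a b => exact ⟨h.1, hk, hk2⟩
  | node x fl k' l r =>
    obtain ⟨-, -, hl, hr, c, hc, h1, h2⟩ := h
    have e : ∀ S : Set V, v ∈ S → A ∪ S = B ∪ S := by
      intro S hS
      ext w
      by_cases e : w = v
      · subst e; simp [hS]
      · simp [hAB w e]
    rw [e _ hm.2] at hl h1
    rw [e _ hm.1] at hr h2
    exact ⟨hk, hk2, hl, hr, c, hc, h1, h2⟩

theorem setCount_most {v : V} {t : RTree V} {A B O' : Set V} (hm : t.Meets v) (h : t.WF O')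
    (hAB : ∀ w, w ≠ v → (w ∈ A ↔ w ∈ B)) {k : ℕ} {ρ : Bool} {d : V} (hd : d ≠ v)
    (hM : t.Most A ρ d) : (t.setCount k).Most B ρ d := by
  have hd' := hAB d hd
  cases t with
  | leaf x fl k' a b =>
    rcases hM with hM | hM
    · exact Or.inl ⟨hd'.1 hM.1, hM.2⟩
    · exact hM.2.elim
  | node x fl k' l r =>
    rcases hM with hM | hM
    · exact Or.inl ⟨hd'.1 hM.1, hM.2⟩
    · obtain ⟨-, -, -, -, c, hc, -⟩ := h
      have h1 : d ∈ l.verts ∩ r.verts := hM.2.2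
      have h2 : v ∈ l.verts ∩ r.verts := hm
      rw [hc] at h1 h2
      exact (hd (h1.trans h2.symm)).elim

theorem Most.erase {v : V} {t : RTree V} {A : Set V} {ρ : Bool} {d : V} (hd : d ≠ v)
    (h : t.Most A ρ d) : t.Most (A \ {v}) ρ d := by
  have key : ∀ w, t.Side (A \ {v}) ρ w → t.Side A ρ w := by
    intro w; cases t <;> simp only [Side, Set.mem_sdiff] <;> tauto
  rcases h with h | ⟨h, h'⟩
  · left
    cases t <;> simp only [Side, Set.mem_sdiff, Set.mem_singleton_iff] at h ⊢ <;> tauto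
  · refine Or.inr ⟨fun ⟨w, hw⟩ => h ⟨w, key w hw⟩, ?_⟩
    cases t <;> simp only [Mid, Set.mem_sdiff, Set.mem_singleton_iff] at h' ⊢ <;> tauto

theorem fr_wf_change {v : V} {f : Fr V} {t t' : RTree V} {A B : Set V} (hvt : v ∈ t.verts)
    (hvf : v ∉ f.sib.verts) (hAB : ∀ w, w ≠ v → (w ∈ A ↔ w ∈ B)) (h : (Fr.fill f t).WF A)
    (hv : t'.verts = t.verts) (h' : t'.WF (B ∪ f.sib.verts))
    (hm : ∀ ρ d, d ≠ v → t.Most (A ∪ f.sib.verts) ρ d → t'.Most (B ∪ f.sib.verts) ρ d)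
    (k : ℕ) (hk : k = ((t.verts ∪ f.sib.verts) ∩ B).ncard) (hk2 : k ≤ 2) :
    (Fr.fill { f with k := k } t').WF B := by
  rw [Fr.fill, wf_mk] at h ⊢
  obtain ⟨-, -, h1, h2, c, hc, h3, h4⟩ := h
  have e : A ∪ t.verts = B ∪ t.verts := by
    ext w
    by_cases e : w = v
    · subst e; simp [hvt]
    · simp [hAB w e]
  have hc' : c ∈ t.verts ∩ f.sib.verts := hc ▸ rfl
  rw [hv, ← e]
  exact ⟨hk, hk2, h', h2, c, hc, hm _ _ (fun e => hvf (e ▸ hc'.2)) h3, h4⟩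

theorem ncard_erase {v : V} {S A : Set V} (hv : v ∈ S) (hA : v ∈ A) :
    (S ∩ A).ncard - 1 = (S ∩ (A \ {v})).ncard := by
  have h : v ∈ S ∩ A := ⟨hv, hA⟩
  rw [← Set.inter_sdiff_assoc, Set.ncard_sdiff_singleton_of_mem h]

theorem ncard_insert {v : V} {S A : Set V} (hS : S.Finite) (hv : v ∈ S) (hA : v ∉ A) :
    (S ∩ A).ncard + 1 = (S ∩ insert v A).ncard := by
  rw [Set.inter_insert_of_mem hv, Set.ncard_insert_of_notMem (fun h => hA h.2)
    (hS.inter_of_left A)]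

theorem oC_insert (v : V) (O : Set V) (C : List (Fr V)) :
    oC (insert v O) C = insert v (oC O C) := by
  ext w
  simp only [mem_oC, Set.mem_insert_iff, or_assoc]

/-- Unmarking an exposed vertex, above the consuming node. -/
theorem erase_fill {v : V} {O : Set V} (hvO : v ∈ O) (C : List (Fr V)) :
    ∀ {t t' : RTree V} (_ : (fill C t).WF O) (_ : v ∈ t.verts) (_ : ∀ g ∈ C, v ∉ g.sib.verts)
      (_ : t'.verts = t.verts) (_ : t'.WF (oC O C \ {v}))
      (_ : ∀ ρ d, d ≠ v → t.Most (oC O C) ρ d → t'.Most (oC O C \ {v}) ρ d),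
      (fill (bump (· - 1) C) t').WF (O \ {v}) := by
  induction C with
  | nil => intro t t' h hvt hvC hv h' hm; exact h'
  | cons f C ih =>
    intro t t' h hvt hvC hv h' hm
    have hf := hvC f (by simp)
    have hw := WF.of_fill (C := C) (t := Fr.fill f t) h
    have hO : v ∈ oC O C := mem_oC.2 (Or.inl hvO)
    have e : oC O (f :: C) \ {v} = (oC O C \ {v}) ∪ f.sib.verts := by
      ext w
      simp only [oC, Set.mem_sdiff, Set.mem_union, Set.mem_singleton_iff]
      by_cases e : w = v
      · subst e; simp [hf]
      · simp [e]
    rw [e] at h' hm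
    have hk := hw.count_eq
    have hk2 := hw.count_le
    rw [Fr.fill_count, Fr.fill_verts] at hk
    rw [Fr.fill_count] at hk2
    refine ih (t := Fr.fill f t) (t' := Fr.fill { f with k := f.k - 1 } t') h (by simp [hvt])
      (fun g hg => hvC g (by simp [hg])) (by simp [hv]) ?_ ?_
    · refine fr_wf_change hvt hf ?_ hw hv h' hm _ ?_ (by omega)
      · intro w hw; simp [hw]
      · rw [hk, ncard_erase (S := t.verts ∪ f.sib.verts) (Or.inl hvt) hO]
    · intro ρ d hd hM
      have := (hM.erase hd)
      refine fr_most_congr { f with k := f.k - 1 } hv ρ d ?_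
      rw [Fr.fill, most_mk] at this ⊢
      exact this

end RTree

namespace TopTreeProg
open RTree
variable {V : Type}

theorem isP_false {t : RTree V} (h : t.count ≠ 2) : t.isP = false := by simpa [isP] using h

/-- If nothing is to do on a path between two point clusters, it is short. -/
theorem irred_points {C : List (Fr V)} {t : RTree V} (h : irred (types C t) = true)
    (h0 : t.count ≠ 2) (hr : (fill C t).count ≠ 2) : C.length ≤ 1 := by
  have h0' := isP_false h0
  rcases C with - | ⟨f₁, - | ⟨f₂, - | ⟨f₃, - | ⟨f₄, C⟩⟩⟩⟩
  · simp
  · simp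
  · simp only [fill_cons, fill_nil, Fr.fill_count] at hr
    simp only [types, List.map, h0', irred] at h
    simp at h; exact (hr h).elim
  · simp only [fill_cons, fill_nil, Fr.fill_count] at hr
    simp only [types, List.map, h0', irred, redex] at h
    have : (f₃.k == 2) = false := by simpa using hr
    rw [this] at h
    revert h
    cases (f₁.k == 2) <;> cases (f₂.k == 2) <;> simp
  · exfalso
    simp only [types, List.map, h0', irred, redex] at h
    revert h
    cases (f₁.k == 2) <;> cases (f₂.k == 2) <;> cases (f₃.k == 2) <;> cases (f₄.k == 2) <;> simp

theorem setNumBoundary_ok {s : Mem V} {C : List (Fr V)} {t : RTree V}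
    (h : Holds s.node none (fill C t)) (hn : (fill C t).addrs.Nodup) (k : ℕ) :
    (setNumBoundary t.addr k).run s = some ((), (s.adv 2).upd t.addr ((t.setCount k).rcd (par C))) ∧
    Holds ((s.adv 2).upd t.addr ((t.setCount k).rcd (par C))).node none (fill C (t.setCount k)) := by
  have h1 := fill_node h
  refine ⟨?_, ?_⟩
  · rw [run_setNumBoundary, h1, setCount_rcd]; rfl
  · have hb := ((holds_iff ..).1 ((holds_fill ..).1 h).1).2
    have hnt := (List.nodup_append.1 ((fill_addrs _ _).nodup_iff.1 hn)).1
    rw [addrs_eq, List.nodup_cons] at hnt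
    refine Holds.replace h hn (fun n hn => ?_) ((holds_iff ..).2 ⟨?_, ?_⟩) (by simp)
    · rw [Mem.upd_node, if_neg (fun e => hn (by rw [e]; exact addr_mem t))]; rfl
    · rw [setCount_addr, Mem.upd_node, if_pos rfl]
    · rw [setCount_below]
      refine hb.congr fun n hn => ?_
      rw [Mem.upd_node, if_neg (by rintro rfl; exact hnt.1 hn)]; rfl

/-- A program that applies `g` to the boundary counts on the path to the root. -/
theorem bumpPath_spec {g : ℕ → ℕ} {P : ℕ → Prog V ℕ}
    (hP : ∀ x, P x = do
      setNumBoundary x (g (← getNumBoundary x))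
      match ← getParent x with
      | some parent => P parent
      | none => return x) (C : List (Fr V)) :
    ∀ {s : Mem V} {t : RTree V} (_ : Holds s.node none (fill C t)) (_ : (fill C t).addrs.Nodup),
    ∃ s', (P t.addr).run s = some ((fill C t).addr, s') ∧ s.Same s' (fill C t).addrs ∧
      s'.time ≤ s.time + 4 * (C.length + 1) ∧
      Holds s'.node none (fill (bump g C) (t.setCount (g t.count))) := by
  induction C with
  | nil =>
    intro s t h hn
    have h1 := fill_node h
    obtain ⟨r, H⟩ := setNumBoundary_ok (s := s.adv 1) h hn (g t.count)
    refine ⟨(((s.adv 1).adv 2).upd t.addr ((t.setCount (g t.count)).rcd (par []))).adv 1,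
      ?_, ?_, by simp, H⟩
    · have h2 := fill_node H
      rw [setCount_addr] at h2
      rw [hP, run_bind, run_getNumBoundary, h1]
      simp only [Option.bind_some, rcd] at r ⊢
      rw [run_bind, r]
      simp only [run_bind, run_getParent, Option.bind_some]
      simp only [rcd] at h2
      rw [h2]
      simp [par, run_pure]
    · refine ⟨fun n hn => ?_, rfl, rfl, rfl⟩
      rw [Mem.adv_node, Mem.upd_node, if_neg]
      · rfl
      · rintro rfl; exact hn (addr_mem t)
  | cons f C ih =>
    intro s t h hn
    have h1 := fill_node h
    obtain ⟨r, H⟩ := setNumBoundary_ok (s := s.adv 1) h hn (g t.count)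
    have hn' : (fill C (Fr.fill f (t.setCount (g t.count)))).addrs.Nodup :=
      nodup_fill_of_rearr (C := f :: C) (Rearr.setCount _ _) hn
    obtain ⟨s', r', S', ht', H'⟩ := ih (s := (((s.adv 1).adv 2).upd t.addr
      ((t.setCount (g t.count)).rcd (par (f :: C)))).adv 1) H hn'
    have hR : Rearr (fill (f :: C) t) (fill (f :: C) (t.setCount (g t.count))) :=
      (Rearr.setCount _ _).fill _
    refine ⟨s', ?_, ?_, ?_, ?_⟩
    · have h2 := fill_node H
      rw [setCount_addr] at h2
      rw [hP, run_bind, run_getNumBoundary, h1]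
      simp only [Option.bind_some, rcd] at r ⊢
      rw [run_bind, r]
      simp only [run_bind, run_getParent, Option.bind_some]
      simp only [rcd] at h2
      rw [h2]
      rw [Fr.fill_addr] at r'
      simp only [par, Option.bind_some]
      refine Eq.trans ?_ (r'.trans ?_)
      · rfl
      · rw [← hR.addr]; rfl
    · refine Mem.Same.trans (s' := (((s.adv 1).adv 2).upd t.addr
        ((t.setCount (g t.count)).rcd (par (f :: C)))).adv 1) ⟨fun n hn => ?_, rfl, rfl, rfl⟩ S' ?_
      · rw [Mem.adv_node, Mem.upd_node, if_neg]
        · rfl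
        · rintro rfl
          exact hn ((fill_addrs _ _).mem_iff.2 (List.mem_append_left _ (addr_mem t)))
      · intro n hn; exact hR.addrs.mem_iff.2 hn
    · simp only [Mem.adv_time, Mem.upd_time, List.length_cons] at ht' ⊢; omega
    · rw [fill_setCount] at H'
      rw [Fr.fill_count] at H'
      exact H'

theorem bump_fill (g : ℕ → ℕ) (C : List (Fr V)) (t t' : RTree V) (h : Rearr t t') :
    Rearr (fill C t) (fill (bump g C) t') := by
  induction C generalizing t t' with
  | nil => exact h
  | cons f C ih => exact ih _ _ (Rearr.node h (Rearr.refl _))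

theorem bump_pot (g : ℕ → ℕ) (C : List (Fr V)) (t : RTree V) (k : ℕ) :
    (fill (bump g C) (t.setCount k)).pot = (fill C t).pot := by
  have : ∀ n, sibPot (bump g C) = sibPot C ∧ pathPot (bump g C) n = pathPot C n := by
    induction C with
    | nil => intro n; exact ⟨rfl, rfl⟩
    | cons f C ih =>
      intro n
      have h := ih (n + f.sib.size)
      refine ⟨?_, ?_⟩
      · simp only [bump, List.map_cons, sibPot] at h ⊢; rw [h.1]
      · simp only [bump, List.map_cons, pathPot] at h ⊢; rw [h.2]
  rw [fill_pot, fill_pot, (this t.size).1, setCount_size, (this t.size).2, setCount_pot]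

/-- The result of `expose` or `deexpose` in one top tree. -/
structure MarkOk [DecidableEq V] (K B : ℝ) (s s' : Mem V) (v : V) (m : Bool) (X : Set V)
    (τ τ' : RTree V) : Prop where
  ok : Ok s' X τ'
  rearr : Rearr τ τ'
  node : ∀ n, n ∉ τ.addrs → s'.node n = s.node n
  exposed : s'.exposed = Function.update s.exposed v m
  incident : s'.incident = s.incident
  next : s'.next = s.next
  cost : (s'.time : ℝ) - s.time + K * (τ'.pot - τ.pot) ≤ B * (1 + rk τ.size)

theorem SplayOk.sibs {s s' : Mem V} {O : Set V} {C C' : List (Fr V)} {t t' : RTree V}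
    (h : SplayOk s s' O C t C' t') {v : V} (hv : ∀ g ∈ C, v ∉ g.sib.verts) :
    ∀ g ∈ C', v ∉ g.sib.verts := by
  have h1 := (fill_leaves C t).symm.trans (h.rearr.leaves.trans (fill_leaves C' t'))
  have h2 : t'.leaves = t.leaves := by rcases h.tog with e | e <;> simp [e, toggle_leaves]
  rw [h2, List.perm_append_left_iff] at h1
  intro g hg hvg
  obtain ⟨e, he, hve⟩ := (mem_verts_iff _ _).1 hvg
  obtain ⟨g', hg', he'⟩ := List.mem_flatMap.1 (h1.mem_iff.2 (List.mem_flatMap.2 ⟨g, hg, he⟩))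
  exact hv g' hg' ((mem_verts_iff _ _).2 ⟨e, he', hve⟩)

theorem run_setExposed [DecidableEq V] (v : V) (b : Bool) (s : Mem V) :
    (setExposed v b).run s =
      some ((), { s.adv 1 with exposed := Function.update s.exposed v b }) := rfl

theorem expose_local [DecidableEq V] {K : ℝ} (hK : 7200 ≤ K) {s : Mem V} {X : Set V}
    {τ : RTree V} (h : Ok s X τ) (hv : VertOk s X τ) {v : V} (hvτ : v ∈ τ.verts) (hvX : v ∉ X)
    (hX : (τ.verts ∩ X).Subsingleton) :
    ∃ s' τ', (expose v).run s = some (some τ.addr, s') ∧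
      MarkOk K (16000 + 100 * K) s s' v true (insert v X) τ τ' := by
  have hroot : ∀ {τ'}, Rearr τ τ' → τ'.WF X → τ'.count ≠ 2 := by
    intro τ' hR hw
    rw [hw.count_eq, hR.verts]
    have := (Set.ncard_le_one (τ.verts_finite.inter_of_left X)).2 fun a ha b hb => hX ha hb
    omega
  obtain ⟨s1, C1, t1, r1, S1, ok1, R1, hv1, hC1, hm1, c1⟩ := findConsumingNode_spec (c := 160)
    (K := K) (by norm_num) (by linarith) h hv hvτ
  obtain ⟨s2, C2, t2, r2, S2, ok2, R2, hv2, hC2, hm2, hk2, hr2, ht2, hp2⟩ := rotateToPoint_spec hvX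
    C1 ok1 (hroot R1 ok1.wf) hv1 hC1 hm1
  obtain ⟨s3, C3, t3, r3, sp, hi, c3⟩ := fullSplay_spec hK C2 ok2
  obtain ⟨hv3, hk3, ha3, hm3⟩ := fill_tog_verts sp.tog
  have R3 : Rearr τ (fill C3 t3) := (R1.trans R2).trans sp.rearr
  have hr3 := hroot R3 sp.ok.wf
  have hl := irred_points hi (by rw [hk3]; exact hk2) hr3
  have hvC3 := sp.sibs hC2
  obtain ⟨s4, r4, S4, ht4, H4⟩ := bumpPath_spec (g := (· + 1)) (P := incrementPath)
    (fun x => by rw [incrementPath]) C3 sp.ok.holds sp.ok.nodup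
  have R4 : Rearr τ (fill (bump (· + 1) C3) (t3.setCount (t3.count + 1))) :=
    R3.trans (bump_fill _ _ _ _ (Rearr.setCount _ _))
  have hvt : v ∈ t3.verts := hv3 ▸ hv2
  have hw3 := sp.ok.wf.of_fill
  have hvO : v ∉ oC X C3 := fun hO => by
    rcases mem_oC.1 hO with h | ⟨g, hg, h⟩
    exacts [hvX h, hvC3 g hg h]
  have hins : ∀ (A : Set V) w, w ≠ v → (w ∈ A ↔ w ∈ insert v A) := by
    intro A w hw; simp [hw]
  have hw4 : (t3.setCount (t3.count + 1)).WF (oC (insert v X) C3) := by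
    rw [oC_insert]
    refine setCount_wf ((hm3 v).2 hm2) (hins _) hw3 _ ?_ ?_
    · rw [← ncard_insert t3.verts_finite hvt hvO, ← hw3.count_eq]
    · have := hw3.count_le; omega
  have hM4 : ∀ ρ d, d ≠ v → t3.Most (oC X C3) ρ d →
      (t3.setCount (t3.count + 1)).Most (oC (insert v X) C3) ρ d := by
    intro ρ d hd hM
    rw [oC_insert]
    exact setCount_most ((hm3 v).2 hm2) hw3 (hins _) hd hM
  have hW : (fill (bump (· + 1) C3) (t3.setCount (t3.count + 1))).WF (insert v X) := by
    rcases C3 with - | ⟨f, - | ⟨f', C⟩⟩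
    · exact hw4
    · have hwf := sp.ok.wf
      have hk := hwf.count_eq
      have hk2 := hwf.count_le
      simp only [fill_cons, fill_nil, Fr.fill_count, Fr.fill_verts] at hk hk2 hr3
      refine fr_wf_change hvt (hvC3 f (by simp)) (hins X) hwf (by simp) hw4 hM4 (f.k + 1) ?_
        (by omega)
      rw [hk, ncard_insert (t3.verts_finite.union f.sib.verts_finite) (Or.inl hvt) hvX]
    · simp at hl
  refine ⟨{ s4.adv 1 with exposed := Function.update s4.exposed v true }, _, ?_,
    ⟨⟨H4, (R4.addrs.nodup_iff.1 h.nodup), hW⟩, R4, ?_, ?_, ?_, ?_, ?_⟩⟩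
  · rw [ha3] at r4
    rw [expose, run_bind, r1, Option.bind_some]
    simp only [run_bind, r2, r3, r4, Option.bind_some, run_setExposed, run_pure]
    rw [R3.addr]
  · intro n hn
    have e1 := S1.node n hn
    have e2 := S2.node n (fun h => hn (R1.addrs.mem_iff.2 h))
    have e3 := sp.same.node n (fun h => hn ((R1.trans R2).addrs.mem_iff.2 h))
    have e4 := S4.node n (fun h => hn (R3.addrs.mem_iff.2 h))
    exact e4.trans (e3.trans (e2.trans e1))
  · simp only [S4.exposed, sp.same.exposed, S2.exposed, S1.exposed]
  · simp only [Mem.adv_incident, S4.incident, sp.same.incident, S2.incident, S1.incident]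
  · simp only [Mem.adv_next, S4.next, sp.same.next, S2.next, S1.next]
  · have hs1 := R1.size
    have hs2 := (R1.trans R2).size
    rw [hs1] at hp2
    rw [hs2] at c3
    rw [bump_pot]
    have hN := rk_nonneg τ.size
    have h1 := rk_nonneg t1.size
    have h2 : (s2.time : ℝ) ≤ s1.time + 160 * (C1.length + 1) := by exact_mod_cast ht2
    have h4 : (s4.time : ℝ) ≤ s3.time + 4 * (C3.length + 1) := by exact_mod_cast ht4
    have h5 : (C3.length : ℝ) ≤ 1 := by exact_mod_cast hl
    have h6 : K * ((fill C2 t2).pot - (fill C1 t1).pot) ≤ K * rk τ.size :=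
      mul_le_mul_of_nonneg_left (by linarith) (by linarith)
    have h7 : 0 ≤ K * rk τ.size := mul_nonneg (by linarith) hN
    simp only [Mem.adv_time, Nat.cast_add]
    norm_num
    nlinarith

theorem deexpose_local [DecidableEq V] {K : ℝ} (hK : 7200 ≤ K) {s : Mem V} {X : Set V}
    {τ : RTree V} (h : Ok s X τ) (hv : VertOk s X τ) {v : V} (hvτ : v ∈ τ.verts) (hvX : v ∈ X) :
    ∃ s' τ', (deexpose v).run s = some (some τ.addr, s') ∧
      MarkOk K (16000 + 100 * K) s s' v false (X \ {v}) τ τ' := by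
  obtain ⟨s3, C3, t3, r3, S3, ok3, R3, hvt, hvC3, hm3, c3⟩ := findConsumingNode_spec (c := 160)
    (K := K) (by norm_num) (by linarith) h hv hvτ
  obtain ⟨s4, r4, S4, ht4, H4⟩ := bumpPath_spec (g := (· - 1)) (P := decrementPath)
    (fun x => by rw [decrementPath]) C3 ok3.holds ok3.nodup
  have R4 : Rearr τ (fill (bump (· - 1) C3) (t3.setCount (t3.count - 1))) :=
    R3.trans (bump_fill _ _ _ _ (Rearr.setCount _ _))
  have hw3 := ok3.wf.of_fill
  have hvO : v ∈ oC X C3 := mem_oC.2 (Or.inl hvX)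
  have hins : ∀ (A : Set V) w, w ≠ v → (w ∈ A ↔ w ∈ A \ {v}) := by
    intro A w hw; simp [hw]
  have hw4 : (t3.setCount (t3.count - 1)).WF (oC X C3 \ {v}) := by
    refine setCount_wf hm3 (hins _) hw3 _ ?_ ?_
    · rw [← ncard_erase hvt hvO, ← hw3.count_eq]
    · have := hw3.count_le; omega
  have hW : (fill (bump (· - 1) C3) (t3.setCount (t3.count - 1))).WF (X \ {v}) :=
    erase_fill hvX C3 ok3.wf hvt hvC3 (by simp) hw4 fun ρ d hd hM =>
      setCount_most hm3 hw3 (hins _) hd hM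
  refine ⟨{ s4.adv 1 with exposed := Function.update s4.exposed v false }, _, ?_,
    ⟨⟨H4, (R4.addrs.nodup_iff.1 h.nodup), hW⟩, R4, ?_, ?_, ?_, ?_, ?_⟩⟩
  · rw [deexpose, run_bind, r3, Option.bind_some]
    simp only [run_bind, r4, Option.bind_some, run_setExposed, run_pure]
    rw [R3.addr]
  · intro n hn
    exact (S4.node n (fun h => hn (R3.addrs.mem_iff.2 h))).trans (S3.node n hn)
  · simp only [S4.exposed, S3.exposed]
  · simp only [Mem.adv_incident, S4.incident, S3.incident]
  · simp only [Mem.adv_next, S4.next, S3.next]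
  · rw [bump_pot]
    have hN := rk_nonneg τ.size
    have h4 : (s4.time : ℝ) ≤ s3.time + 4 * (C3.length + 1) := by exact_mod_cast ht4
    have h7 : 0 ≤ K * rk τ.size := mul_nonneg (by linarith) hN
    have h0 : (0 : ℝ) ≤ C3.length := Nat.cast_nonneg _
    simp only [Mem.adv_time, Nat.cast_add]
    norm_num
    nlinarith

/-- Marking an isolated vertex. -/
theorem expose_isolated [DecidableEq V] {s : Mem V} {v : V} (h : s.incident v = []) :
    (expose v).run s =
      some (none, { s.adv 2 with exposed := Function.update s.exposed v true }) := by
  rw [expose, run_bind, findConsumingNode, run_bind, run_anyEdge, h]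
  rfl

theorem deexpose_isolated [DecidableEq V] {s : Mem V} {v : V} (h : s.incident v = []) :
    (deexpose v).run s =
      some (none, { s.adv 2 with exposed := Function.update s.exposed v false }) := by
  rw [deexpose, run_bind, findConsumingNode, run_bind, run_anyEdge, h]
  rfl

end TopTreeProg

namespace TopTree
variable {V : Type}

@[simp] theorem mirror_mirror (t : TopTree V) : t.mirror.mirror = t := by
  induction t with
  | leaf => rfl
  | node x l r hl hr => simp [mirror, hl, hr]
@[simp] theorem mirror_addr (t : TopTree V) : t.mirror.addr = t.addr := by cases t <;> rfl
@[simp] theorem mirror_cluster (t : TopTree V) : t.mirror.cluster = t.cluster := by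
  induction t with
  | leaf x a b => simp [mirror, cluster, Sym2.eq_swap]
  | node x l r hl hr => simp [mirror, cluster, hl, hr, Set.union_comm]
@[simp] theorem mirror_verts (t : TopTree V) : t.mirror.verts = t.verts := by
  induction t with
  | leaf x a b => simp [mirror, verts, Set.pair_comm]
  | node x l r hl hr => simp [mirror, verts, hl, hr, Set.union_comm]
@[simp] theorem mirror_numLeaves (t : TopTree V) : t.mirror.numLeaves = t.numLeaves := by
  induction t with
  | leaf x a b => rfl
  | node x l r hl hr => simp [mirror, numLeaves, hl, hr, Nat.add_comm]
@[simp] theorem mirror_potential (t : TopTree V) : t.mirror.potential = t.potential := by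
  induction t with
  | leaf x a b => rfl
  | node x l r hl hr =>
    simp only [potential, mirror, subtrees, List.map_cons, List.map_append, List.sum_cons,
      List.sum_append] at *
    rw [hl, hr, add_comm (List.sum _)]
    simp [numLeaves, Nat.add_comm]
theorem mirror_subtrees (t : TopTree V) : t.mirror.subtrees.Perm (t.subtrees.map mirror) := by
  induction t with
  | leaf x a b => exact .refl _
  | node x l r hl hr =>
    simp only [mirror, subtrees, List.map_cons, List.map_append]
    exact ((hr.append hl).trans List.perm_append_comm).cons _

section
variable (G : SimpleGraph V) (X : Set V)

@[simp] theorem mirror_boundary (t : TopTree V) : t.mirror.boundary G X = t.boundary G X := by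
  simp [boundary]
theorem mirror_isLeft (t : TopTree V) (v : V) :
    t.mirror.IsLeftBoundary G X v ↔ t.IsRightBoundary G X v := by
  unfold IsLeftBoundary IsRightBoundary
  rw [mirror_boundary]
  cases t <;> simp [mirror, and_comm]
theorem mirror_isRight (t : TopTree V) (v : V) :
    t.mirror.IsRightBoundary G X v ↔ t.IsLeftBoundary G X v := by
  rw [← mirror_isLeft, mirror_mirror]
theorem mirror_isMiddle (t : TopTree V) (v : V) :
    t.mirror.IsMiddleBoundary G X v ↔ t.IsMiddleBoundary G X v := by
  unfold IsMiddleBoundary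
  rw [mirror_boundary]
  cases t <;> simp [mirror, and_comm]
theorem mirror_isLeftmost (t : TopTree V) (v : V) :
    t.mirror.IsLeftmostBoundary G X v ↔ t.IsRightmostBoundary G X v := by
  simp only [IsLeftmostBoundary, IsRightmostBoundary, mirror_isLeft, mirror_isMiddle]
theorem mirror_isRightmost (t : TopTree V) (v : V) :
    t.mirror.IsRightmostBoundary G X v ↔ t.IsLeftmostBoundary G X v := by
  simp only [IsLeftmostBoundary, IsRightmostBoundary, mirror_isRight, mirror_isMiddle]
theorem mirror_isOriented (t : TopTree V) : t.mirror.IsOriented G X ↔ t.IsOriented G X := by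
  cases t with
  | leaf => rfl
  | node x l r =>
    simp only [mirror, IsOriented, mirror_verts, mirror_isRightmost, mirror_isLeftmost,
      Set.inter_comm r.verts]
    exact exists_congr fun c => and_congr_right fun _ => and_comm
theorem mirror_isValid (t : TopTree V) : t.mirror.IsValidCluster G X ↔ t.IsValidCluster G X := by
  have key : ∀ t : TopTree V, t.IsValidCluster G X → t.mirror.IsValidCluster G X := by
    intro t h
    refine ⟨by simpa using h.1, by simpa using h.2, by simpa using h.3, ?_⟩
    have h4 := h.4
    cases t with
    | leaf => trivial
    | node x l r => simpa [mirror] using h4.symm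
  exact ⟨fun h => by simpa using key _ h, key t⟩
end

/-- All invariants of one cluster. -/
structure Inv (G : SimpleGraph V) (X : Set V) (s : Mem V) (c : TopTree V) : Prop where
  valid : c.IsValidCluster G X
  oriented : c.IsOriented G X
  count : ∀ r, s.node c.addr = some r → r.numBoundary = (c.boundary G X).ncard

theorem mirror_inv (G : SimpleGraph V) (X : Set V) (s : Mem V) (c : TopTree V) :
    c.mirror.Inv G X s ↔ c.Inv G X s := by
  have key : ∀ c : TopTree V, c.Inv G X s → c.mirror.Inv G X s := fun c h =>
    ⟨(mirror_isValid ..).2 h.1, (mirror_isOriented ..).2 h.2, by simpa using h.3⟩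
  exact ⟨fun h => by simpa using key _ h, key c⟩

theorem forall_mirror {P : TopTree V → Prop} (hP : ∀ c : TopTree V, P c.mirror ↔ P c)
    (t : TopTree V) : (∀ c ∈ t.mirror.subtrees, P c) ↔ ∀ c ∈ t.subtrees, P c := by
  simp only [(mirror_subtrees t).mem_iff, List.mem_map]
  constructor
  · exact fun h c hc => (hP c).1 (h _ ⟨c, hc, rfl⟩)
  · rintro h _ ⟨c, hc, rfl⟩
    exact (hP c).2 (h c hc)

theorem exists_of_mem_verts {t : TopTree V} {v : V} (h : v ∈ t.verts) :
    ∃ e ∈ t.cluster, v ∈ e := by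
  induction t with
  | leaf x a b => exact ⟨s(a, b), rfl, by simpa [verts] using h⟩
  | node x l r hl hr =>
    rcases h with h | h
    · obtain ⟨e, h1, h2⟩ := hl h; exact ⟨e, Or.inl h1, h2⟩
    · obtain ⟨e, h1, h2⟩ := hr h; exact ⟨e, Or.inr h1, h2⟩

theorem mem_verts_of_mem {t : TopTree V} {e : Sym2 V} {v : V} (h : e ∈ t.cluster) (hv : v ∈ e) :
    v ∈ t.verts := by
  induction t with
  | leaf x a b => obtain rfl : e = s(a, b) := h; simpa [verts] using hv
  | node x l r hl hr =>
    rcases h with h | h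
    · exact Or.inl (hl h)
    · exact Or.inr (hr h)

end TopTree

namespace RTree
variable {V : Type}
open TopTree (mirrorIf)

/-- The top tree with all flip bits carried out. -/
def view : RTree V → TopTree V
  | leaf x fl _ a b => (TopTree.leaf x a b).mirrorIf fl
  | node x fl _ l r => (TopTree.node x l.view r.view).mirrorIf fl

theorem view_node_cases (x fl k) (l r : RTree V) :
    (node x fl k l r).view = TopTree.node x l.view r.view ∨
    (node x fl k l r).view = (TopTree.node x l.view r.view).mirror := by
  cases fl
  · exact Or.inl rfl
  · exact Or.inr rfl

@[simp] theorem view_addr (t : RTree V) : t.view.addr = t.addr := by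
  cases t with
  | leaf x fl => cases fl <;> rfl
  | node x fl => cases fl <;> rfl
@[simp] theorem view_verts (t : RTree V) : t.view.verts = t.verts := by
  induction t with
  | leaf x fl k a b => cases fl <;> simp [view, mirrorIf, TopTree.verts, verts]
  | node x fl k l r hl hr => cases fl <;> simp [view, mirrorIf, TopTree.verts, verts, hl, hr]
@[simp] theorem view_numLeaves (t : RTree V) : t.view.numLeaves = t.size := by
  induction t with
  | leaf x fl k a b => cases fl <;> rfl
  | node x fl k l r hl hr => cases fl <;> simp [view, mirrorIf, TopTree.numLeaves, size, hl, hr]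
@[simp] theorem view_potential (t : RTree V) : t.view.potential = t.pot := by
  induction t with
  | leaf x fl k a b => cases fl <;> simp [view, mirrorIf, TopTree.potential, TopTree.subtrees,
      TopTree.mirror, TopTree.numLeaves, pot]
  | node x fl k l r hl hr =>
    have : (TopTree.node x l.view r.view).potential = (node x fl k l r).pot := by
      rw [TopTree.potential, TopTree.subtrees, List.map_cons, List.map_append, List.sum_cons,
        List.sum_append]
      simp only [TopTree.potential] at hl hr
      rw [hl, hr]
      simp [TopTree.numLeaves, pot, rk]
    rcases view_node_cases x fl k l r with e | e <;> rw [e]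
    · exact this
    · rw [TopTree.mirror_potential, this]

theorem view_cluster (t : RTree V) :
    t.view.cluster = {e | ∃ p ∈ t.leaves, e = s(p.2.1, p.2.2)} := by
  induction t with
  | leaf x fl k a b =>
    have : (TopTree.leaf x a b).cluster = {e | ∃ p ∈ (leaf x fl k a b).leaves, e = s(p.2.1, p.2.2)} := by
      ext e; simp [TopTree.cluster, leaves]
    rw [← this]
    cases fl <;> simp [view, mirrorIf]
  | node x fl k l r hl hr =>
    have : (TopTree.node x l.view r.view).cluster =
        {e | ∃ p ∈ (node x fl k l r).leaves, e = s(p.2.1, p.2.2)} := by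
      ext e
      simp only [TopTree.cluster, hl, hr, leaves, List.mem_append, Set.mem_union, Set.mem_ofPred_eq,
        or_and_right, exists_or]
    rw [← this]
    cases fl <;> simp [view, mirrorIf]

theorem Rearr.cluster {t t' : RTree V} (h : Rearr t t') : t'.view.cluster = t.view.cluster := by
  simp only [view_cluster, h.leaves.mem_iff]

theorem view_subtrees_addr (t : RTree V) : (t.view.subtrees.map TopTree.addr).Perm t.addrs := by
  have hm : ∀ T : TopTree V, (T.mirror.subtrees.map TopTree.addr).Perm
      (T.subtrees.map TopTree.addr) := fun T => by
    refine ((TopTree.mirror_subtrees T).map _).trans ?_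
    simp only [List.map_map]
    exact List.Perm.of_eq (List.map_congr_left fun c _ => TopTree.mirror_addr c)
  induction t with
  | leaf x fl k a b => cases fl <;> exact .refl _
  | node x fl k l r hl hr =>
    have : ((TopTree.node x l.view r.view).subtrees.map TopTree.addr).Perm
        (node x fl k l r).addrs := by
      simp only [TopTree.subtrees, List.map_cons, List.map_append, addrs]
      exact (hl.append hr).cons _
    rcases view_node_cases x fl k l r with e | e <;> rw [e]
    · exact this
    · exact (hm _).trans this

theorem Holds.stored {s : Mem V} {p : Option ℕ} {t : RTree V} (h : Holds s.node p t) :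
    StoredAt s p t.addr t.view := by
  induction t generalizing p with
  | leaf x fl k a b => exact StoredAt.leaf h
  | node x fl k l r hl hr => exact StoredAt.node h.1 (hl h.2.1) (hr h.2.2)

theorem exists_of_stored {s : Mem V} {p : Option ℕ} {x : ℕ} {T : TopTree V}
    (h : StoredAt s p x T) : ∃ t : RTree V, Holds s.node p t ∧ t.view = T ∧ t.addr = x := by
  induction h with
  | @leaf p x k fl a b h => exact ⟨RTree.leaf x fl k a b, h, rfl, rfl⟩
  | @node p x k fl c₀ c₁ t₀ t₁ h h₀ h₁ ih₀ ih₁ =>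
    obtain ⟨l, hl, rfl, rfl⟩ := ih₀
    obtain ⟨r, hr, rfl, rfl⟩ := ih₁
    exact ⟨RTree.node x fl k l r, ⟨h, hl, hr⟩, rfl, rfl⟩

section
variable {G : SimpleGraph V} {X : Set V}

/-- `O` describes the boundary of the cluster. -/
def Env (G : SimpleGraph V) (X O : Set V) (t : RTree V) : Prop :=
  ∀ v ∈ t.verts, v ∈ O ↔ v ∈ X ∨ ∃ e ∈ G.edgeSet, e ∉ t.view.cluster ∧ v ∈ e

theorem Env.boundary {O : Set V} {t : RTree V} (h : Env G X O t) :
    t.view.boundary G X = t.verts ∩ O := by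
  ext v
  simp only [TopTree.boundary, Set.mem_ofPred_eq, view_verts, Set.mem_inter_iff]
  exact and_congr_right fun hv => (h v hv).symm

theorem view_node_cluster (x fl k) (l r : RTree V) :
    (node x fl k l r).view.cluster = l.view.cluster ∪ r.view.cluster := by
  rcases view_node_cases x fl k l r with e | e <;> rw [e]
  · rfl
  · rw [TopTree.mirror_cluster]; rfl

theorem Env.child {O : Set V} {l r : RTree V} (hd : Disjoint l.view.cluster r.view.cluster)
    (hr : r.view.cluster ⊆ G.edgeSet)
    (h : ∀ v ∈ l.verts, v ∈ O ↔ v ∈ X ∨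
      ∃ e ∈ G.edgeSet, e ∉ l.view.cluster ∪ r.view.cluster ∧ v ∈ e) :
    Env G X (O ∪ r.verts) l := by
  intro v hv
  have hiff := h v hv
  constructor
  · rintro (hO | hvr)
    · rcases hiff.1 hO with h1 | ⟨e, h1, h2, h3⟩
      · exact Or.inl h1
      · exact Or.inr ⟨e, h1, fun h => h2 (Or.inl h), h3⟩
    · rw [← view_verts] at hvr
      obtain ⟨e, h1, h2⟩ := TopTree.exists_of_mem_verts hvr
      exact Or.inr ⟨e, hr h1, fun h => Set.disjoint_left.1 hd h h1, h2⟩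
  · rintro (h1 | ⟨e, h1, h2, h3⟩)
    · exact Or.inl (hiff.2 (Or.inl h1))
    · by_cases h4 : e ∈ r.view.cluster
      · exact Or.inr (view_verts r ▸ TopTree.mem_verts_of_mem h4 h3)
      · exact Or.inl (hiff.2 (Or.inr ⟨e, h1, fun h => h.elim h2 h4, h3⟩))

theorem Env.left {O : Set V} {x fl k} {l r : RTree V} (h : Env G X O (node x fl k l r))
    (hd : Disjoint l.view.cluster r.view.cluster) (hr : r.view.cluster ⊆ G.edgeSet) :
    Env G X (O ∪ r.verts) l :=
  Env.child hd hr fun v hv => by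
    have := h v (Or.inl hv)
    rwa [view_node_cluster] at this

theorem Env.right {O : Set V} {x fl k} {l r : RTree V} (h : Env G X O (node x fl k l r))
    (hd : Disjoint l.view.cluster r.view.cluster) (hl : l.view.cluster ⊆ G.edgeSet) :
    Env G X (O ∪ l.verts) r :=
  Env.child hd.symm hl fun v hv => by
    have := h v (Or.inr hv)
    rwa [view_node_cluster, Set.union_comm] at this

theorem Env.isLeft {O : Set V} {t : RTree V} (h : Env G X O t) (v : V) :
    t.view.IsLeftBoundary G X v ↔ t.Side O false v := by
  unfold TopTree.IsLeftBoundary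
  rw [h.boundary]
  cases t with
  | leaf x fl k a b =>
    cases fl <;> simp [view, mirrorIf, TopTree.mirror, Side, verts] <;> grind
  | node x fl k l r =>
    cases fl <;> simp [view, mirrorIf, TopTree.mirror, Side, verts] <;> grind

theorem Env.isRight {O : Set V} {t : RTree V} (h : Env G X O t) (v : V) :
    t.view.IsRightBoundary G X v ↔ t.Side O true v := by
  unfold TopTree.IsRightBoundary
  rw [h.boundary]
  cases t with
  | leaf x fl k a b =>
    cases fl <;> simp [view, mirrorIf, TopTree.mirror, Side, verts] <;> grind
  | node x fl k l r =>
    cases fl <;> simp [view, mirrorIf, TopTree.mirror, Side, verts] <;> grind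

theorem Env.isMiddle {O : Set V} {t : RTree V} (h : Env G X O t) (v : V) :
    t.view.IsMiddleBoundary G X v ↔ t.Mid O v := by
  unfold TopTree.IsMiddleBoundary
  rw [h.boundary]
  cases t with
  | leaf x fl k a b => cases fl <;> simp [view, mirrorIf, TopTree.mirror, Mid]
  | node x fl k l r =>
    cases fl <;> simp [view, mirrorIf, TopTree.mirror, Mid, verts] <;> grind

theorem Env.isRightmost {O : Set V} {t : RTree V} (h : Env G X O t) (v : V) :
    t.view.IsRightmostBoundary G X v ↔ t.Most O true v := by
  simp only [TopTree.IsRightmostBoundary, Most, h.isRight, h.isMiddle]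

theorem Env.isLeftmost {O : Set V} {t : RTree V} (h : Env G X O t) (v : V) :
    t.view.IsLeftmostBoundary G X v ↔ t.Most O false v := by
  simp only [TopTree.IsLeftmostBoundary, Most, h.isLeft, h.isMiddle]

theorem forall_view_node {P : TopTree V → Prop} (hP : ∀ c : TopTree V, P c.mirror ↔ P c)
    (x fl k) (l r : RTree V) : (∀ c ∈ (node x fl k l r).view.subtrees, P c) ↔
      P (TopTree.node x l.view r.view) ∧ (∀ c ∈ l.view.subtrees, P c) ∧
        ∀ c ∈ r.view.subtrees, P c := by
  have : (∀ c ∈ (TopTree.node x l.view r.view).subtrees, P c) ↔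
      P (TopTree.node x l.view r.view) ∧ (∀ c ∈ l.view.subtrees, P c) ∧
        ∀ c ∈ r.view.subtrees, P c := by
    simp only [TopTree.subtrees, List.mem_cons, List.mem_append, or_imp, forall_and, forall_eq]
  rw [← this]
  rcases view_node_cases x fl k l r with e | e <;> rw [e]
  exact TopTree.forall_mirror hP _

theorem node_boundary (x fl k) (l r : RTree V) :
    (TopTree.node x l.view r.view).boundary G X = (node x fl k l r).view.boundary G X := by
  rcases view_node_cases x fl k l r with e | e <;> rw [e]
  rw [TopTree.mirror_boundary]

theorem encard_le_two {S : Set V} (hS : S.Finite) : S.encard ≤ 2 ↔ S.ncard ≤ 2 := by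
  rw [← hS.cast_ncard_eq]
  exact_mod_cast Iff.rfl

theorem wf_of_inv {s : Mem V} {O : Set V} {t : RTree V} {p : Option ℕ} (hH : Holds s.node p t)
    (hE : Env G X O t) (h : ∀ c ∈ t.view.subtrees, c.Inv G X s) : t.WF O := by
  induction t generalizing p O with
  | leaf x fl k a b =>
    have h1 : (TopTree.leaf x a b).Inv G X s := by
      cases fl
      · exact h _ (by simp [view, mirrorIf, TopTree.subtrees])
      · exact (TopTree.mirror_inv ..).1
          (h _ (by simp [view, mirrorIf, TopTree.mirror, TopTree.subtrees]))
    have hb : (TopTree.leaf x a b).boundary G X = ({a, b} : Set V) ∩ O := by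
      have := hE.boundary
      cases fl
      · exact this
      · rw [← TopTree.mirror_boundary]; exact this
    have h2 := h1.valid.boundary_le
    have h3 := h1.count _ hH
    rw [hb] at h2 h3
    rw [encard_le_two ((Set.toFinite {a, b}).inter_of_left O)] at h2
    have h4 : s(a, b) ∈ G.edgeSet := h1.valid.subset rfl
    refine ⟨?_, h3, by simp only at h3; omega⟩
    rintro rfl
    simp at h4
  | node x fl k l r hl hr =>
    rw [forall_view_node (fun c => TopTree.mirror_inv G X s c)] at h
    obtain ⟨h1, h2, h3⟩ := h
    have hd : Disjoint l.view.cluster r.view.cluster := h1.valid.disjoint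
    have hsub : l.view.cluster ∪ r.view.cluster ⊆ G.edgeSet := h1.valid.subset
    have hEl := hE.left hd fun _ h => hsub (Or.inr h)
    have hEr := hE.right hd fun _ h => hsub (Or.inl h)
    have h4 := h1.valid.boundary_le
    have h5 := h1.count _ hH.1
    rw [node_boundary x fl k, hE.boundary] at h4 h5
    rw [encard_le_two ((verts_finite _).inter_of_left O)] at h4
    obtain ⟨c, hc, h6, h7⟩ := h1.oriented
    rw [view_verts, view_verts] at hc
    exact ⟨h5, by simp only at h5; omega, hl hH.2.1 hEl h2, hr hH.2.2 hEr h3, c, hc,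
      (hEl.isRightmost c).1 h6, (hEr.isLeftmost c).1 h7⟩

theorem WF.disjoint {O : Set V} {x fl k} {l r : RTree V} (h : (node x fl k l r).WF O) 
    (hG : (node x fl k l r).view.cluster ⊆ G.edgeSet) :
    Disjoint l.view.cluster r.view.cluster := by
  obtain ⟨-, -, -, -, c, hc, -⟩ := h
  rw [view_node_cluster] at hG
  refine Set.disjoint_left.2 fun e h1 h2 => ?_
  induction e with
  | h a b =>
    have key : ∀ v ∈ s(a, b), v = c := fun v hv => by
      have : v ∈ l.verts ∩ r.verts := ⟨view_verts l ▸ TopTree.mem_verts_of_mem h1 hv,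
        view_verts r ▸ TopTree.mem_verts_of_mem h2 hv⟩
      rwa [hc] at this
    have h3 : s(a, b) ∈ G.edgeSet := hG (Or.inl h1)
    rw [key a (by simp), key b (by simp)] at h3
    simp at h3

theorem WF.connected {O : Set V} {t : RTree V} (h : t.WF O) :
    ∀ v ∈ t.verts, ∀ w ∈ t.verts, (SimpleGraph.fromEdgeSet t.view.cluster).Reachable v w := by
  induction t generalizing O with
  | leaf x fl k a b =>
    have hab := h.1
    have hc : (leaf x fl k a b).view.cluster = {s(a, b)} := by
      rw [view_cluster]; ext e; simp [leaves]
    rw [hc]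
    have hr : (SimpleGraph.fromEdgeSet {s(a, b)}).Reachable a b :=
      SimpleGraph.Adj.reachable (by simp [hab])
    rintro v (rfl | rfl) w (rfl | rfl)
    exacts [.refl _, hr, hr.symm, .refl _]
  | node x fl k l r hl hr =>
    obtain ⟨-, -, h1, h2, c, hc, -⟩ := h
    have hc' : c ∈ l.verts ∩ r.verts := hc ▸ rfl
    rw [view_node_cluster]
    have m1 : ∀ v ∈ l.verts, ∀ w ∈ l.verts, (SimpleGraph.fromEdgeSet
        (l.view.cluster ∪ r.view.cluster)).Reachable v w := fun v hv w hw =>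
      (hl h1 v hv w hw).mono (SimpleGraph.fromEdgeSet_mono Set.subset_union_left)
    have m2 : ∀ v ∈ r.verts, ∀ w ∈ r.verts, (SimpleGraph.fromEdgeSet
        (l.view.cluster ∪ r.view.cluster)).Reachable v w := fun v hv w hw =>
      (hr h2 v hv w hw).mono (SimpleGraph.fromEdgeSet_mono Set.subset_union_right)
    rintro v (hv | hv) w (hw | hw)
    · exact m1 v hv w hw
    · exact (m1 v hv c hc'.1).trans (m2 c hc'.2 w hw)
    · exact (m2 v hv c hc'.2).trans (m1 c hc'.1 w hw)
    · exact m2 v hv w hw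

theorem WF.valid {O : Set V} {t : RTree V} (h : t.WF O) (hE : Env G X O t)
    (hG : t.view.cluster ⊆ G.edgeSet) : t.view.IsValidCluster G X := by
  refine ⟨hG, by simpa using h.connected, ?_, ?_⟩
  · rw [hE.boundary, encard_le_two ((verts_finite _).inter_of_left O), ← h.count_eq]
    exact h.count_le
  · cases t with
    | leaf x fl k a b => cases fl <;> trivial
    | node x fl k l r =>
      have := h.disjoint hG
      cases fl
      · exact this
      · simpa [view, mirrorIf, TopTree.mirror] using this.symm

theorem WF.inv {s : Mem V} {O : Set V} {t : RTree V} {p : Option ℕ} (h : t.WF O)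
    (hH : Holds s.node p t) (hE : Env G X O t) (hG : t.view.cluster ⊆ G.edgeSet) :
    ∀ c ∈ t.view.subtrees, c.Inv G X s := by
  have hroot : ∀ {t : RTree V} {p O}, t.WF O → Holds s.node p t → Env G X O t →
      ∀ r, s.node t.view.addr = some r → r.numBoundary = (t.view.boundary G X).ncard := by
    intro t p O h hH hE r hr
    rw [view_addr, ((holds_iff ..).1 hH).1] at hr
    rw [hE.boundary, ← h.count_eq, ← Option.some.inj hr]; rfl
  induction t generalizing p O with
  | leaf x fl k a b =>
    have : (leaf x fl k a b).view.Inv G X s :=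
      ⟨h.valid hE hG, by cases fl <;> trivial, hroot h hH hE⟩
    intro c hc
    have : c = (leaf x fl k a b).view := by
      cases fl <;> simpa [view, mirrorIf, TopTree.mirror, TopTree.subtrees] using hc
    rw [this]; assumption
  | node x fl k l r hl hr =>
    have hd := h.disjoint hG
    have hG' := hG
    rw [view_node_cluster] at hG'
    have hEl := hE.left hd fun _ h => hG' (Or.inr h)
    have hEr := hE.right hd fun _ h => hG' (Or.inl h)
    obtain ⟨-, -, h1, h2, c, hc, h3, h4⟩ := id h
    rw [forall_view_node (fun c => TopTree.mirror_inv G X s c)]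
    refine ⟨?_, hl h1 hH.2.1 hEl fun _ h => hG' (Or.inl h),
      hr h2 hH.2.2 hEr fun _ h => hG' (Or.inr h)⟩
    have hv : (TopTree.node x l.view r.view).IsValidCluster G X := by
      have := h.valid hE hG
      rcases view_node_cases x fl k l r with e | e <;> rw [e] at this
      · exact this
      · exact (TopTree.mirror_isValid ..).1 this
    refine ⟨hv, ⟨c, by rw [view_verts, view_verts, hc], (hEl.isRightmost c).2 h3,
      (hEr.isLeftmost c).2 h4⟩, ?_⟩
    intro rr hr
    rw [node_boundary x fl k]
    exact hroot h hH hE rr (by rw [view_addr]; exact hr)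

theorem WF.ncard_verts {O : Set V} {t : RTree V} (h : t.WF O) : t.verts.ncard = t.size + 1 := by
  induction t generalizing O with
  | leaf x fl k a b => exact Set.ncard_pair h.1
  | node x fl k l r hl hr =>
    obtain ⟨-, -, h1, h2, c, hc, -⟩ := h
    have := Set.ncard_union_add_ncard_inter l.verts r.verts l.verts_finite r.verts_finite
    rw [hc, Set.ncard_singleton, hl h1, hr h2] at this
    simp only [verts, size]
    omega

end

end RTree

section
open RTree

/-- The memory `s` holds the forest `G`, the exposed vertices `X` and the top trees `R`, and all
invariants hold. -/
structure StoresRep {V : Type} (s : Mem V) (G : SimpleGraph V) (X : Set V) (R : List (RTree V)) :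
    Prop where
  acyclic : G.IsAcyclic
  tree : ∀ t ∈ R, Holds s.node none t ∧ t.WF X
  sub : ∀ t ∈ R, t.view.cluster ⊆ G.edgeSet
  closed : ∀ t ∈ R, ∀ e ∈ G.edgeSet, ∀ v ∈ e, v ∈ t.verts → e ∈ t.view.cluster
  covers : ∀ e ∈ G.edgeSet, ∃ t ∈ R, e ∈ t.view.cluster
  disjoint : R.Pairwise fun t t' => Disjoint t.verts t'.verts
  nodup : (R.flatMap RTree.addrs).Nodup
  allocated : ∀ x, s.node x ≠ none → x ∈ R.flatMap RTree.addrs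
  fresh : ∀ x, s.node x ≠ none → x < s.next
  exposed : ∀ v, s.exposed v = true ↔ v ∈ X
  incident_nodup : ∀ v, (s.incident v).Nodup
  incident_mem : ∀ v e, e ∈ s.incident v ↔
    ∃ t ∈ R, ∃ a b, (e, a, b) ∈ t.leaves ∧ (v = a ∨ v = b)

namespace StoresRep
variable {V : Type} {s : Mem V} {G : SimpleGraph V} {X : Set V} {R R' : List (RTree V)}

theorem perm (h : StoresRep s G X R) (p : R.Perm R') : StoresRep s G X R' where
  acyclic := h.acyclic
  tree t ht := h.tree t (p.mem_iff.2 ht)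
  sub t ht := h.sub t (p.mem_iff.2 ht)
  closed t ht := h.closed t (p.mem_iff.2 ht)
  covers e he := by simpa only [p.mem_iff] using h.covers e he
  disjoint := (p.pairwise_iff fun h => h.symm).1 h.disjoint
  nodup := (p.flatMap_right _).nodup_iff.1 h.nodup
  allocated x hx := (p.flatMap_right _).mem_iff.1 (h.allocated x hx)
  fresh := h.fresh
  exposed := h.exposed
  incident_nodup := h.incident_nodup
  incident_mem v e := by simpa only [p.mem_iff] using h.incident_mem v e

theorem env (h : StoresRep s G X R) {t : RTree V} (ht : t ∈ R) : Env G X X t := by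
  intro v hv
  refine ⟨Or.inl, ?_⟩
  rintro (h1 | ⟨e, h1, h2, h3⟩)
  · exact h1
  · exact (h2 (h.closed t ht e h1 v h3 hv)).elim

theorem unique (h : StoresRep s G X R) {t t' : RTree V} (ht : t ∈ R) (ht' : t' ∈ R) {v : V}
    (hv : v ∈ t.verts) (hv' : v ∈ t'.verts) : t = t' := by
  by_contra hne
  have : Std.Symm fun t t' : RTree V => Disjoint t.verts t'.verts := ⟨fun _ _ h => h.symm⟩
  exact Set.disjoint_left.1 (h.disjoint.forall ht ht' hne) hv hv'

theorem mem_addrs (h : StoresRep s G X R) {t : RTree V} (ht : t ∈ R) : t.addrs.Nodup :=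
  (List.nodup_flatMap.1 h.nodup).1 t ht

theorem ok (h : StoresRep s G X R) {t : RTree V} (ht : t ∈ R) : TopTreeProg.Ok s X t :=
  ⟨(h.tree t ht).1, h.mem_addrs ht, (h.tree t ht).2⟩

theorem vertOk (h : StoresRep s G X R) {t : RTree V} (ht : t ∈ R) : VertOk s X t := by
  refine ⟨fun v _ => h.exposed v, fun v _ => h.incident_nodup v, fun v hv e => ?_⟩
  rw [h.incident_mem]
  constructor
  · rintro ⟨t', ht', a, b, hm, hab⟩
    obtain rfl := h.unique ht ht' hv ((mem_verts_iff _ _).2 ⟨_, hm, hab⟩)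
    exact ⟨a, b, hm, hab⟩
  · rintro ⟨a, b, hm, hab⟩
    exact ⟨t, ht, a, b, hm, hab⟩

theorem reach (h : StoresRep s G X R) {t : RTree V} (ht : t ∈ R) {v : V} (hv : v ∈ t.verts) (w : V) :
    G.Reachable v w ↔ w ∈ t.verts := by
  constructor
  · rintro ⟨p⟩
    induction p with
    | nil => exact hv
    | @cons u x y hux p ih =>
      refine ih ?_
      have : s(u, x) ∈ t.view.cluster := h.closed t ht s(u, x) hux u (by simp) hv
      rw [← view_verts]
      exact TopTree.mem_verts_of_mem this (by simp)
  · intro hw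
    refine ((h.tree t ht).2.connected v hv w hw).mono ?_
    intro a b hab
    rw [SimpleGraph.fromEdgeSet_adj] at hab
    exact h.sub t ht hab.1

theorem treeSize_eq (h : StoresRep s G X R) {t : RTree V} (ht : t ∈ R) {v : V} (hv : v ∈ t.verts) :
    treeSize G v = t.size + 1 := by
  rw [← (h.tree t ht).2.ncard_verts, treeSize]
  congr 1
  ext w
  exact h.reach ht hv w

theorem isolated_adj (h : StoresRep s G X R) {v : V} (hv : ∀ t ∈ R, v ∉ t.verts) (w : V) :
    ¬ G.Adj v w := by
  intro hvw
  obtain ⟨t, ht, he⟩ := h.covers s(v, w) hvw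
  exact hv t ht (view_verts t ▸ TopTree.mem_verts_of_mem he (by simp))

theorem isolated_reach (h : StoresRep s G X R) {v : V} (hv : ∀ t ∈ R, v ∉ t.verts) {w : V}
    (hw : G.Reachable v w) : w = v := by
  obtain ⟨p⟩ := hw
  cases p with
  | nil => rfl
  | cons h' p => exact (h.isolated_adj hv _ h').elim

theorem isolated_size (h : StoresRep s G X R) {v : V} (hv : ∀ t ∈ R, v ∉ t.verts) :
    treeSize G v = 1 := by
  have : {w | G.Reachable v w} = {v} := by
    ext w
    exact ⟨fun hw => h.isolated_reach hv hw, fun hw => by obtain rfl : w = v := hw; exact .refl _⟩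
  rw [treeSize, this, Set.ncard_singleton]

theorem isolated_incident (h : StoresRep s G X R) {v : V} (hv : ∀ t ∈ R, v ∉ t.verts) :
    s.incident v = [] := by
  rw [List.eq_nil_iff_forall_not_mem]
  intro e he
  obtain ⟨t, ht, a, b, hm, hab⟩ := (h.incident_mem v e).1 he
  exact hv t ht ((mem_verts_iff _ _).2 ⟨_, hm, hab⟩)

theorem edgeAt_of_leaf {p : Option ℕ} {t : RTree V} (H : Holds s.node p t) {e : ℕ} {a b : V}
    (h : (e, a, b) ∈ t.leaves) : s.edgeAt e = some (a, b) := by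
  induction t generalizing p with
  | leaf x fl k a' b' =>
    simp only [leaves, List.mem_singleton, Prod.mk.injEq] at h
    obtain ⟨rfl, rfl, rfl⟩ := h
    have : s.node e = _ := H
    simp [Mem.edgeAt, this]
  | node x fl k l r hl hr =>
    rcases List.mem_append.1 h with h | h
    exacts [hl H.2.1 h, hr H.2.2 h]

theorem edgeAt_of_inner {p : Option ℕ} {t : RTree V} (H : Holds s.node p t) {e : ℕ}
    (h : e ∈ t.inner) : s.edgeAt e = none := by
  induction t generalizing p with
  | leaf x fl k a' b' => simp [RTree.inner] at h
  | node x fl k l r hl hr =>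
    rcases List.mem_cons.1 h with rfl | h
    · simp [Mem.edgeAt, H.1]
    · rcases List.mem_append.1 h with h | h
      exacts [hl H.2.1 h, hr H.2.2 h]

theorem edgeAt_iff (h : StoresRep s G X R) (e : ℕ) (a b : V) :
    s.edgeAt e = some (a, b) ↔ ∃ t ∈ R, (e, a, b) ∈ t.leaves := by
  constructor
  · intro he
    have hne : s.node e ≠ none := by
      intro h0
      rw [Mem.edgeAt, h0] at he
      simp at he
    obtain ⟨t, ht, hm⟩ := List.mem_flatMap.1 (h.allocated e hne)
    rw [(addrs_perm t).mem_iff, List.mem_append] at hm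
    rcases hm with hm | hm
    · obtain ⟨⟨e', a', b'⟩, hm', rfl⟩ := List.mem_map.1 hm
      have := edgeAt_of_leaf (h.tree t ht).1 hm'
      rw [this] at he
      obtain ⟨rfl, rfl⟩ := Prod.mk.inj (Option.some.inj he)
      exact ⟨t, ht, hm'⟩
    · rw [edgeAt_of_inner (h.tree t ht).1 hm] at he
      simp at he
  · rintro ⟨t, ht, hm⟩
    exact edgeAt_of_leaf (h.tree t ht).1 hm

theorem edgeAt_ext {s s' : Mem V} (h : ∀ e a b, s'.edgeAt e = some (a, b) ↔ s.edgeAt e = some (a, b)) :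
    s'.edgeAt = s.edgeAt := by
  funext e
  ext ⟨a, b⟩
  simpa using h e a b

theorem represents (h : StoresRep s G X R) : Represents s G X (R.map view) := by
  have hinv : ∀ t ∈ R, ∀ c ∈ t.view.subtrees, c.Inv G X s := fun t ht =>
    (h.tree t ht).2.inv (h.tree t ht).1 (h.env ht) (h.sub t ht)
  have hp : (((R.map view).flatMap TopTree.subtrees).map TopTree.addr).Perm
      (R.flatMap RTree.addrs) := by
    rw [List.map_flatMap, List.flatMap_map]
    exact List.Perm.flatMap_left _ fun t _ => view_subtrees_addr t
  refine ⟨⟨h.acyclic, ?_, ?_, ?_, ?_, ?_⟩, ⟨?_, ?_, ?_, h.fresh, ?_, h.exposed, h.incident_nodup, ?_⟩⟩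
  · simp only [List.forall_mem_map]
    exact fun t ht c hc => (hinv t ht c hc).valid
  · simp only [List.forall_mem_map]
    exact fun t ht c hc => (hinv t ht c hc).oriented
  · simp only [List.forall_mem_map, view_verts]
    intro t ht v hv
    ext e
    constructor
    · exact fun he => ⟨h.sub t ht he, fun w hw => (h.reach ht hv w).2
        (view_verts t ▸ TopTree.mem_verts_of_mem he hw)⟩
    · rintro ⟨he, hw⟩
      induction e with
      | h a b => exact h.closed t ht _ he a (by simp) ((h.reach ht hv a).1 (hw a (by simp)))
  · intro e he
    obtain ⟨t, ht, h'⟩ := h.covers e he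
    exact ⟨t.view, List.mem_map_of_mem ht, h'⟩
  · rw [List.pairwise_map]
    refine h.disjoint.imp fun {t t'} hd => Set.disjoint_left.2 fun e he he' => ?_
    induction e with
    | h a b =>
      exact Set.disjoint_left.1 hd (view_verts t ▸ TopTree.mem_verts_of_mem he (by simp : a ∈ _))
        (view_verts t' ▸ TopTree.mem_verts_of_mem he' (by simp))
  · simp only [List.forall_mem_map, view_addr]
    exact fun t ht => (h.tree t ht).1.stored
  · exact hp.nodup_iff.2 h.nodup
  · exact fun x hx => hp.mem_iff.2 (h.allocated x hx)
  · simp only [List.forall_mem_map]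
    exact fun t ht c hc => (hinv t ht c hc).count
  · intro v e
    rw [h.incident_mem]
    constructor
    · rintro ⟨t, ht, a, b, hm, hab⟩
      exact ⟨a, b, (h.edgeAt_iff e a b).2 ⟨t, ht, hm⟩, hab⟩
    · rintro ⟨a, b, hm, hab⟩
      obtain ⟨t, ht, hm⟩ := (h.edgeAt_iff e a b).1 hm
      exact ⟨t, ht, a, b, hm, hab⟩

end StoresRep

theorem exists_map_view {V : Type} {P : RTree V → Prop} (F : List (TopTree V))
    (h : ∀ T ∈ F, ∃ t, P t ∧ t.view = T) : ∃ R : List (RTree V), R.map view = F ∧ ∀ t ∈ R, P t := by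
  induction F with
  | nil => exact ⟨[], rfl, by simp⟩
  | cons T F ih =>
    obtain ⟨t, ht, rfl⟩ := h T (by simp)
    obtain ⟨R, rfl, hR⟩ := ih fun T hT => h T (by simp [hT])
    exact ⟨t :: R, rfl, by simpa [ht] using hR⟩

theorem Represents.exists_rep {V : Type} {s : Mem V} {G : SimpleGraph V} {X : Set V}
    {F : List (TopTree V)} (h : Represents s G X F) :
    ∃ R : List (RTree V), R.map view = F ∧ StoresRep s G X R := by
  obtain ⟨hF, hS⟩ := h
  obtain ⟨R, rfl, hR⟩ := exists_map_view (P := fun t => Holds s.node none t) F fun T hT => by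
    obtain ⟨t, h1, h2, -⟩ := exists_of_stored (hS.stored T hT)
    exact ⟨t, h1, h2⟩
  have hp : (((R.map view).flatMap TopTree.subtrees).map TopTree.addr).Perm
      (R.flatMap RTree.addrs) := by
    rw [List.map_flatMap, List.flatMap_map]
    exact List.Perm.flatMap_left _ fun t _ => view_subtrees_addr t
  have hsub : ∀ t ∈ R, t.view.cluster ⊆ G.edgeSet := fun t ht e he => by
    obtain ⟨v, hv⟩ : ∃ v, v ∈ e := by induction e with | h a b => exact ⟨a, by simp⟩
    rw [hF.component t.view (List.mem_map_of_mem ht) v (TopTree.mem_verts_of_mem he hv)] at he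
    exact he.1
  have hclosed : ∀ t ∈ R, ∀ e ∈ G.edgeSet, ∀ v ∈ e, v ∈ t.verts → e ∈ t.view.cluster := by
    intro t ht e he v hv hvt
    rw [hF.component t.view (List.mem_map_of_mem ht) v (by simpa using hvt)]
    refine ⟨he, ?_⟩
    induction e with
    | h a b =>
      have hab : G.Adj a b := he
      intro w hw
      rw [Sym2.mem_iff] at hv hw
      rcases hv with rfl | rfl <;> rcases hw with rfl | rfl
      exacts [.refl _, hab.reachable, hab.symm.reachable, .refl _]
  have hdisj : R.Pairwise fun t t' => Disjoint t.verts t'.verts := by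
    have := List.pairwise_map.1 hF.disjoint
    refine this.imp_of_mem fun {t t'} ht ht' hd => Set.disjoint_left.2 fun v hv hv' => ?_
    obtain ⟨e, he, hve⟩ := TopTree.exists_of_mem_verts (view_verts t ▸ hv)
    exact Set.disjoint_left.1 hd he (hclosed t' ht' e (hsub t ht he) v hve hv')
  have htree : ∀ t ∈ R, Holds s.node none t ∧ t.WF X := by
    intro t ht
    refine ⟨hR t ht, wf_of_inv (hR t ht) (G := G) (X := X) ?_ fun c hc => ⟨?_, ?_, ?_⟩⟩
    · intro v hv
      refine ⟨Or.inl, ?_⟩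
      rintro (h1 | ⟨e, h1, h2, h3⟩)
      · exact h1
      · exact (h2 (hclosed t ht e h1 v h3 hv)).elim
    · exact hF.valid _ (List.mem_map_of_mem ht) c hc
    · exact hF.oriented _ (List.mem_map_of_mem ht) c hc
    · exact hS.numBoundary _ (List.mem_map_of_mem ht) c hc
  have hrep : StoresRep s G X R := ⟨hF.acyclic, htree, hsub, hclosed, fun e he => by
      obtain ⟨T, hT, h'⟩ := hF.covers e he
      obtain ⟨t, ht, rfl⟩ := List.mem_map.1 hT
      exact ⟨t, ht, h'⟩, hdisj, hp.nodup_iff.1 hS.nodup, fun x hx => hp.mem_iff.1 (hS.allocated x hx),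
      hS.fresh, hS.exposed, hS.incident_nodup, fun v e => by
      rw [hS.incident_mem]
      constructor
      · rintro ⟨a, b, hm, hab⟩
        have hne : s.node e ≠ none := by
          intro h0
          rw [Mem.edgeAt, h0] at hm
          simp at hm
        obtain ⟨t, ht, hm'⟩ := List.mem_flatMap.1 (hp.mem_iff.1 (hS.allocated e hne))
        rw [(addrs_perm t).mem_iff, List.mem_append] at hm'
        rcases hm' with hm' | hm'
        · obtain ⟨⟨e', a', b'⟩, hm2, rfl⟩ := List.mem_map.1 hm'
          rw [StoresRep.edgeAt_of_leaf (hR t ht) hm2] at hm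
          obtain ⟨rfl, rfl⟩ := Prod.mk.inj (Option.some.inj hm)
          exact ⟨t, ht, _, _, hm2, hab⟩
        · rw [StoresRep.edgeAt_of_inner (hR t ht) hm'] at hm
          simp at hm
      · rintro ⟨t, ht, a, b, hm, hab⟩
        exact ⟨a, b, StoresRep.edgeAt_of_leaf (hR t ht) hm, hab⟩⟩
  exact ⟨R, rfl, hrep⟩

/-- The potential of a family of top trees. -/
noncomputable def potSum {V : Type} (R : List (RTree V)) : ℝ := (R.map RTree.pot).sum

theorem forestPotential_view {V : Type} (R : List (RTree V)) :
    forestPotential (R.map view) = potSum R := by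
  simp [forestPotential, potSum, Function.comp_def]

theorem potSum_perm {V : Type} {R R' : List (RTree V)} (h : R.Perm R') : potSum R = potSum R' :=
  (h.map _).sum_eq

theorem potSum_cons {V : Type} (t : RTree V) (R : List (RTree V)) :
    potSum (t :: R) = t.pot + potSum R := by simp [potSum]

theorem isRootOf_view {V : Type} {R : List (RTree V)} {t : RTree V} (ht : t ∈ R) {v : V}
    (hv : v ∈ t.verts) {x : ℕ} (hx : t.addr = x) : IsRootOf (R.map view) v (some x) :=
  ⟨t.view, List.mem_map_of_mem ht, by simpa using hv, by simpa using hx⟩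

theorem isRootOf_none {V : Type} {R : List (RTree V)} {v : V} (h : ∀ t ∈ R, v ∉ t.verts) :
    IsRootOf (R.map view) v none := by
  simpa [IsRootOf] using h

theorem exists_perm_cons {V : Type} {R : List (RTree V)} {t : RTree V} (h : t ∈ R) :
    ∃ R', R.Perm (t :: R') := by
  classical
  obtain ⟨A, B, rfl⟩ := List.append_of_mem h
  exact ⟨A ++ B, List.perm_middle⟩

namespace StoresRep
open TopTreeProg
variable {V : Type} {s : Mem V} {G : SimpleGraph V} {X : Set V} {R R' : List (RTree V)}

theorem not_mem_of_cons {t : RTree V} (h : StoresRep s G X (t :: R)) {t' : RTree V} (ht' : t' ∈ R) :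
    (∀ v ∈ t.verts, v ∉ t'.verts) ∧ ∀ n ∈ t'.addrs, n ∉ t.addrs := by
  refine ⟨fun v hv hv' => Set.disjoint_left.1 ((List.pairwise_cons.1 h.disjoint).1 t' ht') hv hv',
    fun n hn hn' => ?_⟩
  have := h.nodup
  rw [List.flatMap_cons, List.nodup_append] at this
  exact this.2.2 n hn' n (List.mem_flatMap.2 ⟨t', ht', hn⟩) rfl

/-- Changing the mark of a vertex and rearranging its top tree. -/
theorem mark [DecidableEq V] {K B : ℝ} {s' : Mem V} {v : V} {m : Bool} {X' : Set V}
    {τ τ' : RTree V} (h : StoresRep s G X (τ :: R)) (hm : MarkOk K B s s' v m X' τ τ')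
    (hv : v ∈ τ.verts) (hX : ∀ w, w ≠ v → (w ∈ X' ↔ w ∈ X)) (hvX : v ∈ X' ↔ m = true) :
    StoresRep s' G X' (τ' :: R) where
  acyclic := h.acyclic
  tree t ht := by
    rcases List.mem_cons.1 ht with rfl | ht
    · exact ⟨hm.ok.holds, hm.ok.wf⟩
    · obtain ⟨h1, h2⟩ := h.tree t (by simp [ht])
      obtain ⟨h3, h4⟩ := h.not_mem_of_cons ht
      exact ⟨h1.congr fun n hn => hm.node n (h4 n hn),
        (wf_congr fun w hw => hX w fun e => h3 v hv (e ▸ hw)).2 h2⟩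
  sub t ht := by
    rcases List.mem_cons.1 ht with rfl | ht
    · rw [hm.rearr.cluster]; exact h.sub τ (by simp)
    · exact h.sub t (by simp [ht])
  closed t ht := by
    rcases List.mem_cons.1 ht with rfl | ht
    · rw [hm.rearr.cluster, hm.rearr.verts]; exact h.closed τ (by simp)
    · exact h.closed t (by simp [ht])
  covers e he := by simpa [hm.rearr.cluster] using h.covers e he
  disjoint := by simpa [hm.rearr.verts] using h.disjoint
  nodup := by
    rw [List.flatMap_cons]
    exact (hm.rearr.addrs.append_right _).nodup_iff.1 h.nodup
  allocated x hx := by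
    rw [List.flatMap_cons, List.mem_append, ← hm.rearr.addrs.mem_iff]
    by_cases hxt : x ∈ τ.addrs
    · exact Or.inl hxt
    · rw [hm.node x hxt] at hx
      simpa using h.allocated x hx
  fresh x hx := by
    rw [hm.next]
    by_cases hxt : x ∈ τ.addrs
    · have : ∀ {p : Option ℕ} {t : RTree V}, Holds s.node p t → ∀ x ∈ t.addrs, s.node x ≠ none := by
        intro p t
        induction t generalizing p with
        | leaf y fl k a b =>
          intro H x hx
          obtain rfl : x = y := by simpa [addrs] using hx
          rw [show s.node x = _ from H]; simp
        | node y fl k l r hl hr =>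
          intro H x hx
          simp only [addrs, List.mem_cons, List.mem_append] at hx
          rcases hx with rfl | hx | hx
          · rw [H.1]; simp
          · exact hl H.2.1 x hx
          · exact hr H.2.2 x hx
      exact h.fresh x (this (h.tree τ (by simp)).1 x hxt)
    · rw [hm.node x hxt] at hx
      exact h.fresh x hx
  exposed w := by
    rw [hm.exposed]
    by_cases e : w = v
    · subst e; simp [hvX]
    · rw [Function.update_of_ne e, h.exposed, hX w e]
  incident_nodup w := by rw [hm.incident]; exact h.incident_nodup w
  incident_mem w e := by
    rw [hm.incident, h.incident_mem]
    simp [hm.rearr.leaves.mem_iff]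

/-- Changing the mark of an isolated vertex. -/
theorem mark_isolated [DecidableEq V] {s' : Mem V} {v : V} {m : Bool} {X' : Set V}
    (h : StoresRep s G X R) (h1 : s'.node = s.node) (h2 : s'.next = s.next)
    (h3 : s'.incident = s.incident) (h4 : s'.exposed = Function.update s.exposed v m)
    (hv : ∀ t ∈ R, v ∉ t.verts) (hX : ∀ w, w ≠ v → (w ∈ X' ↔ w ∈ X)) (hvX : v ∈ X' ↔ m = true) :
    StoresRep s' G X' R where
  acyclic := h.acyclic
  tree t ht := by
    rw [h1]
    exact ⟨(h.tree t ht).1, (wf_congr fun w hw => hX w fun e => hv t ht (e ▸ hw)).2 (h.tree t ht).2⟩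
  sub := h.sub
  closed := h.closed
  covers := h.covers
  disjoint := h.disjoint
  nodup := h.nodup
  allocated := by rw [h1]; exact h.allocated
  fresh := by rw [h1, h2]; exact h.fresh
  exposed w := by
    rw [h4]
    by_cases e : w = v
    · subst e; simp [hvX]
    · rw [Function.update_of_ne e, h.exposed, hX w e]
  incident_nodup := by rw [h3]; exact h.incident_nodup
  incident_mem := by rw [h3]; exact h.incident_mem

theorem edgeAt_eq {s' : Mem V} {G' : SimpleGraph V} {X' : Set V} (h : StoresRep s G X R)
    (h' : StoresRep s' G' X' R') (hR : ∀ p, (∃ t ∈ R', p ∈ t.leaves) ↔ ∃ t ∈ R, p ∈ t.leaves) :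
    s'.edgeAt = s.edgeAt :=
  edgeAt_ext fun e a b => by rw [h.edgeAt_iff, h'.edgeAt_iff, hR]

/-- The effect of changing the mark of a vertex on the whole data structure. -/
theorem mark_spec [DecidableEq V] {K B : ℝ} (hB : 2 ≤ B) {v : V} {m : Bool} {X' : Set V}
    {P : Prog V (Option ℕ)} (h : StoresRep s G X R) (hX : ∀ w, w ≠ v → (w ∈ X' ↔ w ∈ X))
    (hvX : v ∈ X' ↔ m = true)
    (hiso : s.incident v = [] → P.run s =
      some (none, { s.adv 2 with exposed := Function.update s.exposed v m }))
    (hloc : ∀ τ ∈ R, v ∈ τ.verts → ∃ s' τ', P.run s = some (some τ.addr, s') ∧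
      MarkOk K B s s' v m X' τ τ') :
    ∃ r s' R', P.run s = some (r, s') ∧ StoresRep s' G X' R' ∧ IsRootOf (R.map view) v r ∧
      IsRootOf (R'.map view) v r ∧ s'.edgeAt = s.edgeAt ∧
      amortizedCost K s (R.map view) s' (R'.map view) ≤ B * (1 + Real.logb 2 (treeSize G v)) ∧
      ∀ w r, IsRootOf (R.map view) w r → IsRootOf (R'.map view) w r := by
  by_cases hv : ∃ τ ∈ R, v ∈ τ.verts
  · obtain ⟨τ, hτ, hvτ⟩ := hv
    obtain ⟨s', τ', r, hm⟩ := hloc τ hτ hvτ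
    obtain ⟨R₀, hp⟩ := exists_perm_cons hτ
    have h1 := (h.perm hp).mark hm hvτ hX hvX
    refine ⟨_, s', τ' :: R₀, r, h1, isRootOf_view hτ hvτ rfl,
      isRootOf_view (t := τ') (by simp) (by rw [hm.rearr.verts]; exact hvτ) hm.rearr.addr,
      (h.perm hp).edgeAt_eq h1 fun p => by simp [hm.rearr.leaves.mem_iff], ?_, fun w r hr => ?_⟩
    rotate_left
    · cases r with
      | none =>
        have hr' : ∀ t ∈ R, w ∉ t.verts := fun t ht => by
          simpa using hr t.view (List.mem_map_of_mem ht)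
        refine isRootOf_none fun t ht => ?_
        rcases List.mem_cons.1 ht with rfl | ht
        · rw [hm.rearr.verts]; exact hr' τ hτ
        · exact hr' t (hp.mem_iff.2 (by simp [ht]))
      | some x =>
        simpa [IsRootOf, hm.rearr.verts, hm.rearr.addr, hp.mem_iff] using hr
    rw [amortizedCost, forestPotential_view, forestPotential_view, potSum_perm hp, potSum_cons,
      potSum_cons, h.treeSize_eq hτ hvτ]
    have h2 := hm.cost
    have h3 : rk τ.size ≤ Real.logb 2 ((τ.size + 1 : ℕ) : ℝ) :=
      rk_mono (size_pos τ) (Nat.le_succ _)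
    have h4 : B * (1 + rk τ.size) ≤ B * (1 + Real.logb 2 ((τ.size + 1 : ℕ) : ℝ)) :=
      mul_le_mul_of_nonneg_left (by linarith) (by linarith)
    rw [show τ'.pot + potSum R₀ - (τ.pot + potSum R₀) = τ'.pot - τ.pot by ring]
    linarith
  · push Not at hv
    refine ⟨none, _, R, hiso (h.isolated_incident hv), h.mark_isolated rfl rfl rfl rfl hv hX hvX,
      isRootOf_none hv, isRootOf_none hv, rfl, ?_, fun _ _ hr => hr⟩
    rw [amortizedCost, h.isolated_size hv]
    simp only [Mem.adv_time]
    push_cast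
    simp
    linarith

end StoresRep

namespace StoresRep
open TopTreeProg
variable {V : Type} [DecidableEq V] {s : Mem V} {G : SimpleGraph V} {X : Set V} {R : List (RTree V)}

theorem expose_spec {K : ℝ} (hK : 7200 ≤ K) (h : StoresRep s G X R) {v : V} (hvX : v ∉ X)
    (hX : {w | w ∈ X ∧ G.Reachable v w}.Subsingleton) :
    ∃ r s' R', (expose v).run s = some (r, s') ∧ StoresRep s' G (insert v X) R' ∧
      IsRootOf (R.map view) v r ∧ IsRootOf (R'.map view) v r ∧ s'.edgeAt = s.edgeAt ∧
      amortizedCost K s (R.map view) s' (R'.map view) ≤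
        (16000 + 100 * K) * (1 + Real.logb 2 (treeSize G v)) ∧
      ∀ w r, IsRootOf (R.map view) w r → IsRootOf (R'.map view) w r :=
  h.mark_spec (m := true) (by linarith) (fun w hw => by simp [hw]) (by simp) expose_isolated
    fun _ hτ hv => expose_local hK (h.ok hτ) (h.vertOk hτ) hv hvX
      fun _ ha _ hb => hX ⟨ha.2, (h.reach hτ hv _).2 ha.1⟩ ⟨hb.2, (h.reach hτ hv _).2 hb.1⟩

theorem deexpose_spec {K : ℝ} (hK : 7200 ≤ K) (h : StoresRep s G X R) {v : V} (hvX : v ∈ X) :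
    ∃ r s' R', (deexpose v).run s = some (r, s') ∧ StoresRep s' G (X \ {v}) R' ∧
      IsRootOf (R.map view) v r ∧ IsRootOf (R'.map view) v r ∧ s'.edgeAt = s.edgeAt ∧
      amortizedCost K s (R.map view) s' (R'.map view) ≤
        (16000 + 100 * K) * (1 + Real.logb 2 (treeSize G v)) ∧
      ∀ w r, IsRootOf (R.map view) w r → IsRootOf (R'.map view) w r :=
  h.mark_spec (m := false) (by linarith) (fun w hw => by simp [hw]) (by simp) deexpose_isolated
    fun _ hτ hv => deexpose_local hK (h.ok hτ) (h.vertOk hτ) hv hvX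

theorem init (V : Type) : StoresRep (Mem.init V) ⊥ ∅ [] where
  acyclic := SimpleGraph.isAcyclic_bot
  tree := by simp
  sub := by simp
  closed := by simp
  covers := by simp
  disjoint := by simp
  nodup := by simp
  allocated := by simp [Mem.init]
  fresh := by simp [Mem.init]
  exposed := by simp [Mem.init]
  incident_nodup := by simp [Mem.init]
  incident_mem := by simp [Mem.init]

end StoresRep

/-- The nodes in memory are exactly those of the trees `R`. -/
structure Heap {V : Type} (s : Mem V) (R : List (RTree V)) : Prop where
  holds : ∀ t ∈ R, Holds s.node none t
  nodup : (R.flatMap RTree.addrs).Nodup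
  allocated : ∀ x, s.node x ≠ none → x ∈ R.flatMap RTree.addrs
  fresh : ∀ x, s.node x ≠ none → x < s.next

theorem StoresRep.heap {V : Type} {s : Mem V} {G : SimpleGraph V} {X : Set V} {R : List (RTree V)}
    (h : StoresRep s G X R) : Heap s R :=
  ⟨fun t ht => (h.tree t ht).1, h.nodup, h.allocated, h.fresh⟩

theorem RTree.Holds.ne_none {V : Type} {h : ℕ → Option (NodeRec V)} {p : Option ℕ} {t : RTree V}
    (H : Holds h p t) : ∀ x ∈ t.addrs, h x ≠ none := by
  induction t generalizing p with
  | leaf y fl k a b =>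
    intro x hx
    obtain rfl : x = y := by simpa [addrs] using hx
    rw [show h x = _ from H]; simp
  | node y fl k l r hl hr =>
    intro x hx
    simp only [addrs, List.mem_cons, List.mem_append] at hx
    rcases hx with rfl | hx | hx
    · rw [H.1]; simp
    · exact hl H.2.1 x hx
    · exact hr H.2.2 x hx

theorem RTree.Holds.setParent {V : Type} {h h' : ℕ → Option (NodeRec V)} {p p' : Option ℕ}
    {t : RTree V} (H : Holds h p t) (hd : t.addrs.Nodup) (h1 : h' t.addr = some (t.rcd p'))
    (h2 : ∀ n ∈ t.addrs, n ≠ t.addr → h' n = h n) : Holds h' p' t := by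
  rw [holds_iff] at H ⊢
  refine ⟨h1, H.2.congr fun n hn => h2 n (by simp [addrs_eq, hn]) ?_⟩
  rw [addrs_eq, List.nodup_cons] at hd
  exact fun e => hd.1 (e ▸ hn)

namespace Heap
open TopTreeProg
variable {V : Type} {s s' : Mem V} {R R' : List (RTree V)}

theorem perm (h : Heap s R) (p : R.Perm R') : Heap s R' where
  holds t ht := h.holds t (p.mem_iff.2 ht)
  nodup := (p.flatMap_right _).nodup_iff.1 h.nodup
  allocated x hx := (p.flatMap_right _).mem_iff.1 (h.allocated x hx)
  fresh := h.fresh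

theorem lt (h : Heap s R) {x : ℕ} (hx : x ∈ R.flatMap RTree.addrs) : x < s.next := by
  obtain ⟨t, ht, hx⟩ := List.mem_flatMap.1 hx
  exact h.fresh x ((h.holds t ht).ne_none x hx)

theorem congr (h : Heap s R) (h1 : s'.node = s.node) (h2 : s'.next = s.next) : Heap s' R := by
  obtain ⟨a, b, c, d⟩ := h
  exact ⟨by rwa [h1], b, by rwa [h1], by rwa [h1, h2]⟩

theorem replace {t t' : RTree V} (h : Heap s (t :: R)) (ht : Holds s'.node none t')
    (hr : Rearr t t') (hn : ∀ n, n ∉ t.addrs → s'.node n = s.node n) (hx : s'.next = s.next) :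
    Heap s' (t' :: R) := by
  have hp : ((t :: R).flatMap RTree.addrs).Perm ((t' :: R).flatMap RTree.addrs) :=
    hr.addrs.append_right _
  have hd := h.nodup
  rw [List.flatMap_cons, List.nodup_append] at hd
  refine ⟨fun u hu => ?_, hp.nodup_iff.1 h.nodup, fun x hx => ?_, fun x hx' => ?_⟩
  · rcases List.mem_cons.1 hu with rfl | hu
    · exact ht
    · exact (h.holds u (by simp [hu])).congr fun n hn' => hn n fun hn'' =>
        hd.2.2 n hn'' n (List.mem_flatMap.2 ⟨u, hu, hn'⟩) rfl
  · rw [← hp.mem_iff]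
    by_cases hxt : x ∈ t.addrs
    · exact List.mem_append_left _ hxt
    · rw [hn x hxt] at hx
      exact h.allocated x hx
  · rw [hx]
    by_cases hxt : x ∈ t.addrs
    · exact h.lt (List.mem_append_left _ hxt)
    · rw [hn x hxt] at hx'
      exact h.fresh x hx'

theorem newLeaf (h : Heap s R) (a b : V) (k : ℕ) :
    ∃ s', (newNode ⟨none, .leaf a b, k, false⟩).run s = some (s.next, s') ∧
      Heap s' (.leaf s.next false k a b :: R) ∧ s'.exposed = s.exposed ∧
      s'.incident = s.incident ∧ s'.time = s.time + 1 := by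
  refine ⟨_, run_newNode _ s, ⟨fun t ht => ?_, ?_, fun x hx => ?_, fun x hx => ?_⟩, rfl, rfl, rfl⟩
  · rcases List.mem_cons.1 ht with rfl | ht
    · simp [Holds, Mem.upd]
    · refine (h.holds t ht).congr fun n hn => ?_
      have : n ≠ s.next := (h.lt (List.mem_flatMap.2 ⟨t, ht, hn⟩)).ne
      simp [Mem.upd, this]
  · rw [List.flatMap_cons]
    exact List.nodup_cons.2 ⟨fun hx => (h.lt hx).ne rfl, h.nodup⟩
  · rw [List.flatMap_cons]
    by_cases e : x = s.next
    · simp [e, addrs]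
    · refine List.mem_append_right _ (h.allocated x ?_)
      simpa [Mem.upd, e] using hx
  · by_cases e : x = s.next
    · simp [e]
    · have := h.fresh x (by simpa [Mem.upd, e] using hx)
      simp; omega

theorem newInternal {p q : RTree V} (h : Heap s (p :: q :: R)) (k : ℕ) :
    ∃ s', (newInternal p.addr q.addr k).run s = some (s.next, s') ∧
      Heap s' (.node s.next false k p q :: R) ∧ s'.exposed = s.exposed ∧
      s'.incident = s.incident ∧ s'.time = s.time + 5 := by
  have hp := (holds_iff _ _ _).1 (h.holds p (by simp))
  have hq := (holds_iff _ _ _).1 (h.holds q (by simp))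
  have hd := h.nodup
  simp only [List.flatMap_cons] at hd
  obtain ⟨hdp, hd', hpq⟩ := List.nodup_append.1 hd
  obtain ⟨hdq, hdR, hqR⟩ := List.nodup_append.1 hd'
  have hne : q.addr ≠ p.addr := fun e =>
    hpq p.addr (addr_mem p) q.addr (List.mem_append_left _ (addr_mem q)) e.symm
  have hlt : ∀ {t}, t ∈ p :: q :: R → ∀ n ∈ t.addrs, n ≠ s.next := fun ht n hn =>
    (h.lt (List.mem_flatMap.2 ⟨_, ht, hn⟩)).ne
  have hpn := hlt (t := p) (by simp) _ (addr_mem p)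
  have hqn := hlt (t := q) (by simp) _ (addr_mem q)
  set σ : Mem V := ((((({ (s.adv 1).upd s.next ⟨none, .internal p.addr q.addr, k, false⟩ with
    next := s.next + 1 } : Mem V)).adv 2).upd p.addr (p.rcd (some s.next))).adv 2).upd q.addr
      (q.rcd (some s.next)) with hσ
  have hnode : ∀ n, σ.node n = if n = q.addr then some (q.rcd (some s.next)) else
      if n = p.addr then some (p.rcd (some s.next)) else
      if n = s.next then some ⟨none, .internal p.addr q.addr, k, false⟩ else s.node n := by
    intro n
    simp [hσ, Mem.upd, Mem.adv, Function.update_apply]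
  have hrun : (TopTreeProg.newInternal p.addr q.addr k).run s = some (s.next, σ) := by
    rw [TopTreeProg.newInternal, run_bind, run_newNode, Option.bind_some]
    simp only [run_bind, run_setParent, Mem.upd_node, Mem.adv_node, run_pure, hpn, hqn, hne,
      if_false, hp.1, hq.1, Option.bind_some, hσ]
    rfl
  refine ⟨σ, hrun, ⟨fun t ht => ?_, ?_, fun x hx => ?_, fun x hx => ?_⟩, rfl, rfl, rfl⟩
  · rcases List.mem_cons.1 ht with rfl | ht
    · refine ⟨?_, ?_, ?_⟩
      · rw [hnode, if_neg hqn.symm, if_neg hpn.symm, if_pos rfl]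
      · refine (h.holds p (by simp)).setParent hdp ?_ fun n hn hn' => ?_
        · rw [hnode, if_neg hne.symm, if_pos rfl]
        · rw [hnode, if_neg, if_neg hn', if_neg (hlt (by simp) n hn)]
          exact fun e => hpq n hn q.addr (List.mem_append_left _ (addr_mem q)) e
      · refine (h.holds q (by simp)).setParent hdq ?_ fun n hn hn' => ?_
        · rw [hnode, if_pos rfl]
        · rw [hnode, if_neg hn', if_neg, if_neg (hlt (by simp) n hn)]
          exact fun e => hpq p.addr (addr_mem p) n (List.mem_append_left _ hn) e.symm
    · refine (h.holds t (by simp [ht])).congr fun n hn => ?_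
      have hnR : n ∈ R.flatMap RTree.addrs := List.mem_flatMap.2 ⟨t, ht, hn⟩
      rw [hnode, if_neg, if_neg, if_neg (hlt (by simp [ht]) n hn)]
      · exact fun e => hpq p.addr (addr_mem p) n (List.mem_append_right _ hnR) e.symm
      · exact fun e => hqR q.addr (addr_mem q) n hnR e.symm
  · have : ((RTree.node s.next false k p q :: R).flatMap RTree.addrs) =
        s.next :: (p :: q :: R).flatMap RTree.addrs := by simp [addrs]
    rw [this]
    exact List.nodup_cons.2 ⟨fun hx => (h.lt hx).ne rfl, h.nodup⟩
  · have : ((RTree.node s.next false k p q :: R).flatMap RTree.addrs) =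
        s.next :: (p :: q :: R).flatMap RTree.addrs := by simp [addrs]
    rw [this]
    rw [hnode] at hx
    split_ifs at hx with h1 h2 h3
    · exact h1 ▸ List.mem_cons_of_mem _ (List.mem_flatMap.2 ⟨q, by simp, addr_mem q⟩)
    · exact h2 ▸ List.mem_cons_of_mem _ (List.mem_flatMap.2 ⟨p, by simp, addr_mem p⟩)
    · exact h3 ▸ List.mem_cons_self
    · exact List.mem_cons_of_mem _ (h.allocated x hx)
  · rw [hnode] at hx
    show x < s.next + 1
    split_ifs at hx with h1 h2 h3
    · exact h1 ▸ (h.lt (List.mem_flatMap.2 ⟨q, by simp, addr_mem q⟩)).trans (Nat.lt_succ_self _)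
    · exact h2 ▸ (h.lt (List.mem_flatMap.2 ⟨p, by simp, addr_mem p⟩)).trans (Nat.lt_succ_self _)
    · omega
    · exact (h.fresh x hx).trans (Nat.lt_succ_self _)

end Heap

namespace TopTreeProg
variable {V : Type}

/-- Flip the given root if it has a boundary vertex on the given side. -/
def orient (side : Bool) (T : Option ℕ) : Prog V Unit :=
  match T with
  | some x => do if ← hasSideBoundary side x then toggleFlip x
  | none => pure ()

/-- A new internal node above two roots, the first of which may be missing. -/
def joinLeft (T : Option ℕ) (e k : ℕ) : Prog V ℕ :=
  match T with
  | some x => newInternal x e k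
  | none => pure e

/-- A new internal node above two roots, the second of which may be missing. -/
def joinRight (x : ℕ) (T : Option ℕ) (k : ℕ) : Prog V ℕ :=
  match T with
  | some y => newInternal x y k
  | none => pure x

/-- Expose a vertex, orient the root and unmark the vertex. -/
def present [DecidableEq V] (side : Bool) (v : V) : Prog V (Option ℕ) := do
  let T ← expose v
  orient side T
  setExposed v false
  return T

theorem link_eq [DecidableEq V] (u v : V) : link u v = (do
    let Tu ← present false u
    let Tv ← present true v
    let e ← newNode ⟨none, .leaf u v, Tu.isSome.toNat + Tv.isSome.toNat, false⟩
    addIncident u e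
    addIncident v e
    let T ← joinLeft Tu e Tv.isSome.toNat
    let T ← joinRight T Tv 0
    return some T) := by
  rw [link]
  simp only [present, bind_assoc, pure_bind]
  refine bind_congr fun Tu => ?_
  have key : ∀ (side : Bool) (T : Option ℕ) (P : Prog V (Option ℕ)),
      (orient side T >>= fun _ => P) = match T with
        | some x => do if ← hasSideBoundary side x then toggleFlip x
                       P
        | none => P := by
    intro side T P
    cases T with
    | none => rfl
    | some x =>
      simp only [orient, bind_assoc]
      refine bind_congr fun b => ?_
      cases b <;> rfl
  rw [key]
  cases Tu <;> simp only [key, bind_assoc] <;> rfl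

end TopTreeProg

namespace TopTreeProg
variable {V : Type} {s : Mem V} {X : Set V} {R : List (RTree V)} {u v : V}

/-- The only boundary vertex `v` of the root is its leftmost or rightmost one. -/
structure Presented (σ : Bool) (v : V) (τ τ' : RTree V) : Prop where
  rearr : Rearr τ τ'
  wf : τ'.WF {v}
  most : τ'.Most {v} σ v

theorem present_local [DecidableEq V] {K : ℝ} (hK : 7200 ≤ K) {τ : RTree V} (h : Ok s X τ)
    (hv : VertOk s X τ) (hvτ : v ∈ τ.verts) (hX : Disjoint τ.verts X) (side : Bool) :
    ∃ s' τ', (present side v).run s = some (some τ'.addr, s') ∧ Holds s'.node none τ' ∧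
      Presented (!side) v τ τ' ∧ (∀ n, n ∉ τ.addrs → s'.node n = s.node n) ∧
      s'.exposed = s.exposed ∧ s'.incident = s.incident ∧ s'.next = s.next ∧
      (s'.time : ℝ) - s.time + K * (τ'.pot - τ.pot) ≤ (16010 + 100 * K) * (1 + rk τ.size) := by
  have hvX : v ∉ X := Set.disjoint_left.1 hX hvτ
  obtain ⟨s1, τ1, r1, hm⟩ := expose_local hK h hv hvτ hvX
    (by rw [Set.disjoint_iff_inter_eq_empty.1 hX]; exact Set.subsingleton_empty)
  have hvo : VertOk s1 (insert v X) τ1 := by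
    refine ⟨fun w hw => ?_, fun w hw => ?_, fun w hw e => ?_⟩ <;> rw [hm.rearr.verts] at hw
    · rw [hm.exposed, Set.mem_insert_iff]
      by_cases e : w = v
      · simp [e]
      · rw [Function.update_of_ne e, hv.exposed w hw]
        simp [e]
    · rw [hm.incident]; exact hv.nodup w hw
    · rw [hm.incident, hv.mem w hw]
      simp only [hm.rearr.leaves.mem_iff]
  have hO : ∀ w ∈ τ1.verts, w ∈ insert v X ↔ w ∈ ({v} : Set V) := fun w hw => by
    rw [hm.rearr.verts] at hw
    simp [Set.disjoint_left.1 hX hw]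
  obtain ⟨b, n, hn, r2, hb⟩ := run_hasSide (C := []) hm.ok hvo side 0
  have hvτ1 : v ∈ τ1.verts := by rw [hm.rearr.verts]; exact hvτ
  have hex : Function.update s1.exposed v false = s.exposed := by
    rw [hm.exposed, Function.update_idem]
    refine Function.update_eq_self_iff.2 ?_
    have := hv.exposed v hvτ
    cases hs : s.exposed v
    · rfl
    · exact (hvX (this.1 hs)).elim
  have hroot := (holds_iff _ _ _).1 hm.ok.holds
  have hrk := rk_nonneg τ.size
  have hcost := hm.cost
  have hwf : τ1.WF {v} := (wf_congr hO).1 hm.ok.wf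
  have r1' : (present side v).run s =
      ((orient side (some τ1.addr) >>= fun _ => setExposed v false >>= fun _ =>
        pure (some τ1.addr)).run s1) := by
    rw [present, run_bind, r1, hm.rearr.addr]
    rfl
  have r2' : (hasSideBoundary side τ1.addr).run s1 = some (b, s1.adv (0 + n)) := r2
  cases b with
  | false =>
    refine ⟨{ (s1.adv (n + 1)) with exposed := s.exposed }, τ1, ?_, hm.ok.holds,
      ⟨hm.rearr, hwf, ?_⟩, hm.node, rfl, hm.incident, hm.next, ?_⟩
    · rw [r1', run_bind, orient, run_bind, r2']
      simp only [Option.bind_some, Bool.false_eq_true, if_false, run_pure, run_bind,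
        run_setExposed, Mem.adv_exposed, hex]
      simp [Mem.adv, Nat.add_assoc]
    · have hno : ¬ ∃ w, τ1.Side {v} side w := by
        rintro ⟨w, hw⟩
        refine absurd (hb.2 ⟨w, ?_⟩) (by simp)
        exact (side_congr hO side w).2 hw
      rcases position hvτ1 (O := {v}) rfl side with h1 | h1 | h1
      · exact (hno ⟨v, h1⟩).elim
      · refine Or.inr ⟨fun ⟨w, hw⟩ => h1.not_side (!side) ?_, h1⟩
        obtain rfl : w = v := hw.mem.2
        exact hw
      · exact Or.inl h1
    · have : (n : ℝ) ≤ 5 := by exact_mod_cast hn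
      simp only [Mem.adv_time]
      push_cast
      nlinarith
  | true =>
    obtain ⟨w, hw⟩ := hb.1 rfl
    have hw' := (side_congr hO side w).1 hw
    obtain rfl : w = v := hw'.mem.2
    refine ⟨{ ((s1.adv (n + 4)).upd τ1.addr (τ1.toggle.rcd none)) with exposed := s.exposed },
      τ1.toggle, ?_, ?_, ⟨hm.rearr.trans (.toggle _), (wf_toggle _ _).2 hwf, ?_⟩, ?_, rfl,
      hm.incident, hm.next, ?_⟩
    · rw [r1', run_bind, orient, run_bind, r2']
      simp only [Option.bind_some, if_true, run_toggleFlip, Mem.adv_node, hroot.1,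
        run_bind, run_setExposed, Mem.adv_exposed, Mem.upd_exposed, hex, run_pure]
      simp [Mem.adv, Mem.upd, rcd, Nat.add_assoc]
    · refine (holds_iff _ _ _).2 ⟨by simp [Mem.upd], ?_⟩
      refine Below.congr ((toggle_below _ _).2 hroot.2) fun n hn => ?_
      have hd := hm.ok.nodup
      rw [addrs_eq, List.nodup_cons] at hd
      have : n ≠ τ1.addr := fun e => hd.1 (by simpa [e] using hn)
      simp [Mem.upd, this]
    · rw [most_toggle, Bool.not_not]
      exact Or.inl hw'
    · intro n hn
      have : n ≠ τ1.addr := by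
        rintro rfl
        exact hn (hm.rearr.addrs.mem_iff.2 (addr_mem _))
      rw [← hm.node n hn]
      simp [Mem.upd, this]
    · have : (n : ℝ) ≤ 5 := by exact_mod_cast hn
      have hp : τ1.toggle.pot = τ1.pot := by cases τ1 <;> rfl
      rw [hp]
      simp only [Mem.upd_time, Mem.adv_time]
      push_cast
      nlinarith

theorem present_isolated [DecidableEq V] (hi : s.incident v = []) (he : s.exposed v = false)
    (side : Bool) : (present side v).run s = some (none, s.adv 3) := by
  rw [present, run_bind, expose_isolated hi, Option.bind_some]
  simp only [orient, run_bind, run_pure, run_setExposed, Option.bind_some, Function.update_idem]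
  have : Function.update s.exposed v false = s.exposed := Function.update_eq_self_iff.2 he.symm
  simp [this, Mem.adv]

theorem present_spec [DecidableEq V] {K : ℝ} (hK : 7200 ≤ K) {T : Option (RTree V)} {N : ℕ}
    (h : Heap s (T.toList ++ R)) (he : s.exposed v = false)
    (hT : ∀ τ ∈ T, τ.WF X ∧ VertOk s X τ ∧ v ∈ τ.verts ∧ Disjoint τ.verts X ∧ τ.size ≤ N)
    (hN : T = none → s.incident v = []) (side : Bool) :
    ∃ s' T', (present side v).run s = some (Option.map addr T', s') ∧ Heap s' (T'.toList ++ R) ∧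
      Option.Rel (Presented (!side) v) T T' ∧
      s'.exposed = s.exposed ∧ s'.incident = s.incident ∧ s'.next = s.next ∧
      (s'.time : ℝ) - s.time + K * (potSum T'.toList - potSum T.toList) ≤
        (16010 + 100 * K) * (1 + rk N) := by
  cases T with
  | none =>
    refine ⟨_, none, present_isolated (hN rfl) he side, h.congr rfl rfl, .none, rfl, rfl, rfl, ?_⟩
    have := rk_nonneg N
    simp only [Mem.adv_time]
    push_cast
    nlinarith
  | some τ =>
    obtain ⟨h1, h2, h3, h4, h5⟩ := hT τ rfl
    have hd := (List.nodup_flatMap.1 h.nodup).1 τ (by simp)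
    obtain ⟨s', τ', r, a1, a2, a3, a4, a5, a6, a7⟩ :=
      present_local hK ⟨h.holds τ (by simp), hd, h1⟩ h2 h3 h4 side
    refine ⟨s', some τ', r, h.replace a1 a2.rearr a3 a6, .some a2, a4, a5, a6, ?_⟩
    have h6 : rk τ.size ≤ rk N := rk_mono (size_pos τ) h5
    have h7 : (16010 + 100 * K) * (1 + rk τ.size) ≤ (16010 + 100 * K) * (1 + rk N) :=
      mul_le_mul_of_nonneg_left (by linarith) (by linarith)
    simp only [Option.toList, potSum, List.map_cons, List.map_nil, List.sum_cons, List.sum_nil,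
      add_zero]
    linarith

theorem wf_linkLeft {τ : RTree V} {O : Set V} {x e k k' : ℕ} (hτ : τ.WF {u}) (hm : τ.Most {u} true u)
    (hO : ∀ w ∈ τ.verts, w ∉ O) (hv : v ∉ τ.verts) (hk : k = (({u, v} : Set V) ∩ (O ∪ τ.verts)).ncard)
    (hk' : k' = (({v} : Set V) ∩ O).ncard) :
    (node x false k' τ (leaf e false k u v)).WF O ∧
      (v ∈ O → (node x false k' τ (leaf e false k u v)).Most O true v) := by
  have hu := hm.mem.1
  have huv : u ≠ v := fun h => hv (h ▸ hu)
  have hc : ∀ w ∈ τ.verts, w ∈ O ∪ ({u, v} : Set V) ↔ w ∈ ({u} : Set V) := by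
    intro w hw
    have : w ≠ v := fun h => hv (h ▸ hw)
    simp [hO w hw, this]
  have hs : (τ.verts ∪ {u, v}) ∩ O = {v} ∩ O := by
    ext w
    simp only [Set.mem_inter_iff, Set.mem_union, Set.mem_insert_iff, Set.mem_singleton_iff]
    constructor
    · rintro ⟨h1 | rfl | rfl, h2⟩
      · exact (hO w h1 h2).elim
      · exact (hO w hu h2).elim
      · exact ⟨rfl, h2⟩
    · rintro ⟨rfl, h2⟩
      exact ⟨Or.inr (Or.inr rfl), h2⟩
  refine ⟨⟨?_, ?_, (wf_congr hc).2 hτ, ⟨huv, hk, ?_⟩, u, ?_, (most_congr hc _ _).2 hm, ?_⟩, ?_⟩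
  · rw [hk']; exact congrArg Set.ncard hs.symm
  · rw [hk']
    have := Set.ncard_le_ncard (Set.inter_subset_left : ({v} : Set V) ∩ O ⊆ {v})
    rw [Set.ncard_singleton] at this
    omega
  · rw [hk]
    exact (Set.ncard_le_ncard Set.inter_subset_left).trans (Set.ncard_pair huv).le
  · ext w
    simp only [verts, Set.mem_inter_iff, Set.mem_insert_iff, Set.mem_singleton_iff]
    constructor
    · rintro ⟨h1, h2 | rfl⟩
      · exact h2
      · exact (hv h1).elim
    · rintro rfl
      exact ⟨hu, Or.inl rfl⟩
  · exact Or.inl ⟨Or.inr hu, rfl⟩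
  · intro hvO
    exact Or.inl ⟨hvO, Or.inr rfl, hv⟩

theorem wf_linkRight {τ t : RTree V} {O : Set V} {x : ℕ} (hτ : τ.WF {v}) (hm : τ.Most {v} false v)
    (ht : t.WF (O ∪ τ.verts)) (hm' : t.Most (O ∪ τ.verts) true v)
    (hO : ∀ w ∈ τ.verts, w ∉ O) (hO' : ∀ w ∈ t.verts, w ∉ O) (hi : t.verts ∩ τ.verts = {v}) :
    (node x false 0 t τ).WF O := by
  have hc : ∀ w ∈ τ.verts, w ∈ O ∪ t.verts ↔ w ∈ ({v} : Set V) := by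
    intro w hw
    rw [← hi]
    simp [hO w hw, hw]
  refine ⟨?_, by omega, ht, (wf_congr hc).2 hτ, v, hi, hm', (most_congr hc _ _).2 hm⟩
  have : (t.verts ∪ τ.verts) ∩ O = ∅ := by
    ext w
    simp only [Set.mem_inter_iff, Set.mem_union, Set.mem_empty_iff_false, iff_false]
    rintro ⟨h1 | h1, h2⟩
    exacts [hO' w h1 h2, hO w h1 h2]
  rw [this, Set.ncard_empty]

theorem joinLeft_spec {T : Option (RTree V)} {e k k' : ℕ} {O : Set V}
    (h : Heap s (leaf e false k u v :: (T.toList ++ R))) (huv : u ≠ v)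
    (hT : ∀ τ ∈ T, τ.WF {u} ∧ τ.Most {u} true u ∧ v ∉ τ.verts ∧ ∀ w ∈ τ.verts, w ∉ O)
    (hk : k = (({u, v} : Set V) ∩ (O ∪ {w | ∃ τ ∈ T, w ∈ τ.verts})).ncard)
    (hk' : k' = (({v} : Set V) ∩ O).ncard) :
    ∃ s' t, (joinLeft (T.map addr) e k').run s = some (t.addr, s') ∧ Heap s' (t :: R) ∧
      s'.exposed = s.exposed ∧ s'.incident = s.incident ∧ s'.time ≤ s.time + 5 ∧
      t.leaves.Perm ((e, u, v) :: T.toList.flatMap leaves) ∧ t.WF O ∧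
      (v ∈ O → t.Most O true v) ∧ t.pot ≤ potSum T.toList + rk t.size := by
  cases T with
  | none =>
    have h0 : {w : V | ∃ τ ∈ (none : Option (RTree V)), w ∈ τ.verts} = ∅ := by simp
    rw [h0, Set.union_empty] at hk
    refine ⟨s, leaf e false k u v, rfl, h, rfl, rfl, by omega, .refl _, ⟨huv, hk, ?_⟩,
      fun hv => Or.inl ⟨hv, rfl⟩, ?_⟩
    · rw [hk]
      exact (Set.ncard_le_ncard Set.inter_subset_left).trans (Set.ncard_pair huv).le
    · simp [pot, size, potSum, rk]
  | some τ =>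
    have h0 : {w : V | ∃ τ' ∈ some τ, w ∈ τ'.verts} = τ.verts := by simp
    rw [h0] at hk
    obtain ⟨h1, h2, h3, h4⟩ := hT τ rfl
    obtain ⟨s', r, a1, a2, a3, a4⟩ := (h.perm (List.Perm.swap _ _ _)).newInternal k'
    obtain ⟨b1, b2⟩ := wf_linkLeft (x := s.next) (e := e) h1 h2 h4 h3 hk hk'
    refine ⟨s', node s.next false k' τ (leaf e false k u v), r, a1, a2, a3, a4.le, ?_, b1, b2, ?_⟩
    · simp [leaves]
    · simp [pot, potSum, rk, size]
      linarith

theorem joinRight_spec {T : Option (RTree V)} {t : RTree V}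
    (h : Heap s (t :: (T.toList ++ R))) (hO' : ∀ w ∈ t.verts, w ∉ X)
    (hT : ∀ τ ∈ T, τ.WF {v} ∧ τ.Most {v} false v ∧ (∀ w ∈ τ.verts, w ∉ X) ∧
      t.verts ∩ τ.verts = {v} ∧ t.Most (X ∪ τ.verts) true v)
    (ht : t.WF (X ∪ {w | ∃ τ ∈ T, w ∈ τ.verts})) :
    ∃ s' t', (joinRight t.addr (T.map addr) 0).run s = some (t'.addr, s') ∧ Heap s' (t' :: R) ∧
      s'.exposed = s.exposed ∧ s'.incident = s.incident ∧ s'.time ≤ s.time + 5 ∧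
      t'.leaves.Perm (t.leaves ++ T.toList.flatMap leaves) ∧ t'.WF X ∧
      t'.pot ≤ t.pot + potSum T.toList + rk t'.size := by
  cases T with
  | none =>
    refine ⟨s, t, rfl, h, rfl, rfl, by omega, by simp, by simpa using ht, ?_⟩
    have := rk_nonneg t.size
    simpa [potSum] using this
  | some τ =>
    have h0 : {w : V | ∃ τ' ∈ some τ, w ∈ τ'.verts} = τ.verts := by simp
    rw [h0] at ht
    obtain ⟨h1, h2, h3, h4, h5⟩ := hT τ rfl
    obtain ⟨s', r, a1, a2, a3, a4⟩ := h.newInternal 0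
    refine ⟨s', node s.next false 0 t τ, r, a1, a2, a3, a4.le, by simp [leaves], wf_linkRight h1 h2 ht h5 h3 hO' h4, ?_⟩
    simp [pot, potSum, rk, size]
    linarith

end TopTreeProg

theorem exists_perm_toList {V : Type} {R : List (RTree V)}
    (h : R.Pairwise fun t t' => Disjoint t.verts t'.verts) (v : V) :
    ∃ (T : Option (RTree V)) (R' : List (RTree V)), R.Perm (T.toList ++ R') ∧
      (∀ τ ∈ T, v ∈ τ.verts) ∧ ∀ t ∈ R', v ∉ t.verts := by
  by_cases hv : ∃ τ ∈ R, v ∈ τ.verts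
  · obtain ⟨τ, hτ, hvτ⟩ := hv
    obtain ⟨R', hp⟩ := exists_perm_cons hτ
    refine ⟨some τ, R', hp, by simpa using hvτ, fun t ht hvt => ?_⟩
    have := (hp.pairwise_iff fun h => h.symm).1 h
    exact Set.disjoint_left.1 ((List.pairwise_cons.1 this).1 t ht) hvτ hvt
  · push Not at hv
    exact ⟨none, R, .refl _, by simp, hv⟩

theorem mem_verts_of_leaves {V : Type} {t : RTree V} {L : List (RTree V)} {e : ℕ} {u v : V}
    (h : t.leaves.Perm ((e, u, v) :: L.flatMap leaves)) (w : V) :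
    w ∈ t.verts ↔ w = u ∨ w = v ∨ ∃ τ ∈ L, w ∈ τ.verts := by
  simp only [mem_verts_iff, h.mem_iff, List.mem_cons, List.mem_flatMap, exists_eq_or_imp,
    or_and_right, exists_or]
  constructor
  · rintro (⟨p, rfl, hp⟩ | ⟨p, ⟨τ, h1, h2⟩, h3⟩)
    · exact hp.imp_right Or.inl
    · exact Or.inr (Or.inr ⟨τ, h1, p, h2, h3⟩)
  · rintro (rfl | rfl | ⟨τ, h1, p, h2, h3⟩)
    · exact Or.inl ⟨_, rfl, Or.inl rfl⟩
    · exact Or.inl ⟨_, rfl, Or.inr rfl⟩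
    · exact Or.inr ⟨p, ⟨τ, h1, h2⟩, h3⟩

theorem mem_cluster_of_leaves {V : Type} {t : RTree V} {L : List (RTree V)} {e : ℕ} {u v : V}
    (h : t.leaves.Perm ((e, u, v) :: L.flatMap leaves)) (w : Sym2 V) :
    w ∈ t.view.cluster ↔ w = s(u, v) ∨ ∃ τ ∈ L, w ∈ τ.view.cluster := by
  simp only [view_cluster, Set.mem_ofPred_eq, h.mem_iff, List.mem_cons, List.mem_flatMap,
    or_and_right, exists_or, exists_eq_left]
  refine or_congr_right ?_
  constructor
  · rintro ⟨p, ⟨τ, h1, h2⟩, h3⟩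
    exact ⟨τ, h1, p, h2, h3⟩
  · rintro ⟨τ, h1, p, h2, h3⟩
    exact ⟨p, ⟨τ, h1, h2⟩, h3⟩

namespace StoresRep
open TopTreeProg
variable {V : Type} {s s' : Mem V} {G : SimpleGraph V} {X : Set V}
  {R R' L : List (RTree V)} {u v : V}

theorem sup_edge [DecidableEq V] {t : RTree V} (h : StoresRep s G X R) (hR : R.Perm (L ++ R'))
    (hL : ∀ τ ∈ L, u ∈ τ.verts ∨ v ∈ τ.verts) (hu : ∀ τ ∈ R', u ∉ τ.verts)
    (hv : ∀ τ ∈ R', v ∉ τ.verts) (huv : ¬ G.Reachable u v) (hh : Heap s' (t :: R'))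
    (hwf : t.WF X) (hl : t.leaves.Perm ((s.next, u, v) :: L.flatMap leaves))
    (he : s'.exposed = s.exposed) (hi : s'.incident = Function.update
      (Function.update s.incident u (s.next :: s.incident u)) v (s.next :: s.incident v)) :
    StoresRep s' (G ⊔ SimpleGraph.edge u v) X (t :: R') := by
  have h' := h.perm hR
  have hne : u ≠ v := fun e => huv (e ▸ .refl _)
  have hedge : ∀ e : Sym2 V, e ∈ (G ⊔ SimpleGraph.edge u v).edgeSet ↔ e ∈ G.edgeSet ∨ e = s(u, v) := by
    intro e
    rw [SimpleGraph.edgeSet_sup, SimpleGraph.edgeSet_edge_of_ne hne]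
    simp [or_comm]
  have hV := mem_verts_of_leaves hl
  have hC := mem_cluster_of_leaves hl
  have hd := List.pairwise_append.1 h'.disjoint
  have hlt : ∀ {w n}, n ∈ s.incident w → n < s.next := by
    intro w n hn
    obtain ⟨τ, h1, a, b, h2, -⟩ := (h.incident_mem w n).1 hn
    exact h.heap.lt (List.mem_flatMap.2 ⟨τ, h1, leaf_addr_mem h2⟩)
  refine ⟨h.acyclic.sup_edge_of_not_reachable huv, ?_, ?_, ?_, ?_, ?_, hh.nodup, hh.allocated,
    hh.fresh, fun w => by rw [he]; exact h.exposed w, fun w => ?_, fun w n => ?_⟩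
  · intro τ hτ
    refine ⟨hh.holds τ hτ, ?_⟩
    rcases List.mem_cons.1 hτ with rfl | hτ
    · exact hwf
    · exact (h'.tree τ (by simp [hτ])).2
  · intro τ hτ e heτ
    rw [hedge]
    rcases List.mem_cons.1 hτ with rfl | hτ
    · rcases (hC e).1 heτ with h1 | ⟨τ', h1, h2⟩
      · exact Or.inr h1
      · exact Or.inl (h'.sub τ' (by simp [h1]) h2)
    · exact Or.inl (h'.sub τ (by simp [hτ]) heτ)
  · intro τ hτ e heG w hwe hwτ
    rw [hedge] at heG
    rcases List.mem_cons.1 hτ with rfl | hτ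
    · rw [hC]
      rcases heG with heG | rfl
      · right
        obtain ⟨τ', h1, h2⟩ := h'.covers e heG
        rcases List.mem_append.1 h1 with h1 | h1
        · exact ⟨τ', h1, h2⟩
        · exfalso
          have hw' : w ∈ τ'.verts := view_verts τ' ▸ TopTree.mem_verts_of_mem h2 hwe
          rcases (hV w).1 hwτ with rfl | rfl | ⟨τ₀, h3, h4⟩
          · exact hu τ' h1 hw'
          · exact hv τ' h1 hw'
          · exact Set.disjoint_left.1 (hd.2.2 τ₀ h3 τ' h1) h4 hw'
      · exact Or.inl rfl
    · rcases heG with heG | rfl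
      · exact h'.closed τ (by simp [hτ]) e heG w hwe hwτ
      · rcases Sym2.mem_iff.1 hwe with rfl | rfl
        exacts [(hu τ hτ hwτ).elim, (hv τ hτ hwτ).elim]
  · intro e heG
    rw [hedge] at heG
    rcases heG with heG | rfl
    · obtain ⟨τ', h1, h2⟩ := h'.covers e heG
      rcases List.mem_append.1 h1 with h1 | h1
      · exact ⟨t, by simp, (hC e).2 (Or.inr ⟨τ', h1, h2⟩)⟩
      · exact ⟨τ', by simp [h1], h2⟩
    · exact ⟨t, by simp, (hC _).2 (Or.inl rfl)⟩
  · refine List.pairwise_cons.2 ⟨fun τ hτ => Set.disjoint_left.2 fun w hw hwτ => ?_, hd.2.1⟩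
    rcases (hV w).1 hw with rfl | rfl | ⟨τ₀, h3, h4⟩
    · exact hu τ hτ hwτ
    · exact hv τ hτ hwτ
    · exact Set.disjoint_left.1 (hd.2.2 τ₀ h3 τ hτ) h4 hwτ
  · rw [hi]
    have hcons : ∀ w, (s.next :: s.incident w).Nodup := fun w =>
      List.nodup_cons.2 ⟨fun hn => (hlt hn).ne rfl, h.incident_nodup w⟩
    by_cases e1 : w = v
    · subst e1; simpa using hcons w
    · rw [Function.update_of_ne e1]
      by_cases e2 : w = u
      · subst e2; simpa using hcons w
      · rw [Function.update_of_ne e2]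
        exact h.incident_nodup w
  · have h1 : n ∈ s'.incident w ↔ (n = s.next ∧ (w = u ∨ w = v)) ∨ n ∈ s.incident w := by
      rw [hi]
      by_cases e1 : w = v
      · subst e1; simp
      · rw [Function.update_of_ne e1]
        by_cases e2 : w = u
        · subst e2; simp
        · rw [Function.update_of_ne e2]
          simp [e1, e2]
    rw [h1, h'.incident_mem]
    simp only [List.mem_cons, List.mem_append, exists_eq_or_imp, hl.mem_iff, List.mem_flatMap,
      Prod.mk.injEq]
    constructor
    · rintro (⟨rfl, h2⟩ | ⟨τ, h2 | h2, a, b, h3, h4⟩)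
      · exact Or.inl ⟨u, v, Or.inl ⟨rfl, rfl, rfl⟩, h2⟩
      · exact Or.inl ⟨a, b, Or.inr ⟨τ, h2, h3⟩, h4⟩
      · exact Or.inr ⟨τ, h2, a, b, h3, h4⟩
    · rintro (⟨a, b, ⟨rfl, rfl, rfl⟩ | ⟨τ, h2, h3⟩, h4⟩ | ⟨τ, h2, a, b, h3, h4⟩)
      · exact Or.inl ⟨rfl, h4⟩
      · exact Or.inr ⟨τ, Or.inl h2, a, b, h3, h4⟩
      · exact Or.inr ⟨τ, Or.inr h2, a, b, h3, h4⟩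

theorem edgeAt_sup {t : RTree V} {G' : SimpleGraph V} (h : StoresRep s G X R)
    (h' : StoresRep s' G' X (t :: R')) (hR : R.Perm (L ++ R'))
    (hl : t.leaves.Perm ((s.next, u, v) :: L.flatMap leaves)) :
    s.edgeAt s.next = none ∧ s'.edgeAt = Function.update s.edgeAt s.next (some (u, v)) := by
  have h0 : s.edgeAt s.next = none := by
    have : s.node s.next = none := by
      by_contra hn
      exact (h.fresh _ hn).ne rfl
    simp [Mem.edgeAt, this]
  refine ⟨h0, funext fun n => Option.ext fun ⟨a, b⟩ => ?_⟩
  rw [h'.edgeAt_iff]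
  simp only [List.mem_cons, exists_eq_or_imp, hl.mem_iff, List.mem_flatMap, Prod.mk.injEq]
  have h1 := (h.perm hR).edgeAt_iff n a b
  simp only [List.mem_append, or_and_right, exists_or] at h1
  rw [or_assoc, ← h1]
  by_cases e : n = s.next
  · subst e
    simp [h0, eq_comm]
  · simp [e]

end StoresRep

namespace TopTreeProg
variable {V : Type}

theorem run_addIncident [DecidableEq V] (v : V) (e : ℕ) (s : Mem V) :
    (addIncident v e).run s = some ((), { s.adv 1 with
      incident := Function.update s.incident v (e :: s.incident v) }) := rfl

theorem ncard_pair_inter {u v : V} (h : u ≠ v) (O : Set V) [DecidablePred (· ∈ O)] :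
    (({u, v} : Set V) ∩ O).ncard = (decide (u ∈ O)).toNat + (decide (v ∈ O)).toNat := by
  by_cases hu : u ∈ O <;> by_cases hv : v ∈ O <;>
    simp [Set.insert_inter_of_mem, Set.insert_inter_of_notMem, hu, hv, Set.ncard_pair h]

theorem Presented.rel_mem {σ : Bool} {v : V} {T T' : Option (RTree V)}
    (h : Option.Rel (Presented σ v) T T') {τ' : RTree V} (hτ : τ' ∈ T') :
    ∃ τ ∈ T, Presented σ v τ τ' := by
  cases h with
  | none => simp at hτ
  | some h =>
    obtain rfl := Option.mem_some_iff.1 hτ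
    exact ⟨_, rfl, h⟩

theorem Presented.rel_leaves {σ : Bool} {v : V} {T T' : Option (RTree V)}
    (h : Option.Rel (Presented σ v) T T') :
    (T'.toList.flatMap leaves).Perm (T.toList.flatMap leaves) := by
  cases h with
  | none => simp
  | some h => simpa using h.rearr.leaves.symm

end TopTreeProg

namespace StoresRep
open TopTreeProg
variable {V : Type} [DecidableEq V] {s s' : Mem V} {G : SimpleGraph V} {X : Set V}
  {R : List (RTree V)} {u v : V}

theorem link_spec {K : ℝ} (hK : 7200 ≤ K) (h : StoresRep s G X R) (huv : ¬ G.Reachable u v)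
    (hX : ∀ w ∈ X, ¬ G.Reachable u w ∧ ¬ G.Reachable v w) :
    ∃ r s' R', (link u v).run s = some (r, s') ∧ StoresRep s' (G ⊔ SimpleGraph.edge u v) X R' ∧
      r ≠ none ∧ IsRootOf (R'.map view) u r ∧ IsRootOf (R'.map view) v r ∧
      (∃ e, s.edgeAt e = none ∧ s'.edgeAt = Function.update s.edgeAt e (some (u, v))) ∧
      amortizedCost K s (R.map view) s' (R'.map view) ≤ (32040 + 202 * K) *
        (1 + Real.logb 2 (treeSize (G ⊔ SimpleGraph.edge u v) u)) := by
  classical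
  have hne : u ≠ v := fun e => huv (e ▸ .refl _)
  obtain ⟨Tu, R₁, hp₁, hu₁, hu₁'⟩ := exists_perm_toList h.disjoint u
  have h₁ := h.perm hp₁
  obtain ⟨Tv, R₂, hp₂, hv₂, hv₂'⟩ := exists_perm_toList (List.pairwise_append.1 h₁.disjoint).2.1 v
  have hp : R.Perm ((Tu.toList ++ Tv.toList) ++ R₂) := by
    rw [List.append_assoc]
    exact hp₁.trans (hp₂.append_left _)
  have hmu : ∀ τ ∈ Tu, τ ∈ R := fun τ hτ => hp.mem_iff.2 (by simp [Option.mem_toList.2 hτ])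
  have hmv : ∀ τ ∈ Tv, τ ∈ R := fun τ hτ => hp.mem_iff.2 (by simp [Option.mem_toList.2 hτ])
  have hm₂ : ∀ τ ∈ R₂, τ ∈ R₁ := fun τ hτ => hp₂.mem_iff.2 (by simp [hτ])
  have hXu : ∀ τ ∈ Tu, Disjoint τ.verts X := fun τ hτ => Set.disjoint_left.2 fun w hw hwX =>
    (hX w hwX).1 ((h.reach (hmu τ hτ) (hu₁ τ hτ) w).2 hw)
  have hXv : ∀ τ ∈ Tv, Disjoint τ.verts X := fun τ hτ => Set.disjoint_left.2 fun w hw hwX =>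
    (hX w hwX).2 ((h.reach (hmv τ hτ) (hv₂ τ hτ) w).2 hw)
  have hvu : ∀ τ ∈ Tu, v ∉ τ.verts := fun τ hτ hv => huv ((h.reach (hmu τ hτ) (hu₁ τ hτ) v).2 hv)
  have huX : u ∉ X := fun hu => (hX u hu).1 (.refl _)
  have hvX : v ∉ X := fun hv => (hX v hv).2 (.refl _)
  have hsu : s.exposed u = false := by simpa using (h.exposed u).not.2 huX
  have hsv : s.exposed v = false := by simpa using (h.exposed v).not.2 hvX
  have huv' : ∀ τ ∈ Tu, ∀ τ' ∈ Tv, Disjoint τ.verts τ'.verts := by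
    intro τ hτ τ' hτ'
    have := (List.pairwise_append.1 (h.perm hp).disjoint).1
    exact (List.pairwise_append.1 this).2.2 τ (Option.mem_toList.2 hτ) τ' (Option.mem_toList.2 hτ')
  set N := ((s.next, u, v) :: (Tu.toList ++ Tv.toList).flatMap leaves).length with hN
  have hsize : ∀ τ ∈ Tu.toList ++ Tv.toList, τ.size ≤ N := by
    intro τ hτ
    rw [size_eq, hN, List.length_cons, List.length_flatMap]
    have := List.single_le_sum (l := (Tu.toList ++ Tv.toList).map fun a => a.leaves.length)
      (fun _ _ => Nat.zero_le _) _ (List.mem_map_of_mem hτ)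
    omega
  -- expose both ends
  obtain ⟨s1, Tu', r1, hh1, hr1, he1, hi1, hn1, hc1⟩ := present_spec hK (v := u) (X := X) (N := N)
    (T := Tu) (R := Tv.toList ++ R₂)
    (by simpa [List.append_assoc] using h.heap.perm hp) hsu
    (fun τ hτ => ⟨(h.tree τ (hmu τ hτ)).2, h.vertOk (hmu τ hτ), hu₁ τ hτ, hXu τ hτ,
      hsize τ (by simp [Option.mem_toList.2 hτ])⟩)
    (fun hT => h₁.isolated_incident fun t ht => by
      subst hT
      exact hu₁' t (by simpa using ht)) false
  have hswap : ∀ A B C : List (RTree V), (A ++ (B ++ C)).Perm (B ++ (A ++ C)) := fun A B C => by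
    rw [← List.append_assoc, ← List.append_assoc]
    exact List.perm_append_comm.append_right C
  obtain ⟨s2, Tv', r2, hh2, hr2, he2, hi2, hn2, hc2⟩ := present_spec hK (v := v) (X := X) (N := N)
    (T := Tv) (R := Tu'.toList ++ R₂) (hh1.perm (hswap _ _ _)) (by rw [he1]; exact hsv)
    (fun τ hτ => ⟨(h.tree τ (hmv τ hτ)).2, (h.vertOk (hmv τ hτ)).congr he1 hi1 (.refl _),
      hv₂ τ hτ, hXv τ hτ, hsize τ (by simp [Option.mem_toList.2 hτ])⟩)
    (fun hT => by
      rw [hi1]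
      refine (h.perm hp).isolated_incident fun t ht => ?_
      subst hT
      rcases List.mem_append.1 ht with ht | ht
      · exact hvu t (by simpa using ht)
      · exact hv₂' t ht) true
  obtain ⟨s3, r3, hh3, he3, hi3, ht3⟩ := hh2.newLeaf u v (Tu'.isSome.toNat + Tv'.isSome.toNat)
  have hnx : s2.next = s.next := by rw [hn2, hn1]
  rw [hnx] at r3 hh3
  set s4 : Mem V := { s3.adv 2 with
    incident := Function.update
      (Function.update s.incident u (s.next :: s.incident u)) v (s.next :: s.incident v) } with hs4
  have r4 : (addIncident u s.next >>= fun _ => addIncident v s.next).run s3 = some ((), s4) := by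
    rw [run_bind, run_addIncident, Option.bind_some, run_addIncident, hs4, hi3, hi2, hi1]
    simp [Function.update_of_ne hne.symm, Mem.adv]
  have hPu : ∀ τ' ∈ Tu', ∃ τ ∈ Tu, Presented true u τ τ' := fun τ' hτ' =>
    Presented.rel_mem hr1 hτ'
  have hPv : ∀ τ' ∈ Tv', ∃ τ ∈ Tv, Presented false v τ τ' := fun τ' hτ' =>
    Presented.rel_mem hr2 hτ'
  have hvO : v ∈ X ∪ {w | ∃ τ ∈ Tv', w ∈ τ.verts} ↔ Tv'.isSome = true := by
    simp only [Set.mem_union, hvX, false_or, Option.isSome_iff_exists]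
    constructor
    · rintro ⟨τ, h1, -⟩
      exact ⟨τ, h1⟩
    · rintro ⟨τ, h1⟩
      obtain ⟨τ₀, -, hP⟩ := hPv τ h1
      exact ⟨τ, h1, hP.most.mem.1⟩
  have huO : u ∉ X ∪ {w | ∃ τ ∈ Tv', w ∈ τ.verts} := by
    rintro (h1 | ⟨τ, h1, h2⟩)
    · exact huX h1
    · obtain ⟨τ₀, h3, hP⟩ := hPv τ h1
      rw [hP.rearr.verts] at h2
      exact hu₁' τ₀ (hp₂.mem_iff.2 (by simp [Option.mem_toList.2 h3])) h2
  have huS : u ∈ {w | ∃ τ ∈ Tu', w ∈ τ.verts} ↔ Tu'.isSome = true := by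
    rw [Option.isSome_iff_exists]
    constructor
    · rintro ⟨τ, h1, -⟩
      exact ⟨τ, h1⟩
    · rintro ⟨τ, h1⟩
      obtain ⟨τ₀, -, hP⟩ := hPu τ h1
      exact ⟨τ, h1, hP.most.mem.1⟩
  have hvS : v ∉ {w | ∃ τ ∈ Tu', w ∈ τ.verts} := by
    rintro ⟨τ, h1, h2⟩
    obtain ⟨τ₀, h3, hP⟩ := hPu τ h1
    rw [hP.rearr.verts] at h2
    exact hvu τ₀ h3 h2
  have hh4 : Heap s4 (leaf s.next false (Tu'.isSome.toNat + Tv'.isSome.toNat) u v ::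
      (Tu'.toList ++ (Tv'.toList ++ R₂))) :=
    (hh3.perm ((hswap _ _ _).cons _)).congr rfl rfl
  obtain ⟨s5, t, r5, hh5, he5, hi5, ht5, hl5, hw5, hm5, hp5⟩ := joinLeft_spec (T := Tu')
    (k' := Tv'.isSome.toNat) (O := X ∪ {w | ∃ τ ∈ Tv', w ∈ τ.verts}) hh4 hne
    (fun τ' hτ' => by
      obtain ⟨τ, h3, hP⟩ := hPu τ' hτ'
      refine ⟨hP.wf, hP.most, fun hv => hvS ⟨τ', hτ', hv⟩, fun w hw => ?_⟩
      rw [hP.rearr.verts] at hw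
      rintro (h1 | ⟨σ', h1, h2⟩)
      · exact Set.disjoint_left.1 (hXu τ h3) hw h1
      · obtain ⟨σ, h4, hP'⟩ := hPv σ' h1
        rw [hP'.rearr.verts] at h2
        exact Set.disjoint_left.1 (huv' τ h3 σ h4) hw h2)
    (by
      rw [ncard_pair_inter hne]
      congr 2
      · rw [Bool.eq_iff_iff, decide_eq_true_iff, Set.mem_union, huS]
        exact (or_iff_right huO).symm
      · rw [Bool.eq_iff_iff, decide_eq_true_iff, Set.mem_union, hvO]
        exact (or_iff_left hvS).symm)
    (by
      by_cases hv : v ∈ X ∪ {w | ∃ τ ∈ Tv', w ∈ τ.verts}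
      · rw [hvO.1 hv, Set.inter_eq_left.2 (by simpa using hv)]
        simp
      · have : Tv'.isSome = false := by simpa using fun e => hv (hvO.2 e)
        rw [this, Set.singleton_inter_eq_empty.2 hv]
        simp)
  have hV5 := mem_verts_of_leaves hl5
  have hV5X : ∀ w ∈ t.verts, w ∉ X := by
    intro w hw
    rcases (hV5 w).1 hw with rfl | rfl | ⟨τ', h1, h2⟩
    · exact huX
    · exact hvX
    · obtain ⟨τ, h3, hP⟩ := hPu τ' (Option.mem_toList.1 h1)
      rw [hP.rearr.verts] at h2
      exact Set.disjoint_left.1 (hXu τ h3) h2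
  obtain ⟨s6, t', r6, hh6, he6, hi6, ht6, hl6, hw6, hp6⟩ := joinRight_spec (T := Tv') hh5 hV5X
    (fun σ' hσ' => by
      obtain ⟨σ, h3, hP⟩ := hPv σ' hσ'
      have hset : {w : V | ∃ τ ∈ Tv', w ∈ τ.verts} = σ'.verts := by
        rw [Option.mem_def] at hσ'
        subst hσ'
        simp
      refine ⟨hP.wf, hP.most, fun w hw => ?_, ?_, hset ▸ hm5 (hvO.2 ?_)⟩
      · rw [hP.rearr.verts] at hw
        exact Set.disjoint_left.1 (hXv σ h3) hw
      · ext w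
        rw [Set.mem_inter_iff, hV5, Set.mem_singleton_iff]
        constructor
        · rintro ⟨rfl | rfl | ⟨τ', h1, h2⟩, h5⟩
          · exact (huO (Or.inr ⟨σ', hσ', h5⟩)).elim
          · rfl
          · obtain ⟨τ, h4, hP'⟩ := hPu τ' (Option.mem_toList.1 h1)
            rw [hP'.rearr.verts] at h2
            rw [hP.rearr.verts] at h5
            exact (Set.disjoint_left.1 (huv' τ h4 σ h3) h2 h5).elim
        · rintro rfl
          exact ⟨Or.inr (Or.inl rfl), hP.most.mem.1⟩
      · rw [Option.mem_def] at hσ'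
        rw [hσ']; rfl) hw5
  have hl : t'.leaves.Perm ((s.next, u, v) :: (Tu.toList ++ Tv.toList).flatMap leaves) := by
    refine hl6.trans ((hl5.append (Presented.rel_leaves hr2)).trans ?_)
    rw [List.cons_append, List.flatMap_append]
    exact ((Presented.rel_leaves hr1).append_right _).cons _
  have hrep : StoresRep s6 (G ⊔ SimpleGraph.edge u v) X (t' :: R₂) := by
    refine h.sup_edge hp ?_ (fun τ hτ => hu₁' τ (hm₂ τ hτ)) hv₂' huv hh6 hw6 hl ?_ ?_
    · intro τ hτ
      rcases List.mem_append.1 hτ with hτ | hτ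
      · exact Or.inl (hu₁ τ (Option.mem_toList.1 hτ))
      · exact Or.inr (hv₂ τ (Option.mem_toList.1 hτ))
    · rw [he6, he5, hs4]
      show s3.exposed = _
      rw [he3, he2, he1]
    · rw [hi6, hi5, hs4]
  have hV := mem_verts_of_leaves hl
  have hut : u ∈ t'.verts := (hV u).2 (Or.inl rfl)
  have hvt : v ∈ t'.verts := (hV v).2 (Or.inr (Or.inl rfl))
  have hrun : (link u v).run s = some (some t'.addr, s6) := by
    rw [link_eq, run_bind, r1, Option.bind_some, run_bind, r2, Option.bind_some, run_bind]
    simp only [Option.isSome_map]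
    rw [r3, Option.bind_some, ← bind_assoc, run_bind, r4, Option.bind_some, run_bind, r5,
      Option.bind_some, run_bind, r6, Option.bind_some, run_pure]
  refine ⟨_, s6, _, hrun, hrep, by simp, isRootOf_view (t := t') (by simp) hut rfl,
    isRootOf_view (t := t') (by simp) hvt rfl, ⟨s.next, h.edgeAt_sup hrep hp hl⟩, ?_⟩
  have hNt : t'.size = N := by rw [size_eq, hl.length_eq]
  have hNt5 : t.size ≤ N := by
    rw [← hNt, size_eq, size_eq, hl6.length_eq, List.length_append]
    omega
  rw [amortizedCost, forestPotential_view, forestPotential_view, potSum_perm hp, potSum_cons,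
    hrep.treeSize_eq (t := t') (by simp) hut]
  have hpa : potSum ((Tu.toList ++ Tv.toList) ++ R₂) =
      potSum Tu.toList + potSum Tv.toList + potSum R₂ := by
    simp [potSum, add_assoc]
  rw [hpa]
  have hrkN : rk N ≤ Real.logb 2 ((t'.size + 1 : ℕ) : ℝ) := by
    rw [← hNt]
    exact rk_mono (size_pos t') (Nat.le_succ _)
  have hrk5 : rk t.size ≤ rk N := rk_mono (size_pos t) hNt5
  rw [hNt] at hp6
  have htime : (s6.time : ℝ) ≤ s2.time + 13 := by
    have : s6.time ≤ s2.time + 13 := by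
      have : s4.time = s3.time + 2 := rfl
      omega
    exact_mod_cast this
  have hfin : (32040 + 202 * K) * (1 + rk N) ≤
      (32040 + 202 * K) * (1 + Real.logb 2 ((t'.size + 1 : ℕ) : ℝ)) :=
    mul_le_mul_of_nonneg_left (by linarith) (by linarith)
  refine le_trans ?_ hfin
  have hrN := rk_nonneg N
  have hpot : K * (t'.pot + potSum R₂ - (potSum Tu.toList + potSum Tv.toList + potSum R₂)) ≤
      K * (potSum Tu'.toList - potSum Tu.toList) + K * (potSum Tv'.toList - potSum Tv.toList) +
        K * (2 * rk N) := by
    rw [← mul_add, ← mul_add]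
    exact mul_le_mul_of_nonneg_left (by linarith) (by linarith)
  nlinarith

end StoresRep

namespace TopTreeProg
variable {V : Type}

theorem mem_caddrs {C : List (Fr V)} {n : ℕ} :
    n ∈ caddrs C ↔ ∃ f ∈ C, n = f.addr ∨ n ∈ f.sib.addrs := by
  induction C with
  | nil => simp [caddrs]
  | cons f C ih => simp [caddrs, ih, or_assoc]

theorem deleteAllAncestors_spec (C : List (Fr V)) :
    ∀ {s : Mem V} {t : RTree V} (_ : Holds s.node none (fill C t)) (_ : (fill C t).addrs.Nodup),
    ∃ s', (deleteAllAncestors t.addr).run s = some ((), s') ∧ s.Same s' (fill C t).addrs ∧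
      s'.time ≤ s.time + 6 * (C.length + 1) ∧ s'.node t.addr = none ∧
      (∀ f ∈ C, s'.node f.addr = none ∧ Holds s'.node none f.sib) ∧
      ∀ n ∈ t.belowAddrs, s'.node n = s.node n := by
  induction C with
  | nil =>
    intro s t h hn
    have h1 := fill_node h
    refine ⟨{ (s.adv 2) with node := Function.update s.node t.addr none }, ?_,
      ⟨fun n hn => ?_, rfl, rfl, rfl⟩, ?_, ?_, by simp, fun n hn' => ?_⟩
    · rw [deleteAllAncestors, run_bind, run_getParent, h1]
      simp only [rcd, par, Option.bind_some, run_bind, run_pure, run_deleteNode, Mem.adv_node, h1]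
      rfl
    · have : n ≠ t.addr := fun e => hn (e ▸ addr_mem t)
      simp [this]
    · simp
    · simp
    · have hd : t.addrs.Nodup := hn
      rw [addrs_eq, List.nodup_cons] at hd
      have : n ≠ t.addr := fun e => hd.1 (e ▸ hn')
      simp [this]
  | cons f C ih =>
    intro s t h hn
    have h1 := fill_node h
    have h2 := fill_node (C := C) (t := Fr.fill f t) h
    have h3 := ((holds_fill ..).1 h).2.2.1
    have hd := List.nodup_append.1 ((fill_addrs (f :: C) t).nodup_iff.1 hn)
    have hd2 := List.nodup_cons.1 hd.2.1
    have hd3 := List.nodup_append.1 hd2.2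
    obtain ⟨hts, htf⟩ := fill_ne hn
    obtain ⟨s1, r1, S1, ht1, hf1, hC1, hb1⟩ := ih (s := s.adv 3) (t := Fr.fill f t) h hn
    rw [Fr.fill_addr] at r1 hf1
    have hbel : (Fr.fill f t).belowAddrs.Perm (t.addrs ++ f.sib.addrs) := by
      have := mk_addrs f.addr f.fl f.k f.zero t f.sib
      rw [addrs_eq, mk_addr, List.perm_cons] at this
      exact this
    have hsame : ∀ n, n ∈ t.addrs ∨ n ∈ f.sib.addrs → s1.node n = s.node n := fun n hn =>
      hb1 n (hbel.mem_iff.2 (List.mem_append.2 hn))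
    have hsib := (holds_iff _ _ _).1 h3
    have hs1 : s1.node f.sib.addr = some (f.sib.rcd (some f.addr)) := by
      rw [hsame _ (Or.inr (addr_mem _)), hsib.1]
    have ht1' : s1.node t.addr = some (t.rcd (some f.addr)) := by
      rw [hsame _ (Or.inl (addr_mem _)), h1]; rfl
    refine ⟨{ (s1.adv 3) with node := Function.update (Function.update s1.node f.sib.addr
      (some (f.sib.rcd none))) t.addr none }, ?_, ⟨fun n hn => ?_, S1.exposed, S1.incident, S1.next⟩,
      ?_, ?_, ?_, ?_⟩
    · rw [deleteAllAncestors, run_bind, run_getParent, h1]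
      simp only [rcd, par, Option.bind_some]
      have h2' := h2
      rw [fr_rcd, Fr.fill_addr] at h2'
      rw [run_bind, run_sibling (s := s.adv 1) (x := t.addr) (y := f.addr) h1 h2']
      have hz : (if ((if f.zero then t.addr else f.sib.addr) == t.addr) = true then
          (if f.zero then f.sib.addr else t.addr) else (if f.zero then t.addr else f.sib.addr)) =
          f.sib.addr := by
        cases f.zero <;> simp [hts.symm]
      rw [hz, Option.bind_some, run_bind]
      have r1' : (deleteAllAncestors f.addr).run ((s.adv 1).adv 2) = some ((), s1) := r1
      rw [r1', Option.bind_some]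
      simp only [run_bind, Option.bind_some, run_setParent, hs1, run_deleteNode, Mem.upd_node,
        Mem.adv_node, hts, if_false, ht1', rcd, Mem.adv, Mem.upd]
      rw [Function.update_of_ne hts, ht1']
      rfl
    · have hn' := fun h' => hn ((fill_addrs (f :: C) t).mem_iff.2 h')
      have e1 : n ≠ t.addr := fun e => hn' (List.mem_append_left _ (e ▸ addr_mem t))
      have e2 : n ≠ f.sib.addr := fun e => hn' (List.mem_append_right _
        (List.mem_cons_of_mem _ (List.mem_append_left _ (e ▸ addr_mem f.sib))))
      have := S1.node n hn
      simpa [e1, e2] using this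
    · have : (s.adv 3).time = s.time + 3 := rfl
      simp only [Mem.adv_time, List.length_cons]
      omega
    · simp
    · intro g hg
      rcases List.mem_cons.1 hg with rfl | hg
      · refine ⟨?_, ?_⟩
        · have e2 : g.addr ≠ g.sib.addr := fun e => hd2.1 (List.mem_append_left _ (e ▸ addr_mem _))
          simpa [htf.symm, e2] using hf1
        · refine h3.setParent hd3.1 ?_ fun n hn1 hn2 => ?_
          · simp [hts.symm]
          · have e1 : n ≠ t.addr := fun e => hd.2.2 t.addr (addr_mem t) n
              (List.mem_cons_of_mem _ (List.mem_append_left _ hn1)) e.symm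
            simpa [e1, hn2] using hsame n (Or.inr hn1)
      · have hne : ∀ n ∈ caddrs C, n ≠ t.addr ∧ n ≠ f.sib.addr := fun n hn1 =>
          ⟨fun e => hd.2.2 t.addr (addr_mem t) n
            (List.mem_cons_of_mem _ (List.mem_append_right _ hn1)) e.symm,
            fun e => hd3.2.2 f.sib.addr (addr_mem _) n hn1 e.symm⟩
        obtain ⟨a1, a2⟩ := hC1 g hg
        refine ⟨?_, a2.congr fun n hn1 => ?_⟩
        · obtain ⟨e1, e2⟩ := hne g.addr (mem_caddrs.2 ⟨g, hg, Or.inl rfl⟩)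
          simpa [e1, e2] using a1
        · obtain ⟨e1, e2⟩ := hne n (mem_caddrs.2 ⟨g, hg, Or.inr hn1⟩)
          simp [e1, e2]
    · intro n hn1
      have hn2 : n ∈ t.addrs := by rw [addrs_eq]; exact List.mem_cons_of_mem _ hn1
      have e1 : n ≠ t.addr := by
        have := hd.1
        rw [addrs_eq, List.nodup_cons] at this
        exact fun e => this.1 (e ▸ hn1)
      have e2 : n ≠ f.sib.addr := hd.2.2 n hn2 f.sib.addr
        (List.mem_cons_of_mem _ (List.mem_append_left _ (addr_mem _)))
      simpa [e1, e2] using hsame n (Or.inl hn2)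

theorem _root_.Heap.delete {s : Mem V} {R : List (RTree V)} {C : List (Fr V)} {x : ℕ} {fl : Bool}
    {k : ℕ} {a b : V} (h : Heap s (fill C (leaf x fl k a b) :: R)) :
    ∃ s', (deleteAllAncestors x).run s = some ((), s') ∧ Heap s' (C.map Fr.sib ++ R) ∧
      s'.exposed = s.exposed ∧ s'.incident = s.incident ∧
      s'.time ≤ s.time + 6 * (C.length + 1) ∧ s'.node x = none := by
  have hd := h.nodup
  rw [List.flatMap_cons, List.nodup_append] at hd
  obtain ⟨hd1, hd2, hd3⟩ := hd
  obtain ⟨s', r, S, ht, h1, h2, -⟩ := deleteAllAncestors_spec C (h.holds _ List.mem_cons_self) hd1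
  have hp := fill_addrs C (leaf x fl k a b)
  have hsub : ((C.map Fr.sib).flatMap RTree.addrs).Sublist (caddrs C) := by
    clear hp h2 h1 ht S r hd1 hd3 h
    induction C with
    | nil => simp
    | cons f C ih =>
      simp only [List.map_cons, List.flatMap_cons, caddrs]
      exact ((List.Sublist.refl _).append ih).cons _
  refine ⟨s', r, ⟨fun t ht => ?_, ?_, fun n hn => ?_, fun n hn => ?_⟩, S.exposed, S.incident, ht, h1⟩
  · rcases List.mem_append.1 ht with ht | ht
    · obtain ⟨f, hf, rfl⟩ := List.mem_map.1 ht
      exact (h2 f hf).2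
    · refine (h.holds t (by simp [ht])).congr fun n hn => S.node n fun hn' => ?_
      exact hd3 n hn' n (List.mem_flatMap.2 ⟨t, ht, hn⟩) rfl
  · rw [List.flatMap_append, List.nodup_append]
    refine ⟨(List.nodup_append.1 (hp.nodup_iff.1 hd1)).2.1.sublist hsub, hd2, fun n hn => ?_⟩
    exact hd3 n (hp.mem_iff.2 (List.mem_append_right _ (hsub.subset hn)))
  · rw [List.flatMap_append, List.mem_append]
    by_cases hn' : n ∈ (fill C (leaf x fl k a b)).addrs
    · left
      rcases List.mem_append.1 (hp.mem_iff.1 hn') with h3 | h3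
      · obtain rfl : n = x := by simpa [addrs] using h3
        exact (hn h1).elim
      · obtain ⟨f, hf, rfl | h4⟩ := mem_caddrs.1 h3
        · exact (hn (h2 f hf).1).elim
        · exact List.mem_flatMap.2 ⟨f.sib, List.mem_map_of_mem hf, h4⟩
    · right
      rw [S.node n hn'] at hn
      rcases List.mem_append.1 (h.allocated n hn) with h3 | h3
      exacts [(hn' h3).elim, h3]
  · rw [S.next]
    by_cases hn' : n ∈ (fill C (leaf x fl k a b)).addrs
    · exact h.lt (List.mem_append_left _ hn')
    · rw [S.node n hn'] at hn
      exact h.fresh n hn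

/-- If nothing is to do on a path and neither the root nor its child is a path cluster, then the path
is short. -/
theorem length_le_two {C : List (Fr V)} {t : RTree V} (h : irred (types C t) = true)
    (hr : (fill C t).isP = false)
    (hc : ∀ D f, C = D ++ [f] → (fill D t).isP = false) : C.length ≤ 2 := by
  induction C generalizing t with
  | nil => simp
  | cons f₁ C ih =>
    rcases C with - | ⟨f₂, - | ⟨f₃, C⟩⟩
    · simp
    · simp
    · exfalso
      have h' : irred (types (f₂ :: f₃ :: C) (Fr.fill f₁ t)) = true := by
        rw [types_cons, types_cons] at h
        rw [types_cons]
        revert h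
        simp only [types, List.map, irred]
        simp only [Bool.and_eq_true]
        exact fun h => h.2
      have hlen := ih h' hr fun D f e => hc (f₁ :: D) f (by rw [e]; rfl)
      obtain rfl : C = [] := by
        rcases C with - | ⟨f₄, C⟩
        · rfl
        · simp at hlen
      have h3 := hc [f₁, f₂] f₃ rfl
      simp only [fill_cons, fill_nil, Fr.fill_isP] at hr h3
      simp only [types, List.map, irred, redex, hr, h3] at h
      revert h
      cases t.isP <;> cases (f₁.k == 2) <;> simp

end TopTreeProg

namespace TopTreeProg
variable {V : Type}

theorem run_removeIncident [DecidableEq V] (v : V) (e : ℕ) (s : Mem V) :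
    (removeIncident v e).run s = some ((), { s.adv 1 with
      incident := Function.update s.incident v ((s.incident v).erase e) }) := rfl

/-- The pieces into which a splayed top tree falls when the leaf is removed. -/
theorem siblings_spec {X : Set V} {C : List (Fr V)} {e k : ℕ} {fl : Bool} {a b : V}
    (h : (fill C (leaf e fl k a b)).WF X) (hX : ∀ w ∈ (fill C (leaf e fl k a b)).verts, w ∉ X)
    (hi : irred (types C (leaf e fl k a b)) = true) :
    C.length ≤ 2 ∧ (∀ g ∈ C.map Fr.sib, g.WF (X ∪ {a, b}) ∧ ¬ (a ∈ g.verts ∧ b ∈ g.verts)) ∧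
      (C.map Fr.sib).Pairwise fun t t' => Disjoint t.verts t'.verts := by
  have hab : a ≠ b := (h.of_fill (C := C)).1
  have hr0 : (fill C (leaf e fl k a b)).count = 0 := by
    rw [h.count_eq, Set.disjoint_iff_inter_eq_empty.1 (Set.disjoint_left.2 hX), Set.ncard_empty]
  have hr : (fill C (leaf e fl k a b)).isP = false := isP_false (by omega)
  have hlen : C.length ≤ 2 := by
    refine length_le_two hi hr fun D f hC => isP_false ?_
    subst hC
    rw [fill_append, fill_cons, fill_nil, Fr.fill] at h hX
    obtain ⟨-, -, h1, -, c, hc, -⟩ := (wf_mk ..).1 h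
    rw [h1.count_eq]
    have : (fill D (leaf e fl k a b)).verts ∩ (X ∪ f.sib.verts) = {c} := by
      rw [Set.inter_union_distrib_left, hc,
        Set.disjoint_iff_inter_eq_empty.1 (Set.disjoint_left.2 fun w hw =>
          hX w (by rw [mk_verts]; exact Or.inl hw)), Set.empty_union]
    rw [this, Set.ncard_singleton]
    decide
  refine ⟨hlen, ?_⟩
  rcases C with - | ⟨f, - | ⟨g, - | ⟨f₃, C⟩⟩⟩
  · simp
  · obtain ⟨-, -, -, h2, c, hc, -⟩ := (wf_mk ..).1 (show (RTree.mk ..).WF X from h)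
    refine ⟨?_, by simp⟩
    simp only [List.map_cons, List.map_nil, List.mem_singleton, forall_eq]
    refine ⟨h2, fun ⟨h3, h4⟩ => hab ?_⟩
    have ha : a ∈ ({c} : Set V) := hc ▸ ⟨Or.inl rfl, h3⟩
    have hb : b ∈ ({c} : Set V) := hc ▸ ⟨Or.inr rfl, h4⟩
    exact ha.trans hb.symm
  · obtain ⟨-, -, h1, h2, c, hc, -⟩ := (wf_mk ..).1 (show (RTree.mk ..).WF X from h)
    obtain ⟨-, -, h3, h4, d, hd, -⟩ := (wf_mk ..).1 (show (RTree.mk ..).WF _ from h1)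
    rw [Fr.fill_verts] at h2 hc
    have hfab : ¬ (a ∈ f.sib.verts ∧ b ∈ f.sib.verts) := fun ⟨h5, h6⟩ => hab <| by
      have ha : a ∈ ({d} : Set V) := hd ▸ ⟨Or.inl rfl, h5⟩
      have hb : b ∈ ({d} : Set V) := hd ▸ ⟨Or.inr rfl, h6⟩
      exact ha.trans hb.symm
    have hgc : ∀ w, w ∈ ({a, b} : Set V) ∨ w ∈ f.sib.verts → w ∈ g.sib.verts → w = c :=
      fun w h5 h6 => by
        have : w ∈ ({c} : Set V) := hc ▸ ⟨h5, h6⟩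
        exact this
    have hgab : ¬ (a ∈ g.sib.verts ∧ b ∈ g.sib.verts) := fun ⟨h5, h6⟩ => hab <|
      (hgc a (Or.inl (Or.inl rfl)) h5).trans (hgc b (Or.inl (Or.inr rfl)) h6).symm
    have hk : k = 2 := by
      have hg : (g.k == 2) = false := by simpa using hr
      simp only [types, List.map, irred, hg, Bool.or_false] at hi
      have h5 : (leaf e fl k a b).count = 2 := by simpa [isP] using hi
      exact h5
    have hin : ∀ w ∈ ({a, b} : Set V), w ∈ f.sib.verts ∨ w ∈ g.sib.verts := by
      have h5 : k = (({a, b} : Set V) ∩ ((X ∪ g.sib.verts) ∪ f.sib.verts)).ncard := h3.2.1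
      have h6 : ({a, b} : Set V) ∩ ((X ∪ g.sib.verts) ∪ f.sib.verts) = {a, b} := by
        refine Set.eq_of_subset_of_ncard_le Set.inter_subset_left ?_ (Set.toFinite _)
        rw [← h5, hk, Set.ncard_pair hab]
      intro w hw
      rw [← h6] at hw
      rcases hw with ⟨h7, (h8 | h8) | h8⟩
      · refine (hX w ?_ h8).elim
        simp only [fill_cons, fill_nil, Fr.fill_verts]
        exact Or.inl (Or.inl h7)
      · exact Or.inr h8
      · exact Or.inl h8
    have hdis : ∀ w ∈ f.sib.verts, w ∉ g.sib.verts := by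
      intro w hwf hwg
      obtain rfl := hgc w (Or.inr hwf) hwg
      by_cases ha : a ∈ f.sib.verts
      · have hb : b ∉ f.sib.verts := fun hb => hfab ⟨ha, hb⟩
        have hbg := (hin b (Or.inr rfl)).resolve_left hb
        rw [← hgc b (Or.inl (Or.inr rfl)) hbg] at hwf
        exact hb hwf
      · have hag := (hin a (Or.inl rfl)).resolve_left ha
        rw [← hgc a (Or.inl (Or.inl rfl)) hag] at hwf
        exact ha hwf
    refine ⟨?_, by simpa using Set.disjoint_left.2 hdis⟩
    simp only [List.map_cons, List.map_nil, List.mem_cons, List.not_mem_nil, or_false,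
      forall_eq_or_imp, forall_eq]
    refine ⟨⟨(wf_congr fun w hw => ?_).1 h4, hfab⟩, (wf_congr fun w hw => ?_).1 h2, hgab⟩
    · have := hdis w hw
      simp only [Set.mem_union, this, or_false]
      rfl
    · have : w ∉ f.sib.verts := fun h5 => hdis w h5 hw
      simp only [Set.mem_union, this, or_false]
      rfl
  · simp at hlen

theorem potSum_siblings (C : List (Fr V)) (t : RTree V) :
    potSum (C.map Fr.sib) ≤ (fill C t).pot := by
  have h : potSum (C.map Fr.sib) = sibPot C := by
    induction C with
    | nil => simp [potSum, sibPot]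
    | cons f C ih => rw [List.map_cons, potSum_cons, ih, sibPot]
  rw [h, fill_pot]
  have h1 := pot_nonneg t
  have h2 := le_pathPot C (size_pos t)
  have h3 := mul_nonneg (Nat.cast_nonneg (α := ℝ) C.length) (rk_nonneg t.size)
  linarith

end TopTreeProg

theorem rk_le_of_le {m n : ℕ} (h : m ≤ n) : rk m ≤ rk n := by
  rcases Nat.eq_zero_or_pos m with rfl | hm
  · simpa [rk] using rk_nonneg n
  · exact rk_mono hm h

namespace StoresRep
open TopTreeProg
variable {V : Type} {s s' : Mem V} {G : SimpleGraph V} {X : Set V}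
  {R L : List (RTree V)} {u v : V}

theorem deleteEdge [DecidableEq V] {τ : RTree V} {e : ℕ} (h : StoresRep s G X (τ :: R))
    (hl : τ.leaves.Perm ((e, u, v) :: L.flatMap leaves)) (hh : Heap s' (L ++ R))
    (hL : ∀ g ∈ L, g.WF (X ∪ {u, v}) ∧ ¬ (u ∈ g.verts ∧ v ∈ g.verts))
    (hd : L.Pairwise fun t t' => Disjoint t.verts t'.verts) (hn : s'.node e = none)
    (he : ∀ w, s'.exposed w = true ↔ w ∈ X ∪ {u, v})
    (hi : s'.incident = Function.update (Function.update s.incident u ((s.incident u).erase e)) v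
      ((s.incident v).erase e)) (huv : u ≠ v) :
    StoresRep s' (G.deleteEdges {s(u, v)}) (X ∪ {u, v}) (L ++ R) ∧
      s'.edgeAt = Function.update s.edgeAt e none := by
  have hV := mem_verts_of_leaves hl
  have hC := mem_cluster_of_leaves hl
  have hut : u ∈ τ.verts := (hV u).2 (Or.inl rfl)
  have hvt : v ∈ τ.verts := (hV v).2 (Or.inr (Or.inl rfl))
  have hLτ : ∀ g ∈ L, ∀ w ∈ g.verts, w ∈ τ.verts := fun g hg w hw =>
    (hV w).2 (Or.inr (Or.inr ⟨g, hg, hw⟩))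
  have hRτ : ∀ g ∈ R, ∀ w ∈ τ.verts, w ∉ g.verts := fun g hg => (h.not_mem_of_cons hg).1
  have hedge : ∀ f : Sym2 V, f ∈ (G.deleteEdges {s(u, v)}).edgeSet ↔ f ∈ G.edgeSet ∧ f ≠ s(u, v) := by
    intro f
    rw [SimpleGraph.edgeSet_deleteEdges]
    rfl
  have heuv : s.edgeAt e = some (u, v) :=
    (h.edgeAt_iff e u v).2 ⟨τ, by simp, hl.mem_iff.2 (by simp)⟩
  have hleaf : ∀ n a b, (∃ t ∈ τ :: R, (n, a, b) ∈ t.leaves) ↔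
      (n, a, b) = (e, u, v) ∨ ∃ t ∈ L ++ R, (n, a, b) ∈ t.leaves := by
    intro n a b
    simp only [List.mem_cons, exists_eq_or_imp, hl.mem_iff, List.mem_flatMap, List.mem_append,
      or_and_right, exists_or, or_assoc, exists_eq_left]
  have hnew : ∀ n a b, (∃ t ∈ L ++ R, (n, a, b) ∈ t.leaves) → n ≠ e := by
    rintro n a b ⟨t, ht, hm⟩ rfl
    exact (hh.holds t ht).ne_none n (leaf_addr_mem hm) hn
  have hrep : StoresRep s' (G.deleteEdges {s(u, v)}) (X ∪ {u, v}) (L ++ R) := by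
    refine ⟨h.acyclic.anti (G.deleteEdges_le _), ?_, ?_, ?_, ?_, ?_, hh.nodup, hh.allocated, hh.fresh,
      he, fun w => ?_, fun w n => ?_⟩
    · intro t ht
      refine ⟨hh.holds t ht, ?_⟩
      rcases List.mem_append.1 ht with ht | ht
      · exact (hL t ht).1
      · refine (wf_congr fun w hw => ?_).1 (h.tree t (by simp [ht])).2
        have h1 : w ≠ u := fun e => hRτ t ht u hut (e ▸ hw)
        have h2 : w ≠ v := fun e => hRτ t ht v hvt (e ▸ hw)
        simp [h1, h2]
    · intro t ht f hf
      rw [hedge]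
      rcases List.mem_append.1 ht with ht | ht
      · refine ⟨h.sub τ (by simp) ((hC f).2 (Or.inr ⟨t, ht, hf⟩)), ?_⟩
        rintro rfl
        exact (hL t ht).2 ⟨view_verts t ▸ TopTree.mem_verts_of_mem hf (by simp),
          view_verts t ▸ TopTree.mem_verts_of_mem hf (by simp)⟩
      · refine ⟨h.sub t (by simp [ht]) hf, ?_⟩
        rintro rfl
        exact hRτ t ht u hut (view_verts t ▸ TopTree.mem_verts_of_mem hf (by simp))
    · intro t ht f hf w hwf hwt
      rw [hedge] at hf
      rcases List.mem_append.1 ht with ht | ht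
      · have h1 := h.closed τ (by simp) f hf.1 w hwf (hLτ t ht w hwt)
        obtain ⟨g, hg, hfg⟩ := ((hC f).1 h1).resolve_left hf.2
        have hwg : w ∈ g.verts := view_verts g ▸ TopTree.mem_verts_of_mem hfg hwf
        have : g = t := by
          by_contra hne
          have : Std.Symm fun t t' : RTree V => Disjoint t.verts t'.verts := ⟨fun _ _ h => h.symm⟩
          exact Set.disjoint_left.1 (hd.forall hg ht hne) hwg hwt
        exact this ▸ hfg
      · exact h.closed t (by simp [ht]) f hf.1 w hwf hwt
    · intro f hf
      rw [hedge] at hf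
      obtain ⟨t, ht, hft⟩ := h.covers f hf.1
      rcases List.mem_cons.1 ht with rfl | ht
      · obtain ⟨g, hg, hfg⟩ := ((hC f).1 hft).resolve_left hf.2
        exact ⟨g, by simp [hg], hfg⟩
      · exact ⟨t, by simp [ht], hft⟩
    · exact List.pairwise_append.2 ⟨hd, (List.pairwise_cons.1 h.disjoint).2, fun g hg t ht =>
        Set.disjoint_left.2 fun w hw => hRτ t ht w (hLτ g hg w hw)⟩
    · rw [hi]
      by_cases e1 : w = v
      · subst e1; simpa using (h.incident_nodup w).erase e
      · rw [Function.update_of_ne e1]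
        by_cases e2 : w = u
        · subst e2; simpa using (h.incident_nodup w).erase e
        · rw [Function.update_of_ne e2]
          exact h.incident_nodup w
    · have h1 : n ∈ s'.incident w ↔ n ∈ s.incident w ∧ ¬ (n = e ∧ (w = u ∨ w = v)) := by
        rw [hi]
        by_cases e1 : w = v
        · subst e1
          simp [(h.incident_nodup w).mem_erase_iff, and_comm]
        · rw [Function.update_of_ne e1]
          by_cases e2 : w = u
          · subst e2
            simp [(h.incident_nodup w).mem_erase_iff, and_comm]
          · rw [Function.update_of_ne e2]
            simp [e1, e2]
      rw [h1, h.incident_mem]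
      constructor
      · rintro ⟨⟨t, ht, a, b, hm, hw⟩, h2⟩
        rcases (hleaf n a b).1 ⟨t, ht, hm⟩ with h3 | ⟨t', ht', hm'⟩
        · obtain ⟨rfl, rfl, rfl⟩ := Prod.mk.injEq .. ▸ h3 |>.imp_right (Prod.mk.inj ·)
          exact (h2 ⟨rfl, hw⟩).elim
        · exact ⟨t', ht', a, b, hm', hw⟩
      · rintro ⟨t, ht, a, b, hm, hw⟩
        obtain ⟨t', ht', hm'⟩ := (hleaf n a b).2 (Or.inr ⟨t, ht, hm⟩)
        exact ⟨⟨t', ht', a, b, hm', hw⟩, fun h2 => hnew n a b ⟨t, ht, hm⟩ h2.1⟩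
  refine ⟨hrep, funext fun n => Option.ext fun ⟨a, b⟩ => ?_⟩
  rw [hrep.edgeAt_iff]
  by_cases e1 : n = e
  · subst e1
    simp only [Function.update_self, reduceCtorEq, iff_false]
    exact fun h1 => hnew n a b h1 rfl
  · rw [Function.update_of_ne e1, h.edgeAt_iff, hleaf]
    simp [e1]

theorem cut_spec [DecidableEq V] {K : ℝ} (hK : 7200 ≤ K) (h : StoresRep s G X R) {e : ℕ}
    (he : s.edgeAt e = some (u, v)) (hX : ∀ w ∈ X, ¬ G.Reachable u w) :
    ∃ ru rv s' R', (cut e).run s = some ((ru, rv), s') ∧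
      StoresRep s' (G.deleteEdges {s(u, v)}) X R' ∧ IsRootOf (R'.map view) u ru ∧
      IsRootOf (R'.map view) v rv ∧ s'.edgeAt = Function.update s.edgeAt e none ∧
      amortizedCost K s (R.map view) s' (R'.map view) ≤
        (46000 + 300 * K) * (1 + Real.logb 2 (treeSize G u)) := by
  obtain ⟨τ, hτ, hm⟩ := (h.edgeAt_iff e u v).1 he
  obtain ⟨C, fl, k, rfl⟩ := exists_zipper hm
  obtain ⟨R₀, hp⟩ := exists_perm_cons hτ
  have h0 := h.perm hp
  have huτ : u ∈ (fill C (leaf e fl k u v)).verts := (mem_verts_iff _ _).2 ⟨_, hm, Or.inl rfl⟩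
  have hvτ : v ∈ (fill C (leaf e fl k u v)).verts := (mem_verts_iff _ _).2 ⟨_, hm, Or.inr rfl⟩
  have hτX : ∀ w ∈ (fill C (leaf e fl k u v)).verts, w ∉ X := fun w hw hwX =>
    hX w hwX ((h.reach hτ huτ w).2 hw)
  have huX := hτX u huτ
  have hvX := hτX v hvτ
  have huv : u ≠ v := ((h.tree _ hτ).2.of_fill (C := C)).1
  have hnode : s.node e = some ⟨par C, .leaf u v, k, fl⟩ := fill_node (h.tree _ hτ).1
  obtain ⟨s1, C', t', r1, sp, hirr, hc1⟩ := fullSplay_spec hK C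
    (t := leaf e fl k u v) ((h.ok hτ).reads 1)
  obtain ⟨fl', rfl⟩ : ∃ fl', t' = leaf e fl' k u v := by
    rcases sp.tog with rfl | rfl
    exacts [⟨_, rfl⟩, ⟨_, rfl⟩]
  have hrk := rk_nonneg (fill C (leaf e fl k u v)).size
  have hsu : Function.update s.exposed u false = s.exposed := by
    exact Function.update_eq_self_iff.2 (Bool.eq_false_iff.2 ((h.exposed u).not.2 huX)).symm
  have h1 : StoresRep s1 G X (fill C' (leaf e fl' k u v) :: R₀) := by
    refine h0.mark (K := K) (B := 16000 + 100 * K) (v := u) (m := false)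
      ⟨sp.ok, sp.rearr, sp.same.node, sp.same.exposed.trans hsu.symm, sp.same.incident,
        sp.same.next, ?_⟩ huτ (fun _ _ => Iff.rfl) (by simpa using huX)
    have h2 : ((s.adv 1).time : ℝ) = s.time + 1 := by simp
    rw [h2] at hc1
    nlinarith
  have hV' : ∀ w, w ∈ (fill C' (leaf e fl' k u v)).verts → w ∉ X := by
    rw [sp.rearr.verts]; exact hτX
  obtain ⟨hlen, hL, hd⟩ := siblings_spec sp.ok.wf hV' hirr
  obtain ⟨s2, r2, hh2, he2, hi2, ht2, hn2⟩ := h1.heap.delete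
  set s3 : Mem V := { s2.adv 4 with
    exposed := Function.update (Function.update s.exposed u true) v true
    incident := Function.update (Function.update s.incident u ((s.incident u).erase e)) v
      ((s.incident v).erase e) } with hs3
  have hl : (fill C' (leaf e fl' k u v)).leaves.Perm
      ((e, u, v) :: (C'.map Fr.sib).flatMap leaves) := by
    refine (fill_leaves _ _).trans ?_
    rw [List.flatMap_map]
    exact .refl _
  obtain ⟨h3, hE3⟩ := h1.deleteEdge (s' := s3) hl (hh2.congr rfl rfl) hL hd hn2 (by
      intro w
      simp only [hs3, Set.mem_union, Set.mem_insert_iff, Set.mem_singleton_iff]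
      by_cases e1 : w = v
      · simp [e1]
      · by_cases e2 : w = u
        · simp [e1, e2, Function.update_apply]
        · simp [e1, e2, h.exposed]) (by rw [hs3, sp.same.incident]; rfl) huv
  obtain ⟨ru, s4, R4, r4, h4, -, hr4, hE4, hc4, -⟩ := h3.deexpose_spec hK (v := u) (by simp)
  obtain ⟨rv, s5, R5, r5, h5, -, hr5, hE5, hc5, hroot⟩ := h4.deexpose_spec hK (v := v)
    (by simp [huv.symm])
  have hXX : ((X ∪ {u, v}) \ {u}) \ {v} = X := by
    ext w
    simp only [Set.mem_sdiff, Set.mem_union, Set.mem_insert_iff, Set.mem_singleton_iff]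
    constructor
    · rintro ⟨⟨h | h | h, h6⟩, h7⟩
      exacts [h, (h6 h).elim, (h7 h).elim]
    · exact fun h => ⟨⟨Or.inl h, fun e => huX (e ▸ h)⟩, fun e => hvX (e ▸ h)⟩
  rw [hXX] at h5
  have hE1 : s1.edgeAt = s.edgeAt := h0.edgeAt_eq h1 fun p => by simp [sp.rearr.leaves.mem_iff]
  have hrun : (cut e).run s = some ((ru, rv), s5) := by
    rw [cut, run_bind, run_getEndpoints hnode, Option.bind_some, run_bind]
    have r1' : (fullSplay e).run (s.adv 1) = some ((), s1) := r1
    rw [r1', Option.bind_some, run_bind, r2, Option.bind_some]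
    have r3 : (removeIncident u e >>= fun _ => removeIncident v e >>= fun _ =>
        setExposed u true >>= fun _ => setExposed v true).run s2 = some ((), s3) := by
      simp only [run_bind, run_removeIncident, run_setExposed, Option.bind_some, hs3, hi2, he2,
        sp.same.incident, sp.same.exposed, Mem.adv]
      simp [Function.update_of_ne huv.symm]
    have hassoc : ∀ P : Prog V (Option ℕ × Option ℕ),
        (removeIncident u e >>= fun _ => removeIncident v e >>= fun _ =>
          setExposed u true >>= fun _ => setExposed v true >>= fun _ => P) =
        ((removeIncident u e >>= fun _ => removeIncident v e >>= fun _ =>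
          setExposed u true >>= fun _ => setExposed v true) >>= fun _ => P) := by
      intro P
      simp only [bind_assoc]
    rw [hassoc, run_bind, r3, Option.bind_some, run_bind, r4, Option.bind_some, run_bind, r5,
      Option.bind_some, run_pure]
  refine ⟨ru, rv, s5, R5, hrun, h5, hroot u ru hr4, hr5, ?_, ?_⟩
  · rw [hE5, hE4, hE3, hE1]
  · have hsz := h.treeSize_eq hτ huτ
    have hle : ∀ w ∈ (fill C (leaf e fl k u v)).verts,
        treeSize (G.deleteEdges {s(u, v)}) w ≤ treeSize G u := by
      intro w hw
      rw [hsz, ← h.treeSize_eq hτ hw]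
      refine Set.ncard_le_ncard (fun x hx => SimpleGraph.Reachable.mono (G.deleteEdges_le _) hx) ?_
      refine (verts_finite (fill C (leaf e fl k u v))).subset fun x hx => ?_
      exact (h.reach hτ hw x).1 hx
    have hu1 := rk_le_of_le (hle u huτ)
    have hv1 := rk_le_of_le (hle v hvτ)
    have hs1 : rk (fill C (leaf e fl k u v)).size ≤ rk (treeSize G u) :=
      rk_le_of_le (by rw [hsz]; omega)
    have hpot := potSum_siblings C' (leaf e fl' k u v)
    have hadd : potSum (C'.map Fr.sib ++ R₀) = potSum (C'.map Fr.sib) + potSum R₀ := by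
      simp [potSum]
    rw [amortizedCost, forestPotential_view, forestPotential_view] at hc4 hc5 ⊢
    rw [hadd] at hc4
    rw [potSum_perm hp, potSum_cons]
    have ht : (s3.time : ℝ) ≤ s1.time + 22 := by
      have : s3.time = s2.time + 4 := rfl
      have : s3.time ≤ s1.time + 22 := by omega
      exact_mod_cast this
    have h2 : ((s.adv 1).time : ℝ) = s.time + 1 := by simp
    rw [h2] at hc1
    change _ ≤ _ * (1 + rk _) at hc4
    change _ ≤ _ * (1 + rk _) at hc5
    change _ ≤ _ * (1 + rk _)
    have hKp : K * potSum (C'.map Fr.sib) ≤ K * (fill C' (leaf e fl' k u v)).pot :=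
      mul_le_mul_of_nonneg_left hpot (by linarith)
    have e4 : (16000 + 100 * K) * (1 + rk (treeSize (G.deleteEdges {s(u, v)}) u)) ≤
        (16000 + 100 * K) * (1 + rk (treeSize G u)) :=
      mul_le_mul_of_nonneg_left (by linarith) (by linarith)
    have e5 : (16000 + 100 * K) * (1 + rk (treeSize (G.deleteEdges {s(u, v)}) v)) ≤
        (16000 + 100 * K) * (1 + rk (treeSize G u)) :=
      mul_le_mul_of_nonneg_left (by linarith) (by linarith)
    have e1 : 84 * K * rk (fill C (leaf e fl k u v)).size ≤ 84 * K * rk (treeSize G u) :=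
      mul_le_mul_of_nonneg_left hs1 (by linarith)
    have hr0 := rk_nonneg (treeSize G u)
    have hKr : 0 ≤ K * rk (treeSize G u) := mul_nonneg (by linarith) hr0
    linarith

end StoresRep

end

open TopTreeProg in
theorem mainTheorem1 :
    ∃ K C : ℝ, 0 < K ∧ 0 < C ∧ ∀ (V : Type) [DecidableEq V],
      -- the empty data structure
      (Represents (Mem.init V) ⊥ ∅ [] ∧ forestPotential ([] : List (TopTree V)) = 0) ∧
      -- the operations, from any state that satisfies the invariants
      ∀ (s : Mem V) (G : SimpleGraph V) (X : Set V) (F : List (TopTree V)),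
        Represents s G X F →
        -- expose
        (∀ v : V, v ∉ X → {w | w ∈ X ∧ G.Reachable v w}.Subsingleton →
          ∃ r s' F', (expose v).run s = some (r, s') ∧
            Represents s' G (insert v X) F' ∧
            IsRootOf F v r ∧ IsRootOf F' v r ∧
            s'.edgeAt = s.edgeAt ∧
            amortizedCost K s F s' F' ≤ C * (1 + Real.logb 2 (treeSize G v))) ∧
        -- deexpose
        (∀ v : V, v ∈ X →
          ∃ r s' F', (deexpose v).run s = some (r, s') ∧
            Represents s' G (X \ {v}) F' ∧
            IsRootOf F v r ∧ IsRootOf F' v r ∧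
            s'.edgeAt = s.edgeAt ∧
            amortizedCost K s F s' F' ≤ C * (1 + Real.logb 2 (treeSize G v))) ∧
        -- link
        (∀ u v : V, ¬ G.Reachable u v →
          (∀ w ∈ X, ¬ G.Reachable u w ∧ ¬ G.Reachable v w) →
          ∃ r s' F', (link u v).run s = some (r, s') ∧
            Represents s' (G ⊔ SimpleGraph.edge u v) X F' ∧
            r ≠ none ∧ IsRootOf F' u r ∧ IsRootOf F' v r ∧
            (∃ e, s.edgeAt e = none ∧
              s'.edgeAt = Function.update s.edgeAt e (some (u, v))) ∧
            amortizedCost K s F s' F' ≤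
              C * (1 + Real.logb 2 (treeSize (G ⊔ SimpleGraph.edge u v) u))) ∧
        -- cut
        (∀ (e : ℕ) (u v : V), s.edgeAt e = some (u, v) →
          (∀ w ∈ X, ¬ G.Reachable u w) →
          ∃ ru rv s' F', (cut e).run s = some ((ru, rv), s') ∧
            Represents s' (G.deleteEdges {s(u, v)}) X F' ∧
            IsRootOf F' u ru ∧ IsRootOf F' v rv ∧
            s'.edgeAt = Function.update s.edgeAt e none ∧
            amortizedCost K s F s' F' ≤ C * (1 + Real.logb 2 (treeSize G u))) := by
  refine ⟨7200, 46000 + 300 * 7200, by norm_num, by norm_num, fun V _ =>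
    ⟨⟨(StoresRep.init V).represents, by simp [forestPotential]⟩, fun s G X F hF => ?_⟩⟩
  obtain ⟨R, rfl, h⟩ := hF.exists_rep
  have hB : ∀ (B : ℝ), B ≤ 46000 + 300 * 7200 → ∀ n : ℕ,
      B * (1 + Real.logb 2 n) ≤ (46000 + 300 * 7200) * (1 + Real.logb 2 n) := fun B hB n =>
    mul_le_mul_of_nonneg_right hB (by have : 0 ≤ Real.logb 2 n := RTree.rk_nonneg n; linarith)
  refine ⟨fun v hv hX => ?_, fun v hv => ?_, fun u v huv hX => ?_, fun e u v he hX => ?_⟩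
  · obtain ⟨r, s', R', h1, h2, h3, h4, h5, h6, -⟩ := h.expose_spec le_rfl hv hX
    exact ⟨r, s', _, h1, h2.represents, h3, h4, h5, h6.trans (hB _ (by norm_num) _)⟩
  · obtain ⟨r, s', R', h1, h2, h3, h4, h5, h6, -⟩ := h.deexpose_spec le_rfl hv
    exact ⟨r, s', _, h1, h2.represents, h3, h4, h5, h6.trans (hB _ (by norm_num) _)⟩
  · obtain ⟨r, s', R', h1, h2, h3, h4, h5, h6, h7⟩ := h.link_spec le_rfl huv hX
    exact ⟨r, s', _, h1, h2.represents, h3, h4, h5, h6, h7.trans (hB _ (by norm_num) _)⟩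
  · obtain ⟨ru, rv, s', R', h1, h2, h3, h4, h5, h6⟩ := h.cut_spec le_rfl he hX
    exact ⟨ru, rv, s', _, h1, h2.represents, h3, h4, h5, h6.trans (hB _ (by norm_num) _)⟩
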